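/- Let $R$ be a complete discrete valuation ring of mixed characteristic $(0,p)$ with perfect residue field $k$ and fraction field $K$. Let $I\subset R$ be an ideal with a PD-structure $\gamma$ such that $p\in I$, and put $\mathbf S=\operatorname{Spec}R$, $S=V(I)$. Let $\mathbf X=\operatorname{Spec}A$ be an affine smooth $\mathbf S$-scheme such that $X=\mathbf X\times_{\mathbf S}S$ is connected (and non-empty). Let $\mathbf D=\hat A$ be the $p$-adic completion of $A$, let $\Omega_{\mathbf D}$ be the $p$-adic completion of $\Omega^1_{A/R}$, with its differentials $d:\hat A\to\Omega_{\mathbf D}$ and $d^1:\Omega_{\mathbf D}\to\Omega^2_{\mathbf D}=\bigwedge^2\Omega_{\mathbf D}$, and put $A_K=K\otimes_R\hat A$, $\Omega_K=K\otimes_R\Omega_{\mathbf D}$ and $\operatorname{Der}=\operatorname{Der}_R(\hat A,\hat A)$. Consider the following categories. * $\mathrm{Conn}(\mathbf D/\mathbf S,\Omega_{\mathbf D})$: finitely presented $\hat A$-modules $M$ with an integrable connection $\nabla:M\to M\otimes_{\hat A}\Omega_{\mathbf D}$, that is an additive map with $\nabla(am)=a\nabla(m)+m\otimes da$ whose composition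 with $m\otimes\omega\mapsto\nabla(m)\wedge\omega+m\otimes d^1\omega$ vanishes; the morphisms are the horizontal linear maps. * $\mathrm{QNCf}(\mathbf X/\mathbf S,\Omega_{\mathbf D})$: its full subcategory of topologically quasi-nilpotent connections, that is of those such that for every $n$ and all coordinates $x_1,\dots,x_d$ on an open $D(f)\subset\operatorname{Spec}(\hat A/p^n)$ (the $dx_i$ form a basis of the differentials over $R$), with dual vector fields $\partial_i$, every section over $D(f)$ of the reduction of $M$ modulo $p^n$ is killed by a power of each $\nabla(\partial_i)$. * $\mathrm{Conn}(\mathbf D\times K/K,\Omega_{\mathbf D}\otimes K)$: finitely presented $A_K$-modules with an integrable connection with values in $\Omega_K$, for the $K$-linear extensions of $d$ and $d^1$. * $\mathrm{Diff}(\mathbf D,\operatorname{Der}(\mathbf D/\mathbf S))$: finitely presented $\hat A$-modules $M$ with an $\hat A$-linear action of $\operatorname{Der}$ by additive maps, such that $D(am)=D(a)m+aD(m)$ and $[D,D']m=D(D'm)-D'(Dm)$; the morphisms are the equivariant linear maps. * $\mathrm{Diff}(\mathbf D\times K,\operatorname{Der}(\mathbf D/\mathbf S)\otimes K)$: the same for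 the ring $A_K$ with the action of $K\otimes_R\operatorname{Der}$. They are symmetric monoidal for the tensor product of modules with the usual connections and actions. For an $R$-linear category $\mathcal C$ let $\mathcal C\otimes K$ be the category with the same objects and with morphisms $K\otimes_R\operatorname{Hom}_{\mathcal C}(-,-)$. By a Tannakian category we mean a $K$-linear symmetric monoidal category that is abelian and rigid, in which the endomorphisms of the unit form a field, and which has an exact faithful $K$-linear tensor functor to the finite dimensional vector spaces over some field extension of $K$. Then the five categories in the following square with a tail are Tannakian: $$\begin{array}{ccccc}\mathrm{QNCf}(\mathbf X/\mathbf S,\Omega_{\mathbf D})\otimes K&\to&\mathrm{Conn}(\mathbf D/\mathbf S,\Omega_{\mathbf D})\otimes K&\to&\mathrm{Conn}(\mathbf D\times K/K,\Omega_{\mathbf D}\otimes K)\\ &&\downarrow\simeq&&\downarrow\simeq\\ &&\mathrm{Diff}(\mathbf D,\operatorname{Der}(\mathbf D/\mathbf S))\otimes K&\to&\mathrm{Diff}(\mathbf D\times K,\operatorname{Der}(\mathbf D/\mathbf S)\otimes K)\end{array}$$ Here the first functor is the inclusion, the other two horizontal functors are $M\mapsto A_K\otimes_{\hat A}M$, and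 the vertical functors let a derivation $D$ act by $(\mathrm{id}\otimes\langle D,-\rangle)\circ\nabla$. All five functors are fully faithful $K$-linear exact symmetric monoidal functors, the two vertical ones are equivalences, and the square commutes up to a monoidal natural isomorphism. -/

import Mathlib

open CategoryTheory MonoidalCategory TensorProduct
universe u v w

noncomputable section

/-- objects of `C ⊗_R K`. -/
structure ScalarExt (R K : Type u) (C : Type v) where
  of ::
  as : C

namespace ScalarExt
section
variable {R K : Type u} [CommRing R] [CommRing K] [Algebra R K]
variable {C : Type v} [Category.{u} C] [Preadditive C] [Linear R C]

instance : Category.{u} (ScalarExt R K C) where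
  Hom X Y := K ⊗[R] (X.as ⟶ Y.as)
  id X := (1 : K) ⊗ₜ[R] 𝟙 X.as
  comp {X Y Z} f g :=
    TensorProduct.map₂ (LinearMap.mul R K) (Linear.comp X.as Y.as Z.as) f g
  id_comp {X Y} f := by
    induction f using TensorProduct.induction_on with
    | zero => simp
    | tmul k f => simp
    | add x y hx hy => rw [map_add, hx, hy]
  comp_id {X Y} f := by
    induction f using TensorProduct.induction_on with
    | zero => simp
    | tmul k f => simp
    | add x y hx hy => rw [map_add, LinearMap.add_apply, hx, hy]
  assoc {W X Y Z} f g h := by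
    induction f using TensorProduct.induction_on with
    | zero => simp
    | add x y hx hy => simp only [map_add, LinearMap.add_apply, hx, hy]
    | tmul k f =>
    induction g using TensorProduct.induction_on with
    | zero => simp
    | add x y hx hy => simp only [map_add, LinearMap.add_apply, hx, hy]
    | tmul k f =>
    induction h using TensorProduct.induction_on with
    | zero => simp
    | add x y hx hy => simp only [map_add, LinearMap.add_apply, hx, hy]
    | tmul k f => simp [mul_assoc]

/-- The morphism `k ⊗ f` of `C ⊗_R K`. -/
def hom {X Y : ScalarExt R K C} (k : K) (f : X.as ⟶ Y.as) : X ⟶ Y := (k ⊗ₜ[R] f : K ⊗[R] (X.as ⟶ Y.as))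

instance : Preadditive (ScalarExt R K C) where
  homGroup X Y := inferInstanceAs (AddCommGroup (K ⊗[R] (X.as ⟶ Y.as)))
  add_comp X Y Z f f' g := by
    change TensorProduct.map₂ _ _ (_ + _) _ = _
    rw [map_add, LinearMap.add_apply]; rfl
  comp_add X Y Z f g g' := by
    change TensorProduct.map₂ _ _ _ (_ + _) = _
    rw [map_add]; rfl

@[elab_as_elim]
theorem hom_induction {X Y : ScalarExt R K C} {P : (X ⟶ Y) → Prop} (f : X ⟶ Y)
    (zero : P 0) (tmul : ∀ k f, P (hom k f)) (add : ∀ f g, P f → P g → P (f + g)) : P f :=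
  TensorProduct.induction_on (R := R) (M := K) (N := X.as ⟶ Y.as) (motive := P) f zero tmul add

theorem hom_comp {X Y Z : ScalarExt R K C} (k l : K) (f : X.as ⟶ Y.as) (g : Y.as ⟶ Z.as) :
    (hom k f : X ⟶ Y) ≫ (hom l g : Y ⟶ Z) = hom (k * l) (f ≫ g) := by
  change TensorProduct.map₂ _ _ (_ ⊗ₜ _) (_ ⊗ₜ _) = _
  simp [hom]

theorem id_eq (X : ScalarExt R K C) : 𝟙 X = hom 1 (𝟙 X.as) := rfl

theorem hom_add {X Y : ScalarExt R K C} (k : K) (f g : X.as ⟶ Y.as) :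
    (hom k (f + g) : X ⟶ Y) = hom k f + hom k g := TensorProduct.tmul_add _ _ _

instance instModuleHom (X Y : ScalarExt R K C) : Module K (X ⟶ Y) :=
  inferInstanceAs (Module K (K ⊗[R] (X.as ⟶ Y.as)))

theorem smul_hom {X Y : ScalarExt R K C} (r a : K) (f : X.as ⟶ Y.as) :
    r • (hom a f : X ⟶ Y) = hom (r * a) f := TensorProduct.smul_tmul' _ _ _

instance : Linear K (ScalarExt R K C) where
  homModule := instModuleHom
  smul_comp X Y Z r f g := by
    induction f using hom_induction with
    | zero => rw [smul_zero, Limits.zero_comp, smul_zero]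
    | add x y hx hy => simp only [smul_add, Preadditive.add_comp, hx, hy]
    | tmul k f =>
    induction g using hom_induction with
    | zero => rw [Limits.comp_zero, Limits.comp_zero, smul_zero]
    | add x y hx hy => simp only [smul_add, Preadditive.comp_add, hx, hy]
    | tmul l g => rw [smul_hom, hom_comp, hom_comp, smul_hom, mul_assoc]
  comp_smul X Y Z f r g := by
    induction f using hom_induction with
    | zero => rw [Limits.zero_comp, Limits.zero_comp, smul_zero]
    | add x y hx hy => simp only [smul_add, Preadditive.add_comp, hx, hy]
    | tmul k f =>
    induction g using hom_induction with
    | zero => rw [smul_zero, Limits.comp_zero, smul_zero]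
    | add x y hx hy => simp only [smul_add, Preadditive.comp_add, hx, hy]
    | tmul l g => rw [smul_hom, hom_comp, hom_comp, smul_hom, mul_left_comm]

variable (R K C) in
/-- The natural functor `C ⥤ C ⊗_R K`. -/
def ι : C ⥤ ScalarExt R K C where
  obj X := of X
  map f := hom 1 f
  map_comp f g := by rw [hom_comp, one_mul]

@[simp] theorem ι_obj (X : C) : (ι R K C).obj X = of X := rfl

variable [MonoidalCategory C] [MonoidalPreadditive C] [MonoidalLinear R C]

def whiskerL (X : C) (Y Z : C) : (Y ⟶ Z) →ₗ[R] (X ⊗ Y ⟶ X ⊗ Z) where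
  toFun f := X ◁ f
  map_add' := by simp
  map_smul' := by simp

def whiskerR (X : C) (Y Z : C) : (Y ⟶ Z) →ₗ[R] (Y ⊗ X ⟶ Z ⊗ X) where
  toFun f := f ▷ X
  map_add' := by simp
  map_smul' := by simp

instance : MonoidalCategoryStruct (ScalarExt R K C) where
  tensorObj X Y := of (X.as ⊗ Y.as)
  whiskerLeft X Y Z f := (whiskerL X.as Y.as Z.as).lTensor K f
  whiskerRight {Y Z} f X := (whiskerR X.as Y.as Z.as).lTensor K f
  tensorUnit := of (𝟙_ C)
  associator X Y Z := (ι R K C).mapIso (α_ X.as Y.as Z.as)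
  leftUnitor X := (ι R K C).mapIso (λ_ X.as)
  rightUnitor X := (ι R K C).mapIso (ρ_ X.as)

theorem whiskerLeft_hom (X : ScalarExt R K C) {Y Z : ScalarExt R K C} (k : K) (f : Y.as ⟶ Z.as) :
    X ◁ (hom k f : Y ⟶ Z) = hom k (X.as ◁ f) := rfl
theorem hom_whiskerRight (X : ScalarExt R K C) {Y Z : ScalarExt R K C} (k : K) (f : Y.as ⟶ Z.as) :
    (hom k f : Y ⟶ Z) ▷ X = hom k (f ▷ X.as) := rfl
theorem whiskerLeft_add' (X : ScalarExt R K C) {Y Z : ScalarExt R K C} (f g : Y ⟶ Z) :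
    X ◁ (f + g) = X ◁ f + X ◁ g := map_add ((whiskerL X.as Y.as Z.as).lTensor K) f g
theorem add_whiskerRight' (X : ScalarExt R K C) {Y Z : ScalarExt R K C} (f g : Y ⟶ Z) :
    (f + g) ▷ X = f ▷ X + g ▷ X := map_add ((whiskerR X.as Y.as Z.as).lTensor K) f g
theorem whiskerLeft_zero' (X : ScalarExt R K C) {Y Z : ScalarExt R K C} :
    X ◁ (0 : Y ⟶ Z) = 0 := map_zero ((whiskerL X.as Y.as Z.as).lTensor K)
theorem zero_whiskerRight' (X : ScalarExt R K C) {Y Z : ScalarExt R K C} :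
    (0 : Y ⟶ Z) ▷ X = 0 := map_zero ((whiskerR X.as Y.as Z.as).lTensor K)

theorem tensorHom_def' {X Y X' Y' : ScalarExt R K C} (f : X ⟶ Y) (g : X' ⟶ Y') :
  f ⊗ₘ g = f ▷ X' ≫ Y ◁ g := rfl
theorem assoc_hom (X Y Z : ScalarExt R K C) : (α_ X Y Z).hom = hom 1 (α_ X.as Y.as Z.as).hom := rfl
theorem left_hom (X : ScalarExt R K C) : (λ_ X).hom = hom 1 (λ_ X.as).hom := rfl
theorem right_hom (X : ScalarExt R K C) : (ρ_ X).hom = hom 1 (ρ_ X.as).hom := rfl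
theorem tensor_as (X Y : ScalarExt R K C) : (X ⊗ Y).as = X.as ⊗ Y.as := rfl

theorem tensorHom_hom {X Y X' Y' : ScalarExt R K C} (k l : K) (f : X.as ⟶ Y.as)
    (g : X'.as ⟶ Y'.as) :
    (hom k f : X ⟶ Y) ⊗ₘ (hom l g : X' ⟶ Y') = hom (k * l) (f ⊗ₘ g) := by
  rw [tensorHom_def', hom_whiskerRight, whiskerLeft_hom]
  erw [hom_comp]
  rw [MonoidalCategory.tensorHom_def]

theorem add_tensorHom {X Y X' Y' : ScalarExt R K C} (f f' : X ⟶ Y) (g : X' ⟶ Y') :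
    (f + f') ⊗ₘ g = f ⊗ₘ g + f' ⊗ₘ g := by
  simp only [tensorHom_def', add_whiskerRight', Preadditive.add_comp]
theorem tensorHom_add {X Y X' Y' : ScalarExt R K C} (f : X ⟶ Y) (g g' : X' ⟶ Y') :
    f ⊗ₘ (g + g') = f ⊗ₘ g + f ⊗ₘ g' := by
  simp only [tensorHom_def', whiskerLeft_add', Preadditive.comp_add]
theorem zero_tensorHom {X Y X' Y' : ScalarExt R K C} (g : X' ⟶ Y') :
    (0 : X ⟶ Y) ⊗ₘ g = 0 := by
  simp only [tensorHom_def', zero_whiskerRight', Limits.zero_comp]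
theorem tensorHom_zero {X Y X' Y' : ScalarExt R K C} (f : X ⟶ Y) :
    f ⊗ₘ (0 : X' ⟶ Y') = 0 := by
  simp only [tensorHom_def', whiskerLeft_zero', Limits.comp_zero]

instance : MonoidalCategory (ScalarExt R K C) where
  tensorHom_def _ _ := rfl
  id_tensorHom_id X Y := by
    rw [id_eq, id_eq, tensorHom_hom, id_tensorHom_id, mul_one]; rfl
  tensorHom_comp_tensorHom f₁ f₂ g₁ g₂ := by
    induction f₁ using hom_induction with
    | zero => simp only [zero_tensorHom, Limits.zero_comp]
    | add x y hx hy => simp only [add_tensorHom, Preadditive.add_comp, hx, hy]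
    | tmul =>
    induction f₂ using hom_induction with
    | zero => simp only [tensorHom_zero, Limits.zero_comp]
    | add x y hx hy => simp only [tensorHom_add, Preadditive.add_comp, hx, hy]
    | tmul =>
    induction g₁ using hom_induction with
    | zero => simp only [zero_tensorHom, Limits.comp_zero]
    | add x y hx hy => simp only [add_tensorHom, Preadditive.comp_add, hx, hy]
    | tmul =>
    induction g₂ using hom_induction with
    | zero => simp only [tensorHom_zero, Limits.comp_zero]
    | add x y hx hy => simp only [tensorHom_add, Preadditive.comp_add, hx, hy]
    | tmul =>
      simp only [tensorHom_hom, hom_comp]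
      rw [tensorHom_comp_tensorHom, mul_mul_mul_comm]
  whiskerLeft_id X Y := by rw [id_eq, whiskerLeft_hom, MonoidalCategory.whiskerLeft_id]; rfl
  id_whiskerRight X Y := by rw [id_eq, hom_whiskerRight, MonoidalCategory.id_whiskerRight]; rfl
  associator_naturality f₁ f₂ f₃ := by
    induction f₁ using hom_induction with
    | zero => simp only [zero_tensorHom, Limits.comp_zero, Limits.zero_comp]
    | add x y hx hy => simp only [add_tensorHom, Preadditive.add_comp, Preadditive.comp_add, hx, hy]
    | tmul =>
    induction f₂ using hom_induction with
    | zero => simp only [tensorHom_zero, zero_tensorHom, Limits.comp_zero, Limits.zero_comp]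
    | add x y hx hy =>
      simp only [add_tensorHom, tensorHom_add, Preadditive.add_comp, Preadditive.comp_add, hx, hy]
    | tmul =>
    induction f₃ using hom_induction with
    | zero => simp only [tensorHom_zero, zero_tensorHom, Limits.comp_zero, Limits.zero_comp]
    | add x y hx hy =>
      simp only [add_tensorHom, tensorHom_add, Preadditive.add_comp, Preadditive.comp_add, hx, hy]
    | tmul =>
      simp only [tensorHom_hom, assoc_hom]
      erw [hom_comp, hom_comp]
      rw [associator_naturality, mul_one, one_mul, mul_assoc]
  leftUnitor_naturality f := by
    induction f using hom_induction with
    | zero => simp only [whiskerLeft_zero', Limits.comp_zero, Limits.zero_comp]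
    | add x y hx hy => simp only [whiskerLeft_add', Preadditive.add_comp, Preadditive.comp_add, hx, hy]
    | tmul =>
      simp only [whiskerLeft_hom, left_hom]
      erw [hom_comp, hom_comp, leftUnitor_naturality, mul_one, one_mul]
  rightUnitor_naturality f := by
    induction f using hom_induction with
    | zero => simp only [zero_whiskerRight', Limits.comp_zero, Limits.zero_comp]
    | add x y hx hy => simp only [add_whiskerRight', Preadditive.add_comp, Preadditive.comp_add, hx, hy]
    | tmul =>
      simp only [hom_whiskerRight, right_hom]
      erw [hom_comp, hom_comp, rightUnitor_naturality, mul_one, one_mul]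
  pentagon W X Y Z := by
    change (hom 1 ((α_ W.as X.as Y.as).hom ▷ Z.as) : of _ ⟶ of _) ≫
      (hom 1 (α_ W.as (X.as ⊗ Y.as) Z.as).hom : of _ ⟶ of _) ≫
      (hom 1 (W.as ◁ (α_ X.as Y.as Z.as).hom) : of _ ⟶ of _) =
      (hom 1 (α_ (W.as ⊗ X.as) Y.as Z.as).hom : of _ ⟶ of _) ≫
      (hom 1 (α_ W.as X.as (Y.as ⊗ Z.as)).hom : of _ ⟶ of _)
    simp only [hom_comp, mul_one, pentagon]
  triangle X Y := by
    change (hom 1 (α_ X.as (𝟙_ C) Y.as).hom : of _ ⟶ of _) ≫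
      (hom 1 (X.as ◁ (λ_ Y.as).hom) : of _ ⟶ of _) = (hom 1 ((ρ_ X.as).hom ▷ Y.as) : of _ ⟶ of _)
    simp only [hom_comp, mul_one, triangle]

instance : MonoidalPreadditive (ScalarExt R K C) where
  whiskerLeft_zero := whiskerLeft_zero' _
  zero_whiskerRight := zero_whiskerRight' _
  whiskerLeft_add := whiskerLeft_add' _
  add_whiskerRight := add_whiskerRight' _

instance : MonoidalLinear K (ScalarExt R K C) where
  whiskerLeft_smul X Y Z r f := by
    induction f using hom_induction with
    | zero => rw [smul_zero, whiskerLeft_zero', smul_zero]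
    | add x y hx hy => simp only [whiskerLeft_add', smul_add, hx, hy]
    | tmul k f => rw [smul_hom, whiskerLeft_hom, whiskerLeft_hom, smul_hom]
  smul_whiskerRight r Y Z f X := by
    induction f using hom_induction with
    | zero => rw [smul_zero, zero_whiskerRight', smul_zero]
    | add x y hx hy => simp only [add_whiskerRight', smul_add, hx, hy]
    | tmul k f => rw [smul_hom, hom_whiskerRight, hom_whiskerRight, smul_hom]

instance : (ι R K C).Monoidal :=
  Functor.CoreMonoidal.toMonoidal
    { εIso := Iso.refl _
      μIso := fun _ _ => Iso.refl _
      μIso_hom_natural_left := fun f X => by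
        simp only [Iso.refl_hom]; erw [Category.id_comp, Category.comp_id]; rfl
      μIso_hom_natural_right := fun f X => by
        simp only [Iso.refl_hom]; erw [Category.id_comp, Category.comp_id]; rfl
      associativity := fun X Y Z => by
        simp only [Iso.refl_hom]
        erw [MonoidalCategory.id_whiskerRight, MonoidalCategory.whiskerLeft_id, Category.id_comp,
          Category.id_comp, Category.comp_id, Category.comp_id]
        rfl
      left_unitality := fun X => by
        simp only [Iso.refl_hom]
        erw [MonoidalCategory.id_whiskerRight, Category.id_comp, Category.id_comp]
        rfl
      right_unitality := fun X => by
        simp only [Iso.refl_hom]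
        erw [MonoidalCategory.whiskerLeft_id, Category.id_comp, Category.id_comp]
        rfl }

end

section Braided
variable {R K : Type u} [CommRing R] [CommRing K] [Algebra R K]
variable {C : Type v} [Category.{u} C] [Preadditive C] [Linear R C]
variable [MonoidalCategory C] [MonoidalPreadditive C] [MonoidalLinear R C] [SymmetricCategory C]

instance : BraidedCategory (ScalarExt R K C) where
  braiding X Y := (ι R K C).mapIso (β_ X.as Y.as)
  braiding_naturality_left {X Y} f Z := by
    change _ ≫ (hom 1 (β_ Y.as Z.as).hom : of _ ⟶ of _) =
      (hom 1 (β_ X.as Z.as).hom : of _ ⟶ of _) ≫ _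
    induction f using hom_induction with
    | zero => simp only [whiskerLeft_zero', zero_whiskerRight', Limits.comp_zero, Limits.zero_comp]
    | add x y hx hy =>
      simp only [whiskerLeft_add', add_whiskerRight', Preadditive.add_comp, Preadditive.comp_add,
        hx, hy]
    | tmul =>
      simp only [whiskerLeft_hom, hom_whiskerRight]
      erw [hom_comp, hom_comp, BraidedCategory.braiding_naturality_left, mul_one, one_mul]
  braiding_naturality_right X {Y Z} f := by
    change _ ≫ (hom 1 (β_ X.as Z.as).hom : of _ ⟶ of _) =
      (hom 1 (β_ X.as Y.as).hom : of _ ⟶ of _) ≫ _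
    induction f using hom_induction with
    | zero => simp only [whiskerLeft_zero', zero_whiskerRight', Limits.comp_zero, Limits.zero_comp]
    | add x y hx hy =>
      simp only [whiskerLeft_add', add_whiskerRight', Preadditive.add_comp, Preadditive.comp_add,
        hx, hy]
    | tmul =>
      simp only [whiskerLeft_hom, hom_whiskerRight]
      erw [hom_comp, hom_comp, BraidedCategory.braiding_naturality_right, mul_one, one_mul]
  hexagon_forward X Y Z := by
    change (hom 1 (α_ X.as Y.as Z.as).hom : of _ ⟶ of _) ≫
      (hom 1 (β_ X.as (Y.as ⊗ Z.as)).hom : of _ ⟶ of _) ≫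
      (hom 1 (α_ Y.as Z.as X.as).hom : of _ ⟶ of _) =
      (hom 1 ((β_ X.as Y.as).hom ▷ Z.as) : of _ ⟶ of _) ≫
      (hom 1 (α_ Y.as X.as Z.as).hom : of _ ⟶ of _) ≫
      (hom 1 (Y.as ◁ (β_ X.as Z.as).hom) : of _ ⟶ of _)
    simp only [hom_comp, mul_one, BraidedCategory.hexagon_forward]
  hexagon_reverse X Y Z := by
    change (hom 1 (α_ X.as Y.as Z.as).inv : of _ ⟶ of _) ≫
      (hom 1 (β_ (X.as ⊗ Y.as) Z.as).hom : of _ ⟶ of _) ≫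
      (hom 1 (α_ Z.as X.as Y.as).inv : of _ ⟶ of _) =
      (hom 1 (X.as ◁ (β_ Y.as Z.as).hom) : of _ ⟶ of _) ≫
      (hom 1 (α_ X.as Z.as Y.as).inv : of _ ⟶ of _) ≫
      (hom 1 ((β_ X.as Z.as).hom ▷ Y.as) : of _ ⟶ of _)
    simp only [hom_comp, mul_one, BraidedCategory.hexagon_reverse]

instance : SymmetricCategory (ScalarExt R K C) where
  symmetry X Y := by
    change (hom 1 (β_ X.as Y.as).hom : of _ ⟶ of _) ≫ (hom 1 (β_ Y.as X.as).hom : of _ ⟶ of _) = _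
    simp only [hom_comp, mul_one, SymmetricCategory.symmetry]; rfl

instance : (ι R K C).Braided where
  braided X Y := by
    change 𝟙 _ ≫ _ = _ ≫ 𝟙 _
    erw [Category.comp_id, Category.id_comp]; rfl

end Braided

/-- A functor from an `R`-linear to a `K`-linear category is linear along `R → K`. -/
class IsLinearAlong (R K : Type u) [CommRing R] [CommRing K] [Algebra R K]
    {C : Type v} [Category.{u} C] [Preadditive C] [Linear R C]
    {D : Type w} [Category.{u} D] [Preadditive D] [Linear K D] (F : C ⥤ D) : Prop where
  map_add : ∀ {X Y : C} (f g : X ⟶ Y), F.map (f + g) = F.map f + F.map g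
  map_smul : ∀ {X Y : C} (r : R) (f : X ⟶ Y), F.map (r • f) = algebraMap R K r • F.map f

section Lift
variable {R K : Type u} [CommRing R] [CommRing K] [Algebra R K]
variable {C : Type v} [Category.{u} C] [Preadditive C] [Linear R C]
variable {D : Type w} [Category.{u} D] [Preadditive D]

instance : IsLinearAlong R K (ι R K C) where
  map_add f g := hom_add _ _ _
  map_smul {X Y} r f := by
    change (1 : K) ⊗ₜ[R] (r • f) = algebraMap R K r • ((1 : K) ⊗ₜ[R] f)
    rw [TensorProduct.tmul_smul, algebraMap_smul]

instance {E : Type v} [Category.{u} E] [Preadditive E] [Linear R E] (G : E ⥤ C) [G.Additive]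
    [G.Linear R] [Linear K D] (F : C ⥤ D) [IsLinearAlong R K F] : IsLinearAlong R K (G ⋙ F) where
  map_add f g := by simp [IsLinearAlong.map_add (R := R) (K := K)]
  map_smul r f := by simp [IsLinearAlong.map_smul (R := R) (K := K)]

variable [Linear K D] (F : C ⥤ D) [IsLinearAlong R K F]

variable (R K) in
def liftMap (X Y : C) : K ⊗[R] (X ⟶ Y) →+ (F.obj X ⟶ F.obj Y) :=
  TensorProduct.liftAddHom
    (AddMonoidHom.mk' (fun k => AddMonoidHom.mk' (fun f => k • F.map f)
      (fun f g => by rw [IsLinearAlong.map_add (R := R) (K := K), smul_add]))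
      (fun k l => by ext f; exact add_smul k l (F.map f)))
    (fun r k f => by
      change (r • k) • F.map f = k • F.map (r • f)
      rw [IsLinearAlong.map_smul (R := R) (K := K), smul_smul, Algebra.smul_def, mul_comm])

theorem liftMap_tmul (X Y : C) (k : K) (f : X ⟶ Y) :
    liftMap R K F X Y (k ⊗ₜ[R] f) = k • F.map f := rfl

variable (R K) in
/-- The `K`-linear functor `C ⊗_R K ⥤ D` induced by a functor `C ⥤ D` linear along `R → K`. -/
def lift : ScalarExt R K C ⥤ D where
  obj X := F.obj X.as
  map {X Y} f := liftMap R K F X.as Y.as f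
  map_id X := by
    change liftMap R K F _ _ ((1 : K) ⊗ₜ[R] 𝟙 X.as) = _
    rw [liftMap_tmul, one_smul, F.map_id]
  map_comp {X Y Z} f g := by
    induction f using hom_induction with
    | zero => rw [Limits.zero_comp]; erw [map_zero, map_zero, Limits.zero_comp]
    | add x y hx hy =>
      rw [Preadditive.add_comp]; erw [map_add, hx, hy, map_add, Preadditive.add_comp]
    | tmul k f =>
    induction g using hom_induction with
    | zero => rw [Limits.comp_zero]; erw [map_zero, map_zero, Limits.comp_zero]
    | add x y hx hy =>
      rw [Preadditive.comp_add]; erw [map_add, hx, hy, map_add, Preadditive.comp_add]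
    | tmul l g =>
      rw [hom_comp]
      erw [liftMap_tmul, liftMap_tmul, liftMap_tmul]
      rw [F.map_comp, Linear.smul_comp, Linear.comp_smul, smul_smul]

theorem lift_map_hom {X Y : ScalarExt R K C} (k : K) (f : X.as ⟶ Y.as) :
    (lift R K F).map (hom k f : X ⟶ Y) = k • F.map f := rfl

instance : (lift R K F).Additive where
  map_add {X Y f g} := map_add (liftMap R K F X.as Y.as) f g

instance : (lift R K F).Linear K where
  map_smul {X Y} f r := by
    induction f using hom_induction with
    | zero => rw [smul_zero, Functor.map_zero, smul_zero]
    | add x y hx hy => rw [smul_add, Functor.map_add, Functor.map_add, hx, hy, smul_add]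
    | tmul k f => rw [smul_hom, lift_map_hom, lift_map_hom]; exact mul_smul _ _ _

variable [MonoidalCategory C] [MonoidalPreadditive C] [MonoidalLinear R C] [SymmetricCategory C]
variable [MonoidalCategory D] [MonoidalPreadditive D] [MonoidalLinear K D] [SymmetricCategory D]
variable [F.Braided]

open Functor.LaxMonoidal Functor.Monoidal

theorem liftMap_whiskerRight {X Y : C} (t : K ⊗[R] (X ⟶ Y)) (Z : C) :
    liftMap R K F X Y t ▷ F.obj Z ≫ μ F Y Z =
      μ F X Z ≫ liftMap R K F _ _ ((whiskerR Z X Y).lTensor K t) := by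
  induction t using TensorProduct.induction_on with
  | zero => simp
  | tmul k f => simp [liftMap_tmul, whiskerR]
  | add x y hx hy => simp only [map_add, MonoidalPreadditive.add_whiskerRight,
      Preadditive.add_comp, Preadditive.comp_add, hx, hy]

theorem liftMap_whiskerLeft {X Y : C} (t : K ⊗[R] (X ⟶ Y)) (Z : C) :
    F.obj Z ◁ liftMap R K F X Y t ≫ μ F Z Y =
      μ F Z X ≫ liftMap R K F _ _ ((whiskerL Z X Y).lTensor K t) := by
  induction t using TensorProduct.induction_on with
  | zero => simp
  | tmul k f => simp [liftMap_tmul, whiskerL]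
  | add x y hx hy => simp only [map_add, MonoidalPreadditive.whiskerLeft_add,
      Preadditive.add_comp, Preadditive.comp_add, hx, hy]

theorem lift_map_one {X Y : C} (f : X ⟶ Y) :
    (lift R K F).map (hom 1 f : of X ⟶ of Y) = F.map f := one_smul K (F.map f)

instance : (lift R K F).Monoidal :=
  Functor.CoreMonoidal.toMonoidal
    { εIso := εIso F
      μIso := fun X Y => μIso F X.as Y.as
      μIso_hom_natural_left := fun f X' => liftMap_whiskerRight F f X'.as
      μIso_hom_natural_right := fun X' f => liftMap_whiskerLeft F f X'.as
      associativity := fun X Y Z => by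
        erw [lift_map_one F (α_ X.as Y.as Z.as).hom]; exact associativity F _ _ _
      left_unitality := fun X => by
        erw [lift_map_one F (λ_ X.as).hom]; exact left_unitality F _
      right_unitality := fun X => by
        erw [lift_map_one F (ρ_ X.as).hom]; exact right_unitality F _ }

instance : (lift R K F).Braided where
  braided X Y := by
    erw [lift_map_one F (β_ X.as Y.as).hom]
    exact Functor.LaxBraided.braided (F := F) X.as Y.as

end Lift
end ScalarExt

/-- A kind of extra structure on `A`-modules (such as a connection, or an action of derivations),
the property of being a structure-preserving linear map, and the structure carried by tensor
products and by the unit; `B`-linear combinations of structure-preserving maps are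
structure-preserving. -/
structure ModuleTheory (B A : Type u) [CommRing B] [CommRing A] [Algebra B A] where
  Str : ModuleCat.{u} A → Type u
  IsHom : ∀ {M N : ModuleCat.{u} A}, Str M → Str N → (M ⟶ N) → Prop
  isHom_id : ∀ {M} (s : Str M), IsHom s s (𝟙 M)
  isHom_comp : ∀ {M N P} {s : Str M} {t : Str N} {r : Str P} {f : M ⟶ N} {g : N ⟶ P},
    IsHom s t f → IsHom t r g → IsHom s r (f ≫ g)
  isHom_zero : ∀ {M N} {s : Str M} {t : Str N}, IsHom s t 0
  isHom_add : ∀ {M N} {s : Str M} {t : Str N} {f g : M ⟶ N},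
    IsHom s t f → IsHom s t g → IsHom s t (f + g)
  isHom_smul : ∀ {M N} {s : Str M} {t : Str N} (b : B) {f : M ⟶ N},
    IsHom s t f → IsHom s t (algebraMap B A b • f)
  isHom_inv : ∀ {M N} {s : Str M} {t : Str N} (e : M ≅ N), IsHom s t e.hom → IsHom t s e.inv
  unit : Str (𝟙_ (ModuleCat A))
  tensor : ∀ {M N}, Str M → Str N → Str (M ⊗ N)
  isHom_tensor : ∀ {M N M' N'} {s : Str M} {t : Str N} {s' : Str M'} {t' : Str N'}
    {f : M ⟶ N} {g : M' ⟶ N'},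
    IsHom s t f → IsHom s' t' g → IsHom (tensor s s') (tensor t t') (f ⊗ₘ g)
  isHom_associator : ∀ {M N P} (s : Str M) (t : Str N) (r : Str P),
    IsHom (tensor (tensor s t) r) (tensor s (tensor t r)) (α_ M N P).hom
  isHom_leftUnitor : ∀ {M} (s : Str M), IsHom (tensor unit s) s (λ_ M).hom
  isHom_rightUnitor : ∀ {M} (s : Str M), IsHom (tensor s unit) s (ρ_ M).hom
  isHom_braiding : ∀ {M N} (s : Str M) (t : Str N),
    IsHom (tensor s t) (tensor t s) (β_ M N).hom

namespace ModuleTheory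
section
variable {B A : Type u} [CommRing B] [CommRing A] [Algebra B A] (T : ModuleTheory B A)

/-- The category of modules with the given extra structure. -/
structure Obj where
  module : ModuleCat.{u} A
  str : T.Str module

variable {T}

theorem isHom_neg {M N : ModuleCat.{u} A} {s : T.Str M} {t : T.Str N} {f : M ⟶ N}
    (h : T.IsHom s t f) : T.IsHom s t (-f) := by
  have := T.isHom_smul (-1) h
  rwa [map_neg, map_one, neg_smul, one_smul] at this

/-- The structure-preserving linear maps. -/
def homs (X Y : T.Obj) : AddSubgroup (X.module ⟶ Y.module) where
  carrier := {f | T.IsHom X.str Y.str f}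
  zero_mem' := T.isHom_zero
  add_mem' := T.isHom_add
  neg_mem' := isHom_neg

instance : Category T.Obj where
  Hom X Y := homs X Y
  id X := ⟨𝟙 X.module, T.isHom_id _⟩
  comp f g := ⟨f.1 ≫ g.1, T.isHom_comp f.2 g.2⟩
  id_comp f := Subtype.ext (Category.id_comp f.1)
  comp_id f := Subtype.ext (Category.comp_id f.1)
  assoc f g h := Subtype.ext (Category.assoc f.1 g.1 h.1)

/-- Constructor for morphisms. -/
def mkHom {X Y : T.Obj} (f : X.module ⟶ Y.module) (h : T.IsHom X.str Y.str f) : X ⟶ Y := ⟨f, h⟩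

/-- Constructor for isomorphisms. -/
def mkIso {X Y : T.Obj} (e : X.module ≅ Y.module) (h : T.IsHom X.str Y.str e.hom) : X ≅ Y where
  hom := mkHom e.hom h
  inv := mkHom e.inv (T.isHom_inv e h)
  hom_inv_id := Subtype.ext e.hom_inv_id
  inv_hom_id := Subtype.ext e.inv_hom_id

instance : Preadditive T.Obj where
  homGroup X Y := inferInstanceAs (AddCommGroup (homs X Y))
  add_comp _ _ _ f f' g := Subtype.ext (Preadditive.add_comp _ _ _ f.1 f'.1 g.1)
  comp_add _ _ _ f g g' := Subtype.ext (Preadditive.comp_add _ _ _ f.1 g.1 g'.1)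

variable (T) in
/-- The functor forgetting the extra structure. -/
def forget : T.Obj ⥤ ModuleCat.{u} A where
  obj X := X.module
  map f := f.1

instance : (forget T).Faithful where
  map_injective h := Subtype.ext h

instance : (forget T).Additive where
  map_add := rfl

instance (X Y : T.Obj) : Module B (X ⟶ Y) where
  smul b f := ⟨algebraMap B A b • f.1, T.isHom_smul b f.2⟩
  one_smul f := Subtype.ext (by
    change algebraMap B A 1 • f.1 = f.1; rw [map_one, one_smul])
  mul_smul a b f := Subtype.ext (by
    change algebraMap B A (a * b) • f.1 = algebraMap B A a • algebraMap B A b • f.1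
    rw [map_mul, mul_smul])
  smul_zero a := Subtype.ext (smul_zero _)
  smul_add a f g := Subtype.ext (smul_add _ _ _)
  add_smul a b f := Subtype.ext (by
    change algebraMap B A (a + b) • f.1 = algebraMap B A a • f.1 + algebraMap B A b • f.1
    rw [map_add, add_smul])
  zero_smul f := Subtype.ext (by
    change algebraMap B A 0 • f.1 = 0; rw [map_zero, zero_smul])

instance : Linear B T.Obj where
  smul_comp _ _ _ b f g := Subtype.ext (Linear.smul_comp _ _ _ (algebraMap B A b) f.1 g.1)
  comp_smul _ _ _ f b g := Subtype.ext (Linear.comp_smul _ _ _ f.1 (algebraMap B A b) g.1)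

theorem smul_val {X Y : T.Obj} (b : B) (f : X ⟶ Y) : (b • f).1 = algebraMap B A b • f.1 := rfl

instance : MonoidalCategoryStruct T.Obj where
  tensorObj X Y := ⟨X.module ⊗ Y.module, T.tensor X.str Y.str⟩
  tensorUnit := ⟨𝟙_ _, T.unit⟩
  tensorHom f g := ⟨f.1 ⊗ₘ g.1, T.isHom_tensor f.2 g.2⟩
  whiskerLeft X _ _ g := ⟨X.module ◁ g.1, by
    have := T.isHom_tensor (T.isHom_id X.str) g.2
    rwa [id_tensorHom] at this⟩
  whiskerRight f Y := ⟨f.1 ▷ Y.module, by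
    have := T.isHom_tensor f.2 (T.isHom_id Y.str)
    rwa [tensorHom_id] at this⟩
  associator X Y Z := mkIso (α_ _ _ _) (T.isHom_associator X.str Y.str Z.str)
  leftUnitor X := mkIso (λ_ _) (T.isHom_leftUnitor X.str)
  rightUnitor X := mkIso (ρ_ _) (T.isHom_rightUnitor X.str)

instance : MonoidalCategory T.Obj where
  tensorHom_def f g := Subtype.ext (MonoidalCategory.tensorHom_def f.1 g.1)
  id_tensorHom_id X Y := Subtype.ext (MonoidalCategory.id_tensorHom_id X.module Y.module)
  tensorHom_comp_tensorHom f₁ f₂ g₁ g₂ :=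
    Subtype.ext (MonoidalCategory.tensorHom_comp_tensorHom f₁.1 f₂.1 g₁.1 g₂.1)
  whiskerLeft_id X Y := Subtype.ext (MonoidalCategory.whiskerLeft_id X.module Y.module)
  id_whiskerRight X Y := Subtype.ext (MonoidalCategory.id_whiskerRight X.module Y.module)
  associator_naturality f g h :=
    Subtype.ext (MonoidalCategory.associator_naturality f.1 g.1 h.1)
  leftUnitor_naturality f := Subtype.ext (MonoidalCategory.leftUnitor_naturality f.1)
  rightUnitor_naturality f := Subtype.ext (MonoidalCategory.rightUnitor_naturality f.1)
  pentagon W X Y Z :=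
    Subtype.ext (MonoidalCategory.pentagon W.module X.module Y.module Z.module)
  triangle X Y := Subtype.ext (MonoidalCategory.triangle X.module Y.module)

instance : (forget T).Monoidal :=
  Functor.CoreMonoidal.toMonoidal
    { εIso := Iso.refl _
      μIso := fun _ _ => Iso.refl _
      μIso_hom_natural_left := fun f X => by
        simp only [Iso.refl_hom]; erw [Category.id_comp, Category.comp_id]; rfl
      μIso_hom_natural_right := fun f X => by
        simp only [Iso.refl_hom]; erw [Category.id_comp, Category.comp_id]; rfl
      associativity := fun X Y Z => by
        simp only [Iso.refl_hom]
        erw [MonoidalCategory.id_whiskerRight, MonoidalCategory.whiskerLeft_id, Category.id_comp,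
          Category.id_comp]
      left_unitality := fun X => by
        simp only [Iso.refl_hom]
        erw [MonoidalCategory.id_whiskerRight, Category.id_comp, Category.id_comp]
        rfl
      right_unitality := fun X => by
        simp only [Iso.refl_hom]
        erw [MonoidalCategory.whiskerLeft_id, Category.id_comp, Category.id_comp]
        rfl }

instance : BraidedCategory T.Obj :=
  .ofFaithful (forget T) (fun X Y => mkIso (β_ X.module Y.module) (T.isHom_braiding X.str Y.str))
    (fun X Y => by
      change 𝟙 _ ≫ _ = _ ≫ 𝟙 _
      erw [Category.comp_id, Category.id_comp]; rfl)

instance : (forget T).Braided where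
  braided X Y := by
    change 𝟙 _ ≫ _ = _ ≫ 𝟙 _
    erw [Category.comp_id, Category.id_comp]; rfl

instance : SymmetricCategory T.Obj := .ofFaithful (forget T)

instance : MonoidalPreadditive T.Obj := monoidalPreadditive_of_faithful (forget T)

instance : MonoidalLinear B T.Obj where
  whiskerLeft_smul X _ _ b f :=
    Subtype.ext (MonoidalLinear.whiskerLeft_smul X.module (algebraMap B A b) f.1)
  smul_whiskerRight b _ _ f X :=
    Subtype.ext (MonoidalLinear.smul_whiskerRight (algebraMap B A b) f.1 X.module)

end

section Functor

variable {B A B' A' : Type u} [CommRing B] [CommRing A] [Algebra B A] [CommRing B'] [CommRing A']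
  [Algebra B' A'] (T : ModuleTheory B A) (T' : ModuleTheory B' A')

/-- The data transporting one kind of structure on modules to another along a symmetric monoidal
functor of module categories. -/
structure Transport (F : ModuleCat.{u} A ⥤ ModuleCat.{u} A') [F.Braided] where
  str : ∀ {M}, T.Str M → T'.Str (F.obj M)
  isHom_map : ∀ {M N} {s : T.Str M} {t : T.Str N} {f : M ⟶ N},
    T.IsHom s t f → T'.IsHom (str s) (str t) (F.map f)
  isHom_ε : T'.IsHom T'.unit (str T.unit) (Functor.LaxMonoidal.ε F)
  isHom_μ : ∀ {M N} (s : T.Str M) (t : T.Str N),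
    T'.IsHom (T'.tensor (str s) (str t)) (str (T.tensor s t)) (Functor.LaxMonoidal.μ F M N)

variable {T T'}

namespace Transport

variable {F : ModuleCat.{u} A ⥤ ModuleCat.{u} A'} [F.Braided] (φ : Transport T T' F)

/-- The functor between categories of modules with structure. -/
def functor : T.Obj ⥤ T'.Obj where
  obj X := ⟨F.obj X.module, φ.str X.str⟩
  map f := ⟨F.map f.1, φ.isHom_map f.2⟩
  map_id X := Subtype.ext (F.map_id _)
  map_comp f g := Subtype.ext (F.map_comp f.1 g.1)

open Functor.Monoidal Functor.LaxMonoidal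

instance : φ.functor.Monoidal :=
  Functor.CoreMonoidal.toMonoidal
    { εIso := mkIso (εIso F) φ.isHom_ε
      μIso := fun X Y => mkIso (μIso F X.module Y.module) (φ.isHom_μ X.str Y.str)
      μIso_hom_natural_left := fun f X => Subtype.ext (μ_natural_left F f.1 X.module)
      μIso_hom_natural_right := fun X f => Subtype.ext (μ_natural_right F X.module f.1)
      associativity := fun X Y Z => Subtype.ext (associativity F X.module Y.module Z.module)
      left_unitality := fun X => Subtype.ext (left_unitality F X.module)
      right_unitality := fun X => Subtype.ext (right_unitality F X.module) }

instance : φ.functor.Braided where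
  braided X Y := Subtype.ext (Functor.LaxBraided.braided (F := F) X.module Y.module)

end Transport
end Functor
end ModuleTheory

/-- The wedge product `Ω × Ω → ⋀² Ω`. -/
def wedge (A : Type u) [CommRing A] (Ω : Type u) [AddCommGroup Ω] [Module A Ω] :
    Ω →ₗ[A] Ω →ₗ[A] ⋀[A]^2 Ω :=
  have e0 : ∀ x y z : Ω, Function.update ![x, y] 0 z = ![z, y] := fun x y z => by
    ext i; fin_cases i <;> simp [Function.update]
  have e1 : ∀ x y z : Ω, Function.update ![x, y] 1 z = ![x, z] := fun x y z => by
    ext i; fin_cases i <;> simp [Function.update]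
  LinearMap.mk₂ A (fun x y => exteriorPower.ιMulti A 2 ![x, y])
    (fun x x' y => by
      have := (exteriorPower.ιMulti A 2 (M := Ω)).map_update_add ![x, y] 0 x x'
      rwa [e0, e0, e0] at this)
    (fun c x y => by
      have := (exteriorPower.ιMulti A 2 (M := Ω)).map_update_smul ![x, y] 0 c x
      rwa [e0, e0] at this)
    (fun x y y' => by
      have := (exteriorPower.ιMulti A 2 (M := Ω)).map_update_add ![x, y] 1 y y'
      rwa [e1, e1, e1] at this)
    (fun c x y => by
      have := (exteriorPower.ιMulti A 2 (M := Ω)).map_update_smul ![x, y] 1 c y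
      rwa [e1, e1] at this)

section
variable {A : Type u} [CommRing A] {Ω : Type u} [AddCommGroup Ω] [Module A Ω]

theorem wedge_apply (x y : Ω) : wedge A Ω x y = exteriorPower.ιMulti A 2 ![x, y] := rfl

theorem wedge_self (x : Ω) : wedge A Ω x x = 0 :=
  (exteriorPower.ιMulti A 2 (M := Ω)).map_eq_zero_of_eq ![x, x] (i := 0) (j := 1) rfl (by decide)

theorem wedge_swap (x y : Ω) : wedge A Ω x y = - wedge A Ω y x := by
  have h := wedge_self (A := A) (x + y)
  simp only [map_add, LinearMap.add_apply, wedge_self, zero_add, add_zero] at h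
  exact eq_neg_of_add_eq_zero_right h
end

/-- A first order differential calculus on the `B`-algebra `A`: an `A`-module `Ω` with a
`B`-derivation `d : A → Ω` whose image spans `Ω` (so `Ω` is a quotient of `Ω_{A/B}`), such that
the exterior differential of one-forms is defined on `Ω`, as a map `d1 : Ω → ⋀² Ω`. -/
structure Calculus (B A : Type u) [CommRing B] [CommRing A] [Algebra B A] where
  Ω : Type u
  [grp : AddCommGroup Ω]
  [mod : Module A Ω]
  d : A →+ Ω
  d_mul : ∀ a b, d (a * b) = a • d b + b • d a
  d_algebraMap : ∀ b : B, d (algebraMap B A b) = 0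
  span_d : Submodule.span A (Set.range d) = ⊤
  d1 : Ω →+ ⋀[A]^2 Ω
  d1_smul : ∀ (a : A) (ω : Ω), d1 (a • ω) = wedge A Ω (d a) ω + a • d1 ω
  d1_d : ∀ a, d1 (d a) = 0

attribute [instance] Calculus.grp Calculus.mod

namespace Calculus
variable {B A : Type u} [CommRing B] [CommRing A] [Algebra B A] (𝒜 : Calculus B A)

theorem d_one : 𝒜.d 1 = 0 := by
  have := 𝒜.d_algebraMap 1
  rwa [map_one] at this

@[elab_as_elim]
theorem Ω_induction {P : 𝒜.Ω → Prop} (ω : 𝒜.Ω) (d : ∀ a, P (𝒜.d a)) (zero : P 0)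
    (add : ∀ x y, P x → P y → P (x + y)) (smul : ∀ (a : A) x, P x → P (a • x)) : P ω := by
  have h : ω ∈ Submodule.span A (Set.range 𝒜.d) := by rw [𝒜.span_d]; trivial
  induction h using Submodule.span_induction with
  | mem x h => obtain ⟨a, rfl⟩ := h; exact d a
  | zero => exact zero
  | add x y _ _ hx hy => exact add x y hx hy
  | smul a x _ hx => exact smul a x hx

section Connections
variable (M N P : Type u) [AddCommGroup M] [Module A M] [AddCommGroup N] [Module A N]
  [AddCommGroup P] [Module A P]

/-- An `Ω`-connection on `M`. (It is `B`-linear because `d` kills `B`.) -/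
structure PreConn where
  nabla : M →+ M ⊗[A] 𝒜.Ω
  leibniz : ∀ (a : A) (m : M), nabla (a • m) = a • nabla m + m ⊗ₜ[A] 𝒜.d a

variable {𝒜 M N P}

/-- The extension of a connection to `M ⊗ Ω → M ⊗ ⋀² Ω`, `m ⊗ ω ↦ ∇ m ∧ ω + m ⊗ d ω`. -/
def PreConn.nabla1 (s : 𝒜.PreConn M) : M ⊗[A] 𝒜.Ω →+ M ⊗[A] (⋀[A]^2 𝒜.Ω) :=
  TensorProduct.liftAddHom
    (AddMonoidHom.mk' (fun m => AddMonoidHom.mk'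
      (fun ω => ((wedge A 𝒜.Ω).flip ω).lTensor M (s.nabla m) + m ⊗ₜ[A] 𝒜.d1 ω)
      (fun ω ω' => by
        simp only [map_add, LinearMap.lTensor_add, LinearMap.add_apply, TensorProduct.tmul_add]
        abel))
      (fun m m' => by
        ext ω
        simp only [map_add, AddMonoidHom.mk'_apply, AddMonoidHom.add_apply, TensorProduct.add_tmul]
        abel))
    (fun a m ω => by
      simp only [AddMonoidHom.mk'_apply, s.leibniz, map_add, map_smul, LinearMap.lTensor_tmul,
        LinearMap.flip_apply, 𝒜.d1_smul, TensorProduct.tmul_add, LinearMap.lTensor_smul,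
        LinearMap.smul_apply, TensorProduct.smul_tmul, TensorProduct.tmul_smul]
      abel)

theorem PreConn.nabla1_tmul (s : 𝒜.PreConn M) (m : M) (ω : 𝒜.Ω) :
    s.nabla1 (m ⊗ₜ[A] ω) =
      ((wedge A 𝒜.Ω).flip ω).lTensor M (s.nabla m) + m ⊗ₜ[A] 𝒜.d1 ω := rfl

/-- The connection is integrable: its curvature vanishes. -/
def PreConn.Integrable (s : 𝒜.PreConn M) : Prop := ∀ m, s.nabla1 (s.nabla m) = 0

/-- A linear map is horizontal. -/
def PreConn.Horizontal (s : 𝒜.PreConn M) (t : 𝒜.PreConn N) (f : M →ₗ[A] N) : Prop :=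
  ∀ m, f.rTensor 𝒜.Ω (s.nabla m) = t.nabla (f m)

variable (𝒜) in
/-- The trivial connection `d` on `A`. -/
def PreConn.unit : 𝒜.PreConn A where
  nabla := AddMonoidHom.mk' (fun a => (1 : A) ⊗ₜ[A] 𝒜.d a) (fun a b => by
    rw [map_add, TensorProduct.tmul_add])
  leibniz a m := by
    simp only [AddMonoidHom.mk'_apply, smul_eq_mul, 𝒜.d_mul, TensorProduct.tmul_add,
      TensorProduct.tmul_smul]
    congr 1
    rw [TensorProduct.smul_tmul', smul_eq_mul, mul_one]

theorem PreConn.unit_nabla (a : A) : (PreConn.unit 𝒜).nabla a = (1 : A) ⊗ₜ[A] 𝒜.d a := rfl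

theorem PreConn.unit_integrable : (PreConn.unit 𝒜).Integrable := fun a => by
  rw [unit_nabla, nabla1_tmul, unit_nabla, d_one, 𝒜.d1_d]
  simp

/-- The map `m ⊗ n ↦ ∇ m ⊗ n + m ⊗ ∇ n`. -/
def PreConn.tensorNabla (s : 𝒜.PreConn M) (t : 𝒜.PreConn N) :
    M ⊗[A] N →+ (M ⊗[A] N) ⊗[A] 𝒜.Ω :=
  TensorProduct.liftAddHom
    (AddMonoidHom.mk' (fun m => AddMonoidHom.mk'
      (fun n => ((TensorProduct.mk A M N).flip n).rTensor 𝒜.Ω (s.nabla m) +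
        (TensorProduct.mk A M N m).rTensor 𝒜.Ω (t.nabla n))
      (fun n n' => by
        simp only [map_add, LinearMap.rTensor_add, LinearMap.add_apply]
        abel))
      (fun m m' => by
        ext n
        simp only [map_add, AddMonoidHom.mk'_apply, AddMonoidHom.add_apply, LinearMap.rTensor_add,
          LinearMap.add_apply]
        abel))
    (fun a m n => by
      simp only [AddMonoidHom.mk'_apply, s.leibniz, t.leibniz, map_add, map_smul,
        LinearMap.rTensor_tmul, LinearMap.flip_apply, LinearMap.rTensor_smul, LinearMap.smul_apply,
        TensorProduct.mk_apply]
      abel)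

theorem PreConn.tensorNabla_tmul (s : 𝒜.PreConn M) (t : 𝒜.PreConn N) (m : M) (n : N) :
    s.tensorNabla t (m ⊗ₜ[A] n) = ((TensorProduct.mk A M N).flip n).rTensor 𝒜.Ω (s.nabla m) +
        (TensorProduct.mk A M N m).rTensor 𝒜.Ω (t.nabla n) := rfl

/-- The tensor product connection `m ⊗ n ↦ ∇ m ⊗ n + m ⊗ ∇ n`. -/
def PreConn.tensor (s : 𝒜.PreConn M) (t : 𝒜.PreConn N) : 𝒜.PreConn (M ⊗[A] N) where
  nabla := s.tensorNabla t
  leibniz a x := by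
    induction x using TensorProduct.induction_on with
    | zero => rw [smul_zero, map_zero, smul_zero, TensorProduct.zero_tmul, add_zero]
    | add x y hx hy =>
      rw [smul_add, map_add, hx, hy, map_add, TensorProduct.add_tmul, smul_add]; abel
    | tmul m n =>
      rw [TensorProduct.smul_tmul', tensorNabla_tmul, tensorNabla_tmul, s.leibniz, map_add,
        map_smul, LinearMap.rTensor_tmul, LinearMap.flip_apply, TensorProduct.mk_apply,
        map_smul, LinearMap.rTensor_smul, LinearMap.smul_apply, smul_add]
      abel

theorem PreConn.tensor_nabla (s : 𝒜.PreConn M) (t : 𝒜.PreConn N) (m : M) (n : N) :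
    (s.tensor t).nabla (m ⊗ₜ[A] n) = ((TensorProduct.mk A M N).flip n).rTensor 𝒜.Ω (s.nabla m) +
        (TensorProduct.mk A M N m).rTensor 𝒜.Ω (t.nabla n) := rfl

theorem PreConn.tensor_integrable {s : 𝒜.PreConn M} {t : 𝒜.PreConn N} (hs : s.Integrable)
    (ht : t.Integrable) : (s.tensor t).Integrable := by
  have h1 : ∀ (n : N) (x : M ⊗[A] 𝒜.Ω),
      (s.tensor t).nabla1 (((TensorProduct.mk A M N).flip n).rTensor 𝒜.Ω x) =
        ((TensorProduct.mk A M N).flip n).rTensor _ (s.nabla1 x) +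
        TensorProduct.map₂ (TensorProduct.mk A M N) (wedge A 𝒜.Ω).flip x (t.nabla n) := by
    intro n x
    induction x using TensorProduct.induction_on with
    | zero => simp
    | add x y hx hy => simp only [map_add, LinearMap.add_apply, hx, hy]; abel
    | tmul m ω =>
      simp only [LinearMap.rTensor_tmul, nabla1_tmul, map_add, LinearMap.flip_apply,
        TensorProduct.mk_apply, tensor_nabla]
      generalize s.nabla m = x
      generalize t.nabla n = y
      have e1 : ((wedge A 𝒜.Ω).flip ω).lTensor (M ⊗[A] N)
          (((TensorProduct.mk A M N).flip n).rTensor 𝒜.Ω x) =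
          ((TensorProduct.mk A M N).flip n).rTensor _ (((wedge A 𝒜.Ω).flip ω).lTensor M x) := by
        rw [← LinearMap.comp_apply, ← LinearMap.comp_apply, LinearMap.lTensor_comp_rTensor,
          LinearMap.rTensor_comp_lTensor]
      have e2 : ((wedge A 𝒜.Ω).flip ω).lTensor (M ⊗[A] N)
          ((TensorProduct.mk A M N m).rTensor 𝒜.Ω y) =
          TensorProduct.map₂ (TensorProduct.mk A M N) (wedge A 𝒜.Ω).flip (m ⊗ₜ[A] ω) y := by
        induction y using TensorProduct.induction_on with
        | zero => simp
        | add x y hx hy => simp only [map_add, hx, hy]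
        | tmul n η => simp
      rw [e1, e2]; abel
  have h2 : ∀ (m : M) (y : N ⊗[A] 𝒜.Ω),
      (s.tensor t).nabla1 ((TensorProduct.mk A M N m).rTensor 𝒜.Ω y) =
        (TensorProduct.mk A M N m).rTensor _ (t.nabla1 y) +
        TensorProduct.map₂ (TensorProduct.mk A M N) (wedge A 𝒜.Ω) (s.nabla m) y := by
    intro m y
    induction y using TensorProduct.induction_on with
    | zero => simp
    | add x y hx hy => simp only [map_add, hx, hy]; abel
    | tmul n ω =>
      simp only [LinearMap.rTensor_tmul, nabla1_tmul, map_add,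
        TensorProduct.mk_apply, tensor_nabla]
      generalize s.nabla m = x
      generalize t.nabla n = y
      have e1 : ((wedge A 𝒜.Ω).flip ω).lTensor (M ⊗[A] N)
          ((TensorProduct.mk A M N m).rTensor 𝒜.Ω y) =
          (TensorProduct.mk A M N m).rTensor _ (((wedge A 𝒜.Ω).flip ω).lTensor N y) := by
        rw [← LinearMap.comp_apply, ← LinearMap.comp_apply, LinearMap.lTensor_comp_rTensor,
          LinearMap.rTensor_comp_lTensor]
      have e2 : ((wedge A 𝒜.Ω).flip ω).lTensor (M ⊗[A] N)
          (((TensorProduct.mk A M N).flip n).rTensor 𝒜.Ω x) =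
          TensorProduct.map₂ (TensorProduct.mk A M N) (wedge A 𝒜.Ω) x (n ⊗ₜ[A] ω) := by
        induction x using TensorProduct.induction_on with
        | zero => simp
        | add x y hx hy => simp only [map_add, LinearMap.add_apply, hx, hy]
        | tmul n η => simp
      rw [e1, e2]; abel
  have h3 : ∀ (x : M ⊗[A] 𝒜.Ω) (y : N ⊗[A] 𝒜.Ω),
      TensorProduct.map₂ (TensorProduct.mk A M N) (wedge A 𝒜.Ω).flip x y +
      TensorProduct.map₂ (TensorProduct.mk A M N) (wedge A 𝒜.Ω) x y = 0 := by
    intro x y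
    induction x using TensorProduct.induction_on with
    | zero => simp
    | add x x' hx hy =>
      simp only [map_add, LinearMap.add_apply]
      rw [add_add_add_comm, hx, hy, add_zero]
    | tmul m ω =>
      induction y using TensorProduct.induction_on with
      | zero => simp
      | add x x' hx hy => simp only [map_add]; rw [add_add_add_comm, hx, hy, add_zero]
      | tmul n η =>
        simp only [TensorProduct.map₂_apply_tmul, TensorProduct.map_tmul, LinearMap.flip_apply]
        rw [wedge_swap ω η, TensorProduct.tmul_neg, add_neg_cancel]
  intro x
  induction x using TensorProduct.induction_on with
  | zero => simp
  | add x y hx hy => simp only [map_add, hx, hy, add_zero]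
  | tmul m n =>
    rw [tensor_nabla, map_add, h1, h2, hs m, ht n, map_zero, map_zero, zero_add, zero_add]
    exact h3 _ _

end Connections
end Calculus

theorem finitePresentation_tensor (A : Type u) [CommRing A] (M N : Type u) [AddCommGroup M]
    [Module A M] [AddCommGroup N] [Module A N] [Module.FinitePresentation A M]
    [Module.FinitePresentation A N] : Module.FinitePresentation A (M ⊗[A] N) := by
  obtain ⟨n, m, f, g, hf, hg⟩ := Module.FinitePresentation.exists_fin' A N
  have : Module.FinitePresentation A (M ⊗[A] (Fin n → A)) :=
    .of_equiv (TensorProduct.piScalarRight A A M (Fin n)).symm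
  refine Module.finitePresentation_of_surjective (f.lTensor M) (LinearMap.lTensor_surjective M hf) ?_
  rw [LinearMap.exact_iff.mp (lTensor_exact M hg hf)]
  exact (Module.Finite.iff_fg).mp inferInstance

namespace Calculus
variable {B A : Type u} [CommRing B] [CommRing A] [Algebra B A] (𝒜 : Calculus B A)

namespace PreConn
variable {𝒜}
variable {M N P M' N' : Type u} [AddCommGroup M] [Module A M] [AddCommGroup N] [Module A N]
  [AddCommGroup P] [Module A P] [AddCommGroup M'] [Module A M'] [AddCommGroup N'] [Module A N']

theorem horizontal_of_span {s : 𝒜.PreConn M} {t : 𝒜.PreConn N} (f : M →ₗ[A] N) (S : Set M)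
    (hS : Submodule.span A S = ⊤) (h : ∀ m ∈ S, f.rTensor 𝒜.Ω (s.nabla m) = t.nabla (f m)) :
    s.Horizontal t f := by
  intro m
  have hm : m ∈ Submodule.span A S := by rw [hS]; trivial
  induction hm using Submodule.span_induction with
  | mem x hx => exact h x hx
  | zero => simp
  | add x y _ _ hx hy => simp only [map_add, hx, hy]
  | smul a x _ hx => simp only [s.leibniz, t.leibniz, map_add, map_smul, hx, LinearMap.rTensor_tmul]

theorem horizontal_tensor_ext {s : 𝒜.PreConn M} {t : 𝒜.PreConn N} {r : 𝒜.PreConn P}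
    (f : M ⊗[A] N →ₗ[A] P)
    (h : ∀ m n, f.rTensor 𝒜.Ω ((s.tensor t).nabla (m ⊗ₜ n)) = r.nabla (f (m ⊗ₜ n))) :
    (s.tensor t).Horizontal r f := by
  intro x
  induction x using TensorProduct.induction_on with
  | zero => simp
  | tmul m n => exact h m n
  | add x y hx hy => simp only [map_add, hx, hy]

theorem horizontal_inv {s : 𝒜.PreConn M} {t : 𝒜.PreConn N} (f : M →ₗ[A] N) (g : N →ₗ[A] M)
    (hfg : f ∘ₗ g = .id) (hgf : g ∘ₗ f = .id) (h : s.Horizontal t f) : t.Horizontal s g := by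
  intro n
  have h1 := h (g n)
  rw [← LinearMap.comp_apply f g, hfg, LinearMap.id_apply] at h1
  rw [← h1, ← LinearMap.comp_apply, ← LinearMap.rTensor_comp, hgf, LinearMap.rTensor_id,
    LinearMap.id_apply]

theorem horizontal_map {s : 𝒜.PreConn M} {t : 𝒜.PreConn N} {s' : 𝒜.PreConn M'}
    {t' : 𝒜.PreConn N'} {f : M →ₗ[A] N} {g : M' →ₗ[A] N'} (hf : s.Horizontal t f)
    (hg : s'.Horizontal t' g) :
    (s.tensor s').Horizontal (t.tensor t') (TensorProduct.map f g) := by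
  apply horizontal_tensor_ext
  intro m n
  rw [tensor_nabla, TensorProduct.map_tmul, tensor_nabla, ← hf, ← hg, map_add]
  simp only [← LinearMap.comp_apply, ← LinearMap.rTensor_comp]
  congr 2

theorem horizontal_assoc (s : 𝒜.PreConn M) (t : 𝒜.PreConn N) (r : 𝒜.PreConn P) :
    ((s.tensor t).tensor r).Horizontal (s.tensor (t.tensor r))
      (TensorProduct.assoc A M N P).toLinearMap := by
  apply horizontal_tensor_ext
  intro x p
  induction x using TensorProduct.induction_on with
  | zero => simp
  | add x y hx hy => simp only [TensorProduct.add_tmul, map_add, hx, hy]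
  | tmul m n =>
    rw [tensor_nabla, tensor_nabla, LinearEquiv.coe_coe, TensorProduct.assoc_tmul, tensor_nabla,
      tensor_nabla]
    simp only [map_add, ← LinearMap.comp_apply, ← LinearMap.rTensor_comp]
    rw [← add_assoc]
    congr 2

theorem horizontal_lid (s : 𝒜.PreConn M) :
    ((unit 𝒜).tensor s).Horizontal s (TensorProduct.lid A M).toLinearMap := by
  apply horizontal_tensor_ext
  intro a m
  have e : (TensorProduct.lid A M).toLinearMap ∘ₗ TensorProduct.mk A A M a = a • .id := by
    ext; simp
  have h1 : (TensorProduct.lid A M).toLinearMap.rTensor 𝒜.Ω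
      ((TensorProduct.mk A A M a).rTensor 𝒜.Ω (s.nabla m)) = a • s.nabla m := by
    rw [← LinearMap.comp_apply, ← LinearMap.rTensor_comp, e, LinearMap.rTensor_smul]; simp
  rw [tensor_nabla, LinearEquiv.coe_coe, TensorProduct.lid_tmul, s.leibniz, unit_nabla, map_add, h1,
    add_comm]
  simp

theorem horizontal_rid (s : 𝒜.PreConn M) :
    (s.tensor (unit 𝒜)).Horizontal s (TensorProduct.rid A M).toLinearMap := by
  apply horizontal_tensor_ext
  intro m a
  have e : (TensorProduct.rid A M).toLinearMap ∘ₗ (TensorProduct.mk A M A).flip a = a • .id := by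
    ext; simp
  have h1 : (TensorProduct.rid A M).toLinearMap.rTensor 𝒜.Ω
      (((TensorProduct.mk A M A).flip a).rTensor 𝒜.Ω (s.nabla m)) = a • s.nabla m := by
    rw [← LinearMap.comp_apply, ← LinearMap.rTensor_comp, e, LinearMap.rTensor_smul]; simp
  rw [tensor_nabla, LinearEquiv.coe_coe, TensorProduct.rid_tmul, s.leibniz, unit_nabla, map_add, h1]
  simp

theorem horizontal_comm (s : 𝒜.PreConn M) (t : 𝒜.PreConn N) :
    (s.tensor t).Horizontal (t.tensor s) (TensorProduct.comm A M N).toLinearMap := by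
  apply horizontal_tensor_ext
  intro m n
  rw [tensor_nabla, LinearEquiv.coe_coe, TensorProduct.comm_tmul, tensor_nabla, map_add, add_comm]
  simp only [← LinearMap.comp_apply, ← LinearMap.rTensor_comp]
  congr 2

end PreConn

/-- An integrable connection on a finitely presented module. -/
structure ConnStr (M : Type u) [AddCommGroup M] [Module A M] extends 𝒜.PreConn M where
  finitePresentation : Module.FinitePresentation A M
  integrable : toPreConn.Integrable

/-- The theory of finitely presented modules with integrable connection. -/
def connTheory : ModuleTheory B A where
  Str M := 𝒜.ConnStr M
  IsHom s t f := s.toPreConn.Horizontal t.toPreConn f.hom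
  isHom_id s m := by
    simp
  isHom_comp {M N P s t r f g} hf hg m := by
    have h1 := hg (f.hom m)
    rw [← hf m, ← LinearMap.comp_apply, ← LinearMap.rTensor_comp] at h1
    exact h1
  isHom_zero m := by simp
  isHom_add {M N s t f g} hf hg m := by
    simp only [ModuleCat.hom_add, LinearMap.rTensor_add, LinearMap.add_apply, map_add]
    rw [hf m, hg m]
  isHom_smul {M N s t} b f hf m := by
    simp only [ModuleCat.hom_smul, LinearMap.rTensor_smul, LinearMap.smul_apply, t.leibniz,
      𝒜.d_algebraMap, TensorProduct.tmul_zero, add_zero]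
    rw [hf m]
  isHom_inv {M N s t} e h := PreConn.horizontal_inv e.hom.hom e.inv.hom
    (by rw [← ModuleCat.hom_comp, e.inv_hom_id, ModuleCat.hom_id])
    (by rw [← ModuleCat.hom_comp, e.hom_inv_id, ModuleCat.hom_id]) h
  unit := ⟨PreConn.unit 𝒜, inferInstanceAs (Module.FinitePresentation A A),
    PreConn.unit_integrable⟩
  tensor {M N} s t := ⟨s.toPreConn.tensor t.toPreConn,
    have := s.finitePresentation
    have := t.finitePresentation
    finitePresentation_tensor A M N,
    PreConn.tensor_integrable s.integrable t.integrable⟩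
  isHom_tensor h h' := PreConn.horizontal_map h h'
  isHom_associator s t r := PreConn.horizontal_assoc _ _ _
  isHom_leftUnitor s := PreConn.horizontal_lid _
  isHom_rightUnitor s := PreConn.horizontal_rid _
  isHom_braiding s t := PreConn.horizontal_comm _ _

/-- The category of finitely presented `A`-modules with integrable `Ω`-connection. -/
abbrev Conn := 𝒜.connTheory.Obj

end Calculus

section BaseChangeFunctor
variable (A A' : Type u) [CommRing A] [CommRing A'] [Algebra A A']

/-- The base change functor `M ↦ A' ⊗ M`. -/
def bcFunctor : ModuleCat.{u} A ⥤ ModuleCat.{u} A' where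
  obj M := ModuleCat.of A' (A' ⊗[A] M)
  map f := ModuleCat.ofHom (f.hom.baseChange A')
  map_id M := by ext; simp
  map_comp f g := by ext; simp

variable {A'} in
theorem bc_hom_ext {M : ModuleCat.{u} A} {N : ModuleCat.{u} A'}
    {f g : ModuleCat.of A' (A' ⊗[A] M) ⟶ N}
    (h : ∀ m : M, f.hom ((1 : A') ⊗ₜ[A] m) = g.hom ((1 : A') ⊗ₜ[A] m)) :
    f = g := by
  apply ModuleCat.hom_ext
  apply LinearMap.ext
  intro x
  change A' ⊗[A] M at x
  induction x using TensorProduct.induction_on with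
  | zero => rw [map_zero, map_zero]
  | add x y hx hy => rw [map_add, map_add, hx, hy]
  | tmul a m =>
    have e : a ⊗ₜ[A] m = a • ((1 : A') ⊗ₜ[A] m) := by
      rw [TensorProduct.smul_tmul', smul_eq_mul, mul_one]
    rw [e, map_smul, map_smul, h]

variable {A'} in
theorem bc_tensor_hom_ext {M N : ModuleCat.{u} A} {P : ModuleCat.{u} A'}
    {f g : ModuleCat.of A' (A' ⊗[A] (M ⊗[A] N)) ⟶ P}
    (h : ∀ (m : M) (n : N),
      f.hom ((1 : A') ⊗ₜ[A] (m ⊗ₜ[A] n)) = g.hom ((1 : A') ⊗ₜ[A] (m ⊗ₜ[A] n))) :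
    f = g := by
  refine bc_hom_ext A (M := ModuleCat.of A (M ⊗[A] N)) fun x => ?_
  change M ⊗[A] N at x
  induction x using TensorProduct.induction_on with
  | zero => rw [TensorProduct.tmul_zero, map_zero, map_zero]
  | add x y hx hy => rw [TensorProduct.tmul_add, map_add, map_add, hx, hy]
  | tmul m n => exact h m n

variable {A'} in
theorem bc_tensor_hom_ext₃ {M N Q : ModuleCat.{u} A} {P : ModuleCat.{u} A'}
    {f g : ModuleCat.of A' (A' ⊗[A] ((M ⊗[A] N) ⊗[A] Q)) ⟶ P}
    (h : ∀ (m : M) (n : N) (q : Q),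
      f.hom ((1 : A') ⊗ₜ[A] ((m ⊗ₜ[A] n) ⊗ₜ[A] q)) =
        g.hom ((1 : A') ⊗ₜ[A] ((m ⊗ₜ[A] n) ⊗ₜ[A] q))) :
    f = g := by
  refine bc_tensor_hom_ext A (M := ModuleCat.of A (M ⊗[A] N)) fun x q => ?_
  change M ⊗[A] N at x
  induction x using TensorProduct.induction_on with
  | zero => rw [TensorProduct.zero_tmul, TensorProduct.tmul_zero, map_zero, map_zero]
  | add x y hx hy => rw [TensorProduct.add_tmul, TensorProduct.tmul_add, map_add, map_add, hx, hy]
  | tmul m n => exact h m n q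

variable {A'} in
theorem bc_hom_ext₂ {M N : ModuleCat.{u} A} {P : ModuleCat.{u} A'}
    {f g : ModuleCat.of A' (A' ⊗[A] M) ⊗ ModuleCat.of A' (A' ⊗[A] N) ⟶ P}
    (h : ∀ (m : M) (n : N), f.hom ((1 ⊗ₜ[A] m) ⊗ₜ[A'] (1 ⊗ₜ[A] n)) =
      g.hom ((1 ⊗ₜ[A] m) ⊗ₜ[A'] (1 ⊗ₜ[A] n))) :
    f = g := by
  apply ModuleCat.hom_ext
  apply TensorProduct.ext'
  intro x y
  induction x using TensorProduct.induction_on with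
  | zero => rw [TensorProduct.zero_tmul, map_zero, map_zero]
  | add x x' hx hy => rw [TensorProduct.add_tmul, map_add, map_add, hx, hy]
  | tmul a m =>
    induction y using TensorProduct.induction_on with
    | zero => rw [TensorProduct.tmul_zero, map_zero, map_zero]
    | add x x' hx hy => rw [TensorProduct.tmul_add, map_add, map_add, hx, hy]
    | tmul b n =>
      have e : (a ⊗ₜ[A] m) ⊗ₜ[A'] (b ⊗ₜ[A] n) =
          a • b • ((1 ⊗ₜ[A] m) ⊗ₜ[A'] (1 ⊗ₜ[A] n) : (A' ⊗[A] M) ⊗[A'] (A' ⊗[A] N)) := by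
        rw [← TensorProduct.tmul_smul, TensorProduct.smul_tmul', TensorProduct.smul_tmul',
          TensorProduct.smul_tmul', smul_eq_mul, smul_eq_mul, mul_one, mul_one]
      rw [e, map_smul, map_smul, map_smul, map_smul, h]

instance : (bcFunctor A A').Monoidal :=
  Functor.CoreMonoidal.toMonoidal (.mk'
    (εIso := (AlgebraTensorModule.rid A A' A').symm.toModuleIso)
    (μIso := fun M N => (AlgebraTensorModule.distribBaseChange A A' M N).symm.toModuleIso)
    (μIso_inv_natural_left := fun f N => bc_tensor_hom_ext A fun m n => rfl)
    (μIso_inv_natural_right := fun N f => bc_tensor_hom_ext A fun m n => rfl)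
    (oplax_associativity := fun M N P => bc_tensor_hom_ext₃ A fun m n p => rfl)
    (oplax_left_unitality := fun M => bc_hom_ext A fun m => by
      change _ = (((AlgebraTensorModule.rid A A' A') ((1 : A') ⊗ₜ[A] (1 : A))) ⊗ₜ[A']
        ((1 : A') ⊗ₜ[A] m) : A' ⊗[A'] (A' ⊗[A] M))
      rw [AlgebraTensorModule.rid_tmul, one_smul]; rfl)
    (oplax_right_unitality := fun M => bc_hom_ext A fun m => by
      change _ = (((1 : A') ⊗ₜ[A] m) ⊗ₜ[A']
        ((AlgebraTensorModule.rid A A' A') ((1 : A') ⊗ₜ[A] (1 : A))) : (A' ⊗[A] M) ⊗[A'] A')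
      rw [AlgebraTensorModule.rid_tmul, one_smul]; rfl))

instance : (bcFunctor A A').Braided where
  braided M N := bc_hom_ext₂ A fun m n => rfl

variable {A A'} in
theorem bc_ε_apply (a : A') :
    (Functor.LaxMonoidal.ε (bcFunctor A A')).hom a = (a ⊗ₜ[A] (1 : A) : A' ⊗[A] A) := rfl

variable {A A'} in
theorem bc_μ_apply (M N : ModuleCat.{u} A) (m : M) (n : N) :
    (Functor.LaxMonoidal.μ (bcFunctor A A') M N).hom (((1 : A') ⊗ₜ[A] m) ⊗ₜ[A'] ((1 : A') ⊗ₜ[A] n)) =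
      ((1 : A') ⊗ₜ[A] (m ⊗ₜ[A] n) : A' ⊗[A] (M ⊗[A] N)) :=
  (AlgebraTensorModule.distribBaseChange A A' M N).symm_apply_eq.mpr rfl

end BaseChangeFunctor

section ExteriorSquare
variable {A A' : Type u} [CommRing A] [CommRing A'] [Algebra A A']
  {Ω Ω' : Type u} [AddCommGroup Ω] [Module A Ω] [AddCommGroup Ω'] [Module A' Ω']

/-- The map on exterior squares induced by a semilinear map. -/
def exteriorSquareMap (f : Ω →+ Ω') (hf : ∀ (a : A) ω, f (a • ω) = algebraMap A A' a • f ω) :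
    ⋀[A]^2 Ω →+ ⋀[A']^2 Ω' :=
  letI : Module A Ω' := Module.compHom Ω' (algebraMap A A')
  letI : Module A (⋀[A']^2 Ω') := Module.compHom (⋀[A']^2 Ω') (algebraMap A A')
  let g : Ω [⋀^Fin 2]→ₗ[A] ⋀[A']^2 Ω' :=
    { toFun := fun v => exteriorPower.ιMulti A' 2 (fun i => f (v i))
      map_update_add' := fun v i x y => by
        have := (exteriorPower.ιMulti A' 2 (M := Ω')).map_update_add (fun i => f (v i)) i (f x) (f y)
        have e : ∀ z, (fun j => f (Function.update v i z j)) =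
            Function.update (fun j => f (v j)) i (f z) := fun z => by
          ext j; by_cases h : j = i
          · subst h; simp
          · simp [h]
        convert this using 1
        · rw [← map_add, ← e]
        · congr 1
          · rw [← e]
          · rw [← e]
      map_update_smul' := fun v i c x => by
        have := (exteriorPower.ιMulti A' 2 (M := Ω')).map_update_smul (fun i => f (v i)) i
          (algebraMap A A' c) (f x)
        have e : ∀ z, (fun j => f (Function.update v i z j)) =
            Function.update (fun j => f (v j)) i (f z) := fun z => by
          ext j; by_cases h : j = i
          · subst h; simp
          · simp [h]
        refine Eq.trans ?_ (this.trans ?_)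
        · rw [← hf, ← e]
        · rw [← e]; rfl
      map_eq_zero_of_eq' := fun v i j h hij =>
        (exteriorPower.ιMulti A' 2 (M := Ω')).map_eq_zero_of_eq _ (by simp [h]) hij }
  (exteriorPower.alternatingMapLinearEquiv g).toAddMonoidHom

variable (f : Ω →+ Ω') (hf : ∀ (a : A) ω, f (a • ω) = algebraMap A A' a • f ω)

theorem exteriorSquareMap_wedge (x y : Ω) :
    exteriorSquareMap f hf (wedge A Ω x y) = wedge A' Ω' (f x) (f y) := by
  letI : Module A (⋀[A']^2 Ω') := Module.compHom (⋀[A']^2 Ω') (algebraMap A A')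
  refine (exteriorPower.alternatingMapLinearEquiv_apply_ιMulti _ _).trans ?_
  change exteriorPower.ιMulti A' 2 _ = exteriorPower.ιMulti A' 2 _
  congr 1
  ext i; fin_cases i <;> rfl

theorem exteriorSquareMap_smul (a : A) (x : ⋀[A]^2 Ω) :
    exteriorSquareMap f hf (a • x) = algebraMap A A' a • exteriorSquareMap f hf x := by
  letI : Module A (⋀[A']^2 Ω') := Module.compHom (⋀[A']^2 Ω') (algebraMap A A')
  exact map_smul (exteriorPower.alternatingMapLinearEquiv _) a x

end ExteriorSquare

namespace Calculus
variable {B A B' A' : Type u} [CommRing B] [CommRing A] [Algebra B A] [CommRing B'] [CommRing A']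
  [Algebra B' A'] [Algebra A A']

/-- A map on one-forms compatible with the differentials, along `A → A'`. -/
structure Hom (𝒜 : Calculus B A) (𝒜' : Calculus B' A') where
  f : 𝒜.Ω →+ 𝒜'.Ω
  f_smul : ∀ (a : A) ω, f (a • ω) = algebraMap A A' a • f ω
  f_d : ∀ a, f (𝒜.d a) = 𝒜'.d (algebraMap A A' a)

variable {𝒜 : Calculus B A} {𝒜' : Calculus B' A'} (φ : Hom 𝒜 𝒜')

namespace Hom

theorem map_d1 (ω : 𝒜.Ω) :
    exteriorSquareMap φ.f φ.f_smul (𝒜.d1 ω) = 𝒜'.d1 (φ.f ω) := by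
  induction ω using 𝒜.Ω_induction with
  | d a => rw [𝒜.d1_d, φ.f_d, 𝒜'.d1_d, map_zero]
  | zero => simp
  | add x y hx hy => simp only [map_add, hx, hy]
  | smul a x hx =>
    rw [𝒜.d1_smul, map_add, exteriorSquareMap_wedge, exteriorSquareMap_smul, hx, φ.f_d,
      φ.f_smul, 𝒜'.d1_smul]

variable (M : Type u) [AddCommGroup M] [Module A M]

/-- `m ⊗ ω ↦ (1 ⊗ m) ⊗ φ ω`. -/
def ι : M ⊗[A] 𝒜.Ω →+ (A' ⊗[A] M) ⊗[A'] 𝒜'.Ω :=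
  TensorProduct.liftAddHom
    (AddMonoidHom.mk' (fun m => AddMonoidHom.mk' (fun ω => ((1 : A') ⊗ₜ[A] m) ⊗ₜ[A'] φ.f ω)
      (fun ω ω' => by rw [map_add, TensorProduct.tmul_add]))
      (fun m m' => by
        ext ω
        simp only [AddMonoidHom.mk'_apply, AddMonoidHom.add_apply, TensorProduct.tmul_add,
          TensorProduct.add_tmul]))
    (fun a m ω => by
      simp only [AddMonoidHom.mk'_apply, φ.f_smul, TensorProduct.tmul_smul]
      rw [TensorProduct.smul_tmul', TensorProduct.smul_tmul', TensorProduct.smul_tmul',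
        Algebra.smul_def, smul_eq_mul])

/-- `m ⊗ η ↦ (1 ⊗ m) ⊗ φ η` on two-forms. -/
def ι₂ : M ⊗[A] (⋀[A]^2 𝒜.Ω) →+ (A' ⊗[A] M) ⊗[A'] (⋀[A']^2 𝒜'.Ω) :=
  TensorProduct.liftAddHom
    (AddMonoidHom.mk' (fun m => AddMonoidHom.mk'
      (fun ω => ((1 : A') ⊗ₜ[A] m) ⊗ₜ[A'] exteriorSquareMap φ.f φ.f_smul ω)
      (fun ω ω' => by rw [map_add, TensorProduct.tmul_add]))
      (fun m m' => by
        ext ω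
        simp only [AddMonoidHom.mk'_apply, AddMonoidHom.add_apply, TensorProduct.tmul_add,
          TensorProduct.add_tmul]))
    (fun a m ω => by
      simp only [AddMonoidHom.mk'_apply, exteriorSquareMap_smul, TensorProduct.tmul_smul]
      rw [TensorProduct.smul_tmul', TensorProduct.smul_tmul', TensorProduct.smul_tmul',
        Algebra.smul_def, smul_eq_mul])

variable {M}

theorem ι_tmul (m : M) (ω : 𝒜.Ω) :
    φ.ι M (m ⊗ₜ[A] ω) = ((1 : A') ⊗ₜ[A] m) ⊗ₜ[A'] φ.f ω := rfl

theorem ι₂_tmul (m : M) (ω : ⋀[A]^2 𝒜.Ω) : φ.ι₂ M (m ⊗ₜ[A] ω) =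
    ((1 : A') ⊗ₜ[A] m) ⊗ₜ[A'] exteriorSquareMap φ.f φ.f_smul ω := rfl

theorem ι_smul (a : A) (x : M ⊗[A] 𝒜.Ω) : φ.ι M (a • x) = algebraMap A A' a • φ.ι M x := by
  induction x using TensorProduct.induction_on with
  | zero => simp
  | add x y hx hy => simp only [smul_add, map_add, hx, hy]
  | tmul m ω =>
    rw [← TensorProduct.tmul_smul, ι_tmul, ι_tmul, φ.f_smul, TensorProduct.tmul_smul]

theorem tmul_smul_one (a : A) (m : M) : (1 : A') ⊗ₜ[A] (a • m) = algebraMap A A' a ⊗ₜ[A] m := by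
  rw [TensorProduct.tmul_smul, TensorProduct.smul_tmul', Algebra.smul_def, mul_one]

/-- The pulled back connection `a ⊗ m ↦ a ∇ m + (1 ⊗ m) ⊗ d a`. -/
def pullbackNabla (s : 𝒜.PreConn M) : A' ⊗[A] M →+ (A' ⊗[A] M) ⊗[A'] 𝒜'.Ω :=
  TensorProduct.liftAddHom
    (AddMonoidHom.mk' (fun a => AddMonoidHom.mk'
      (fun m => a • φ.ι M (s.nabla m) + ((1 : A') ⊗ₜ[A] m) ⊗ₜ[A'] 𝒜'.d a)
      (fun m m' => by
        simp only [map_add, smul_add, TensorProduct.tmul_add, TensorProduct.add_tmul]; abel))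
      (fun a a' => by
        ext m
        simp only [AddMonoidHom.mk'_apply, AddMonoidHom.add_apply, map_add, add_smul,
          TensorProduct.tmul_add]
        abel))
    (fun a a' m => by
      simp only [AddMonoidHom.mk'_apply, s.leibniz, map_add, ι_smul, ι_tmul, φ.f_d,
        Algebra.smul_def, 𝒜'.d_mul, TensorProduct.tmul_add, smul_add, mul_smul,
        TensorProduct.tmul_smul]
      rw [smul_comm a', show a • ((1 : A') ⊗ₜ[A] m) = algebraMap A A' a • ((1 : A') ⊗ₜ[A] m) from
        (algebraMap_smul A' a _).symm, ← TensorProduct.smul_tmul' (algebraMap A A' a)]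
      abel)

theorem pullbackNabla_tmul (s : 𝒜.PreConn M) (a : A') (m : M) :
    φ.pullbackNabla s (a ⊗ₜ[A] m) =
      a • φ.ι M (s.nabla m) + ((1 : A') ⊗ₜ[A] m) ⊗ₜ[A'] 𝒜'.d a := rfl

/-- The pulled back connection. -/
def pullback (s : 𝒜.PreConn M) : 𝒜'.PreConn (A' ⊗[A] M) where
  nabla := φ.pullbackNabla s
  leibniz b x := by
    induction x using TensorProduct.induction_on with
    | zero => rw [smul_zero, map_zero, smul_zero, TensorProduct.zero_tmul, add_zero]
    | add x y hx hy =>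
      rw [smul_add, map_add, hx, hy, map_add, TensorProduct.add_tmul, smul_add]; abel
    | tmul a m =>
      have e : a ⊗ₜ[A] m = a • ((1 : A') ⊗ₜ[A] m) := by
        rw [TensorProduct.smul_tmul', smul_eq_mul, mul_one]
      rw [TensorProduct.smul_tmul', pullbackNabla_tmul, pullbackNabla_tmul, smul_eq_mul, 𝒜'.d_mul,
        TensorProduct.tmul_add, TensorProduct.tmul_smul, TensorProduct.tmul_smul, e,
        ← TensorProduct.smul_tmul', smul_add, mul_smul]
      abel

theorem pullback_nabla (s : 𝒜.PreConn M) (a : A') (m : M) :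
    (φ.pullback s).nabla (a ⊗ₜ[A] m) =
      a • φ.ι M (s.nabla m) + ((1 : A') ⊗ₜ[A] m) ⊗ₜ[A'] 𝒜'.d a := rfl

theorem pullback_nabla_one (s : 𝒜.PreConn M) (m : M) :
    (φ.pullback s).nabla ((1 : A') ⊗ₜ[A] m) = φ.ι M (s.nabla m) := by
  rw [pullback_nabla, 𝒜'.d_one, TensorProduct.tmul_zero, add_zero, one_smul]

theorem nabla1_smul (s : 𝒜.PreConn M) (a : A) (x : M ⊗[A] 𝒜.Ω) :
    s.nabla1 (a • x) = a • s.nabla1 x + (wedge A 𝒜.Ω (𝒜.d a)).lTensor M x := by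
  induction x using TensorProduct.induction_on with
  | zero => simp
  | add x y hx hy => simp only [smul_add, map_add, hx, hy]; abel
  | tmul m ω =>
    rw [← TensorProduct.tmul_smul, PreConn.nabla1_tmul, PreConn.nabla1_tmul, 𝒜.d1_smul, map_smul,
      LinearMap.lTensor_smul, LinearMap.smul_apply, TensorProduct.tmul_add,
      TensorProduct.tmul_smul, LinearMap.lTensor_tmul, smul_add]
    abel

theorem ι_lTensor (ω : 𝒜.Ω) (x : M ⊗[A] 𝒜.Ω) :
    φ.ι₂ M (((wedge A 𝒜.Ω).flip ω).lTensor M x) =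
      ((wedge A' 𝒜'.Ω).flip (φ.f ω)).lTensor _ (φ.ι M x) := by
  induction x using TensorProduct.induction_on with
  | zero => simp
  | add x y hx hy => simp only [map_add, hx, hy]
  | tmul m η =>
    rw [LinearMap.lTensor_tmul, ι₂_tmul, ι_tmul, LinearMap.lTensor_tmul, LinearMap.flip_apply,
      LinearMap.flip_apply, exteriorSquareMap_wedge]

theorem nabla1_ι (s : 𝒜.PreConn M) (x : M ⊗[A] 𝒜.Ω) :
    (φ.pullback s).nabla1 (φ.ι M x) = φ.ι₂ M (s.nabla1 x) := by
  induction x using TensorProduct.induction_on with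
  | zero => simp
  | add x y hx hy => simp only [map_add, hx, hy]
  | tmul m ω =>
    rw [ι_tmul, PreConn.nabla1_tmul, PreConn.nabla1_tmul, pullback_nabla_one, map_add, ι₂_tmul,
      ι_lTensor, map_d1]

theorem pullback_integrable {s : 𝒜.PreConn M} (hs : s.Integrable) :
    (φ.pullback s).Integrable := by
  intro x
  induction x using TensorProduct.induction_on with
  | zero => simp
  | add x y hx hy => simp only [map_add, hx, hy, add_zero]
  | tmul a m =>
    rw [pullback_nabla, map_add, nabla1_smul, nabla1_ι, hs m, map_zero, smul_zero, zero_add,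
      PreConn.nabla1_tmul, 𝒜'.d1_d, TensorProduct.tmul_zero, add_zero, pullback_nabla_one]
    generalize φ.ι M (s.nabla m) = y
    induction y using TensorProduct.induction_on with
    | zero => simp
    | add x y hx hy =>
      simp only [map_add]
      rw [add_add_add_comm, hx, hy, add_zero]
    | tmul m ω =>
      rw [LinearMap.lTensor_tmul, LinearMap.lTensor_tmul, LinearMap.flip_apply,
        wedge_swap ω, TensorProduct.tmul_neg]
      exact add_neg_cancel (m ⊗ₜ[A'] wedge A' 𝒜'.Ω (𝒜'.d a) ω)

theorem ι_rTensor {N : Type u} [AddCommGroup N] [Module A N] (f : M →ₗ[A] N)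
    (x : M ⊗[A] 𝒜.Ω) : (f.baseChange A').rTensor 𝒜'.Ω (φ.ι M x) = φ.ι N (f.rTensor 𝒜.Ω x) := by
  induction x using TensorProduct.induction_on with
  | zero => simp
  | add x y hx hy => simp only [map_add, hx, hy]
  | tmul m η => rfl

theorem span_one_tmul : Submodule.span A' (Set.range fun m : M => (1 : A') ⊗ₜ[A] m) = ⊤ := by
  rw [eq_top_iff]
  intro x _
  induction x using TensorProduct.induction_on with
  | zero => exact zero_mem _
  | add x y hx hy => exact add_mem (hx trivial) (hy trivial)
  | tmul a m =>
    have e : a ⊗ₜ[A] m = a • ((1 : A') ⊗ₜ[A] m) := by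
      rw [TensorProduct.smul_tmul', smul_eq_mul, mul_one]
    rw [e]
    exact Submodule.smul_mem _ _ (Submodule.subset_span ⟨m, rfl⟩)

theorem span_one_tmul_one {N : Type u} [AddCommGroup N] [Module A N] :
    Submodule.span A' (Set.range fun p : M × N =>
      ((1 : A') ⊗ₜ[A] p.1) ⊗ₜ[A'] ((1 : A') ⊗ₜ[A] p.2)) = ⊤ := by
  rw [eq_top_iff, ← TensorProduct.span_tmul_eq_top, Submodule.span_le]
  rintro _ ⟨x, y, rfl⟩
  have hx : x ∈ Submodule.span A' (Set.range fun m : M => (1 : A') ⊗ₜ[A] m) := by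
    rw [span_one_tmul]; trivial
  have hy : y ∈ Submodule.span A' (Set.range fun m : N => (1 : A') ⊗ₜ[A] m) := by
    rw [span_one_tmul]; trivial
  induction hx using Submodule.span_induction with
  | zero => rw [TensorProduct.zero_tmul]; exact zero_mem _
  | add x x' _ _ h h' => rw [TensorProduct.add_tmul]; exact add_mem h h'
  | smul a x _ h => rw [← TensorProduct.smul_tmul']; exact Submodule.smul_mem _ _ h
  | mem x hx =>
    obtain ⟨m, rfl⟩ := hx
    induction hy using Submodule.span_induction with
    | zero => rw [TensorProduct.tmul_zero]; exact zero_mem _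
    | add x x' _ _ h h' => rw [TensorProduct.tmul_add]; exact add_mem h h'
    | smul a x _ h => rw [TensorProduct.tmul_smul]; exact Submodule.smul_mem _ _ h
    | mem x hx =>
      obtain ⟨n, rfl⟩ := hx
      exact Submodule.subset_span ⟨(m, n), rfl⟩

theorem horizontal_baseChange {N : Type u} [AddCommGroup N] [Module A N] {s : 𝒜.PreConn M}
    {t : 𝒜.PreConn N} {f : M →ₗ[A] N} (hf : s.Horizontal t f) :
    (φ.pullback s).Horizontal (φ.pullback t) (f.baseChange A') := by
  refine PreConn.horizontal_of_span _ _ span_one_tmul ?_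
  rintro _ ⟨m, rfl⟩
  rw [pullback_nabla_one, LinearMap.baseChange_tmul, pullback_nabla_one, ι_rTensor, hf]

theorem μ_horizontal_aux {N : Type u} [AddCommGroup N] [Module A N] {s : 𝒜.PreConn M}
    {t : 𝒜.PreConn N} (μ : (A' ⊗[A] M) ⊗[A'] (A' ⊗[A] N) →ₗ[A'] A' ⊗[A] (M ⊗[A] N))
    (hμ : ∀ m n, μ (((1 : A') ⊗ₜ[A] m) ⊗ₜ[A'] ((1 : A') ⊗ₜ[A] n)) = (1 : A') ⊗ₜ[A] (m ⊗ₜ[A] n))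
    (m : M) (n : N) :
    μ.rTensor 𝒜'.Ω (((φ.pullback s).tensor (φ.pullback t)).nabla
        (((1 : A') ⊗ₜ[A] m) ⊗ₜ[A'] ((1 : A') ⊗ₜ[A] n))) =
      (φ.pullback (s.tensor t)).nabla (μ (((1 : A') ⊗ₜ[A] m) ⊗ₜ[A'] ((1 : A') ⊗ₜ[A] n))) := by
  rw [hμ, pullback_nabla_one, PreConn.tensor_nabla, PreConn.tensor_nabla,
    pullback_nabla_one, pullback_nabla_one, map_add, map_add]
  congr 1
  · generalize s.nabla m = x
    induction x using TensorProduct.induction_on with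
    | zero => simp
    | add x y hx hy => simp only [map_add, hx, hy]
    | tmul m' ω => exact congrArg (· ⊗ₜ[A'] φ.f ω) (hμ m' n)
  · generalize t.nabla n = x
    induction x using TensorProduct.induction_on with
    | zero => simp
    | add x y hx hy => simp only [map_add, hx, hy]
    | tmul n' ω => exact congrArg (· ⊗ₜ[A'] φ.f ω) (hμ m n')

/-- Pullback of integrable connections on finitely presented modules. -/
def transport : ModuleTheory.Transport 𝒜.connTheory 𝒜'.connTheory (bcFunctor A A') where
  str s := ⟨φ.pullback s.toPreConn,
    have := s.finitePresentation
    inferInstanceAs (Module.FinitePresentation A' (A' ⊗[A] _)),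
    φ.pullback_integrable s.integrable⟩
  isHom_map hf := φ.horizontal_baseChange hf
  isHom_ε a := by
    change LinearMap.rTensor 𝒜'.Ω (Functor.LaxMonoidal.ε (bcFunctor A A')).hom
      ((1 : A') ⊗ₜ[A'] 𝒜'.d a) = (φ.pullback (PreConn.unit 𝒜)).nabla (a ⊗ₜ[A] (1 : A))
    rw [pullback_nabla, PreConn.unit_nabla, 𝒜.d_one, TensorProduct.tmul_zero, map_zero, smul_zero,
      zero_add]
    rfl
  isHom_μ {M N} s t := by
    refine PreConn.horizontal_of_span _ _ span_one_tmul_one ?_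
    rintro _ ⟨⟨m, n⟩, rfl⟩
    exact φ.μ_horizontal_aux (s := s.toPreConn) (t := t.toPreConn)
      (Functor.LaxMonoidal.μ (bcFunctor A A') M N).hom (bc_μ_apply M N) m n

/-- The pullback functor of integrable connections. -/
abbrev pullbackFunctor : 𝒜.Conn ⥤ 𝒜'.Conn := φ.transport.functor

end Hom
end Calculus

namespace Calculus
section Twisted
variable {A : Type u} [CommRing A] {Ω : Type u} [AddCommGroup Ω] [Module A Ω]

/-- `Ω × ⋀² Ω` with the `A`-action `a (ω, η) = (a ω, d a ∧ ω + a η)`. A linear map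
`ω ↦ (ω, d1 ω)` to this module is the same as an exterior differential `d1`. -/
def Twisted (d : A →+ Ω) (_ : ∀ a b, d (a * b) = a • d b + b • d a) : Type u := Ω × ⋀[A]^2 Ω

variable {d : A →+ Ω} {hd : ∀ a b, d (a * b) = a • d b + b • d a}

namespace Twisted

instance : AddCommGroup (Twisted d hd) := inferInstanceAs (AddCommGroup (Ω × ⋀[A]^2 Ω))

instance : Module A (Twisted d hd) where
  smul a x := (a • x.1, wedge A Ω (d a) x.1 + a • x.2)
  one_smul x := by
    have h : d 1 = 0 := by simpa using hd 1 1
    refine Prod.ext (one_smul A x.1) ?_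
    change wedge A Ω (d 1) x.1 + (1 : A) • x.2 = x.2
    rw [h, map_zero, LinearMap.zero_apply, zero_add, one_smul]
  mul_smul a b x := by
    refine Prod.ext (mul_smul a b x.1) ?_
    change wedge A Ω (d (a * b)) x.1 + (a * b) • x.2 =
      wedge A Ω (d a) (b • x.1) + a • (wedge A Ω (d b) x.1 + b • x.2)
    rw [hd, map_add, map_smul, map_smul, map_smul, LinearMap.add_apply, LinearMap.smul_apply,
      LinearMap.smul_apply, mul_smul, smul_add]
    abel
  smul_zero a := by
    refine Prod.ext (smul_zero a) ?_
    change wedge A Ω (d a) (0 : Ω) + a • (0 : ⋀[A]^2 Ω) = 0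
    rw [map_zero, smul_zero, add_zero]
  smul_add a x y := by
    refine Prod.ext (smul_add a x.1 y.1) ?_
    change wedge A Ω (d a) (x.1 + y.1) + a • (x.2 + y.2) =
      (wedge A Ω (d a) x.1 + a • x.2) + (wedge A Ω (d a) y.1 + a • y.2)
    rw [map_add, smul_add]; abel
  add_smul a b x := by
    refine Prod.ext (add_smul a b x.1) ?_
    change wedge A Ω (d (a + b)) x.1 + (a + b) • x.2 =
      (wedge A Ω (d a) x.1 + a • x.2) + (wedge A Ω (d b) x.1 + b • x.2)
    rw [map_add, map_add, LinearMap.add_apply, add_smul]; abel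
  zero_smul x := by
    refine Prod.ext (zero_smul A x.1) ?_
    change wedge A Ω (d 0) x.1 + (0 : A) • x.2 = 0
    rw [map_zero, map_zero, LinearMap.zero_apply, zero_smul, add_zero]

theorem smul_def (a : A) (x : Twisted d hd) :
    a • x = (a • x.1, wedge A Ω (d a) x.1 + a • x.2) := rfl

variable (hd) in
/-- The element `(d a, 0)`. -/
def ofD (a : A) : Twisted d hd := (d a, 0)

theorem leibniz (a b : A) : ofD hd (a * b) = a • ofD hd b + b • ofD hd a := by
  rw [smul_def, smul_def]
  refine Prod.ext (hd a b) ?_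
  change 0 = (wedge A Ω (d a) (d b) + a • (0 : ⋀[A]^2 Ω)) + (wedge A Ω (d b) (d a) + b • (0 : ⋀[A]^2 Ω))
  rw [wedge_swap (d b), smul_zero, smul_zero]; abel

/-- The first projection. -/
def fst : Twisted d hd →ₗ[A] Ω where
  toFun x := x.1
  map_add' _ _ := rfl
  map_smul' _ _ := rfl

end Twisted

/-- The calculus determined by a linear map to `Twisted`. -/
def ofTwisted {B : Type u} [CommRing B] [Algebra B A]
    (hB : ∀ b : B, d (algebraMap B A b) = 0) (hs : Submodule.span A (Set.range d) = ⊤)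
    (L : Ω →ₗ[A] Twisted d hd) (hL : ∀ a, L (d a) = Twisted.ofD hd a) : Calculus B A where
  Ω := Ω
  d := d
  d_mul := hd
  d_algebraMap := hB
  span_d := hs
  d1 := AddMonoidHom.mk' (fun ω => (L ω).2) (fun x y => by rw [map_add]; rfl)
  d1_smul a ω := by
    have h : Twisted.fst ∘ₗ L = LinearMap.id := by
      refine LinearMap.ext_on_range hs fun a => ?_
      rw [LinearMap.comp_apply, hL]; rfl
    have h' : (L ω).1 = ω := LinearMap.congr_fun h ω
    change (L (a • ω)).2 = _ + a • (L ω).2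
    rw [map_smul, Twisted.smul_def, h']
  d1_d a := by
    change (L (d a)).2 = 0
    rw [hL]; rfl

end Twisted

section Kaehler
variable (B A : Type u) [CommRing B] [CommRing A] [Algebra B A]

/-- The algebraic calculus `A → Ω_{A/B} → ⋀² Ω_{A/B}`. -/
def kaehler : Calculus B A :=
  have hd : ∀ a b, (KaehlerDifferential.D B A).toLinearMap.toAddMonoidHom (a * b) =
    a • (KaehlerDifferential.D B A).toLinearMap.toAddMonoidHom b +
      b • (KaehlerDifferential.D B A).toLinearMap.toAddMonoidHom a :=
    (KaehlerDifferential.D B A).leibniz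
  letI : Module B (Twisted _ hd) := Module.compHom _ (algebraMap B A)
  haveI : IsScalarTower B A (Twisted _ hd) := .of_algebraMap_smul fun _ _ => rfl
  let δ : Derivation B A (Twisted _ hd) := .mk'
    { toFun := fun a => Twisted.ofD hd a
      map_add' := fun x y => Prod.ext ((KaehlerDifferential.D B A).map_add x y) (add_zero 0).symm
      map_smul' := fun b a => by
        refine Eq.trans ?_ (Twisted.smul_def (algebraMap B A b) _).symm
        refine Prod.ext ?_ ?_
        · exact ((KaehlerDifferential.D B A).map_smul b a).trans (algebraMap_smul A b _).symm
        · change 0 = wedge A _ (KaehlerDifferential.D B A (algebraMap B A b))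
            (KaehlerDifferential.D B A a) + algebraMap B A b • 0
          rw [Derivation.map_algebraMap, map_zero, LinearMap.zero_apply, smul_zero, add_zero] }
    (fun a b => Twisted.leibniz (hd := hd) a b)
  ofTwisted (Ω := Ω[A⁄B]) (hd := hd) (fun b => (KaehlerDifferential.D B A).map_algebraMap b)
    (KaehlerDifferential.span_range_derivation B A) δ.liftKaehlerDifferential
    (fun a => δ.liftKaehlerDifferential_comp_D a)

theorem kaehler_Ω : (kaehler B A).Ω = Ω[A⁄B] := rfl

end Kaehler

section BaseChange
variable {B A : Type u} [CommRing B] [CommRing A] [Algebra B A] (𝒜 : Calculus B A)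
  {B' A' : Type u} [CommRing B'] [CommRing A'] [Algebra B' A'] [Algebra A A']
  {Ω' : Type u} [AddCommGroup Ω'] [Module A Ω'] [Module A' Ω'] [IsScalarTower A A' Ω']

/-- The calculus on `A'` with module of one-forms the base change `Ω'` of `Ω` to `A'` (via `f`),
and differential an extension `d'` of `d` to `A'`. The last hypothesis says that such extensions
are unique, also for two-forms. -/
def ofBaseChange (f : 𝒜.Ω →ₗ[A] Ω') (hf : IsBaseChange A' f) (d' : A' →+ Ω')
    (d'_mul : ∀ a b, d' (a * b) = a • d' b + b • d' a)
    (d'_algebraMap : ∀ b : B', d' (algebraMap B' A' b) = 0)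
    (d'_f : ∀ a, d' (algebraMap A A' a) = f (𝒜.d a))
    (unique : ∀ δ : A' →+ ⋀[A']^2 Ω', (∀ a b, δ (a * b) = a • δ b + b • δ a) →
      (∀ a, δ (algebraMap A A' a) = 0) → (∀ b, δ (algebraMap B' A' b) = 0) → ∀ a, δ a = 0) :
    Calculus B' A' :=
  letI : Module A (Twisted d' d'_mul) := Module.compHom _ (algebraMap A A')
  haveI : IsScalarTower A A' (Twisted d' d'_mul) := .of_algebraMap_smul fun _ _ => rfl
  have hf' : ∀ (a : A) ω, f.toAddMonoidHom (a • ω) = algebraMap A A' a • f.toAddMonoidHom ω :=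
    fun a ω => (f.map_smul a ω).trans (algebraMap_smul A' a _).symm
  let L₀ : 𝒜.Ω →ₗ[A] Twisted d' d'_mul :=
    { toFun := fun ω => (f ω, exteriorSquareMap f.toAddMonoidHom hf' (𝒜.d1 ω))
      map_add' := fun x y => by rw [map_add, map_add, map_add]; rfl
      map_smul' := fun a ω => by
        refine Eq.trans ?_ (Twisted.smul_def (algebraMap A A' a) _).symm
        refine Prod.ext (hf' a ω) ?_
        change exteriorSquareMap f.toAddMonoidHom hf' (𝒜.d1 (a • ω)) = _
        rw [𝒜.d1_smul, map_add, exteriorSquareMap_wedge, exteriorSquareMap_smul]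
        change wedge A' Ω' (f (𝒜.d a)) (f ω) + _ = _
        rw [← d'_f] }
  let L : Ω' →ₗ[A'] Twisted d' d'_mul := hf.lift L₀
  have hL : ∀ ω, L (f ω) = L₀ ω := hf.lift_eq L₀
  have hs : Submodule.span A' (Set.range d') = ⊤ := by
    rw [eq_top_iff]
    rintro x -
    induction x using hf.inductionOn with
    | zero => exact zero_mem _
    | add x y hx hy => exact add_mem hx hy
    | smul a x hx => exact Submodule.smul_mem _ _ hx
    | tmul x =>
      induction x using 𝒜.Ω_induction with
      | d a => rw [← d'_f]; exact Submodule.subset_span ⟨_, rfl⟩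
      | zero => rw [map_zero]; exact zero_mem _
      | add x y hx hy => rw [map_add]; exact add_mem hx hy
      | smul a x hx =>
        rw [map_smul, ← algebraMap_smul A']; exact Submodule.smul_mem _ _ hx
  have h1 : Twisted.fst ∘ₗ L = LinearMap.id := by
    refine hf.algHom_ext _ _ fun ω => ?_
    rw [LinearMap.comp_apply, hL]; rfl
  have h1' : ∀ ω, (L ω).1 = ω := LinearMap.congr_fun h1
  have h2 : ∀ a, (L (d' a)).2 = 0 := by
    refine unique (AddMonoidHom.mk' (fun a => (L (d' a)).2) fun x y => by rw [map_add, map_add]; rfl)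
      (fun a b => ?_) (fun a => ?_) (fun b => ?_)
    · change (L (d' (a * b))).2 = a • (L (d' b)).2 + b • (L (d' a)).2
      rw [d'_mul, map_add, map_smul, map_smul]
      change (a • L (d' b)).2 + (b • L (d' a)).2 = _
      rw [Twisted.smul_def, Twisted.smul_def]
      change (_ + _) + (_ + _) = _
      rw [h1', h1', wedge_swap (d' b)]; abel
    · change (L (d' (algebraMap A A' a))).2 = 0
      rw [d'_f, hL]
      change exteriorSquareMap f.toAddMonoidHom hf' (𝒜.d1 (𝒜.d a)) = 0
      rw [𝒜.d1_d, map_zero]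
    · change (L (d' (algebraMap B' A' b))).2 = 0
      rw [d'_algebraMap, map_zero]; rfl
  ofTwisted d'_algebraMap hs L (fun a => Prod.ext (h1' _) (h2 a))

end BaseChange
end Calculus

section Separated

/-- An additive group is `p`-adically separated. -/
def PSeparated (p : ℕ) (N : Type u) [AddCommGroup N] : Prop :=
  ∀ x : N, (∀ n : ℕ, ∃ y : N, x = p ^ n • y) → x = 0

variable {p : ℕ}

theorem PSeparated.of_injective {N N' : Type u} [AddCommGroup N] [AddCommGroup N'] (f : N →+ N')
    (hf : Function.Injective f) (h : PSeparated p N') : PSeparated p N := fun x hx =>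
  hf ((h (f x) fun n => by
    obtain ⟨y, hy⟩ := hx n
    exact ⟨f y, by rw [hy, map_nsmul]⟩).trans (map_zero f).symm)

theorem PSeparated.of_free {B N : Type u} [CommRing B] [AddCommGroup N] [Module B N]
    [Module.Free B N] (h : PSeparated p B) : PSeparated p N := fun x hx => by
  obtain ⟨ι, b⟩ := Module.Free.exists_basis B N
  refine b.ext_elem fun i => ?_
  rw [map_zero, Finsupp.zero_apply]
  refine h _ fun n => ?_
  obtain ⟨y, rfl⟩ := hx n
  exact ⟨b.repr y i, by rw [map_nsmul]; rfl⟩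

theorem PSeparated.of_projective {B N : Type u} [CommRing B] [AddCommGroup N] [Module B N]
    [Module.Finite B N] [Module.Projective B N] (h : PSeparated p B) : PSeparated p N := by
  obtain ⟨n, f, g, -, -, hfg⟩ := Module.Finite.exists_comp_eq_id_of_projective B N
  exact .of_injective g.toAddMonoidHom
    (Function.LeftInverse.injective (g := f) (LinearMap.congr_fun hfg)) (.of_free (B := B) h)

theorem PSeparated.exteriorSquare {B N : Type u} [CommRing B] [AddCommGroup N] [Module B N]
    [Module.Finite B N] [Module.Projective B N] (h : PSeparated p B) :
    PSeparated p (⋀[B]^2 N) := by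
  obtain ⟨n, f, g, -, -, hfg⟩ := Module.Finite.exists_comp_eq_id_of_projective B N
  exact .of_injective (exteriorPower.map 2 g).toAddMonoidHom
    (exteriorPower.map_injective f hfg) (.of_free (B := B) h)

end Separated

section Completion
variable (p : ℕ) (A : Type u) [CommRing A]

/-- The `p`-adic completion of the ring `A`. -/
abbrev PCompletion : Type u := AdicCompletion (Ideal.span {(p : A)}) A

theorem span_pow_smul_top {M : Type u} [AddCommGroup M] [Module A M] (n : ℕ) (x : M) :
    x ∈ (Ideal.span {(p : A)} ^ n • ⊤ : Submodule A M) ↔ ∃ y : M, x = p ^ n • y := by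
  rw [Ideal.span_singleton_pow, Submodule.ideal_span_singleton_smul,
    Submodule.mem_smul_pointwise_iff_exists]
  constructor
  · rintro ⟨y, -, rfl⟩
    exact ⟨y, by rw [← Nat.cast_smul_eq_nsmul A, Nat.cast_pow]⟩
  · rintro ⟨y, rfl⟩
    exact ⟨y, trivial, by rw [← Nat.cast_smul_eq_nsmul A, Nat.cast_pow]⟩

theorem exists_eq_of_add {M : Type u} [AddCommGroup M] [Module A M] (n : ℕ)
    (x : AdicCompletion (Ideal.span {(p : A)}) M) :
    ∃ (a : M) (y : _), x = AdicCompletion.of _ M a + p ^ n • y := by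
  obtain ⟨a, ha⟩ := Submodule.Quotient.mk_surjective _ (x.val n)
  have h : x - AdicCompletion.of _ M a ∈
      (Ideal.span {(p : A)} ^ n • ⊤ : Submodule A (AdicCompletion (Ideal.span {(p : A)}) M)) := by
    rw [AdicCompletion.pow_smul_top_eq_ker_eval (Submodule.fg_span_singleton _), LinearMap.mem_ker,
      map_sub, AdicCompletion.eval_of, AdicCompletion.eval_apply, ← ha]
    exact sub_self _
  obtain ⟨y, hy⟩ := (span_pow_smul_top p A n _).mp h
  exact ⟨a, y, by rw [← hy, add_sub_cancel]⟩

theorem pSeparated_completion (M : Type u) [AddCommGroup M] [Module A M] :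
    PSeparated p (AdicCompletion (Ideal.span {(p : A)}) M) := fun x hx =>
  IsHausdorff.haus (I := Ideal.span {(p : A)}) inferInstance x fun n =>
    SModEq.zero.mpr ((span_pow_smul_top p A n x).mpr (hx n))

variable {A} in
/-- An additive map on the completion vanishing on `A`, with separated values, vanishes. -/
theorem derivation_completion_eq_zero {N : Type u} [AddCommGroup N]
    (hN : PSeparated p N) (δ : PCompletion p A →+ N)
    (h0 : ∀ a : A, δ (algebraMap A (PCompletion p A) a) = 0) (x : PCompletion p A) : δ x = 0 :=
  hN _ fun n => by
    obtain ⟨a, y, rfl⟩ := exists_eq_of_add p A n x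
    exact ⟨δ y, by rw [map_add, map_nsmul]; exact add_eq_right.mpr (h0 a)⟩

end Completion

section CompletedDifferential
variable (p : ℕ) (R A : Type u) [CommRing R] [CommRing A] [Algebra R A]

/-- The `p`-adic completion of `Ω_{A/R}`. -/
abbrev ΩCompletion : Type u := AdicCompletion (Ideal.span {(p : A)}) Ω[A⁄R]

/-- The differential `A / p^n → Ω / p^n`. -/
def differentialMod (n : ℕ) :
    (A ⧸ (Ideal.span {(p : A)} ^ n • ⊤ : Submodule A A)) →+
      (Ω[A⁄R] ⧸ (Ideal.span {(p : A)} ^ n • ⊤ : Submodule A Ω[A⁄R])) :=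
  QuotientAddGroup.map (Ideal.span {(p : A)} ^ n • ⊤ : Submodule A A).toAddSubgroup
    (Ideal.span {(p : A)} ^ n • ⊤ : Submodule A Ω[A⁄R]).toAddSubgroup
    (KaehlerDifferential.D R A).toLinearMap.toAddMonoidHom (fun x hx => by
      obtain ⟨y, rfl⟩ := (span_pow_smul_top p A n x).mp hx
      exact (span_pow_smul_top p A n _).mpr ⟨KaehlerDifferential.D R A y, map_nsmul _ _ _⟩)

/-- The completed differential. -/
def completedDifferential : PCompletion p A →+ ΩCompletion p R A :=
  AddMonoidHom.mk' (fun x => ⟨fun n => differentialMod p R A n (x.val n), fun {m n} hmn => by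
      obtain ⟨a, ha⟩ := Submodule.Quotient.mk_surjective _ (x.val n)
      change AdicCompletion.transitionMap _ _ hmn (differentialMod p R A n (x.val n)) =
        differentialMod p R A m (x.val m)
      have h : x.val m = AdicCompletion.transitionMap _ A hmn (x.val n) := (x.property hmn).symm
      rw [h, ← ha]
      rfl⟩)
    (fun x y => AdicCompletion.ext fun n => map_add (differentialMod p R A n) _ _)

theorem completedDifferential_of (a : A) :
    completedDifferential p R A (algebraMap A _ a) =
      AdicCompletion.of _ _ (KaehlerDifferential.D R A a) := rfl

theorem completedDifferential_mul (x y : PCompletion p A) :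
    completedDifferential p R A (x * y) =
      x • completedDifferential p R A y + y • completedDifferential p R A x := by
  refine AdicCompletion.ext fun n => ?_
  obtain ⟨a, ha⟩ := Submodule.Quotient.mk_surjective _ (x.val n)
  obtain ⟨b, hb⟩ := Submodule.Quotient.mk_surjective _ (y.val n)
  change differentialMod p R A n (x.val n * y.val n) =
    x.val n • differentialMod p R A n (y.val n) + y.val n • differentialMod p R A n (x.val n)
  rw [← ha, ← hb]
  exact congrArg (Submodule.Quotient.mk) ((KaehlerDifferential.D R A).leibniz a b)

end CompletedDifferential

section Smooth
variable (p : ℕ) (R A : Type u) [CommRing R] [CommRing A] [Algebra R A] [IsNoetherianRing R]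
  [Algebra.Smooth R A]

theorem isBaseChange_ΩCompletion :
    IsBaseChange (PCompletion p A) (AdicCompletion.of (Ideal.span {(p : A)}) Ω[A⁄R]) :=
  haveI : IsNoetherianRing A := Algebra.FiniteType.isNoetherianRing R A
  .of_equiv (AdicCompletion.ofTensorProductEquivOfFiniteNoetherian (Ideal.span {(p : A)}) Ω[A⁄R])
    (fun x => by
      rw [AdicCompletion.ofTensorProductEquivOfFiniteNoetherian_apply,
        AdicCompletion.ofTensorProduct_tmul, one_smul])

theorem finite_ΩCompletion : Module.Finite (PCompletion p A) (ΩCompletion p R A) :=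
  .equiv (isBaseChange_ΩCompletion p R A).equiv

theorem projective_ΩCompletion : Module.Projective (PCompletion p A) (ΩCompletion p R A) :=
  .of_equiv (isBaseChange_ΩCompletion p R A).equiv

/-- The calculus `Â → Ω̂ → ⋀² Ω̂` of the `p`-adic completion of the smooth algebra `A`. -/
def completedCalculus : Calculus R (PCompletion p A) :=
  (Calculus.kaehler R A).ofBaseChange (Ω' := ΩCompletion p R A) (AdicCompletion.of _ Ω[A⁄R])
    (isBaseChange_ΩCompletion p R A) (completedDifferential p R A)
    (completedDifferential_mul p R A)
    (fun r => by
      have h := completedDifferential_of p R A (algebraMap R A r)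
      rw [Derivation.map_algebraMap, map_zero] at h
      exact h)
    (completedDifferential_of p R A)
    (fun δ _ h0 _ => by
      have := finite_ΩCompletion p R A
      have := projective_ΩCompletion p R A
      exact derivation_completion_eq_zero p (.exteriorSquare (pSeparated_completion p A A)) δ h0)

end Smooth

section ReductionMap
variable (p : ℕ) (R A : Type u) [CommRing R] [CommRing A] [Algebra R A] [IsNoetherianRing R]
  [Algebra.Smooth R A]
variable (C : Type u) [CommRing C] [Algebra R C] [Algebra (PCompletion p A) C]
  [IsScalarTower R (PCompletion p A) C]

/-- The map from the completed one-forms to the one-forms of an `Â`-algebra in which `p` is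
nilpotent. -/
def reductionHom (hp : IsNilpotent (p : C)) :
    (completedCalculus p R A).Hom (Calculus.kaehler R C) :=
  letI : Module A Ω[C⁄R] := Module.compHom _ (algebraMap A (PCompletion p A))
  haveI : IsScalarTower A (PCompletion p A) Ω[C⁄R] := .of_algebraMap_smul fun _ _ => rfl
  haveI : IsScalarTower R A Ω[C⁄R] := .of_algebraMap_smul fun r ω => by
    change algebraMap A (PCompletion p A) (algebraMap R A r) • ω = r • ω
    exact algebraMap_smul (PCompletion p A) r ω
  let δ : Derivation R A Ω[C⁄R] := .mk'
    { toFun := fun a => KaehlerDifferential.D R C (algebraMap _ C (algebraMap A (PCompletion p A) a))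
      map_add' := fun a b => by rw [map_add, map_add, map_add]
      map_smul' := fun r a => by
        have h : algebraMap _ C (algebraMap A (PCompletion p A) (r • a)) =
            r • algebraMap _ C (algebraMap A (PCompletion p A) a) := by
          rw [Algebra.smul_def, map_mul, map_mul, Algebra.smul_def,
            IsScalarTower.algebraMap_apply R (PCompletion p A) C]
          rfl
        rw [h, Derivation.map_smul]; rfl }
    (fun a b => by
      change KaehlerDifferential.D R C (algebraMap _ C (algebraMap A (PCompletion p A) (a * b))) = _
      rw [map_mul, map_mul, Derivation.leibniz]
      exact congrArg₂ (· + ·) (algebraMap_smul C (algebraMap A (PCompletion p A) a) _)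
        (algebraMap_smul C (algebraMap A (PCompletion p A) b) _))
  let L : ΩCompletion p R A →ₗ[PCompletion p A] Ω[C⁄R] :=
    (isBaseChange_ΩCompletion p R A).lift δ.liftKaehlerDifferential
  { f := L.toAddMonoidHom
    f_smul := fun a ω => (L.map_smul a ω).trans (algebraMap_smul C a (L ω)).symm
    f_d := fun x => by
      refine sub_eq_zero.mp (derivation_completion_eq_zero p (N := Ω[C⁄R]) (fun x hx => ?_)
        (AddMonoidHom.mk' (fun x => L (completedDifferential p R A x) -
          KaehlerDifferential.D R C (algebraMap _ C x)) fun x y => by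
            rw [map_add, map_add, map_add, map_add]; abel) (fun a => ?_) x)
      · obtain ⟨n, hn⟩ := hp
        obtain ⟨y, rfl⟩ := hx n
        rw [← Nat.cast_smul_eq_nsmul C, Nat.cast_pow, hn, zero_smul]
      · change L (completedDifferential p R A (algebraMap A _ a)) - _ = 0
        rw [completedDifferential_of]
        refine sub_eq_zero.mpr (((isBaseChange_ΩCompletion p R A).lift_eq _ _).trans ?_)
        exact δ.liftKaehlerDifferential_comp_D a }

end ReductionMap

section Generic
attribute [local instance] Algebra.TensorProduct.rightAlgebra
variable {R : Type u} [CommRing R] {B : Type u} [CommRing B] [Algebra R B] (𝒜 : Calculus R B)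
  (K : Type u) [CommRing K] [Algebra R K]

namespace Calculus

theorem d_smul (r : R) (b : B) : 𝒜.d (r • b) = algebraMap R B r • 𝒜.d b := by
  rw [Algebra.smul_def, 𝒜.d_mul, 𝒜.d_algebraMap, smul_zero, add_zero]

/-- The `K`-linear extension of the differential. -/
def genericD : K ⊗[R] B →+ (K ⊗[R] B) ⊗[B] 𝒜.Ω :=
  TensorProduct.liftAddHom
    (AddMonoidHom.mk' (fun k : K => (AddMonoidHom.mk'
      (fun b : B => (k ⊗ₜ[R] (1 : B)) ⊗ₜ[B] 𝒜.d b)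
      (fun b b' => by rw [map_add, TensorProduct.tmul_add]) : B →+ (K ⊗[R] B) ⊗[B] 𝒜.Ω))
      (fun k k' => by
        ext b
        simp only [AddMonoidHom.mk'_apply, AddMonoidHom.add_apply, TensorProduct.add_tmul]))
    (fun r k b => by
      change ((r • k) ⊗ₜ[R] (1 : B)) ⊗ₜ[B] 𝒜.d b = (k ⊗ₜ[R] (1 : B)) ⊗ₜ[B] 𝒜.d (r • b)
      rw [𝒜.d_smul, ← TensorProduct.smul_tmul, Algebra.smul_def (algebraMap R B r)]
      congr 1
      rw [Algebra.TensorProduct.right_algebraMap_apply, Algebra.TensorProduct.tmul_mul_tmul,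
        one_mul, mul_one, Algebra.algebraMap_eq_smul_one, TensorProduct.smul_tmul])

theorem genericD_tmul (k : K) (b : B) :
    𝒜.genericD K (k ⊗ₜ[R] b) = (k ⊗ₜ[R] (1 : B)) ⊗ₜ[B] 𝒜.d b := rfl

theorem genericD_mul (x y : K ⊗[R] B) :
    𝒜.genericD K (x * y) = x • 𝒜.genericD K y + y • 𝒜.genericD K x := by
  induction x using TensorProduct.induction_on with
  | zero => simp
  | add x x' hx hy => rw [add_mul, map_add, map_add, hx, hy, smul_add, add_smul]; abel
  | tmul k b =>
  induction y using TensorProduct.induction_on with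
  | zero => simp
  | add x x' hx hy => rw [mul_add, map_add, map_add, hx, hy, smul_add, add_smul]; abel
  | tmul l c =>
    have e : ∀ (k : K) (b : B), k ⊗ₜ[R] b = b • (k ⊗ₜ[R] (1 : B)) := fun k b => by
      rw [Algebra.smul_def, Algebra.TensorProduct.right_algebraMap_apply,
        Algebra.TensorProduct.tmul_mul_tmul, one_mul, mul_one]
    rw [Algebra.TensorProduct.tmul_mul_tmul, genericD_tmul, genericD_tmul, genericD_tmul, 𝒜.d_mul,
      TensorProduct.smul_tmul', TensorProduct.smul_tmul', smul_eq_mul, smul_eq_mul,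
      Algebra.TensorProduct.tmul_mul_tmul, Algebra.TensorProduct.tmul_mul_tmul, mul_one, mul_one,
      e _ b, e _ c, TensorProduct.tmul_add, TensorProduct.smul_tmul, TensorProduct.smul_tmul,
      mul_comm l k]

/-- The base change of a calculus to `K`: `K ⊗ B → K ⊗ Ω → ⋀² (K ⊗ Ω)`. -/
def generic : Calculus K (K ⊗[R] B) :=
  𝒜.ofBaseChange (TensorProduct.mk B (K ⊗[R] B) 𝒜.Ω 1) (TensorProduct.isBaseChange _ _ _)
    (𝒜.genericD K) (𝒜.genericD_mul K)
    (fun k => by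
      change 𝒜.genericD K (k ⊗ₜ[R] 1) = 0
      rw [genericD_tmul, 𝒜.d_one, TensorProduct.tmul_zero])
    (fun b => rfl)
    (fun δ hδ h0 h1 x => by
      induction x using TensorProduct.induction_on with
      | zero => exact map_zero δ
      | add x y hx hy => rw [map_add, hx, hy, add_zero]
      | tmul k b =>
        have e : k ⊗ₜ[R] b = algebraMap K (K ⊗[R] B) k * algebraMap B (K ⊗[R] B) b := by
          rw [Algebra.TensorProduct.right_algebraMap_apply,
            Algebra.TensorProduct.algebraMap_apply, Algebra.TensorProduct.tmul_mul_tmul,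
            one_mul, mul_one]; rfl
        rw [e, hδ, h0, h1, smul_zero, smul_zero, add_zero])

/-- The natural map `Ω → K ⊗ Ω`. -/
def genericHom : 𝒜.Hom (𝒜.generic K) where
  f := (TensorProduct.mk B (K ⊗[R] B) 𝒜.Ω 1).toAddMonoidHom
  f_smul b ω := (map_smul (TensorProduct.mk B (K ⊗[R] B) 𝒜.Ω 1) b ω).trans
    (algebraMap_smul (K ⊗[R] B) b _).symm
  f_d b := rfl

end Calculus
end Generic

section Linearity
variable {R A K A' : Type u} [CommRing R] [CommRing A] [Algebra R A] [CommRing K] [CommRing A']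
  [Algebra K A'] [Algebra A A'] [Algebra R K] {T : ModuleTheory R A} {T' : ModuleTheory K A'}

theorem transport_isLinearAlong (φ : ModuleTheory.Transport T T' (bcFunctor A A'))
    (h : ∀ r : R, algebraMap A A' (algebraMap R A r) = algebraMap K A' (algebraMap R K r)) :
    ScalarExt.IsLinearAlong R K φ.functor where
  map_add f g := Subtype.ext (ModuleCat.hom_ext (LinearMap.baseChange_add f.1.hom g.1.hom))
  map_smul r f := Subtype.ext (bc_hom_ext A fun m => by
    change (1 : A') ⊗ₜ[A] (algebraMap R A r • f.1.hom m) =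
      algebraMap K A' (algebraMap R K r) • ((1 : A') ⊗ₜ[A] f.1.hom m)
    rw [← h, algebraMap_smul A' (algebraMap R A r), TensorProduct.tmul_smul])

end Linearity

section DerivationPower
variable {R C : Type u} [CommRing R] [CommRing C] [Algebra R C] (D : Derivation R C C)

/-- Modulo `p`, the `p`-th iterate of a derivation is a derivation. -/
theorem derivation_pow_prime {p : ℕ} (hp : p.Prime) (a b : C) : ∃ c : C,
    (D.toLinearMap ^ p) (a * b) =
      a * (D.toLinearMap ^ p) b + b * (D.toLinearMap ^ p) a + p • c := by
  let L : Module.End R C := D.toLinearMap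
  let X : Module.End R (C ⊗[R] C) := L.rTensor C
  let Y : Module.End R (C ⊗[R] C) := L.lTensor C
  have hXY : Commute X Y := by
    change X ∘ₗ Y = Y ∘ₗ X
    rw [LinearMap.lTensor_comp_rTensor, LinearMap.rTensor_comp_lTensor]
  have h1 : LinearMap.mul' R C ∘ₗ (X + Y) = L ∘ₗ LinearMap.mul' R C := by
    ext x y
    change LinearMap.mul' R C (L x ⊗ₜ[R] y + x ⊗ₜ[R] L y) = D (x * y)
    rw [map_add, LinearMap.mul'_apply, LinearMap.mul'_apply, D.leibniz, add_comm, mul_comm (L x)]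
    rfl
  have h2 : ∀ n, LinearMap.mul' R C ∘ₗ ((X + Y) ^ n) = (L ^ n) ∘ₗ LinearMap.mul' R C := by
    intro n
    induction n with
    | zero => rfl
    | succ n ih =>
      rw [pow_succ, Module.End.mul_eq_comp, ← LinearMap.comp_assoc, ih, LinearMap.comp_assoc, h1,
        ← LinearMap.comp_assoc, pow_succ, Module.End.mul_eq_comp]
  obtain ⟨r, hr⟩ := hXY.exists_add_pow_prime_eq hp
  have hX : ∀ n, X ^ n = (L ^ n).rTensor C := fun n => LinearMap.rTensor_pow (M := C) L n
  have hY : ∀ n, Y ^ n = (L ^ n).lTensor C := fun n => LinearMap.lTensor_pow (M := C) L n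
  refine ⟨LinearMap.mul' R C ((X * Y * r) (a ⊗ₜ[R] b)), ?_⟩
  have h3 := LinearMap.congr_fun (h2 p) (a ⊗ₜ[R] b)
  rw [LinearMap.comp_apply, LinearMap.comp_apply, LinearMap.mul'_apply] at h3
  change (L ^ p) (a * b) = _
  rw [← h3, hr, hX, hY, mul_assoc (p : Module.End R (C ⊗[R] C)), mul_assoc (p : Module.End R (C ⊗[R] C)), ← nsmul_eq_mul]
  simp only [LinearMap.add_apply, LinearMap.smul_apply, LinearMap.rTensor_tmul,
    LinearMap.lTensor_tmul, map_add, LinearMap.mul'_apply, map_nsmul]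
  rw [mul_comm ((L ^ p) a) b, add_comm (b * _)]

/-- A derivation killing or normalizing a set of coordinates is nilpotent when `p` is. -/
theorem derivation_nilpotent {p : ℕ} (hp : p.Prime) (hC : IsNilpotent (p : C)) {ι : Type}
    (x : ι → C) (hx : Submodule.span C (Set.range fun i => KaehlerDifferential.D R C (x i)) = ⊤)
    (hD : ∀ i, D (D (x i)) = 0) (c : C) : ∃ k, (D.toLinearMap ^ k) c = 0 := by
  let I : Ideal C := Ideal.span {(p : C)}
  have hI : ∀ y : C, p • y ∈ I := fun y => by
    rw [nsmul_eq_mul]; exact I.mul_mem_right _ (Ideal.mem_span_singleton_self _)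
  let ψ : Derivation R C (C ⧸ I) := .mk' (I.mkQ.restrictScalars R ∘ₗ (D.toLinearMap ^ p))
    (fun a b => by
      obtain ⟨c, hc⟩ := derivation_pow_prime D hp a b
      change I.mkQ ((D.toLinearMap ^ p) (a * b)) = a • I.mkQ ((D.toLinearMap ^ p) b) +
        b • I.mkQ ((D.toLinearMap ^ p) a)
      rw [hc, map_add, map_add, ← map_smul I.mkQ, ← map_smul I.mkQ, smul_eq_mul, smul_eq_mul,
        Submodule.mkQ_apply I (p • c), (Submodule.Quotient.mk_eq_zero I).mpr (hI c), add_zero])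
  have hψ : ψ.liftKaehlerDifferential = 0 := by
    refine LinearMap.ext_on_range hx fun i => ?_
    rw [Derivation.liftKaehlerDifferential_comp_D]
    change I.mkQ ((D.toLinearMap ^ p) (x i)) = 0
    obtain ⟨m, rfl⟩ := Nat.exists_eq_add_of_le' hp.two_le
    rw [pow_add, Module.End.mul_apply, pow_two, Module.End.mul_apply]
    change I.mkQ ((D.toLinearMap ^ m) (D (D (x i)))) = 0
    rw [hD, map_zero, map_zero]
  have h1 : ∀ c : C, ∃ y : C, (D.toLinearMap ^ p) c = p • y := fun c => by
    have h : ψ c = 0 := by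
      rw [← Derivation.liftKaehlerDifferential_comp_D, hψ, LinearMap.zero_apply]
    have h' : (D.toLinearMap ^ p) c ∈ I := (Submodule.Quotient.mk_eq_zero I).mp h
    obtain ⟨y, hy⟩ := Ideal.mem_span_singleton'.mp h'
    exact ⟨y, by rw [nsmul_eq_mul, ← hy, mul_comm]⟩
  have h2 : ∀ n (c : C), ∃ y : C, (D.toLinearMap ^ (p * n)) c = p ^ n • y := by
    intro n
    induction n with
    | zero => exact fun c => ⟨c, by simp⟩
    | succ n ih =>
      intro c
      obtain ⟨y, hy⟩ := h1 c
      obtain ⟨z, hz⟩ := ih y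
      refine ⟨z, ?_⟩
      rw [mul_add, mul_one, pow_add, Module.End.mul_apply, hy, map_nsmul, hz, smul_smul, pow_succ']
  obtain ⟨n, hn⟩ := hC
  obtain ⟨y, hy⟩ := h2 n c
  exact ⟨p * n, by rw [hy, nsmul_eq_mul, Nat.cast_pow, hn, zero_mul]⟩

end DerivationPower

namespace Calculus
section Along
variable {B A : Type u} [CommRing B] [CommRing A] [Algebra B A] {𝒜 : Calculus B A}
variable {M N : Type u} [AddCommGroup M] [Module A M] [AddCommGroup N] [Module A N]

/-- The contraction `id ⊗ φ : M ⊗ Ω → M`. -/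
def contract (M : Type u) [AddCommGroup M] [Module A M] (φ : 𝒜.Ω →ₗ[A] A) : M ⊗[A] 𝒜.Ω →ₗ[A] M :=
  (TensorProduct.rid A M).toLinearMap ∘ₗ φ.lTensor M

theorem contract_tmul (φ : 𝒜.Ω →ₗ[A] A) (m : M) (ω : 𝒜.Ω) :
    contract M φ (m ⊗ₜ[A] ω) = φ ω • m := rfl

theorem contract_rTensor (φ : 𝒜.Ω →ₗ[A] A) (f : M →ₗ[A] N) (x : M ⊗[A] 𝒜.Ω) :
    contract N φ (f.rTensor 𝒜.Ω x) = f (contract M φ x) := by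
  induction x using TensorProduct.induction_on with
  | zero => simp
  | add x y hx hy => simp only [map_add, hx, hy]
  | tmul m ω => rw [LinearMap.rTensor_tmul, contract_tmul, contract_tmul, map_smul]

namespace PreConn

/-- The covariant derivative `(id ⊗ φ) ∘ ∇` along the vector field `φ`. -/
def along (s : 𝒜.PreConn M) (φ : 𝒜.Ω →ₗ[A] A) : M →+ M :=
  (contract M φ).toAddMonoidHom.comp s.nabla

theorem along_apply (s : 𝒜.PreConn M) (φ : 𝒜.Ω →ₗ[A] A) (m : M) :
    s.along φ m = contract M φ (s.nabla m) := rfl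

/-- `m` is killed by some power of the covariant derivative along `φ`. -/
def NilAt (s : 𝒜.PreConn M) (φ : 𝒜.Ω →ₗ[A] A) (m : M) : Prop := ∃ k : ℕ, (s.along φ)^[k] m = 0

theorem NilAt.add {s : 𝒜.PreConn M} {φ : 𝒜.Ω →ₗ[A] A} {m m' : M} (h : s.NilAt φ m)
    (h' : s.NilAt φ m') : s.NilAt φ (m + m') := by
  obtain ⟨k, hk⟩ := h
  obtain ⟨l, hl⟩ := h'
  refine ⟨k + l, ?_⟩
  rw [iterate_map_add, Function.iterate_add_apply _ k l m', hl, add_comm k l,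
    Function.iterate_add_apply, hk, iterate_map_zero, iterate_map_zero,
    add_zero]

theorem along_horizontal {s : 𝒜.PreConn M} {t : 𝒜.PreConn N} {f : M →ₗ[A] N}
    (hf : s.Horizontal t f) (φ : 𝒜.Ω →ₗ[A] A) (m : M) :
    t.along φ (f m) = f (s.along φ m) := by
  rw [along_apply, ← hf m, contract_rTensor]; rfl

theorem NilAt.map {s : 𝒜.PreConn M} {t : 𝒜.PreConn N} {f : M →ₗ[A] N}
    (hf : s.Horizontal t f) {φ : 𝒜.Ω →ₗ[A] A} {m : M} (h : s.NilAt φ m) : t.NilAt φ (f m) := by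
  obtain ⟨k, hk⟩ := h
  refine ⟨k, ?_⟩
  have : ∀ k (m : M), (t.along φ)^[k] (f m) = f ((s.along φ)^[k] m) := by
    intro k
    induction k with
    | zero => exact fun m => rfl
    | succ k ih =>
      intro m
      rw [Function.iterate_succ_apply, along_horizontal hf, ih, ← Function.iterate_succ_apply]
  rw [this, hk, map_zero]

theorem along_tensor (s : 𝒜.PreConn M) (t : 𝒜.PreConn N) (φ : 𝒜.Ω →ₗ[A] A) (m : M) (n : N) :
    (s.tensor t).along φ (m ⊗ₜ[A] n) = s.along φ m ⊗ₜ[A] n + m ⊗ₜ[A] t.along φ n := by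
  rw [along_apply, tensor_nabla, map_add, contract_rTensor, contract_rTensor]
  rfl

theorem NilAt.tensor {s : 𝒜.PreConn M} {t : 𝒜.PreConn N} {φ : 𝒜.Ω →ₗ[A] A} {m : M} {n : N}
    (hm : s.NilAt φ m) (hn : t.NilAt φ n) : (s.tensor t).NilAt φ (m ⊗ₜ[A] n) := by
  obtain ⟨a, ha⟩ := hm
  obtain ⟨b, hb⟩ := hn
  refine ⟨a + b, ?_⟩
  have : ∀ (l a b : ℕ) (m : M) (n : N), a + b = l → (s.along φ)^[a] m = 0 →
      (t.along φ)^[b] n = 0 → ((s.tensor t).along φ)^[l] (m ⊗ₜ[A] n) = 0 := by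
    intro l
    induction l with
    | zero =>
      intro a b m n hl ha hb
      obtain rfl : a = 0 := by omega
      have hm : m = 0 := ha
      rw [hm, TensorProduct.zero_tmul]; rfl
    | succ l ih =>
      intro a b m n hl ha hb
      rw [Function.iterate_succ_apply, along_tensor, iterate_map_add]
      have h1 : ((s.tensor t).along φ)^[l] (s.along φ m ⊗ₜ[A] n) = 0 := by
        cases a with
        | zero =>
          have hm : m = 0 := ha
          rw [hm, map_zero, TensorProduct.zero_tmul, iterate_map_zero]
        | succ a => exact ih a b _ _ (by omega) ha hb
      have h2 : ((s.tensor t).along φ)^[l] (m ⊗ₜ[A] t.along φ n) = 0 := by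
        cases b with
        | zero =>
          have hm : n = 0 := hb
          rw [hm, map_zero, TensorProduct.tmul_zero, iterate_map_zero]
        | succ b => exact ih a b _ _ (by omega) ha hb
      rw [h1, h2, add_zero]
  exact this _ a b m n rfl ha hb

end PreConn
end Along

section QuasiNilpotent
variable {R C : Type u} [CommRing R] [CommRing C] [Algebra R C] {M : Type u} [AddCommGroup M]
  [Module C M]

/-- For all coordinates `x₁, …, x_d` on `Spec C` (that is, the `dx_i` form a basis of the
one-forms), with dual vector fields `∂_i`, every section is killed by a power of each `∇(∂_i)`. -/
def PreConn.NilpotentInCoordinates (s : (kaehler R C).PreConn M) : Prop :=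
  ∀ (d : ℕ) (x : Fin d → C) (b : Module.Basis (Fin d) C (kaehler R C).Ω),
    (∀ i, b i = (kaehler R C).d (x i)) → ∀ i m, s.NilAt (b.coord i) m

theorem nilpotentInCoordinates_unit {p : ℕ} (hp : p.Prime) (hC : IsNilpotent (p : C)) :
    (PreConn.unit (kaehler R C)).NilpotentInCoordinates := by
  intro d x b hb i c
  let D : Derivation R C C := (KaehlerDifferential.linearMapEquivDerivation R C) (b.coord i)
  have hD : ∀ c, (PreConn.unit (kaehler R C)).along (b.coord i) c = D.toLinearMap c := fun c =>
    mul_one (b.coord i ((kaehler R C).d c))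
  have hDx : ∀ j, D (x j) = if j = i then 1 else 0 := fun j => by
    change b.coord i ((kaehler R C).d (x j)) = _
    rw [← hb, Module.Basis.coord_apply, Module.Basis.repr_self, Finsupp.single_apply]
  obtain ⟨k, hk⟩ := derivation_nilpotent D hp hC x (by
      have := b.span_eq
      rwa [show (b : Fin d → _) = fun i => KaehlerDifferential.D R C (x i) from funext hb] at this)
    (fun j => by rw [hDx]; split_ifs <;> simp) c
  refine ⟨k, ?_⟩
  have : ∀ k (c : C), ((PreConn.unit (kaehler R C)).along (b.coord i))^[k] c =
      (D.toLinearMap ^ k) c := by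
    intro k
    induction k with
    | zero => exact fun c => rfl
    | succ k ih =>
      intro c
      rw [Function.iterate_succ_apply, ih, hD, pow_succ]; rfl
  rw [this, hk]

end QuasiNilpotent
end Calculus

section QNC
variable (p : ℕ) (R A : Type u) [CommRing R] [CommRing A] [Algebra R A] [IsNoetherianRing R]
  [Algebra.Smooth R A]

variable {A} in
theorem isNilpotent_localization {n : ℕ}
    (f : PCompletion p A ⧸ Ideal.span {(p : PCompletion p A) ^ n}) :
    IsNilpotent (p : Localization.Away f) := by
  refine ⟨n, ?_⟩
  have h : (p : PCompletion p A ⧸ Ideal.span {(p : PCompletion p A) ^ n}) ^ n = 0 := by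
    have : Ideal.Quotient.mk (Ideal.span {(p : PCompletion p A) ^ n}) (p ^ n) = 0 :=
      Ideal.Quotient.eq_zero_iff_mem.mpr (Ideal.mem_span_singleton_self _)
    rwa [map_pow, map_natCast] at this
  have h' := congrArg (algebraMap _ (Localization.Away f)) h
  rwa [map_pow, map_natCast, map_zero] at h'

/-- The restriction of one-forms to the basic open set `D(f)` of `Spec (Â / p^n)`. -/
def openReduction (n : ℕ) (f : PCompletion p A ⧸ Ideal.span {(p : PCompletion p A) ^ n}) :
    (completedCalculus p R A).Hom (Calculus.kaehler R (Localization.Away f)) :=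
  reductionHom p R A (Localization.Away f) (isNilpotent_localization p f)

/-- Topologically quasi-nilpotent connections: for every `n`, the reduction modulo `p^n` is
quasi-nilpotent, that is, in any coordinates on any basic open set `D(f)` of `Spec (Â / p^n)`
every section is killed by a power of each `∇(∂_i)`. (As `D(f)` is quasi-compact the powers
may be chosen on `D(f)` itself; the condition is independent of the coordinates, and every
point has a neighbourhood `D(f)` with coordinates.) -/
def topQuasiNilpotent : ObjectProperty (completedCalculus p R A).Conn := fun X =>
  ∀ (n : ℕ) (f : PCompletion p A ⧸ Ideal.span {(p : PCompletion p A) ^ n}),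
    ((openReduction p R A n f).pullback X.str.toPreConn).NilpotentInCoordinates

instance [hp : Fact p.Prime] : (topQuasiNilpotent p R A).IsMonoidal where
  prop_unit := fun n f d x b hb i c => by
    let φ := openReduction p R A n f
    let ε : Localization.Away f →ₗ[Localization.Away f]
        Localization.Away f ⊗[PCompletion p A] PCompletion p A :=
      (Functor.LaxMonoidal.ε (bcFunctor (PCompletion p A) (Localization.Away f))).hom
    have hε : (Calculus.PreConn.unit (Calculus.kaehler R (Localization.Away f))).Horizontal
      (φ.pullback (Calculus.PreConn.unit (completedCalculus p R A))) ε := φ.transport.isHom_ε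
    obtain ⟨c', rfl⟩ : ∃ c', ε c' = c :=
      ⟨AlgebraTensorModule.rid (PCompletion p A) (Localization.Away f) _ c,
        LinearEquiv.symm_apply_apply _ _⟩
    exact Calculus.PreConn.NilAt.map hε
      (Calculus.nilpotentInCoordinates_unit hp.out (isNilpotent_localization p f) d x b hb i c')
  prop_tensor X Y hX hY := fun n f d x b hb i z => by
    let φ := openReduction p R A n f
    let C := Localization.Away f
    let μ : (C ⊗[PCompletion p A] X.module) ⊗[C] (C ⊗[PCompletion p A] Y.module) →ₗ[C]
        C ⊗[PCompletion p A] (X.module ⊗[PCompletion p A] Y.module) :=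
      (Functor.LaxMonoidal.μ (bcFunctor (PCompletion p A) C) X.module Y.module).hom
    have hμ : ((φ.pullback X.str.toPreConn).tensor (φ.pullback Y.str.toPreConn)).Horizontal
      (φ.pullback (X.str.toPreConn.tensor Y.str.toPreConn)) μ :=
      φ.transport.isHom_μ X.str Y.str
    obtain ⟨z', rfl⟩ : ∃ z', μ z' = z :=
      ⟨AlgebraTensorModule.distribBaseChange (PCompletion p A) C X.module Y.module z,
        LinearEquiv.symm_apply_apply _ _⟩
    refine Calculus.PreConn.NilAt.map hμ ?_
    induction z' using TensorProduct.induction_on with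
    | zero => exact ⟨0, rfl⟩
    | add x y hx hy => exact hx.add hy
    | tmul y z => exact (hX n f d x b hb i y).tensor (hY n f d x b hb i z)

/-- The category of topologically quasi-nilpotent integrable connections on finitely presented
`Â`-modules. -/
abbrev QNC := (topQuasiNilpotent p R A).FullSubcategory

end QNC

/-- A differential `B`-algebra structure on `A`: a Lie ring `Δ` which is an `A`-module, acting on
`A` by `B`-derivations. -/
structure DiffRing (B A : Type u) [CommRing B] [CommRing A] [Algebra B A] where
  Δ : Type u
  [lie : LieRing Δ]
  [mod : Module A Δ]
  ι : Δ →ₗ[A] Derivation B A A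
  ι_lie : ∀ x y, ι ⁅x, y⁆ = ⁅ι x, ι y⁆
  lie_smul : ∀ (x : Δ) (a : A) (y : Δ), ⁅x, a • y⁆ = a • ⁅x, y⁆ + ι x a • y

attribute [instance] DiffRing.lie DiffRing.mod

namespace DiffRing
variable {B A : Type u} [CommRing B] [CommRing A] [Algebra B A] (𝒟 : DiffRing B A)

theorem ι_lie_apply (x y : 𝒟.Δ) (a : A) : 𝒟.ι ⁅x, y⁆ a = 𝒟.ι x (𝒟.ι y a) - 𝒟.ι y (𝒟.ι x a) := by
  rw [𝒟.ι_lie, Derivation.commutator_apply]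

section
variable (M N P M' N' : Type u) [AddCommGroup M] [Module A M] [AddCommGroup N] [Module A N]
  [AddCommGroup P] [Module A P] [AddCommGroup M'] [Module A M'] [AddCommGroup N'] [Module A N']

/-- A differential module structure on `M`. -/
structure DiffMod where
  act : 𝒟.Δ →ₗ[A] (M →+ M)
  act_lie : ∀ x y m, act ⁅x, y⁆ m = act x (act y m) - act y (act x m)
  leibniz : ∀ x (a : A) m, act x (a • m) = 𝒟.ι x a • m + a • act x m

variable {𝒟 M N P M' N'}

namespace DiffMod

/-- A linear map commutes with the action of `Δ`. -/
def Equivariant (s : 𝒟.DiffMod M) (t : 𝒟.DiffMod N) (f : M →ₗ[A] N) : Prop :=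
  ∀ x m, f (s.act x m) = t.act x (f m)

variable (𝒟) in
/-- The trivial differential module `A`. -/
def unit : 𝒟.DiffMod A where
  act :=
    { toFun := fun x => (𝒟.ι x).toLinearMap.toAddMonoidHom
      map_add' := fun x y => by ext a; rw [map_add]; rfl
      map_smul' := fun b x => by ext a; rw [map_smul]; rfl }
  act_lie x y m := 𝒟.ι_lie_apply x y m
  leibniz x a m := by
    refine ((𝒟.ι x).leibniz a m).trans ?_
    rw [add_comm, smul_eq_mul, smul_eq_mul, smul_eq_mul, mul_comm m]; rfl

/-- The action `x (m ⊗ n) = x m ⊗ n + m ⊗ x n`. -/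
def tensorAct (s : 𝒟.DiffMod M) (t : 𝒟.DiffMod N) (x : 𝒟.Δ) : M ⊗[A] N →+ M ⊗[A] N :=
  TensorProduct.liftAddHom
    (AddMonoidHom.mk' (fun m => (AddMonoidHom.mk' (fun n => s.act x m ⊗ₜ[A] n + m ⊗ₜ[A] t.act x n)
      (fun n n' => by rw [map_add, TensorProduct.tmul_add, TensorProduct.tmul_add]; abel) :
        N →+ M ⊗[A] N))
      (fun m m' => by
        ext n
        simp only [map_add, AddMonoidHom.mk'_apply, AddMonoidHom.add_apply, TensorProduct.add_tmul]
        abel))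
    (fun a m n => by
      simp only [AddMonoidHom.mk'_apply, s.leibniz, t.leibniz, TensorProduct.add_tmul,
        TensorProduct.tmul_add, TensorProduct.smul_tmul]
      abel)

theorem tensorAct_tmul (s : 𝒟.DiffMod M) (t : 𝒟.DiffMod N) (x : 𝒟.Δ) (m : M) (n : N) :
    s.tensorAct t x (m ⊗ₜ[A] n) = s.act x m ⊗ₜ[A] n + m ⊗ₜ[A] t.act x n := rfl

/-- The tensor product of differential modules. -/
def tensor (s : 𝒟.DiffMod M) (t : 𝒟.DiffMod N) : 𝒟.DiffMod (M ⊗[A] N) where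
  act :=
    { toFun := s.tensorAct t
      map_add' := fun x y => by
        ext z
        induction z using TensorProduct.induction_on with
        | zero => rw [map_zero, map_zero]
        | add x y hx hy => rw [map_add, map_add, hx, hy]
        | tmul m n =>
          rw [AddMonoidHom.add_apply, tensorAct_tmul, tensorAct_tmul, tensorAct_tmul, map_add,
            map_add, AddMonoidHom.add_apply, AddMonoidHom.add_apply, TensorProduct.add_tmul,
            TensorProduct.tmul_add]
          abel
      map_smul' := fun a x => by
        ext z
        induction z using TensorProduct.induction_on with
        | zero => rw [map_zero, map_zero]
        | add x y hx hy => rw [map_add, map_add, hx, hy]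
        | tmul m n =>
          change _ = a • s.tensorAct t x (m ⊗ₜ[A] n)
          rw [tensorAct_tmul, tensorAct_tmul, map_smul, map_smul]
          change (a • s.act x m) ⊗ₜ[A] n + m ⊗ₜ[A] (a • t.act x n) = _
          rw [TensorProduct.tmul_smul, ← TensorProduct.smul_tmul', smul_add] }
  act_lie x y z := by
    change s.tensorAct t _ z = s.tensorAct t x (s.tensorAct t y z) -
      s.tensorAct t y (s.tensorAct t x z)
    induction z using TensorProduct.induction_on with
    | zero => simp only [map_zero, sub_zero]
    | add z z' hx hy => simp only [map_add, hx, hy]; abel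
    | tmul m n =>
      simp only [tensorAct_tmul, map_add, s.act_lie, t.act_lie, TensorProduct.sub_tmul,
        TensorProduct.tmul_sub]
      abel
  leibniz x a z := by
    change s.tensorAct t x _ = _ + a • s.tensorAct t x z
    induction z using TensorProduct.induction_on with
    | zero => simp only [map_zero, smul_zero, add_zero]
    | add z z' hx hy => simp only [map_add, smul_add, hx, hy]; abel
    | tmul m n =>
      rw [TensorProduct.smul_tmul', tensorAct_tmul, tensorAct_tmul, s.leibniz,
        TensorProduct.add_tmul, smul_add, TensorProduct.smul_tmul', TensorProduct.smul_tmul',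
        TensorProduct.smul_tmul']
      abel

theorem tensor_act (s : 𝒟.DiffMod M) (t : 𝒟.DiffMod N) (x : 𝒟.Δ) (m : M) (n : N) :
    (s.tensor t).act x (m ⊗ₜ[A] n) = s.act x m ⊗ₜ[A] n + m ⊗ₜ[A] t.act x n := rfl

theorem equivariant_tensor_ext {s : 𝒟.DiffMod M} {t : 𝒟.DiffMod N} {r : 𝒟.DiffMod P}
    (f : M ⊗[A] N →ₗ[A] P)
    (h : ∀ x m n, f (s.act x m ⊗ₜ[A] n) + f (m ⊗ₜ[A] t.act x n) = r.act x (f (m ⊗ₜ[A] n))) :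
    (s.tensor t).Equivariant r f := by
  intro x z
  induction z using TensorProduct.induction_on with
  | zero => simp only [map_zero]
  | add z z' hx hy => simp only [map_add, hx, hy]
  | tmul m n => rw [tensor_act, map_add, h]

end DiffMod
end

/-- A differential module structure, on a finitely presented module. -/
structure DiffStr (M : Type u) [AddCommGroup M] [Module A M] extends 𝒟.DiffMod M where
  finitePresentation : Module.FinitePresentation A M

open DiffMod in
/-- The theory of finitely presented differential modules. -/
def diffTheory : ModuleTheory B A where
  Str M := 𝒟.DiffStr M
  IsHom s t f := s.toDiffMod.Equivariant t.toDiffMod f.hom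
  isHom_id s x m := rfl
  isHom_comp {M N P s t r f g} hf hg x m := by
    have h1 := hg x (f.hom m)
    rw [← hf x m] at h1
    exact h1
  isHom_zero {M N s t} x m := (map_zero (t.act x)).symm
  isHom_add {M N s t f g} hf hg x m := by
    rw [ModuleCat.hom_add, LinearMap.add_apply, LinearMap.add_apply, map_add, hf, hg]
  isHom_smul {M N s t} b f hf x m := by
    rw [ModuleCat.hom_smul, LinearMap.smul_apply, LinearMap.smul_apply, t.leibniz,
      Derivation.map_algebraMap, zero_smul, zero_add, hf]
  isHom_inv {M N s t} e h x m := by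
    have h1 := h x (e.inv.hom m)
    have h2 : ∀ m, e.hom.hom (e.inv.hom m) = m := e.toLinearEquiv.apply_symm_apply
    have h3 : ∀ m, e.inv.hom (e.hom.hom m) = m := e.toLinearEquiv.symm_apply_apply
    rw [h2] at h1
    rw [← h1, h3]
  unit := ⟨DiffMod.unit 𝒟, inferInstanceAs (Module.FinitePresentation A A)⟩
  tensor {M N} s t := ⟨s.toDiffMod.tensor t.toDiffMod,
    have := s.finitePresentation
    have := t.finitePresentation
    finitePresentation_tensor A M N⟩
  isHom_tensor {M N M' N' s t s' t' f g} h h' := equivariant_tensor_ext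
    (TensorProduct.map f.hom g.hom) fun x m n => by
      rw [TensorProduct.map_tmul, TensorProduct.map_tmul, TensorProduct.map_tmul, tensor_act, h x m,
        h' x n]
  isHom_associator {M N P} s t r := equivariant_tensor_ext
    (TensorProduct.assoc A M N P).toLinearMap fun x z p => by
      induction z using TensorProduct.induction_on with
      | zero => simp only [map_zero, TensorProduct.zero_tmul, add_zero]
      | add z z' hx hy =>
        simp only [map_add, TensorProduct.add_tmul, ← hx, ← hy]; abel
      | tmul m n =>
        simp only [tensor_act, LinearEquiv.coe_coe, TensorProduct.assoc_tmul,
          TensorProduct.add_tmul, map_add]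
        rw [add_assoc, ← TensorProduct.tmul_add]
        rfl
  isHom_leftUnitor {M} s := equivariant_tensor_ext (TensorProduct.lid A M).toLinearMap
    fun x a m => by
      rw [LinearEquiv.coe_coe, TensorProduct.lid_tmul, TensorProduct.lid_tmul,
        TensorProduct.lid_tmul, s.leibniz]; rfl
  isHom_rightUnitor {M} s := equivariant_tensor_ext (TensorProduct.rid A M).toLinearMap
    fun x m a => by
      rw [LinearEquiv.coe_coe, TensorProduct.rid_tmul, TensorProduct.rid_tmul,
        TensorProduct.rid_tmul, s.leibniz, add_comm]; rfl
  isHom_braiding {M N} s t := equivariant_tensor_ext (TensorProduct.comm A M N).toLinearMap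
    fun x m n => by
      rw [LinearEquiv.coe_coe, TensorProduct.comm_tmul, TensorProduct.comm_tmul,
        TensorProduct.comm_tmul, tensor_act, add_comm]

/-- The category of finitely presented differential modules. -/
abbrev Diff := 𝒟.diffTheory.Obj

end DiffRing

namespace Calculus
variable {B A : Type u} [CommRing B] [CommRing A] [Algebra B A]

section TwoForms
variable {𝒜 : Calculus B A}

/-- The linear form `φ ∧ ψ` on two-forms. -/
def wedgeForm (φ ψ : 𝒜.Ω →ₗ[A] A) : ⋀[A]^2 𝒜.Ω →ₗ[A] A :=
  exteriorPower.pairingDual A 𝒜.Ω 2 (exteriorPower.ιMulti A 2 ![φ, ψ])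

theorem wedgeForm_wedge (φ ψ : 𝒜.Ω →ₗ[A] A) (ω η : 𝒜.Ω) :
    wedgeForm φ ψ (wedge A 𝒜.Ω ω η) = φ ω * ψ η - φ η * ψ ω := by
  refine (exteriorPower.pairingDual_ιMulti_ιMulti ![φ, ψ] ![ω, η]).trans ?_
  rw [Matrix.det_fin_two]
  change φ ω * ψ η - ψ ω * φ η = _
  ring

end TwoForms

/-- A pairing of vector fields and one-forms such that `⟨x, d a⟩ = x a`. -/
structure Pairing (𝒜 : Calculus B A) (𝒟 : DiffRing B A) where
  φ : 𝒟.Δ →ₗ[A] 𝒜.Ω →ₗ[A] A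
  φ_d : ∀ x a, φ x (𝒜.d a) = 𝒟.ι x a

namespace Pairing
variable {𝒜 : Calculus B A} {𝒟 : DiffRing B A} (π : 𝒜.Pairing 𝒟)

/-- Cartan's formula. -/
theorem wedgeForm_d1 (x y : 𝒟.Δ) (ω : 𝒜.Ω) : wedgeForm (π.φ x) (π.φ y) (𝒜.d1 ω) =
    𝒟.ι x (π.φ y ω) - 𝒟.ι y (π.φ x ω) - π.φ ⁅x, y⁆ ω := by
  induction ω using 𝒜.Ω_induction with
  | d a => rw [𝒜.d1_d, map_zero, π.φ_d, π.φ_d, π.φ_d, 𝒟.ι_lie_apply, sub_self]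
  | zero => simp only [map_zero, sub_zero]
  | add ω η h h' => simp only [map_add, h, h']; abel
  | smul a ω h =>
    rw [𝒜.d1_smul, map_add, wedgeForm_wedge, map_smul, h]
    simp only [map_smul, π.φ_d, smul_eq_mul, Derivation.leibniz]
    ring

variable {M : Type u} [AddCommGroup M] [Module A M]

theorem contract_nabla1 (s : 𝒜.PreConn M) (x y : 𝒟.Δ) (z : M ⊗[A] 𝒜.Ω) :
    TensorProduct.rid A M ((wedgeForm (π.φ x) (π.φ y)).lTensor M (s.nabla1 z)) =
      s.along (π.φ x) (contract M (π.φ y) z) - s.along (π.φ y) (contract M (π.φ x) z) -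
        contract M (π.φ ⁅x, y⁆) z := by
  induction z using TensorProduct.induction_on with
  | zero => simp only [map_zero, sub_zero]
  | add z z' h h' => simp only [map_add, h, h']; abel
  | tmul m ω =>
    have h1 : ∀ w : M ⊗[A] 𝒜.Ω, TensorProduct.rid A M ((wedgeForm (π.φ x) (π.φ y)).lTensor M
        (((wedge A 𝒜.Ω).flip ω).lTensor M w)) =
        π.φ y ω • contract M (π.φ x) w - π.φ x ω • contract M (π.φ y) w := by
      intro w
      induction w using TensorProduct.induction_on with
      | zero => simp only [map_zero, smul_zero, sub_zero]
      | add z z' h h' => simp only [map_add, h, h', smul_add]; abel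
      | tmul m η =>
        rw [LinearMap.lTensor_tmul, LinearMap.lTensor_tmul, LinearMap.flip_apply, wedgeForm_wedge,
          TensorProduct.rid_tmul, contract_tmul, contract_tmul, sub_smul, mul_smul, mul_smul,
          smul_comm (π.φ x η)]
    rw [PreConn.nabla1_tmul, map_add, map_add, h1, LinearMap.lTensor_tmul, TensorProduct.rid_tmul,
      π.wedgeForm_d1]
    simp only [PreConn.along_apply, contract_tmul, s.leibniz, map_add, map_smul, sub_smul, π.φ_d]
    abel

/-- The differential module attached to an integrable connection: `x ↦ (id ⊗ ⟨x, -⟩) ∘ ∇`. -/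
def diffMod (s : 𝒜.PreConn M) (hs : s.Integrable) : 𝒟.DiffMod M where
  act :=
    { toFun := fun x => s.along (π.φ x)
      map_add' := fun x y => by
        ext m
        rw [AddMonoidHom.add_apply, PreConn.along_apply, PreConn.along_apply, PreConn.along_apply,
          map_add]
        simp only [contract, LinearMap.lTensor_add, LinearMap.comp_apply, LinearMap.add_apply,
          map_add]
      map_smul' := fun a x => by
        ext m
        change _ = a • s.along (π.φ x) m
        rw [PreConn.along_apply, PreConn.along_apply, map_smul]
        simp only [contract, LinearMap.lTensor_smul, LinearMap.comp_apply, LinearMap.smul_apply,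
          map_smul] }
  act_lie x y m := by
    have h := π.contract_nabla1 s x y (s.nabla m)
    rw [hs m, map_zero, map_zero] at h
    exact (sub_eq_zero.mp h.symm).symm
  leibniz x a m := by
    change s.along (π.φ x) (a • m) = _ + a • s.along (π.φ x) m
    rw [PreConn.along_apply, PreConn.along_apply, s.leibniz, map_add, map_smul, contract_tmul,
      π.φ_d, add_comm]

/-- Integrable connections as differential modules. -/
def transport : ModuleTheory.Transport 𝒜.connTheory 𝒟.diffTheory (𝟭 (ModuleCat.{u} A)) where
  str s := ⟨π.diffMod s.toPreConn s.integrable, s.finitePresentation⟩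
  isHom_map {M N s t f} hf x m := (PreConn.along_horizontal hf (π.φ x) m).symm
  isHom_ε x a := (show 𝒟.ι x a = (PreConn.unit 𝒜).along (π.φ x) a by
    rw [PreConn.along_apply, PreConn.unit_nabla, contract_tmul, π.φ_d, smul_eq_mul, mul_one])
  isHom_μ {M N} s t x z := by
    change (DiffRing.DiffMod.tensor (π.diffMod s.toPreConn s.integrable)
      (π.diffMod t.toPreConn t.integrable)).act x z =
      (s.toPreConn.tensor t.toPreConn).along (π.φ x) z
    induction z using TensorProduct.induction_on with
    | zero => rw [map_zero, map_zero]
    | add z z' h h' => rw [map_add, map_add, h, h']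
    | tmul m n => rw [PreConn.along_tensor]; rfl

/-- The functor from integrable connections to differential modules. -/
abbrev toDiff : 𝒜.Conn ⥤ 𝒟.Diff := π.transport.functor

end Pairing
end Calculus

namespace DiffRing

/-- The ring `A` with its `B`-derivations. -/
abbrev der (B A : Type u) [CommRing B] [CommRing A] [Algebra B A] : DiffRing B A where
  Δ := Derivation B A A
  ι := LinearMap.id
  ι_lie _ _ := rfl
  lie_smul x a y := by
    ext b
    simp only [LinearMap.id_apply, Derivation.add_apply, Derivation.smul_apply,
      Derivation.commutator_apply, smul_eq_mul, Derivation.leibniz]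
    ring

section Generic
attribute [local instance] Algebra.TensorProduct.rightAlgebra
variable (K : Type u) [CommRing K] (R B : Type u) [CommRing R] [CommRing B] [Algebra R B]
  [Algebra R K]

/-- The action `(k ⊗ b) (l ⊗ x) = k l ⊗ b x` of `K ⊗ B` on `K ⊗ Der`. -/
@[reducible] def genericModule : Module (K ⊗[R] B) (K ⊗[R] Derivation R B B) :=
  Module.compHom _ ((Module.endTensorEndAlgHom (R := R) (S := R) (A := R) (M := K)
    (N := Derivation R B B)).comp (Algebra.TensorProduct.map (Algebra.lmul R K)
      (Algebra.lsmul R R (Derivation R B B)))).toRingHom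

attribute [local instance] genericModule

theorem generic_smul_tmul (k l : K) (b : B) (x : Derivation R B B) :
    (k ⊗ₜ[R] b : K ⊗[R] B) • (l ⊗ₜ[R] x : K ⊗[R] Derivation R B B) = (k * l) ⊗ₜ[R] (b • x) := rfl

variable {R B} in
/-- The `K`-linear extension of a derivation. -/
def derBaseChange (x : Derivation R B B) : Derivation K (K ⊗[R] B) (K ⊗[R] B) :=
  .mk' (x.toLinearMap.baseChange K) (fun a b => by
    induction a using TensorProduct.induction_on with
    | zero => simp only [zero_mul, map_zero, zero_smul, smul_zero, add_zero]
    | add a a' h h' => rw [add_mul, map_add, map_add, h, h', add_smul, smul_add]; abel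
    | tmul k a =>
    induction b using TensorProduct.induction_on with
    | zero => simp only [mul_zero, map_zero, zero_smul, smul_zero, add_zero]
    | add a a' h h' => rw [mul_add, map_add, map_add, h, h', add_smul, smul_add]; abel
    | tmul l b =>
      rw [Algebra.TensorProduct.tmul_mul_tmul]
      change (k * l) ⊗ₜ[R] x (a * b) =
        (k ⊗ₜ[R] a) * (l ⊗ₜ[R] x b) + (l ⊗ₜ[R] b) * (k ⊗ₜ[R] x a)
      rw [Algebra.TensorProduct.tmul_mul_tmul, Algebra.TensorProduct.tmul_mul_tmul, x.leibniz, TensorProduct.tmul_add, mul_comm l]; rfl)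

theorem derBaseChange_tmul (x : Derivation R B B) (k : K) (b : B) :
    derBaseChange K x (k ⊗ₜ[R] b) = k ⊗ₜ[R] x b := rfl

/-- `k ⊗ x ↦ (l ⊗ b ↦ k l ⊗ x b)`. -/
def genericι : K ⊗[R] Derivation R B B →+ Derivation K (K ⊗[R] B) (K ⊗[R] B) :=
  TensorProduct.liftAddHom
    (AddMonoidHom.mk' (fun k => (AddMonoidHom.mk' (fun x => k • derBaseChange K x) (fun x y => by
        rw [← smul_add]; congr 1
        refine Derivation.ext fun z => ?_
        induction z using TensorProduct.induction_on with
        | zero => rw [map_zero, map_zero]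
        | add z z' h h' => rw [map_add, map_add, h, h']
        | tmul l b => exact TensorProduct.tmul_add l (x b) (y b)) :
        Derivation R B B →+ Derivation K (K ⊗[R] B) (K ⊗[R] B)))
      (fun k l => by ext1 x; exact add_smul k l _))
    (fun r k x => by
      refine Derivation.ext fun z => ?_
      induction z using TensorProduct.induction_on with
      | zero => rw [map_zero, map_zero]
      | add z z' h h' => rw [map_add, map_add, h, h']
      | tmul l b =>
        change ((r • k) * l) ⊗ₜ[R] x b = (k * l) ⊗ₜ[R] (r • x b)
        rw [smul_mul_assoc, TensorProduct.smul_tmul])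

theorem genericι_tmul (k l : K) (x : Derivation R B B) (b : B) :
    genericι K R B (k ⊗ₜ[R] x) (l ⊗ₜ[R] b) = (k * l) ⊗ₜ[R] x b := rfl

theorem genericι_lie (X Y : K ⊗[R] Derivation R B B) (z : K ⊗[R] B) : genericι K R B ⁅X, Y⁆ z =
    genericι K R B X (genericι K R B Y z) - genericι K R B Y (genericι K R B X z) := by
  have z1 : ∀ Y : K ⊗[R] Derivation R B B, ⁅(0 : K ⊗[R] Derivation R B B), Y⁆ = 0 :=
    fun Y => zero_lie Y
  have z2 : ∀ X : K ⊗[R] Derivation R B B, ⁅X, (0 : K ⊗[R] Derivation R B B)⁆ = 0 :=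
    fun Y => lie_zero Y
  have a1 : ∀ X X' Y : K ⊗[R] Derivation R B B, ⁅X + X', Y⁆ = ⁅X, Y⁆ + ⁅X', Y⁆ :=
    fun X X' Y => add_lie X X' Y
  have a2 : ∀ X Y Y' : K ⊗[R] Derivation R B B, ⁅X, Y + Y'⁆ = ⁅X, Y⁆ + ⁅X, Y'⁆ :=
    fun X Y Y' => lie_add X Y Y'
  induction X using TensorProduct.induction_on with
  | zero => rw [z1, map_zero]; simp
  | add X X' h h' =>
    rw [a1, map_add, map_add]
    simp only [Derivation.add_apply, h, h', map_add]
    abel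
  | tmul k x =>
  induction Y using TensorProduct.induction_on with
  | zero => rw [z2, map_zero]; simp
  | add X X' h h' =>
    rw [a2, map_add, map_add]
    simp only [Derivation.add_apply, h, h', map_add]
    abel
  | tmul l y =>
  induction z using TensorProduct.induction_on with
  | zero => simp only [map_zero, sub_zero]
  | add z z' h h' => simp only [map_add, h, h']; abel
  | tmul m c =>
    rw [LieAlgebra.ExtendScalars.bracket_tmul, genericι_tmul, genericι_tmul, genericι_tmul,
      genericι_tmul, genericι_tmul, Derivation.commutator_apply, TensorProduct.tmul_sub,
      mul_assoc, mul_left_comm l k]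

/-- The differential ring `(K ⊗ B, K ⊗ Der(B/R))`. -/
abbrev derGeneric : DiffRing K (K ⊗[R] B) where
  Δ := K ⊗[R] Derivation R B B
  ι :=
    { toFun := genericι K R B
      map_add' := map_add _
      map_smul' := fun a X => by
        induction a using TensorProduct.induction_on with
        | zero => rw [zero_smul, map_zero, map_zero, zero_smul]
        | add a a' h h' => rw [add_smul, map_add, h, h', map_add, add_smul]
        | tmul k b =>
        induction X using TensorProduct.induction_on with
        | zero => rw [smul_zero, map_zero, smul_zero]
        | add a a' h h' => rw [smul_add, map_add, h, h', map_add, smul_add]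
        | tmul l x =>
          rw [generic_smul_tmul]
          refine Derivation.ext fun z => ?_
          induction z using TensorProduct.induction_on with
          | zero => rw [map_zero, map_zero]
          | add z z' h h' => rw [map_add, map_add, h, h']
          | tmul m c =>
            change (k * l * m) ⊗ₜ[R] (b * x c) = (k ⊗ₜ[R] b) * ((l * m) ⊗ₜ[R] x c)
            rw [Algebra.TensorProduct.tmul_mul_tmul, mul_assoc] }
  ι_lie X Y := by
    have key := genericι_lie K R B X Y
    refine Derivation.ext fun z => ?_
    rw [Derivation.commutator_apply]
    exact key z
  lie_smul X a Y := by
    change _ = _ + (genericι K R B X a) • Y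
    induction X using TensorProduct.induction_on with
    | zero => rw [zero_lie, zero_lie, map_zero, smul_zero, Derivation.zero_apply, zero_smul, add_zero]
    | add X X' h h' =>
      rw [add_lie, add_lie, map_add, h, h', Derivation.add_apply, smul_add, add_smul]; abel
    | tmul k x =>
    induction a using TensorProduct.induction_on with
    | zero => rw [zero_smul, lie_zero, zero_smul, map_zero, zero_smul, add_zero]
    | add X X' h h' =>
      rw [add_smul, lie_add, map_add, h, h', add_smul, add_smul]; abel
    | tmul l b =>
    induction Y using TensorProduct.induction_on with
    | zero => rw [smul_zero, lie_zero, smul_zero, smul_zero, add_zero]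
    | add X X' h h' => rw [smul_add, lie_add, h, h', lie_add, smul_add, smul_add]; abel
    | tmul m y =>
      rw [generic_smul_tmul, LieAlgebra.ExtendScalars.bracket_tmul,
        LieAlgebra.ExtendScalars.bracket_tmul, genericι_tmul, generic_smul_tmul, generic_smul_tmul,
        show ⁅x, b • y⁆ = b • ⁅x, y⁆ + x b • y from (der R B).lie_smul x b y,
        TensorProduct.tmul_add, mul_assoc k, mul_left_comm k l]

end Generic
end DiffRing

namespace DiffRing
section
attribute [local instance] Algebra.TensorProduct.rightAlgebra genericModule
variable (K : Type u) [CommRing K] {R B : Type u} [CommRing R] [CommRing B] [Algebra R B]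
  [Algebra R K] {M N : Type u} [AddCommGroup M] [Module B M] [AddCommGroup N] [Module B N]

theorem smul_tmul_one (b : B) (k : K) : b • (k ⊗ₜ[R] (1 : B)) = k ⊗ₜ[R] b := by
  rw [Algebra.smul_def, Algebra.TensorProduct.right_algebraMap_apply,
    Algebra.TensorProduct.tmul_mul_tmul, one_mul, mul_one]

theorem smul_eq_tmul_mul (b : B) (a : K ⊗[R] B) : b • a = ((1 : K) ⊗ₜ[R] b) * a := by
  rw [Algebra.smul_def, Algebra.TensorProduct.right_algebraMap_apply]

/-- The action of `k ⊗ x` on `(K ⊗ B) ⊗ M`. -/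
def genericAct₁ (s : (der R B).DiffMod M) (k : K) (x : Derivation R B B) :
    (K ⊗[R] B) ⊗[B] M →+ (K ⊗[R] B) ⊗[B] M :=
  TensorProduct.liftAddHom
    (AddMonoidHom.mk' (fun a => (AddMonoidHom.mk' (fun m =>
      genericι K R B (k ⊗ₜ[R] x) a ⊗ₜ[B] m + ((k ⊗ₜ[R] (1 : B)) * a) ⊗ₜ[B] s.act x m)
      (fun m m' => by rw [map_add, TensorProduct.tmul_add, TensorProduct.tmul_add]; abel) :
        M →+ (K ⊗[R] B) ⊗[B] M))
      (fun a a' => by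
        ext m
        simp only [map_add, mul_add, AddMonoidHom.mk'_apply, AddMonoidHom.add_apply,
          TensorProduct.add_tmul]
        abel))
    (fun b a m => by
      simp only [AddMonoidHom.mk'_apply]
      rw [s.leibniz, smul_eq_tmul_mul, Derivation.leibniz, genericι_tmul, TensorProduct.tmul_add,
        TensorProduct.add_tmul, ← TensorProduct.smul_tmul, ← TensorProduct.smul_tmul,
        ← TensorProduct.smul_tmul, smul_eq_tmul_mul, smul_eq_tmul_mul, smul_eq_tmul_mul,
        smul_eq_mul, smul_eq_mul, mul_one]
      have e : a * (k ⊗ₜ[R] x b) = ((1 : K) ⊗ₜ[R] (der R B).ι x b) * ((k ⊗ₜ[R] (1 : B)) * a) := by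
        rw [← mul_assoc, Algebra.TensorProduct.tmul_mul_tmul, one_mul, mul_one, mul_comm]; rfl
      rw [e, mul_left_comm (k ⊗ₜ[R] (1 : B))]
      abel)

theorem genericAct₁_tmul (s : (der R B).DiffMod M) (k : K) (x : Derivation R B B) (a : K ⊗[R] B)
    (m : M) : genericAct₁ K s k x (a ⊗ₜ[B] m) =
      genericι K R B (k ⊗ₜ[R] x) a ⊗ₜ[B] m + ((k ⊗ₜ[R] (1 : B)) * a) ⊗ₜ[B] s.act x m := rfl

/-- The action of `K ⊗ Der` on `(K ⊗ B) ⊗ M`,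
`(k ⊗ x) (a ⊗ m) = (k ⊗ x) (a) ⊗ m + k a ⊗ x m`. -/
def genericAct (s : (der R B).DiffMod M) :
    K ⊗[R] Derivation R B B →+ ((K ⊗[R] B) ⊗[B] M →+ (K ⊗[R] B) ⊗[B] M) :=
  TensorProduct.liftAddHom
    (AddMonoidHom.mk' (fun k => (AddMonoidHom.mk' (fun x => genericAct₁ K s k x) (fun x y => by
        ext z
        induction z using TensorProduct.induction_on with
        | zero => rw [map_zero, map_zero]
        | add z z' h h' => rw [map_add, map_add, h, h']
        | tmul a m =>
          have e : s.act (x + y) = s.act x + s.act y := map_add s.act x y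
          rw [AddMonoidHom.add_apply, genericAct₁_tmul, genericAct₁_tmul, genericAct₁_tmul, e,
            TensorProduct.tmul_add, map_add, Derivation.add_apply, AddMonoidHom.add_apply,
            TensorProduct.tmul_add, TensorProduct.add_tmul]
          abel) : Derivation R B B →+ ((K ⊗[R] B) ⊗[B] M →+ (K ⊗[R] B) ⊗[B] M)))
      (fun k l => by
        ext x z
        change genericAct₁ K s (k + l) x z = genericAct₁ K s k x z + genericAct₁ K s l x z
        induction z using TensorProduct.induction_on with
        | zero => rw [map_zero, map_zero, map_zero, add_zero]
        | add z z' h h' => rw [map_add, map_add, map_add, h, h']; abel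
        | tmul a m =>
          rw [genericAct₁_tmul, genericAct₁_tmul, genericAct₁_tmul, TensorProduct.add_tmul, map_add,
            Derivation.add_apply, TensorProduct.add_tmul, TensorProduct.add_tmul, add_mul,
            TensorProduct.add_tmul]
          abel))
    (fun r k x => by
      ext z
      change genericAct₁ K s (r • k) x z = genericAct₁ K s k (r • x) z
      induction z using TensorProduct.induction_on with
      | zero => rw [map_zero, map_zero]
      | add z z' h h' => rw [map_add, map_add, h, h']
      | tmul a m =>
        have e : s.act (r • x) m = algebraMap R B r • s.act x m := by
          have e' : r • x = algebraMap R B r • x := (algebraMap_smul B r x).symm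
          rw [e']
          exact DFunLike.congr_fun (map_smul s.act (algebraMap R B r) x) m
        rw [genericAct₁_tmul, genericAct₁_tmul, TensorProduct.smul_tmul, e,
          ← TensorProduct.smul_tmul (algebraMap R B r), TensorProduct.smul_tmul r k (1 : B),
          ← smul_mul_assoc, smul_tmul_one, Algebra.algebraMap_eq_smul_one])

theorem genericAct_tmul (s : (der R B).DiffMod M) (k : K) (x : Derivation R B B) (a : K ⊗[R] B)
    (m : M) : genericAct K s (k ⊗ₜ[R] x) (a ⊗ₜ[B] m) =
      genericι K R B (k ⊗ₜ[R] x) a ⊗ₜ[B] m + ((k ⊗ₜ[R] (1 : B)) * a) ⊗ₜ[B] s.act x m := rfl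

theorem genericAct_leibniz (s : (der R B).DiffMod M) (X : K ⊗[R] Derivation R B B) (c : K ⊗[R] B)
    (z : (K ⊗[R] B) ⊗[B] M) :
    genericAct K s X (c • z) = genericι K R B X c • z + c • genericAct K s X z := by
  induction X using TensorProduct.induction_on with
  | zero => simp
  | add X X' h h' =>
    simp only [map_add, AddMonoidHom.add_apply, Derivation.add_apply, h, h', add_smul, smul_add]
    abel
  | tmul k x =>
  induction z using TensorProduct.induction_on with
  | zero => simp
  | add z z' h h' => simp only [map_add, smul_add, h, h']; abel
  | tmul a m =>
    rw [TensorProduct.smul_tmul', genericAct_tmul, genericAct_tmul, smul_eq_mul, Derivation.leibniz,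
      TensorProduct.add_tmul, smul_add, TensorProduct.smul_tmul', TensorProduct.smul_tmul',
      TensorProduct.smul_tmul', smul_eq_mul, smul_eq_mul, smul_eq_mul, smul_eq_mul,
      mul_left_comm c, mul_comm a]
    abel

theorem genericAct_tmul_one (s : (der R B).DiffMod M) (k : K) (x : Derivation R B B) (l : K)
    (m : M) : genericAct K s (k ⊗ₜ[R] x) ((l ⊗ₜ[R] (1 : B)) ⊗ₜ[B] m) =
      ((k * l) ⊗ₜ[R] (1 : B)) ⊗ₜ[B] s.act x m := by
  rw [genericAct_tmul, genericι_tmul, x.map_one_eq_zero, TensorProduct.tmul_zero,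
    TensorProduct.zero_tmul, zero_add, Algebra.TensorProduct.tmul_mul_tmul, mul_one]

theorem generic_induction {P : (K ⊗[R] B) ⊗[B] M → Prop} (z : (K ⊗[R] B) ⊗[B] M) (zero : P 0)
    (add : ∀ z z', P z → P z' → P (z + z')) (tmul : ∀ (l : K) (m : M), P ((l ⊗ₜ[R] (1 : B)) ⊗ₜ[B] m)) :
    P z := by
  induction z using TensorProduct.induction_on with
  | zero => exact zero
  | add z z' h h' => exact add z z' h h'
  | tmul a m =>
    induction a using TensorProduct.induction_on with
    | zero => rw [TensorProduct.zero_tmul]; exact zero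
    | add z z' h h' => rw [TensorProduct.add_tmul]; exact add _ _ h h'
    | tmul k b => rw [← smul_tmul_one, TensorProduct.smul_tmul]; exact tmul k _

/-- The base change of a differential module to `K`. -/
def DiffMod.generic (s : (der R B).DiffMod M) :
    (derGeneric K R B).DiffMod ((K ⊗[R] B) ⊗[B] M) where
  act :=
    { toFun := genericAct K s
      map_add' := map_add _
      map_smul' := fun a X => by
        change _ = a • genericAct K s X
        induction a using TensorProduct.induction_on with
        | zero => rw [zero_smul, map_zero]; exact (zero_smul (K ⊗[R] B) (genericAct K s X)).symm
        | add a a' h h' => rw [add_smul, map_add, h, h', add_smul]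
        | tmul k b =>
        change K ⊗[R] Derivation R B B at X
        induction X using TensorProduct.induction_on with
        | zero => rw [smul_zero, map_zero, smul_zero]
        | add a a' h h' => rw [smul_add, map_add, h, h', map_add, smul_add]
        | tmul l x =>
        ext z
        rw [generic_smul_tmul]
        change _ = (k ⊗ₜ[R] b) • genericAct K s (l ⊗ₜ[R] x) z
        induction z using generic_induction with
        | zero => rw [map_zero, map_zero, smul_zero]
        | add z z' h h' => rw [map_add, map_add, h, h', smul_add]
        | tmul m y =>
          have e : s.act (b • x) y = b • s.act x y := DFunLike.congr_fun (map_smul s.act b x) y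
          rw [genericAct_tmul_one, genericAct_tmul_one, e, ← TensorProduct.smul_tmul, smul_tmul_one,
            TensorProduct.smul_tmul', smul_eq_mul, Algebra.TensorProduct.tmul_mul_tmul, mul_one,
            mul_assoc] }
  act_lie X Y z := by
    change K ⊗[R] Derivation R B B at X Y
    change genericAct K s _ z = genericAct K s X (genericAct K s Y z) -
      genericAct K s Y (genericAct K s X z)
    induction X using TensorProduct.induction_on with
    | zero => rw [zero_lie, map_zero]; simp
    | add X X' h h' =>
      rw [add_lie, map_add, map_add]
      simp only [AddMonoidHom.add_apply, h, h', map_add]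
      abel
    | tmul k x =>
    induction Y using TensorProduct.induction_on with
    | zero => rw [lie_zero, map_zero]; simp
    | add X X' h h' =>
      rw [lie_add, map_add, map_add]
      simp only [AddMonoidHom.add_apply, h, h', map_add]
      abel
    | tmul l y =>
    induction z using generic_induction with
    | zero => simp only [map_zero, sub_zero]
    | add z z' h h' => simp only [map_add, h, h']; abel
    | tmul m w =>
      rw [LieAlgebra.ExtendScalars.bracket_tmul, genericAct_tmul_one, genericAct_tmul_one,
        genericAct_tmul_one, genericAct_tmul_one, genericAct_tmul_one, mul_assoc,
        mul_left_comm l k, ← TensorProduct.tmul_sub]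
      exact congrArg _ (s.act_lie x y w)
  leibniz X a z := genericAct_leibniz K s X a z

theorem DiffMod.generic_act (s : (der R B).DiffMod M) (k : K) (x : Derivation R B B) (l : K)
    (m : M) : (s.generic K).act (k ⊗ₜ[R] x : K ⊗[R] Derivation R B B)
      ((l ⊗ₜ[R] (1 : B)) ⊗ₜ[B] m) = ((k * l) ⊗ₜ[R] (1 : B)) ⊗ₜ[B] s.act x m :=
  genericAct_tmul_one K s k x l m

end
end DiffRing

namespace DiffRing
section
attribute [local instance] Algebra.TensorProduct.rightAlgebra genericModule
variable (K : Type u) [CommRing K] (R B : Type u) [CommRing R] [CommRing B] [Algebra R B]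
  [Algebra R K]

/-- Base change of differential modules to `K`. -/
def genericTransport : ModuleTheory.Transport (der R B).diffTheory (derGeneric K R B).diffTheory
    (bcFunctor B (K ⊗[R] B)) where
  str s := ⟨s.toDiffMod.generic K,
    have := s.finitePresentation
    inferInstanceAs (Module.FinitePresentation (K ⊗[R] B) ((K ⊗[R] B) ⊗[B] _))⟩
  isHom_map {M N s t f} hf X z := by
    change K ⊗[R] Derivation R B B at X
    change (K ⊗[R] B) ⊗[B] M at z
    change f.hom.baseChange (K ⊗[R] B) (genericAct K s.toDiffMod X z) =
      genericAct K t.toDiffMod X (f.hom.baseChange (K ⊗[R] B) z)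
    induction X using TensorProduct.induction_on with
    | zero => simp
    | add X X' h h' => simp only [map_add, AddMonoidHom.add_apply, h, h']
    | tmul k x =>
    induction z using generic_induction with
    | zero => simp
    | add z z' h h' => simp only [map_add, h, h']
    | tmul l m =>
      rw [genericAct_tmul_one, LinearMap.baseChange_tmul, LinearMap.baseChange_tmul,
        genericAct_tmul_one, hf x m]
  isHom_ε X a := by
    change K ⊗[R] Derivation R B B at X
    change (genericι K R B X a) ⊗ₜ[B] (1 : B) =
      genericAct K (DiffMod.unit (der R B)) X (a ⊗ₜ[B] (1 : B))
    induction X using TensorProduct.induction_on with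
    | zero => simp
    | add X X' h h' =>
      simp only [map_add, AddMonoidHom.add_apply, Derivation.add_apply, TensorProduct.add_tmul, h, h']
    | tmul k x =>
      have e : (DiffMod.unit (der R B)).act x (1 : B) = 0 := x.map_one_eq_zero
      rw [genericAct_tmul, e, TensorProduct.tmul_zero, add_zero]
  isHom_μ {M N} s t X z := by
    change K ⊗[R] Derivation R B B at X
    change ((K ⊗[R] B) ⊗[B] M) ⊗[K ⊗[R] B] ((K ⊗[R] B) ⊗[B] N) at z
    let μ : ((K ⊗[R] B) ⊗[B] M) ⊗[K ⊗[R] B] ((K ⊗[R] B) ⊗[B] N) →ₗ[K ⊗[R] B]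
        (K ⊗[R] B) ⊗[B] (M ⊗[B] N) :=
      (Functor.LaxMonoidal.μ (bcFunctor B (K ⊗[R] B)) M N).hom
    have hμ' : ∀ m n, μ (((1 : K ⊗[R] B) ⊗ₜ[B] m) ⊗ₜ[K ⊗[R] B] ((1 : K ⊗[R] B) ⊗ₜ[B] n)) =
      (1 : K ⊗[R] B) ⊗ₜ[B] (m ⊗ₜ[B] n) := bc_μ_apply M N
    have hμ : ∀ (a b : K ⊗[R] B) (m : M) (n : N),
        μ ((a ⊗ₜ[B] m) ⊗ₜ[K ⊗[R] B] (b ⊗ₜ[B] n)) = (a * b) ⊗ₜ[B] (m ⊗ₜ[B] n) := by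
      intro a b m n
      have e : (a ⊗ₜ[B] m) ⊗ₜ[K ⊗[R] B] (b ⊗ₜ[B] n) =
          a • b • (((1 : K ⊗[R] B) ⊗ₜ[B] m) ⊗ₜ[K ⊗[R] B] ((1 : K ⊗[R] B) ⊗ₜ[B] n)) := by
        rw [← TensorProduct.tmul_smul, TensorProduct.smul_tmul', TensorProduct.smul_tmul',
          TensorProduct.smul_tmul', smul_eq_mul, smul_eq_mul, mul_one, mul_one]
      rw [e, map_smul, map_smul, hμ', TensorProduct.smul_tmul', TensorProduct.smul_tmul',
        smul_eq_mul, smul_eq_mul, mul_one]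
    change μ (((s.toDiffMod.generic K).tensorAct (t.toDiffMod.generic K) X) z) =
      genericAct K (s.toDiffMod.tensor t.toDiffMod) X (μ z)
    induction X using TensorProduct.induction_on with
    | zero => 
      have e : (s.toDiffMod.generic K).tensorAct (t.toDiffMod.generic K) 0 = 0 :=
        map_zero ((s.toDiffMod.generic K).tensor (t.toDiffMod.generic K)).act
      rw [e]; simp
    | add X X' h h' =>
      have e : (s.toDiffMod.generic K).tensorAct (t.toDiffMod.generic K) (X + X') =
        (s.toDiffMod.generic K).tensorAct (t.toDiffMod.generic K) X +
        (s.toDiffMod.generic K).tensorAct (t.toDiffMod.generic K) X' :=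
        map_add ((s.toDiffMod.generic K).tensor (t.toDiffMod.generic K)).act X X'
      rw [e, AddMonoidHom.add_apply, map_add, h, h', map_add, AddMonoidHom.add_apply]
    | tmul k x =>
    induction z using TensorProduct.induction_on with
    | zero => simp
    | add z z' h h' => simp only [map_add, h, h']
    | tmul y z =>
    induction y using generic_induction with
    | zero => rw [TensorProduct.zero_tmul]; simp
    | add y y' h h' => rw [TensorProduct.add_tmul]; simp only [map_add, h, h']
    | tmul l m =>
    induction z using generic_induction with
    | zero => rw [TensorProduct.tmul_zero]; simp
    | add y y' h h' => rw [TensorProduct.tmul_add]; simp only [map_add, h, h']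
    | tmul l' n =>
      rw [DiffMod.tensorAct_tmul, DiffMod.generic_act, DiffMod.generic_act, map_add, hμ, hμ, hμ,
        Algebra.TensorProduct.tmul_mul_tmul, Algebra.TensorProduct.tmul_mul_tmul,
        Algebra.TensorProduct.tmul_mul_tmul, mul_one, genericAct_tmul_one, DiffMod.tensor_act,
        TensorProduct.tmul_add, mul_assoc, mul_left_comm l k]

end
end DiffRing

namespace Calculus
open DiffRing
section
attribute [local instance] Algebra.TensorProduct.rightAlgebra genericModule
variable (K : Type u) [CommRing K] {R B : Type u} [CommRing R] [CommRing B] [Algebra R B]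
  [Algebra R K] {𝒜 : Calculus R B}

/-- The `K`-linear extension of a linear form on one-forms. -/
def formBaseChange (φ : 𝒜.Ω →ₗ[B] B) : (K ⊗[R] B) ⊗[B] 𝒜.Ω →ₗ[K ⊗[R] B] K ⊗[R] B :=
  (AlgebraTensorModule.rid B (K ⊗[R] B) (K ⊗[R] B)).toLinearMap ∘ₗ φ.baseChange (K ⊗[R] B)

theorem formBaseChange_tmul (φ : 𝒜.Ω →ₗ[B] B) (a : K ⊗[R] B) (ω : 𝒜.Ω) :
    formBaseChange K φ (a ⊗ₜ[B] ω) = φ ω • a := rfl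

/-- The pairing of `K ⊗ Der` and `K ⊗ Ω`. -/
def Pairing.generic (π : 𝒜.Pairing (der R B)) : (𝒜.generic K).Pairing (derGeneric K R B) :=
  let φ₀ : K ⊗[R] Derivation R B B →+ ((K ⊗[R] B) ⊗[B] 𝒜.Ω →ₗ[K ⊗[R] B] K ⊗[R] B) :=
    TensorProduct.liftAddHom
      (AddMonoidHom.mk' (fun k => (AddMonoidHom.mk'
        (fun x => (k ⊗ₜ[R] (1 : B)) • formBaseChange K (π.φ x)) (fun x y => by
          rw [← smul_add]
          congr 1
          refine TensorProduct.AlgebraTensorModule.ext fun a ω => ?_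
          rw [LinearMap.add_apply, formBaseChange_tmul, formBaseChange_tmul, formBaseChange_tmul,
            map_add, LinearMap.add_apply, add_smul]) :
          Derivation R B B →+ ((K ⊗[R] B) ⊗[B] 𝒜.Ω →ₗ[K ⊗[R] B] K ⊗[R] B)))
        (fun k l => by
          ext1 x
          change ((k + l) ⊗ₜ[R] (1 : B)) • formBaseChange K (π.φ x) =
            (k ⊗ₜ[R] (1 : B)) • formBaseChange K (π.φ x) +
              (l ⊗ₜ[R] (1 : B)) • formBaseChange K (π.φ x)
          rw [← add_smul, TensorProduct.add_tmul]))
      (fun r k x => by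
        refine TensorProduct.AlgebraTensorModule.ext fun a ω => ?_
        change ((r • k) ⊗ₜ[R] (1 : B)) * (π.φ x ω • a) = (k ⊗ₜ[R] (1 : B)) * (π.φ (r • x) ω • a)
        have e' : r • x = algebraMap R B r • x := (algebraMap_smul B r x).symm
        rw [e', map_smul, LinearMap.smul_apply, smul_eq_mul, mul_smul,
          mul_smul_comm (algebraMap R B r), ← smul_mul_assoc (algebraMap R B r),
          smul_tmul_one, TensorProduct.smul_tmul r k (1 : B), Algebra.algebraMap_eq_smul_one])
  have hφ₀ : ∀ k x a ω, φ₀ (k ⊗ₜ[R] x) (a ⊗ₜ[B] ω) = (k ⊗ₜ[R] (1 : B)) * (π.φ x ω • a) :=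
    fun _ _ _ _ => rfl
  have hs : ∀ (a : K ⊗[R] B) (X : K ⊗[R] Derivation R B B), φ₀ (a • X) = a • φ₀ X := by
    intro a X
    induction a using TensorProduct.induction_on with
    | zero => rw [zero_smul, map_zero, zero_smul]
    | add a a' h h' => rw [add_smul, map_add, h, h', add_smul]
    | tmul k b =>
    induction X using TensorProduct.induction_on with
    | zero => rw [smul_zero, map_zero, smul_zero]
    | add a a' h h' => rw [smul_add, map_add, h, h', map_add, smul_add]
    | tmul l x =>
    rw [generic_smul_tmul]
    refine TensorProduct.AlgebraTensorModule.ext fun a ω => ?_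
    change φ₀ _ (a ⊗ₜ[B] ω) = (k ⊗ₜ[R] b) * φ₀ _ (a ⊗ₜ[B] ω)
    rw [hφ₀, hφ₀, map_smul, LinearMap.smul_apply, smul_eq_mul, mul_smul, ← mul_assoc,
      Algebra.TensorProduct.tmul_mul_tmul, mul_one, mul_smul_comm, ← smul_mul_assoc,
      smul_tmul_one]
  { φ :=
      { toFun := φ₀
        map_add' := map_add _
        map_smul' := hs }
    φ_d := fun X a => by
      change K ⊗[R] Derivation R B B at X
      change φ₀ X (𝒜.genericD K a) = genericι K R B X a
      induction X using TensorProduct.induction_on with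
      | zero => simp
      | add X X' h h' => rw [map_add, map_add, LinearMap.add_apply, Derivation.add_apply, h, h']
      | tmul k x =>
      induction a using TensorProduct.induction_on with
      | zero => simp
      | add a a' h h' => simp only [map_add, h, h']
      | tmul l b =>
        rw [genericD_tmul, hφ₀, π.φ_d, genericι_tmul, smul_tmul_one,
          Algebra.TensorProduct.tmul_mul_tmul, one_mul]; rfl }

end
end Calculus

section CompletedPairing
variable (p : ℕ) (R A : Type u) [CommRing R] [CommRing A] [Algebra R A] [IsNoetherianRing R]
  [Algebra.Smooth R A]

/-- The linear form on the completed one-forms defined by a derivation of `Â`. -/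
def derivationForm (x : Derivation R (PCompletion p A) (PCompletion p A)) :
    ΩCompletion p R A →ₗ[PCompletion p A] PCompletion p A :=
  (isBaseChange_ΩCompletion p R A).lift (x.compAlgebraMap A).liftKaehlerDifferential

theorem derivationForm_d (x : Derivation R (PCompletion p A) (PCompletion p A))
    (a : PCompletion p A) : derivationForm p R A x (completedDifferential p R A a) = x a := by
  refine sub_eq_zero.mp (derivation_completion_eq_zero p (pSeparated_completion p A A)
    (AddMonoidHom.mk' (fun a => derivationForm p R A x (completedDifferential p R A a) - x a)
      fun a b => by rw [map_add, map_add, map_add]; abel) (fun a => ?_) a)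
  change derivationForm p R A x (completedDifferential p R A (algebraMap A _ a)) - _ = 0
  rw [completedDifferential_of]
  refine sub_eq_zero.mpr (((isBaseChange_ΩCompletion p R A).lift_eq _ _).trans ?_)
  exact (x.compAlgebraMap A).liftKaehlerDifferential_comp_D a

/-- The pairing of `Der(Â/R)` with the completed one-forms. -/
def completedPairing : (completedCalculus p R A).Pairing (DiffRing.der R (PCompletion p A)) :=
  have ext : ∀ f g : ΩCompletion p R A →ₗ[PCompletion p A] PCompletion p A,
      (∀ a, f (completedDifferential p R A a) = g (completedDifferential p R A a)) → f = g :=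
    fun f g h => LinearMap.ext_on_range (completedCalculus p R A).span_d h
  { φ :=
      { toFun := derivationForm p R A
        map_add' := fun x y => ext _ _ fun a => by
          change derivationForm p R A (x + y) _ =
            derivationForm p R A x _ + derivationForm p R A y _
          rw [derivationForm_d, derivationForm_d, derivationForm_d]; rfl
        map_smul' := fun b x => ext _ _ fun a => by
          change derivationForm p R A (b • x) _ = b • derivationForm p R A x _
          rw [derivationForm_d, derivationForm_d]; rfl }
    φ_d := derivationForm_d p R A }

end CompletedPairing

/-- Tannakian categories: a `K`-linear symmetric monoidal category which is abelian (for the given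
additive structure) and rigid, in which the endomorphisms of the unit form a field, and which
has a fibre functor, that is an exact faithful `K`-linear symmetric monoidal functor to the
vector spaces over some field extension of `K`. (Since a monoidal functor maps `End(𝟙)` to the
endomorphisms of the unit, a fibre functor makes its field of coefficients an extension
of `End(𝟙)`, over which the category is Tannakian.) -/
structure IsTannakian (K : Type u) [Field K] (C : Type v) [Category.{u} C] [Preadditive C]
    [Linear K C] [MonoidalCategory C] [MonoidalPreadditive C] [MonoidalLinear K C]
    [SymmetricCategory C] : Prop where
  abelian : ∃ a : Abelian C, a.toPreadditive = ‹Preadditive C›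
  rigid : Nonempty (RigidCategory C)
  isField_end : IsField (End (𝟙_ C))
  exists_fibreFunctor : ∃ (L : Type u) (_ : Field L) (_ : Algebra K L)
    (ω : C ⥤ ModuleCat.{u} L) (_ : ω.Braided),
      ScalarExt.IsLinearAlong K L ω ∧ ω.Faithful ∧ (∀ X, Module.Finite L (ω.obj X)) ∧
      Limits.PreservesFiniteLimits ω ∧ Limits.PreservesFiniteColimits ω

/-- A symmetric monoidal functor between `K`-linear symmetric monoidal categories is fully
faithful, `K`-linear and exact. (The monoidal structure of `F` is an instance argument.) -/
structure IsFullyFaithfulTensorExact (K : Type u) [Field K] {C : Type v} [Category.{u} C]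
    [Preadditive C] [Linear K C] [MonoidalCategory C] [SymmetricCategory C]
    {D : Type w} [Category.{u} D] [Preadditive D] [Linear K D] [MonoidalCategory D]
    [SymmetricCategory D] (F : C ⥤ D) [F.Braided] : Prop where
  full : F.Full
  faithful : F.Faithful
  additive : F.Additive
  linear : F.Linear K
  preservesFiniteLimits : Limits.PreservesFiniteLimits F
  preservesFiniteColimits : Limits.PreservesFiniteColimits F

section Functors
attribute [local instance] Algebra.TensorProduct.rightAlgebra
variable (p : ℕ) (R A : Type u) [CommRing R] [CommRing A] [Algebra R A] [IsNoetherianRing R]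
  [Algebra.Smooth R A] (K : Type u) [CommRing K] [Algebra R K]

instance Calculus.Pairing.toDiff_additive {B A : Type u} [CommRing B] [CommRing A] [Algebra B A]
    {𝒜 : Calculus B A} {𝒟 : DiffRing B A} (π : 𝒜.Pairing 𝒟) : π.toDiff.Additive where
  map_add := rfl

instance Calculus.Pairing.toDiff_linear {B A : Type u} [CommRing B] [CommRing A] [Algebra B A]
    {𝒜 : Calculus B A} {𝒟 : DiffRing B A} (π : 𝒜.Pairing 𝒟) : π.toDiff.Linear B where
  map_smul _ _ := rfl

/-- `Conn(𝐃/𝐒, Ω_𝐃)`. -/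
abbrev ConnD := (completedCalculus p R A).Conn

/-- `Diff(𝐃, Der(𝐃/𝐒))`. -/
abbrev DiffD := (DiffRing.der R (PCompletion p A)).Diff

/-- `Conn(𝐃 × K / K, Ω_𝐃 ⊗ K)`. -/
abbrev ConnDK := ((completedCalculus p R A).generic K).Conn

/-- `Diff(𝐃 × K, Der(𝐃/𝐒) ⊗ K)`. -/
abbrev DiffDK := (DiffRing.derGeneric K R (PCompletion p A)).Diff

theorem generic_compat (B : Type u) [CommRing B] [Algebra R B] (r : R) :
    algebraMap B (K ⊗[R] B) (algebraMap R B r) = algebraMap K (K ⊗[R] B) (algebraMap R K r) := by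
  rw [Algebra.TensorProduct.right_algebraMap_apply, Algebra.TensorProduct.algebraMap_apply,
    Algebra.algebraMap_eq_smul_one, Algebra.algebraMap_eq_smul_one, TensorProduct.tmul_smul,
    TensorProduct.smul_tmul', algebraMap_smul]

instance : ScalarExt.IsLinearAlong R K ((completedCalculus p R A).genericHom K).pullbackFunctor :=
  transport_isLinearAlong _ (generic_compat R K _)

instance : ScalarExt.IsLinearAlong R K (DiffRing.genericTransport K R (PCompletion p A)).functor :=
  transport_isLinearAlong _ (generic_compat R K _)

/-- The inclusion `QNCf(𝐗/𝐒, Ω_𝐃) ⊗ K ⥤ Conn(𝐃/𝐒, Ω_𝐃) ⊗ K`. -/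
abbrev inclusionFunctor [Fact p.Prime] : ScalarExt R K (QNC p R A) ⥤ ScalarExt R K (ConnD p R A) :=
  ScalarExt.lift R K ((topQuasiNilpotent p R A).ι ⋙ ScalarExt.ι R K _)

/-- The base change functor `Conn(𝐃/𝐒, Ω_𝐃) ⊗ K ⥤ Conn(𝐃 × K / K, Ω_𝐃 ⊗ K)`. -/
abbrev connBaseChange : ScalarExt R K (ConnD p R A) ⥤ ConnDK p R A K :=
  ScalarExt.lift R K ((completedCalculus p R A).genericHom K).pullbackFunctor

/-- The base change functor `Diff(𝐃, Der(𝐃/𝐒)) ⊗ K ⥤ Diff(𝐃 × K, Der(𝐃/𝐒) ⊗ K)`. -/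
abbrev diffBaseChange : ScalarExt R K (DiffD p R A) ⥤ DiffDK p R A K :=
  ScalarExt.lift R K (DiffRing.genericTransport K R (PCompletion p A)).functor

/-- The functor `Conn(𝐃/𝐒, Ω_𝐃) ⊗ K ⥤ Diff(𝐃, Der(𝐃/𝐒)) ⊗ K`. -/
abbrev connToDiff : ScalarExt R K (ConnD p R A) ⥤ ScalarExt R K (DiffD p R A) :=
  ScalarExt.lift R K ((completedPairing p R A).toDiff ⋙ ScalarExt.ι R K _)

/-- The functor `Conn(𝐃 × K / K, Ω_𝐃 ⊗ K) ⥤ Diff(𝐃 × K, Der(𝐃/𝐒) ⊗ K)`. -/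
abbrev connToDiffK : ConnDK p R A K ⥤ DiffDK p R A K :=
  ((completedPairing p R A).generic K).toDiff


end Functors

end

/-!
Write `Â` for the `p`-adic completion of `A` and `S = K ⊗ Â`. The theorem is reduced to a single
statement about vector fields: the differential ring formed by `S` and the derivations
`K ⊗ Der(Â)` is *simple*, that is, `0` and `S` are its only ideals stable under derivations
(`isSimple_derGeneric_pCompletion`).

**From connections to differential modules.** As `A` is smooth, the one-forms of `Â` form a finite
projective module, so that vector fields and one-forms have dual families. An integrable connection
is therefore the same as an action of the vector fields
(`Calculus.Pairing.DualFamilies.isEquivalence_toDiff`), over `Â` as well as over `S`. The two base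
changes have the same underlying module and the same action, which gives the monoidal isomorphism
`squareIso`.

**Simple differential rings.** Over a simple noetherian differential ring of characteristic zero the
finite differential modules form a Tannakian category (`DiffRing.IsSimple.isTannakian`). The ring is
a domain because minimal primes are stable. A finite differential module `M` is projective because
the `a` for which `a • id` factors through a finite free module form a stable ideal, which is nonzero
as `M` is generically free. So short exact sequences split linearly and base change to the residue
field of any maximal ideal is exact; it is faithful because the annihilator of `M` is a stable ideal.
An endomorphism of the unit has a stable kernel and a stable image, so it is zero or invertible.

**Simplicity of `S`.** Let `J` be a stable ideal contained in a maximal ideal `m`. The closed point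
`m` extends to a finite flat multisection: `Â / (m ∩ Â)` is finite over `R`, by a dimension count in
its reduction modulo a uniformizer and by Nakayama's lemma over the complete ring `R`
(`Module.Finite.quotient_comap_includeRight`). Hence `S / m` is finite over `K`, and elements of `A`
represent all elements of `Â` modulo `m²`. As `S / m` is separable over `K`, it lifts to a subfield
of `S / m²`, and the projection of `S / m²` to `m / m²` along it is a derivation of `S`. It comes from
a vector field vanishing at `m` (`exists_euler`): an Euler vector field, which acts on `mⁿ / mⁿ⁺¹` as
multiplication by `n`. Stability gives `J ≤ mⁿ ⇒ J ≤ mⁿ⁺¹` for `n ≥ 1`, so `J` lies in all powers of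
`m`, and Krull's intersection theorem gives `J = J²`. So `J` is generated by an idempotent. The
idempotents of `S` are integral, since a smooth algebra over `R` is integrally closed in its generic
fibre, and they lift idempotents of the connected ring `A / I A`; so they are `0` and `1`
(`eq_zero_or_one_of_isIdempotentElem_generic`).

**The categories `𝒞 ⊗ K`.** The base change of differential modules from `Â` to `S` is fully faithful
up to denominators in `R` (`DiffRing.isAlmostFullyFaithful_genericFibre`), because `Â` is noetherian.
A full tensor subcategory of a Tannakian category is Tannakian when it is closed under kernels,
cokernels, products and duals (`IsTannakian.of_fullyFaithful`). For all connections over `Â` these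
conditions are immediate. For the topologically quasi-nilpotent ones
(`isAlmostRigidAbelian_topQuasiNilpotent`), quotients inherit the condition; so do submodules which
are saturated with respect to `p`, as they stay injective modulo `pⁿ`. After multiplying a morphism
by a scalar that kills the torsion of its target its kernel is saturated. Evaluation at generators
embeds a dual as a saturated submodule of a free module, and the Leibniz rule for the pairing then
bounds the order of nilpotency.
-/

noncomputable section

/-! ### The abelian category of differential modules -/

namespace DiffRing
variable {B A : Type u} [CommRing B] [CommRing A] [Algebra B A] {𝒟 : DiffRing B A}

namespace DiffMod
variable {M N : Type u} [AddCommGroup M] [Module A M] [AddCommGroup N] [Module A N]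

/-- Constructor for differential modules from an unbundled action. -/
def ofFun (f : 𝒟.Δ → M → M) (map_add : ∀ x m n, f x (m + n) = f x m + f x n)
    (add_map : ∀ x y m, f (x + y) m = f x m + f y m)
    (smul_map : ∀ (a : A) x m, f (a • x) m = a • f x m)
    (map_lie : ∀ x y m, f ⁅x, y⁆ m = f x (f y m) - f y (f x m))
    (leibniz : ∀ x (a : A) m, f x (a • m) = 𝒟.ι x a • m + a • f x m) : 𝒟.DiffMod M where
  act :=
    { toFun := fun x => AddMonoidHom.mk' (f x) (map_add x)
      map_add' := fun x y => AddMonoidHom.ext (add_map x y)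
      map_smul' := fun a x => AddMonoidHom.ext (smul_map a x) }
  act_lie := map_lie
  leibniz := leibniz

variable (s : 𝒟.DiffMod M)

theorem act_add (x y : 𝒟.Δ) (m : M) : s.act (x + y) m = s.act x m + s.act y m := by
  rw [map_add]; rfl

theorem act_smul (a : A) (x : 𝒟.Δ) (m : M) : s.act (a • x) m = a • s.act x m := by
  rw [map_smul]; rfl

/-- The induced structure on a stable submodule. -/
def sub (P : Submodule A M) (h : ∀ x, ∀ m ∈ P, s.act x m ∈ P) : 𝒟.DiffMod P :=
  ofFun (fun x m => ⟨s.act x m, h x m m.2⟩) (fun x m n => Subtype.ext (map_add (s.act x) _ _))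
    (fun x y m => Subtype.ext (s.act_add x y m)) (fun a x m => Subtype.ext (s.act_smul a x m))
    (fun x y m => Subtype.ext (s.act_lie x y m)) (fun x a m => Subtype.ext (s.leibniz x a m))

/-- The induced structure on the quotient by a stable submodule. -/
def quot (P : Submodule A M) (h : ∀ x, ∀ m ∈ P, s.act x m ∈ P) : 𝒟.DiffMod (M ⧸ P) :=
  ofFun (fun x => QuotientAddGroup.map P.toAddSubgroup P.toAddSubgroup (s.act x) (h x))
    (fun x m n => map_add _ _ _)
    (fun x y m => by
      induction m using Submodule.Quotient.induction_on with
      | _ m => exact congrArg (Submodule.Quotient.mk (p := P)) (s.act_add x y m))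
    (fun a x m => by
      induction m using Submodule.Quotient.induction_on with
      | _ m => exact congrArg (Submodule.Quotient.mk (p := P)) (s.act_smul a x m))
    (fun x y m => by
      induction m using Submodule.Quotient.induction_on with
      | _ m => exact congrArg (Submodule.Quotient.mk (p := P)) (s.act_lie x y m))
    (fun x a m => by
      induction m using Submodule.Quotient.induction_on with
      | _ m => exact congrArg (Submodule.Quotient.mk (p := P)) (s.leibniz x a m))

/-- The componentwise structure on a product. -/
def prod (t : 𝒟.DiffMod N) : 𝒟.DiffMod (M × N) :=
  ofFun (fun x m => (s.act x m.1, t.act x m.2))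
    (fun x m n => Prod.ext (map_add (s.act x) _ _) (map_add (t.act x) _ _))
    (fun x y m => Prod.ext (s.act_add x y _) (t.act_add x y _))
    (fun a x m => Prod.ext (s.act_smul a x _) (t.act_smul a x _))
    (fun x y m => Prod.ext (s.act_lie x y _) (t.act_lie x y _))
    (fun x a m => Prod.ext (s.leibniz x a _) (t.leibniz x a _))

/-- The dual action `(x f) m = x (f m) - f (x m)` on linear forms. -/
def dual : 𝒟.DiffMod (M →ₗ[A] A) :=
  ofFun
    (fun x f =>
      { toFun := fun m => 𝒟.ι x (f m) - f (s.act x m)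
        map_add' := fun m n => by simp only [map_add]; abel
        map_smul' := fun a m => by
          simp only [s.leibniz, map_add, map_smul, smul_eq_mul, Derivation.leibniz,
            RingHom.id_apply]
          ring })
    (fun x f g => by
      ext m
      simp only [LinearMap.coe_mk, AddHom.coe_mk, LinearMap.add_apply, map_add]
      abel)
    (fun x y f => by
      ext m
      simp only [LinearMap.coe_mk, AddHom.coe_mk, LinearMap.add_apply, map_add,
        Derivation.add_apply, AddMonoidHom.add_apply]
      abel)
    (fun a x f => by
      ext m
      simp only [LinearMap.coe_mk, AddHom.coe_mk, LinearMap.smul_apply, map_smul,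
        Derivation.smul_apply, smul_sub]
      rw [← map_smul f a]; rfl)
    (fun x y f => by
      ext m
      simp only [LinearMap.coe_mk, AddHom.coe_mk, LinearMap.sub_apply, map_sub, 𝒟.ι_lie_apply,
        s.act_lie]
      abel)
    (fun x a f => by
      ext m
      simp only [LinearMap.coe_mk, AddHom.coe_mk, LinearMap.smul_apply, LinearMap.add_apply,
        smul_eq_mul, Derivation.leibniz]
      ring)

end DiffMod

section Objects

variable (𝒟) in
/-- A differential module as an object of the category of differential modules. -/
abbrev mkObj (M : Type u) [AddCommGroup M] [Module A M] [Module.FinitePresentation A M]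
    (s : 𝒟.DiffMod M) : 𝒟.Diff := ⟨ModuleCat.of A M, ⟨s, ‹_›⟩⟩

instance (X : 𝒟.Diff) : Module.FinitePresentation A X.module := X.str.finitePresentation

/-- The differential module underlying an object. -/
abbrev _root_.ModuleTheory.Obj.diffMod (X : 𝒟.Diff) : 𝒟.DiffMod X.module := X.str.toDiffMod

/-- A morphism of differential modules from an equivariant linear map. -/
abbrev homMk {X Y : 𝒟.Diff} (f : X.module →ₗ[A] Y.module)
    (h : X.diffMod.Equivariant Y.diffMod f) : X ⟶ Y :=
  ModuleTheory.mkHom (ModuleCat.ofHom f) h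

/-- The linear map underlying a morphism of differential modules. -/
abbrev linMap {X Y : 𝒟.Diff} (f : X ⟶ Y) : X.module →ₗ[A] Y.module := f.1.hom

theorem hom_ext {X Y : 𝒟.Diff} {f g : X ⟶ Y} (h : ∀ m, linMap f m = linMap g m) : f = g :=
  Subtype.ext (ModuleCat.hom_ext (LinearMap.ext h))

theorem linMap_act {X Y : 𝒟.Diff} (f : X ⟶ Y) (x : 𝒟.Δ) (m : X.module) :
    linMap f (X.diffMod.act x m) = Y.diffMod.act x (linMap f m) := f.2 x m

theorem linMap_comp {X Y Z : 𝒟.Diff} (f : X ⟶ Y) (g : Y ⟶ Z) (m : X.module) :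
    linMap (f ≫ g) m = linMap g (linMap f m) := rfl

/-- An isomorphism of differential modules from a bijective morphism. -/
theorem isIso_of_bijective {X Y : 𝒟.Diff} (f : X ⟶ Y) (hf : Function.Bijective (linMap f)) :
    IsIso f :=
  (ModuleTheory.mkIso (LinearEquiv.ofBijective (linMap f) hf).toModuleIso f.2).isIso_hom

open Limits

/-- A morphism of differential modules is a kernel if it is one on underlying modules. -/
theorem isLimit_of_exact {X Y Z : 𝒟.Diff} (i : Z ⟶ X) (f : X ⟶ Y) (w : i ≫ f = 0)
    (hi : Function.Injective (linMap i)) (h : ∀ m, linMap f m = 0 → ∃ z, linMap i z = m) :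
    Nonempty (IsLimit (KernelFork.ofι i w)) := by
  haveI : Mono i := ⟨fun g h e => hom_ext fun m => hi (by rw [← linMap_comp, e]; rfl)⟩
  refine ⟨KernelFork.IsLimit.ofι' i w fun {W} k hk => ?_⟩
  have hk' : ∀ m, ∃ z, linMap i z = linMap k m := fun m => h _ (by
    rw [← linMap_comp, hk]; rfl)
  choose l hl using hk'
  refine ⟨homMk ⟨⟨l, fun m n => hi (by simp only [map_add, hl])⟩,
    fun a m => hi (by simp only [map_smul, hl, RingHom.id_apply])⟩ (fun x m => hi ?_), ?_⟩
  · change linMap i (l (W.diffMod.act x m)) = linMap i (Z.diffMod.act x (l m))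
    rw [hl, linMap_act, linMap_act, hl]
  · exact hom_ext hl

/-- A morphism of differential modules is a cokernel if it is one on underlying modules. -/
theorem isColimit_of_exact {X Y Z : 𝒟.Diff} (f : X ⟶ Y) (q : Y ⟶ Z) (w : f ≫ q = 0)
    (hq : Function.Surjective (linMap q)) (h : ∀ m, linMap q m = 0 → ∃ z, linMap f z = m) :
    Nonempty (IsColimit (CokernelCofork.ofπ q w)) := by
  haveI : Epi q := ⟨fun g h e => hom_ext fun m => by
    obtain ⟨n, rfl⟩ := hq m
    rw [← linMap_comp, e]; rfl⟩
  refine ⟨CokernelCofork.IsColimit.ofπ' q w fun {W} k hk => ?_⟩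
  have hk' : ∀ m, linMap q m = 0 → linMap k m = 0 := fun m hm => by
    obtain ⟨z, rfl⟩ := h m hm
    rw [← linMap_comp, hk]; rfl
  have hk2 : ∀ m n, linMap q m = linMap q n → linMap k m = linMap k n := fun m n e => by
    rw [← sub_eq_zero, ← map_sub]
    exact hk' _ (by rw [map_sub, e, sub_self])
  choose r hr using hq
  have hr' : ∀ m, linMap k (r (linMap q m)) = linMap k m := fun m => hk2 _ _ (hr _)
  refine ⟨homMk ⟨⟨fun z => linMap k (r z), fun m n => ?_⟩, fun a m => ?_⟩ (fun x m => ?_), ?_⟩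
  · rw [← map_add]; exact hk2 _ _ (by simp only [map_add, hr])
  · rw [RingHom.id_apply, ← map_smul]; exact hk2 _ _ (by simp only [map_smul, hr])
  · change linMap k (r (Z.diffMod.act x m)) = W.diffMod.act x (linMap k (r m))
    rw [← linMap_act]; exact hk2 _ _ (by rw [linMap_act, hr, hr])
  · exact hom_ext hr'

section Noetherian
variable [IsNoetherianRing A] {X Y : 𝒟.Diff} (f : X ⟶ Y)

/-- The kernel of a morphism of differential modules. -/
def kerObj : 𝒟.Diff :=
  haveI := Module.finitePresentation_of_finite A (linMap f).ker
  mkObj 𝒟 (linMap f).ker (X.diffMod.sub _ fun x m hm => by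
    rw [LinearMap.mem_ker] at hm ⊢
    rw [linMap_act, hm, map_zero])

/-- The inclusion of the kernel. -/
def kerι : kerObj f ⟶ X := homMk (linMap f).ker.subtype (fun _ _ => rfl)

theorem kerι_comp : kerι f ≫ f = 0 := hom_ext fun m => m.2

theorem kerι_injective : Function.Injective (linMap (kerι f)) := Subtype.val_injective

theorem exists_kerι {m : X.module} (hm : linMap f m = 0) : ∃ z, linMap (kerι f) z = m :=
  ⟨⟨m, hm⟩, rfl⟩

/-- The cokernel of a morphism of differential modules. -/
def cokerObj : 𝒟.Diff :=
  haveI := Module.finitePresentation_of_finite A (Y.module ⧸ (linMap f).range)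
  mkObj 𝒟 (Y.module ⧸ (linMap f).range) (Y.diffMod.quot _ fun x m hm => by
    obtain ⟨n, rfl⟩ := hm
    exact ⟨X.diffMod.act x n, linMap_act f x n⟩)

/-- The projection to the cokernel. -/
def cokerπ : Y ⟶ cokerObj f := homMk (linMap f).range.mkQ (fun _ _ => rfl)

theorem comp_cokerπ : f ≫ cokerπ f = 0 := hom_ext fun m =>
  (Submodule.Quotient.mk_eq_zero _).mpr ⟨m, rfl⟩

theorem cokerπ_surjective : Function.Surjective (linMap (cokerπ f)) :=
  Submodule.Quotient.mk_surjective _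

theorem exists_of_cokerπ {m : Y.module} (hm : linMap (cokerπ f) m = 0) : ∃ z, linMap f z = m :=
  (Submodule.Quotient.mk_eq_zero _).mp hm

end Noetherian

variable (𝒟) in
/-- The zero differential module. -/
def zeroObj : 𝒟.Diff :=
  mkObj 𝒟 PUnit.{u + 1} (DiffMod.ofFun (fun _ m => m) (fun _ _ _ => rfl) (fun _ _ _ => rfl)
    (fun _ _ _ => rfl) (fun _ _ _ => rfl) (fun _ _ _ => rfl))

/-- The product of differential modules. -/
def prodObj (X Y : 𝒟.Diff) : 𝒟.Diff := mkObj 𝒟 (X.module × Y.module) (X.diffMod.prod Y.diffMod)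

/-- The product of differential modules is their biproduct. -/
def prodBicone (X Y : 𝒟.Diff) : BinaryBicone X Y where
  pt := prodObj X Y
  fst := homMk (LinearMap.fst A X.module Y.module) (fun _ _ => rfl)
  snd := homMk (LinearMap.snd A X.module Y.module) (fun _ _ => rfl)
  inl := homMk (LinearMap.inl A X.module Y.module) (fun x m =>
    Prod.ext rfl (map_zero (Y.diffMod.act x)).symm)
  inr := homMk (LinearMap.inr A X.module Y.module) (fun x m =>
    Prod.ext (map_zero (X.diffMod.act x)).symm rfl)

/-- The dual of a differential module over a noetherian ring. -/
def dualObj [IsNoetherianRing A] (X : 𝒟.Diff) : 𝒟.Diff :=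
  haveI := Module.finitePresentation_of_finite A (X.module →ₗ[A] A)
  mkObj 𝒟 (X.module →ₗ[A] A) X.diffMod.dual

/-- The evaluation pairing of the dual. -/
def dualEval [IsNoetherianRing A] (X : 𝒟.Diff) : dualObj X ⊗ X ⟶ 𝟙_ 𝒟.Diff :=
  homMk (X := dualObj X ⊗ X) (Y := 𝟙_ 𝒟.Diff)
    (TensorProduct.lift (LinearMap.id : (X.module →ₗ[A] A) →ₗ[A] _))
    (DiffMod.equivariant_tensor_ext (s := X.diffMod.dual) (t := X.diffMod) (r := DiffMod.unit 𝒟)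
      _ fun x f m => sub_add_cancel (𝒟.ι x (f m)) (f (X.diffMod.act x m)))

instance : HasZeroObject 𝒟.Diff where
  zero := ⟨zeroObj 𝒟,
    { unique_to := fun Y => ⟨⟨⟨0⟩, fun f => hom_ext fun m => map_zero (linMap f)⟩⟩
      unique_from := fun Y => ⟨⟨⟨0⟩, fun f => hom_ext fun m => rfl⟩⟩ }⟩

instance : HasBinaryBiproducts 𝒟.Diff where
  has_binary_biproduct X Y := .mk
    ⟨prodBicone X Y, isBinaryBilimitOfTotal _ (hom_ext fun m =>
      Prod.ext (add_zero m.1) (zero_add m.2))⟩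

instance : HasFiniteProducts 𝒟.Diff :=
  haveI : HasTerminal 𝒟.Diff := HasZeroObject.hasTerminal
  haveI : HasBinaryProducts 𝒟.Diff := inferInstance
  hasFiniteProducts_of_has_binary_and_terminal

instance [IsNoetherianRing A] : HasKernels 𝒟.Diff where
  has_limit f := ⟨⟨⟨_, (isLimit_of_exact (kerι f) f (kerι_comp f) (kerι_injective f)
    fun _ => exists_kerι f).some⟩⟩⟩

instance [IsNoetherianRing A] : HasCokernels 𝒟.Diff where
  has_colimit f := ⟨⟨⟨_, (isColimit_of_exact f (cokerπ f) (comp_cokerπ f) (cokerπ_surjective f)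
    fun _ => exists_of_cokerπ f).some⟩⟩⟩

theorem injective_of_mono [IsNoetherianRing A] {X Y : 𝒟.Diff} (f : X ⟶ Y) [Mono f] :
    Function.Injective (linMap f) := by
  rw [injective_iff_map_eq_zero]
  intro m hm
  obtain ⟨z, rfl⟩ := exists_kerι f hm
  rw [zero_of_comp_mono f (kerι_comp f)]; rfl

theorem surjective_of_epi [IsNoetherianRing A] {X Y : 𝒟.Diff} (f : X ⟶ Y) [Epi f] :
    Function.Surjective (linMap f) := fun m =>
  exists_of_cokerπ f (by rw [zero_of_epi_comp f (comp_cokerπ f)]; rfl)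

instance instAbelian [IsNoetherianRing A] : Abelian 𝒟.Diff where
  normalMonoOfMono f _ := ⟨{
    Z := cokerObj f
    g := cokerπ f
    w := comp_cokerπ f
    isLimit := (isLimit_of_exact f (cokerπ f) (comp_cokerπ f) (injective_of_mono f)
      fun _ => exists_of_cokerπ f).some }⟩
  normalEpiOfEpi f _ := ⟨{
    W := kerObj f
    g := kerι f
    w := kerι_comp f
    isColimit := (isColimit_of_exact (kerι f) f (kerι_comp f) (surjective_of_epi f)
      fun _ => exists_kerι f).some }⟩

end Objects
end DiffRing

/-! ### Simple differential rings -/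

/-- In characteristic zero a derivation preserves nilpotent elements. -/
theorem Derivation.isNilpotent_apply {B A : Type*} [CommRing B] [CommRing A] [Algebra B A]
    (hA : ∀ n : ℕ, n ≠ 0 → IsUnit (n : A)) (D : Derivation B A A) {x : A} (hx : IsNilpotent x) :
    IsNilpotent (D x) := by
  have key : ∀ m e, x ^ (m + 1) * D x ^ e = 0 → x ^ m * D x ^ (e + 2) = 0 := by
    intro m e h
    -- apply `D` to the hypothesis, multiply by `D x`, and discard the multiples of the hypothesis
    have h1 := congrArg (fun a => D a * D x) h
    simp only [Derivation.leibniz, Derivation.leibniz_pow, map_zero, zero_mul, smul_eq_mul,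
      Nat.add_sub_cancel, nsmul_eq_mul] at h1
    have h2 : (e : A) * D x ^ (e - 1) * D x = e * D x ^ e := by
      cases e with
      | zero => simp
      | succ e => rw [Nat.add_sub_cancel, mul_assoc, pow_succ]
    have h3 : ((m + 1 : ℕ) : A) * (x ^ m * D x ^ (e + 2)) = 0 := by
      linear_combination h1 - x ^ (m + 1) * D (D x) * h2 - (e : A) * D (D x) * h
    exact (hA (m + 1) (Nat.succ_ne_zero m)).mul_right_eq_zero.mp h3
  -- each step lowers the exponent of `x`
  have : ∀ n e, x ^ n * D x ^ e = 0 → IsNilpotent (D x) := by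
    intro n
    induction n with
    | zero => exact fun e h => ⟨e, by simpa using h⟩
    | succ n ih => exact fun e h => ih _ (key n e h)
  obtain ⟨n, hn⟩ := hx
  exact this n 0 (by rw [hn, zero_mul])

/-- An element of a minimal prime is nilpotent locally at that prime. -/
theorem exists_isNilpotent_mul_of_mem_minimalPrimes {A : Type*} [CommRing A] {q : Ideal A}
    (hq : q ∈ (nilradical A).minimalPrimes) {x : A} (hx : x ∈ q) :
    ∃ y ∉ q, IsNilpotent (x * y) := by
  have := hq.1.1
  by_contra! h
  -- otherwise some prime ideal avoids `x` and the complement of `q`, contrary to minimality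
  let S : Submonoid A := q.primeCompl ⊔ Submonoid.powers x
  obtain ⟨q', hq', -, hd⟩ := Ideal.exists_le_prime_disjoint (⊥ : Ideal A) S (by
    refine Set.disjoint_left.mpr fun a ha ha' => ?_
    rw [SetLike.mem_coe, Submodule.mem_bot] at ha
    subst ha
    obtain ⟨y, hy, -, ⟨n, rfl⟩, h0⟩ := Submonoid.mem_sup.mp ha'
    refine h y hy ⟨n + 1, ?_⟩
    rw [mul_pow, pow_succ y, pow_succ x]
    linear_combination x * y ^ n * h0)
  have hle : q' ≤ q := fun a ha => by
    by_contra hn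
    exact Set.disjoint_left.mp hd ha (Submonoid.mem_sup_left (S := q.primeCompl) hn)
  have := hq.2 ⟨hq', fun a (ha : a ∈ nilradical A) =>
    nilpotent_iff_mem_prime.mp ha _ ‹_›⟩ hle hx
  exact Set.disjoint_left.mp hd this
    (Submonoid.mem_sup_right (T := Submonoid.powers x) (Submonoid.mem_powers x))

/-- Finite modules over domains are generically free: a nonzero multiple of the identity factors
through the span of a maximal linearly independent family. -/
theorem exists_smul_id_mem_range_dualTensorHom {A M : Type*} [CommRing A] [IsDomain A]
    [AddCommGroup M] [Module A M] [Module.Finite A M] :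
    ∃ a : A, a ≠ 0 ∧ a • LinearMap.id ∈ LinearMap.range (dualTensorHom A M M) := by
  classical
  obtain ⟨f, hf⟩ := exists_linearIndependent_of_le_finrank (R := A) (M := M) le_rfl
  have h1 : ∀ m : M, ∃ a : A, a ≠ 0 ∧ a • m ∈ Submodule.span A (Set.range f) := by
    intro m
    have hn : ¬ LinearIndependent A (Fin.cons m f : Fin (Module.finrank A M + 1) → M) := fun h => by
      have := h.fintype_card_le_finrank
      simp at this
    obtain ⟨c, hc, i, hi⟩ := Fintype.not_linearIndependent_iff.mp hn
    rw [Fin.sum_univ_succ] at hc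
    simp only [Fin.cons_zero, Fin.cons_succ] at hc
    refine ⟨c 0, fun h0 => hi ?_, ?_⟩
    · rw [h0, zero_smul, zero_add] at hc
      have := Fintype.linearIndependent_iff.mp hf _ hc
      exact Fin.cases h0 this i
    · rw [eq_neg_of_add_eq_zero_left hc]
      exact neg_mem (sum_mem fun i _ => Submodule.smul_mem _ _ (Submodule.subset_span ⟨i, rfl⟩))
  obtain ⟨T, hT⟩ := Module.Finite.fg_top (R := A) (M := M)
  choose c hc0 hc using h1
  let a := ∏ m ∈ T, c m
  have ha : ∀ m : M, a • m ∈ Submodule.span A (Set.range f) := by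
    intro m
    have hm : m ∈ Submodule.span A (T : Set M) := by rw [hT]; trivial
    induction hm using Submodule.span_induction with
    | mem x hx =>
      obtain ⟨b, hb⟩ := Finset.dvd_prod_of_mem c hx
      change (∏ m ∈ T, c m) • x ∈ _
      rw [hb, mul_comm, mul_smul]
      exact Submodule.smul_mem _ _ (hc x)
    | zero => rw [smul_zero]; exact zero_mem _
    | add x y _ _ hx hy => rw [smul_add]; exact add_mem hx hy
    | smul b x _ hx => rw [smul_comm]; exact Submodule.smul_mem _ _ hx
  refine ⟨a, Finset.prod_ne_zero_iff.mpr fun m _ => hc0 m, ?_⟩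
  let b := Module.Basis.span hf
  let φ : M →ₗ[A] Submodule.span A (Set.range f) := (a • LinearMap.id).codRestrict _ ha
  refine ⟨∑ i, (b.coord i ∘ₗ φ) ⊗ₜ[A] (b i : M), ?_⟩
  ext m
  have h := congrArg (Submodule.subtype _) (b.sum_repr (φ m))
  rw [map_sum] at h
  rw [map_sum, LinearMap.sum_apply]
  refine Eq.trans ?_ h
  exact Finset.sum_congr rfl fun i _ => rfl

namespace DiffRing
variable {B A : Type u} [CommRing B] [CommRing A] [Algebra B A] {𝒟 : DiffRing B A}

variable (𝒟) in
/-- An ideal is stable under the derivations. -/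
def IsStable (J : Ideal A) : Prop := ∀ x, ∀ a ∈ J, 𝒟.ι x a ∈ J

variable (𝒟) in
/-- A differential ring is simple if it has exactly two stable ideals. -/
structure IsSimple : Prop where
  nontrivial : Nontrivial A
  eq_bot_or_eq_top : ∀ J : Ideal A, 𝒟.IsStable J → J = ⊥ ∨ J = ⊤

namespace IsSimple
variable (h𝒟 : 𝒟.IsSimple)
include h𝒟

/-- A simple differential ring of characteristic zero is a domain, as its minimal primes are
stable. -/
theorem isDomain (hA : ∀ n : ℕ, n ≠ 0 → IsUnit (n : A)) : IsDomain A := by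
  have := h𝒟.nontrivial
  obtain ⟨q, hq⟩ := (nilradical A).nonempty_minimalPrimes (by
    intro h
    have h1 : (1 : A) ∈ nilradical A := by rw [h]; trivial
    obtain ⟨n, hn⟩ := mem_nilradical.mp h1
    exact one_ne_zero ((one_pow n).symm.trans hn))
  have hqp : q.IsPrime := hq.1.1
  have hst : 𝒟.IsStable q := by
    intro x a ha
    obtain ⟨y, hy, hn⟩ := exists_isNilpotent_mul_of_mem_minimalPrimes hq ha
    have h1 := nilpotent_iff_mem_prime.mp ((𝒟.ι x).isNilpotent_apply hA hn) q hqp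
    rw [Derivation.leibniz, smul_eq_mul, smul_eq_mul] at h1
    have h2 := (Ideal.add_mem_iff_right q (q.mul_mem_right _ ha)).mp h1
    exact (hqp.mem_or_mem h2).resolve_left hy
  have hbot := (h𝒟.eq_bot_or_eq_top q hst).resolve_right hqp.ne_top
  rw [hbot] at hqp
  have : NoZeroDivisors A := ⟨fun {a b} hab => by
    have := hqp.mem_or_mem (show a * b ∈ (⊥ : Ideal A) from hab)
    simpa using this⟩
  exact {}

/-- Finite modules with a compatible action of the derivations are projective. -/
theorem projective (hA : ∀ n : ℕ, n ≠ 0 → IsUnit (n : A)) {M : Type u} [AddCommGroup M]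
    [Module A M] [Module.Finite A M] (s : 𝒟.DiffMod M) : Module.Projective A M := by
  have := h𝒟.isDomain hA
  -- the scalars `a` for which `a • id` is of finite rank
  let J : Ideal A := (LinearMap.range (dualTensorHom A M M)).comap
    (LinearMap.toSpanSingleton A (M →ₗ[A] M) LinearMap.id)
  have hJ : ∀ a, a ∈ J ↔ a • LinearMap.id ∈ LinearMap.range (dualTensorHom A M M) :=
    fun a => Iff.rfl
  -- the action on `M* ⊗ M` corresponds to the commutator on endomorphisms of finite rank
  have key : ∀ x z m, dualTensorHom A M M ((s.dual.tensor s).act x z) m =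
      s.act x (dualTensorHom A M M z m) - dualTensorHom A M M z (s.act x m) := by
    intro x z m
    induction z using TensorProduct.induction_on with
    | zero => simp
    | add z z' h h' => simp only [map_add, LinearMap.add_apply, h, h']; abel
    | tmul f n =>
      rw [DiffMod.tensor_act, map_add, LinearMap.add_apply, dualTensorHom_apply,
        dualTensorHom_apply, dualTensorHom_apply, dualTensorHom_apply, s.leibniz]
      change (𝒟.ι x (f m) - f (s.act x m)) • n + _ = _
      rw [sub_smul]; abel
  have hst : 𝒟.IsStable J := by
    intro x a ha
    rw [hJ] at ha ⊢
    obtain ⟨z, hz⟩ := ha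
    refine ⟨(s.dual.tensor s).act x z, ?_⟩
    ext m
    rw [key, hz]
    simp [s.leibniz]
  -- `J` is nonzero, hence contains `1`, and `M` is projective since its identity is of finite rank
  obtain ⟨a, ha0, ha⟩ := exists_smul_id_mem_range_dualTensorHom (A := A) (M := M)
  refine Module.Projective.of_one_mem_range_dualTensorHom ?_
  rcases h𝒟.eq_bot_or_eq_top J hst with h | h
  · exact absurd (show a ∈ J from ha) (by rw [h]; exact ha0)
  · have h1 : (1 : A) ∈ J := by rw [h]; trivial
    rwa [hJ, one_smul] at h1

/-- Nakayama's lemma for differential modules: they vanish if one of their fibres does. -/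
theorem subsingleton_of_eq_smul {M : Type u} [AddCommGroup M] [Module A M] [Module.Finite A M]
    (s : 𝒟.DiffMod M) (m : Ideal A) [hm : m.IsMaximal] (h : m • (⊤ : Submodule A M) = ⊤) :
    Subsingleton M := by
  obtain ⟨r, hr, hr0⟩ := Submodule.exists_sub_one_mem_and_smul_eq_zero_of_fg_of_le_smul m
    (⊤ : Submodule A M) Module.Finite.fg_top h.ge
  have hst : 𝒟.IsStable (Module.annihilator A M) := by
    intro x a ha
    rw [Module.mem_annihilator] at ha ⊢
    intro n
    have := s.leibniz x a n
    rwa [ha, ha, map_zero, add_zero, eq_comm] at this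
  rcases h𝒟.eq_bot_or_eq_top _ hst with h | h
  · have : r ∈ Module.annihilator A M := Module.mem_annihilator.mpr fun n => hr0 n trivial
    rw [h, Submodule.mem_bot] at this
    rw [this, zero_sub, neg_mem_iff] at hr
    exact absurd ((Ideal.eq_top_iff_one m).mpr hr) hm.ne_top
  · exact Module.annihilator_eq_top_iff.mp h

end IsSimple
end DiffRing

/-! ### Duals of differential modules -/

namespace DiffRing
variable {B A : Type u} [CommRing B] [CommRing A] [Algebra B A] {𝒟 : DiffRing B A}

section Duality
variable {X Y : 𝒟.Diff} (ev : Y ⊗ X ⟶ 𝟙_ 𝒟.Diff)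

/-- The linear map from `Y` to the dual of `X` defined by a pairing. -/
def pairingMap : Y.module →ₗ[A] X.module →ₗ[A] A := TensorProduct.curry (linMap ev)

theorem pairingMap_act (x : 𝒟.Δ) (y : Y.module) (m : X.module) :
    𝒟.ι x (pairingMap ev y m) =
      pairingMap ev (Y.diffMod.act x y) m + pairingMap ev y (X.diffMod.act x m) := by
  have h := linMap_act ev x (y ⊗ₜ[A] m)
  refine h.symm.trans ?_
  change linMap ev (Y.diffMod.act x y ⊗ₜ[A] m + y ⊗ₜ[A] X.diffMod.act x m) = _
  rw [map_add]; rfl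

/-- A perfect pairing of differential modules makes them dual to each other: the coevaluation is
horizontal since the identity of `X` is equivariant. -/
theorem nonempty_exactPairing [Module.Projective A X.module]
    (h : Function.Bijective (pairingMap ev)) : Nonempty (ExactPairing X Y) := by
  let Φ : Y.module ⊗[A] X.module →ₗ[A] X.module →ₗ[A] X.module :=
    dualTensorHom A X.module X.module ∘ₗ (pairingMap ev).rTensor X.module
  have hΦ : Function.Bijective Φ := by
    refine (dualTensorHom_bijective (R := A) (M := X.module) (N := X.module)).comp ?_
    exact (LinearEquiv.rTensor X.module (LinearEquiv.ofBijective _ h)).bijective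
  have hact : ∀ x z m, Φ ((Y.diffMod.tensor X.diffMod).act x z) m =
      X.diffMod.act x (Φ z m) - Φ z (X.diffMod.act x m) := by
    intro x z m
    induction z using TensorProduct.induction_on with
    | zero => simp
    | add z z' h h' => simp only [map_add, LinearMap.add_apply, h, h']; abel
    | tmul y n =>
      rw [DiffMod.tensor_act, map_add, LinearMap.add_apply]
      change pairingMap ev (Y.diffMod.act x y) m • n + pairingMap ev y m • X.diffMod.act x n =
        X.diffMod.act x (pairingMap ev y m • n) - pairingMap ev y (X.diffMod.act x m) • n
      rw [X.diffMod.leibniz, pairingMap_act, add_smul]; abel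
  -- the element of `Y ⊗ X` which corresponds to the identity defines the coevaluation
  obtain ⟨z, hz⟩ := hΦ.2 LinearMap.id
  have hz0 : ∀ x, (Y.diffMod.tensor X.diffMod).act x z = 0 := fun x => hΦ.1 (by
    ext m
    rw [hact, hz, map_zero, LinearMap.id_apply, LinearMap.id_apply, sub_self]; rfl)
  let z' : X.module ⊗[A] Y.module := TensorProduct.comm A _ _ z
  have hz' : ∀ x, (X.diffMod.tensor Y.diffMod).act x z' = 0 := fun x => by
    have := 𝒟.diffTheory.isHom_braiding Y.str X.str x z
    refine Eq.trans this.symm ?_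
    have h0 : (TensorProduct.comm A Y.module X.module)
      ((Y.diffMod.tensor X.diffMod).act x z) = 0 := by rw [hz0, map_zero]
    exact h0
  let coev : 𝟙_ 𝒟.Diff ⟶ X ⊗ Y := homMk (X := 𝟙_ 𝒟.Diff) (Y := X ⊗ Y)
    (LinearMap.toSpanSingleton A (X.module ⊗[A] Y.module) z') fun x a => by
      change 𝒟.ι x a • z' = (X.diffMod.tensor Y.diffMod).act x (a • z')
      rw [DiffMod.leibniz, hz', smul_zero, add_zero]
  obtain ⟨S, hS⟩ := TensorProduct.exists_finset z
  have hS' : z' = ∑ i ∈ S, i.2 ⊗ₜ[A] i.1 := by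
    change TensorProduct.comm A _ _ z = _
    rw [hS, map_sum]; rfl
  -- the two triangle identities, in terms of a decomposition `z = ∑ yᵢ ⊗ xᵢ`
  have h1 : ∀ m, ∑ i ∈ S, pairingMap ev i.1 m • i.2 = m := fun m => by
    have := LinearMap.congr_fun hz m
    rw [hS, map_sum, LinearMap.sum_apply] at this
    exact this
  have h2 : ∀ y, ∑ i ∈ S, pairingMap ev y i.2 • i.1 = y := fun y => h.1 (by
    ext m
    rw [map_sum, LinearMap.sum_apply]
    conv_rhs => rw [← h1 m, map_sum]
    refine Finset.sum_congr rfl fun i _ => ?_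
    rw [map_smul, map_smul, LinearMap.smul_apply, smul_eq_mul, smul_eq_mul, mul_comm])
  refine ⟨⟨coev, ev, hom_ext fun t => ?_, hom_ext fun t => ?_⟩⟩
  · change Y.module ⊗[A] A at t
    induction t using TensorProduct.induction_on with
    | zero => rw [map_zero, map_zero]
    | add t t' ht ht' => rw [map_add, map_add, ht, ht']
    | tmul y a =>
      change (linMap ev).rTensor Y.module ((TensorProduct.assoc A Y.module X.module Y.module).symm
        (y ⊗ₜ[A] (a • z'))) = (1 : A) ⊗ₜ[A] (a • y)
      rw [TensorProduct.tmul_smul, map_smul, map_smul, TensorProduct.tmul_smul]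
      congr 1
      conv_rhs => rw [← h2 y, TensorProduct.tmul_sum]
      rw [hS', TensorProduct.tmul_sum, map_sum, map_sum]
      refine Finset.sum_congr rfl fun i _ => ?_
      rw [TensorProduct.assoc_symm_tmul, LinearMap.rTensor_tmul, ← TensorProduct.smul_tmul,
        smul_eq_mul, mul_one]; rfl
  · change A ⊗[A] X.module at t
    induction t using TensorProduct.induction_on with
    | zero => rw [map_zero, map_zero]
    | add t t' ht ht' => rw [map_add, map_add, ht, ht']
    | tmul a m =>
      change (linMap ev).lTensor X.module (TensorProduct.assoc A X.module Y.module X.module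
        ((a • z') ⊗ₜ[A] m)) = (a • m) ⊗ₜ[A] (1 : A)
      rw [← TensorProduct.smul_tmul', map_smul, map_smul, ← TensorProduct.smul_tmul']
      congr 1
      conv_rhs => rw [← h1 m, TensorProduct.sum_tmul]
      rw [hS', TensorProduct.sum_tmul, map_sum, map_sum]
      refine Finset.sum_congr rfl fun i _ => ?_
      rw [TensorProduct.assoc_tmul, LinearMap.lTensor_tmul, TensorProduct.smul_tmul,
        smul_eq_mul, mul_one]; rfl

end Duality

namespace IsSimple
variable (h𝒟 : 𝒟.IsSimple) (hA : ∀ n : ℕ, n ≠ 0 → IsUnit (n : A))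
include h𝒟

include hA in
/-- Since finite differential modules are projective, evaluation on the dual is a perfect pairing.
-/
theorem nonempty_rigidCategory [IsNoetherianRing A] : Nonempty (RigidCategory 𝒟.Diff) := by
  have key : ∀ X : 𝒟.Diff, Nonempty (ExactPairing X (dualObj X)) := fun X =>
    haveI := h𝒟.projective hA X.diffMod
    nonempty_exactPairing (dualEval X) Function.bijective_id
  letI : RightRigidCategory 𝒟.Diff :=
    { rightDual := fun X => letI := (key X).some; ⟨dualObj X⟩ }
  exact ⟨BraidedCategory.rigidCategoryOfRightRigidCategory⟩

/-- The horizontal elements of a simple differential ring form a field. -/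
theorem isField_end : IsField (End (𝟙_ 𝒟.Diff)) := by
  have := h𝒟.nontrivial
  have ext : ∀ f g : 𝟙_ 𝒟.Diff ⟶ 𝟙_ 𝒟.Diff,
      (linMap f : A →ₗ[A] A) 1 = (linMap g : A →ₗ[A] A) 1 → f = g := fun f g h =>
    hom_ext fun m => LinearMap.congr_fun (LinearMap.ext_ring (f := (linMap f : A →ₗ[A] A))
      (g := linMap g) h) m
  refine ⟨⟨0, 1, fun h => ?_⟩, fun f g => ?_, fun {f} hf => ?_⟩
  · have h1 : (0 : A) = 1 :=
      congrArg (fun f : 𝟙_ 𝒟.Diff ⟶ 𝟙_ 𝒟.Diff => (linMap f : A →ₗ[A] A) 1) h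
    exact zero_ne_one h1
  · refine ext _ _ ?_
    have key : ∀ f g : A →ₗ[A] A, f (g 1) = g (f 1) := fun f g => by
      conv_lhs => rw [← mul_one (g 1), ← smul_eq_mul, map_smul]
      conv_rhs => rw [← mul_one (f 1), ← smul_eq_mul, map_smul]
      rw [smul_eq_mul, smul_eq_mul, mul_comm]
    exact key _ _
  · let φ : A →ₗ[A] A := linMap f
    have hφ : ∀ a, φ a = a * φ 1 := fun a => by
      conv_lhs => rw [← mul_one a, ← smul_eq_mul, map_smul, smul_eq_mul]
    have hst : 𝒟.IsStable (LinearMap.range φ) := by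
      rintro x _ ⟨a, rfl⟩
      exact ⟨𝒟.ι x a, linMap_act f x a⟩
    have hker : 𝒟.IsStable (LinearMap.ker φ) := by
      intro x a ha
      have h1 := linMap_act f x a
      have h2 : linMap f a = 0 := ha
      rw [h2, map_zero] at h1
      exact h1
    have hr : LinearMap.range φ = ⊤ := (h𝒟.eq_bot_or_eq_top _ hst).resolve_left fun h => hf
      (hom_ext fun m => LinearMap.congr_fun (LinearMap.range_eq_bot.mp h) m)
    have hk : LinearMap.ker φ = ⊥ := (h𝒟.eq_bot_or_eq_top _ hker).resolve_right fun h => hf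
      (hom_ext fun m => LinearMap.congr_fun (LinearMap.ker_eq_top.mp h) m)
    have : IsIso (f : 𝟙_ 𝒟.Diff ⟶ 𝟙_ 𝒟.Diff) := isIso_of_bijective f
      ⟨LinearMap.ker_eq_bot.mp hk, LinearMap.range_eq_top.mp hr⟩
    exact ⟨inv (f : 𝟙_ 𝒟.Diff ⟶ 𝟙_ 𝒟.Diff), IsIso.inv_hom_id (f : 𝟙_ 𝒟.Diff ⟶ 𝟙_ 𝒟.Diff)⟩

end IsSimple
end DiffRing

/-! ### Fibre functors of differential modules -/

/-- The projection along a complement of the range, which exists as the quotient is projective. -/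
theorem LinearMap.exists_leftInverse_of_projective_quotient {A M N : Type*} [CommRing A]
    [AddCommGroup M] [Module A M] [AddCommGroup N] [Module A N] (f : M →ₗ[A] N)
    (hf : Function.Injective f) [Module.Projective A (N ⧸ LinearMap.range f)] :
    ∃ r : N →ₗ[A] M, r ∘ₗ f = LinearMap.id := by
  obtain ⟨s, hs⟩ := Module.projective_lifting_property (LinearMap.range f).mkQ LinearMap.id
    (Submodule.mkQ_surjective _)
  have hs' : ∀ q, (LinearMap.range f).mkQ (s q) = q := LinearMap.congr_fun hs
  let r' : N →ₗ[A] LinearMap.range f :=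
    (LinearMap.id - s ∘ₗ (LinearMap.range f).mkQ).codRestrict _ fun n => by
      rw [← Submodule.Quotient.mk_eq_zero, ← Submodule.mkQ_apply, LinearMap.sub_apply, map_sub,
        LinearMap.comp_apply, hs', LinearMap.id_apply, sub_self]
  let e := LinearEquiv.ofInjective f hf
  refine ⟨e.symm.toLinearMap ∘ₗ r', LinearMap.ext fun m => ?_⟩
  rw [LinearMap.comp_apply, LinearMap.comp_apply, LinearEquiv.coe_coe, LinearEquiv.symm_apply_eq]
  refine Subtype.ext ?_
  change f m - s ((LinearMap.range f).mkQ (f m)) = f m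
  have h0 : (LinearMap.range f).mkQ (f m) = 0 :=
    (Submodule.Quotient.mk_eq_zero _).mpr (LinearMap.mem_range_self f m)
  rw [h0, map_zero, sub_zero]

namespace DiffRing
variable {B A : Type u} [CommRing B] [CommRing A] [Algebra B A] {𝒟 : DiffRing B A}

variable (𝒟) in
/-- The fibre of differential modules along a ring homomorphism. -/
abbrev fibre (L : Type u) [CommRing L] [Algebra A L] : 𝒟.Diff ⥤ ModuleCat.{u} L :=
  ModuleTheory.forget 𝒟.diffTheory ⋙ bcFunctor A L

instance (L : Type u) [CommRing L] [Algebra A L] : (bcFunctor A L).Additive where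
  map_add {_ _ f g} := ModuleCat.hom_ext (LinearMap.baseChange_add f.hom g.hom)

instance (L : Type u) [CommRing L] [Algebra A L] [Algebra B L] [IsScalarTower B A L] :
    ScalarExt.IsLinearAlong B L (𝒟.fibre L) where
  map_add f g := (𝒟.fibre L).map_add
  map_smul r f := bc_hom_ext A fun m => by
    change (1 : L) ⊗ₜ[A] (algebraMap B A r • f.1.hom m) =
      algebraMap B L r • ((1 : L) ⊗ₜ[A] f.1.hom m)
    rw [IsScalarTower.algebraMap_apply B A L, algebraMap_smul L (algebraMap B A r),
      TensorProduct.tmul_smul]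

namespace IsSimple
variable (h𝒟 : 𝒟.IsSimple) (hA : ∀ n : ℕ, n ≠ 0 → IsUnit (n : A)) [IsNoetherianRing A]
include h𝒟 hA

/-- Monomorphisms of differential modules split linearly, as their cokernel is projective; the
splitting need not be horizontal. -/
theorem exists_retraction {X Y : 𝒟.Diff} (f : X ⟶ Y) (hf : Function.Injective (linMap f)) :
    ∃ r : Y.module →ₗ[A] X.module, r ∘ₗ linMap f = LinearMap.id :=
  haveI : Module.Projective A (Y.module ⧸ LinearMap.range (linMap f)) :=
    h𝒟.projective hA (cokerObj f).diffMod
  LinearMap.exists_leftInverse_of_projective_quotient (linMap f) hf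

/-- Fibres are exact, since short exact sequences of differential modules split linearly. -/
theorem map_fibre_shortExact (L : Type u) [CommRing L] [Algebra A L] (S : ShortComplex 𝒟.Diff)
    (hS : S.ShortExact) : (S.map (𝒟.fibre L)).ShortExact := by
  have := hS.mono_f
  have := hS.epi_g
  have hf : Function.Injective (linMap S.f) := injective_of_mono S.f
  have hg : Function.Surjective (linMap S.g) := surjective_of_epi S.g
  have hex : Function.Exact (linMap S.f) (linMap S.g) := by
    intro m
    refine ⟨fun hm => ?_, ?_⟩
    · obtain ⟨z, rfl⟩ := exists_kerι S.g hm
      refine ⟨linMap (hS.exact.lift (kerι S.g) (kerι_comp S.g)) z, ?_⟩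
      rw [← linMap_comp, hS.exact.lift_f]
    · rintro ⟨z, rfl⟩
      rw [← linMap_comp, S.zero]; rfl
  refine ShortComplex.ShortExact.mk' ((ShortComplex.moduleCat_exact_iff _).mpr fun z hz => ?_) ?_ ?_
  · exact (lTensor_exact L hex hg z).mp hz
  · rw [ModuleCat.mono_iff_injective]
    obtain ⟨r, hr⟩ := h𝒟.exists_retraction hA S.f hf
    refine Function.LeftInverse.injective (g := r.baseChange L) fun z => ?_
    refine (LinearMap.congr_fun (LinearMap.baseChange_comp (A := L) (linMap S.f) r) z).symm.trans ?_
    rw [hr, LinearMap.baseChange_id]; rfl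
  · rw [ModuleCat.epi_iff_surjective]
    exact LinearMap.lTensor_surjective L hg

/-- If a morphism vanishes in the fibre at `m`, then so does its image, which is a direct summand of
the target as a module; by Nakayama's lemma for differential modules the image is zero. -/
theorem faithful_fibre (m : Ideal A) [hm : m.IsMaximal] : (𝒟.fibre (A ⧸ m)).Faithful := by
  have key : ∀ {X Y : 𝒟.Diff} (f : X ⟶ Y), (𝒟.fibre (A ⧸ m)).map f = 0 → f = 0 := by
    intro X Y f hf
    -- the image of `f`
    let I := kerObj (cokerπ f)
    obtain ⟨r, hr⟩ := h𝒟.exists_retraction hA (kerι (cokerπ f)) (kerι_injective _)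
    have h0 : ∀ z : I.module, (1 : A ⧸ m) ⊗ₜ[A] z = 0 := by
      intro z
      obtain ⟨n, hn⟩ := exists_of_cokerπ f (m := linMap (kerι (cokerπ f)) z)
        (by rw [← linMap_comp, kerι_comp]; rfl)
      have h1 : (1 : A ⧸ m) ⊗ₜ[A] linMap f n = 0 :=
        LinearMap.congr_fun (congrArg ModuleCat.Hom.hom hf) ((1 : A ⧸ m) ⊗ₜ[A] n)
      have h2 : r (linMap f n) = z := by rw [hn]; exact LinearMap.congr_fun hr z
      have h3 := congrArg (r.lTensor (A ⧸ m)) h1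
      rwa [LinearMap.lTensor_tmul, h2, map_zero] at h3
    have hI : m • (⊤ : Submodule A I.module) = ⊤ := by
      rw [eq_top_iff]
      intro z _
      have := congrArg (quotTensorEquivQuotSMul I.module m) (h0 z)
      rwa [quotTensorEquivQuotSMul_mk_one_tmul, map_zero, Submodule.Quotient.mk_eq_zero] at this
    have := h𝒟.subsingleton_of_eq_smul I.diffMod m hI
    refine hom_ext fun n => ?_
    obtain ⟨z, hz⟩ := exists_kerι (cokerπ f) (m := linMap f n) (by
      rw [← linMap_comp, comp_cokerπ]; rfl)
    rw [← hz, Subsingleton.elim z 0, map_zero]; rfl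
  exact ⟨fun {X Y f g} h => sub_eq_zero.mp (key _ (by rw [Functor.map_sub, h, sub_self]))⟩

end IsSimple

/-- The category of finitely presented differential modules over a simple noetherian
differential ring of characteristic zero is Tannakian. -/
theorem IsSimple.isTannakian {K A : Type u} [CommRing A] [IsNoetherianRing A] [Field K]
    [CharZero K] [Algebra K A] {𝒟 : DiffRing K A} (h𝒟 : 𝒟.IsSimple) : IsTannakian K 𝒟.Diff := by
  have hA : ∀ n : ℕ, n ≠ 0 → IsUnit (n : A) := fun n hn => by
    have := (IsUnit.mk0 (n : K) (Nat.cast_ne_zero.mpr hn)).map (algebraMap K A)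
    rwa [map_natCast] at this
  have := h𝒟.nontrivial
  obtain ⟨m, hm⟩ := Ideal.exists_maximal A
  letI : Field (A ⧸ m) := Ideal.Quotient.field m
  have hex := ((𝒟.fibre (A ⧸ m)).exact_tfae.out 0 3).mp
    (h𝒟.map_fibre_shortExact hA (A ⧸ m))
  exact
    { abelian := ⟨inferInstance, rfl⟩
      rigid := h𝒟.nonempty_rigidCategory hA
      isField_end := h𝒟.isField_end
      exists_fibreFunctor := ⟨A ⧸ m, inferInstance, inferInstance, 𝒟.fibre (A ⧸ m), inferInstance,
        inferInstance, h𝒟.faithful_fibre hA m, fun X =>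
          inferInstanceAs (Module.Finite (A ⧸ m) ((A ⧸ m) ⊗[A] X.module)), hex.1, hex.2⟩ }

end DiffRing

/-! ### Full tensor subcategories of Tannakian categories -/

section Transfer
open Limits
variable {C : Type v} [Category.{u} C] {D : Type v} [Category.{u} D]

/-- The essential image of a functor contains zero and is closed under binary products, kernels
and cokernels. -/
structure HasAbelianImage [HasZeroMorphisms D] (F : C ⥤ D) : Prop where
  zero : ∃ X, IsZero (F.obj X)
  prod : ∀ X Y, ∃ (Z : C) (p : F.obj Z ⟶ F.obj X) (q : F.obj Z ⟶ F.obj Y),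
    Nonempty (IsLimit (BinaryFan.mk p q))
  ker : ∀ {X Y} (f : F.obj X ⟶ F.obj Y), ∃ (Z : C) (i : F.obj Z ⟶ F.obj X) (w : i ≫ f = 0),
    Nonempty (IsLimit (KernelFork.ofι i w))
  coker : ∀ {X Y} (f : F.obj X ⟶ F.obj Y), ∃ (Z : C) (q : F.obj Y ⟶ F.obj Z) (w : f ≫ q = 0),
    Nonempty (IsColimit (CokernelCofork.ofπ q w))

namespace HasAbelianImage

theorem containsZero [HasZeroMorphisms D] {F : C ⥤ D} (h : HasAbelianImage F) :
    F.essImage.ContainsZero where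
  exists_zero := by
    obtain ⟨X, hX⟩ := h.zero
    exact ⟨_, hX, F.obj_mem_essImage X⟩

theorem isClosedUnderKernels [HasZeroMorphisms D] {F : C ⥤ D} (h : HasAbelianImage F) :
    F.essImage.IsClosedUnderKernels where
  kernels_le := by
    rintro _ ⟨f, k, hk, ⟨X, ⟨eX⟩⟩, ⟨Y, ⟨eY⟩⟩⟩
    obtain ⟨Z, i, w, ⟨hZ⟩⟩ := h.ker (eX.hom ≫ f ≫ eY.inv)
    exact ⟨Z, ⟨hZ.conePointsIsoOfNatIso hk (parallelPair.ext eX eY (by simp) (by simp))⟩⟩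

theorem isClosedUnderCokernels [HasZeroMorphisms D] {F : C ⥤ D} (h : HasAbelianImage F) :
    F.essImage.IsClosedUnderCokernels where
  cokernels_le := by
    rintro _ ⟨f, k, hk, ⟨X, ⟨eX⟩⟩, ⟨Y, ⟨eY⟩⟩⟩
    obtain ⟨Z, i, w, ⟨hZ⟩⟩ := h.coker (eX.hom ≫ f ≫ eY.inv)
    exact ⟨Z, ⟨hZ.coconePointsIsoOfNatIso hk (parallelPair.ext eX eY (by simp) (by simp))⟩⟩

theorem isClosedUnderFiniteProducts [HasZeroMorphisms D] [HasFiniteProducts D] {F : C ⥤ D}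
    (h : HasAbelianImage F) : F.essImage.IsClosedUnderFiniteProducts := by
  have := h.containsZero
  have : F.essImage.IsClosedUnderBinaryProducts :=
    { limitsOfShape_le := by
        rintro W ⟨p⟩
        obtain ⟨X, ⟨eX⟩⟩ := p.prop_diag_obj ⟨WalkingPair.left⟩
        obtain ⟨Y, ⟨eY⟩⟩ := p.prop_diag_obj ⟨WalkingPair.right⟩
        obtain ⟨Z, i, w, ⟨hZ⟩⟩ := h.prod X Y
        exact ⟨Z, ⟨hZ.conePointsIsoOfNatIso p.isLimit
          (mapPairIso eX eY)⟩⟩ }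
  exact ObjectProperty.IsClosedUnderFiniteProducts.mk'

variable [Preadditive C]

section
variable [Abelian D] {F : C ⥤ D} [F.Full] [F.Faithful] (h : HasAbelianImage F)
include h

theorem hasFiniteProducts : HasFiniteProducts C := by
  have := h.isClosedUnderFiniteProducts
  exact ⟨fun n => Adjunction.hasLimitsOfShape_of_equivalence F.toEssImage⟩

/-- `C` is abelian for its given preadditive structure; the structure is transported from the
essential image, which is closed under the operations of the abelian category `D`. -/
theorem exists_abelian : ∃ a : Abelian C, a.toPreadditive = ‹Preadditive C› := by
  have := h.containsZero
  have := h.isClosedUnderKernels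
  have := h.isClosedUnderCokernels
  have := h.isClosedUnderFiniteProducts
  have := h.hasFiniteProducts
  exact ⟨abelianOfEquivalence F.toEssImage, rfl⟩

/-- Limits in `C` are computed in `D`, as the essential image is closed under kernels and products.
-/
theorem preservesFiniteLimits [F.Additive] : PreservesFiniteLimits F := by
  have := h.containsZero
  have := h.isClosedUnderKernels
  have := h.isClosedUnderCokernels
  have := h.isClosedUnderFiniteProducts
  have := fun {X Y} f => F.essImage.preservesKernels_ι (X := X) (Y := Y) f
  have : PreservesFiniteLimits F.essImage.ι :=
    Functor.preservesFiniteLimits_of_preservesKernels _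
  have := comp_preservesFiniteLimits F.toEssImage F.essImage.ι
  exact preservesFiniteLimits_of_natIso F.toEssImageCompι

theorem preservesFiniteColimits [F.Additive] : PreservesFiniteColimits F := by
  have := h.containsZero
  have := h.isClosedUnderKernels
  have := h.isClosedUnderCokernels
  have := h.isClosedUnderFiniteProducts
  have := fun {X Y} f => F.essImage.preservesCokernels_ι (X := X) (Y := Y) f
  have : PreservesFiniteColimits F.essImage.ι :=
    Functor.preservesFiniteColimits_of_preservesCokernels _
  have := comp_preservesFiniteColimits F.toEssImage F.essImage.ι
  exact preservesFiniteColimits_of_natIso F.toEssImageCompι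

end
end HasAbelianImage

variable {K : Type u} [Field K] [Preadditive C] [Linear K C] [MonoidalCategory C]
  [MonoidalPreadditive C] [MonoidalLinear K C] [SymmetricCategory C]
  [Abelian D] [Linear K D] [MonoidalCategory D]
  [MonoidalPreadditive D] [MonoidalLinear K D] [SymmetricCategory D]

/-- A full tensor subcategory of a Tannakian category is Tannakian if it is closed under kernels,
cokernels, products and duals. -/
theorem IsTannakian.of_fullyFaithful (hD : IsTannakian K D) (F : C ⥤ D) [F.Braided] [F.Full]
    [F.Faithful] [F.Additive] [F.Linear K] (h : HasAbelianImage F)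
    (hdual : ∀ X, ∃ Y, Nonempty (ExactPairing (F.obj X) (F.obj Y))) : IsTannakian K C where
  abelian := h.exists_abelian
  rigid := by
    choose d hd using hdual
    letI : RightRigidCategory C :=
      { rightDual := fun X =>
          letI := (hd X).some
          letI := ExactPairing.ofFullyFaithful F X (d X)
          ⟨d X⟩ }
    exact ⟨BraidedCategory.rigidCategoryOfRightRigidCategory⟩
  isField_end := by
    let e : End (𝟙_ C) ≃* End (𝟙_ D) :=
      ((Functor.FullyFaithful.ofFullyFaithful F).mulEquivEnd (𝟙_ C)).trans
        (Functor.Monoidal.εIso F).symm.conj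
    exact MulEquiv.isField hD.isField_end e
  exists_fibreFunctor := by
    obtain ⟨L, _, _, ω, _, _, _, hfin, _, _⟩ := hD.exists_fibreFunctor
    have := h.preservesFiniteLimits
    have := h.preservesFiniteColimits
    exact ⟨L, _, _, F ⋙ ω, inferInstance, inferInstance, inferInstance, fun X => hfin _,
      comp_preservesFiniteLimits F ω, comp_preservesFiniteColimits F ω⟩

/-- A fully faithful tensor functor is exact if its essential image is closed under kernels,
cokernels and products. -/
theorem HasAbelianImage.isFullyFaithfulTensorExact (F : C ⥤ D) [F.Braided] [F.Full]
    [F.Faithful] [F.Additive] [F.Linear K] (h : HasAbelianImage F) :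
    IsFullyFaithfulTensorExact K F :=
  ⟨inferInstance, inferInstance, inferInstance, inferInstance, h.preservesFiniteLimits,
    h.preservesFiniteColimits⟩
end Transfer

/-! ### Extension of scalars of categories to the field of fractions -/

namespace ScalarExt
open Limits
variable {R K : Type u} [CommRing R] [IsDomain R] [Field K] [Algebra R K] [IsFractionRing R K]
variable {C : Type v} [Category.{u} C] [Preadditive C] [Linear R C]
variable {D : Type v} [Category.{u} D] [Preadditive D] [Linear K D] (G : C ⥤ D)

/-- Morphisms over the field of fractions have a common denominator. -/
theorem exists_eq_hom {X Y : ScalarExt R K C} (g : X ⟶ Y) :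
    ∃ (k : K) (f : X.as ⟶ Y.as), g = hom k f := by
  induction g using hom_induction with
  | zero => exact ⟨0, 0, (TensorProduct.zero_tmul _ _).symm⟩
  | tmul k f => exact ⟨k, f, rfl⟩
  | add g g' h h' =>
    obtain ⟨k, f, rfl⟩ := h
    obtain ⟨k', f', rfl⟩ := h'
    obtain ⟨a, s, hs, rfl⟩ := IsFractionRing.div_surjective (A := R) k
    obtain ⟨a', s', hs', rfl⟩ := IsFractionRing.div_surjective (A := R) k'
    have hs0 : algebraMap R K s ≠ 0 := IsFractionRing.to_map_ne_zero_of_mem_nonZeroDivisors hs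
    have hs0' : algebraMap R K s' ≠ 0 := IsFractionRing.to_map_ne_zero_of_mem_nonZeroDivisors hs'
    refine ⟨(algebraMap R K s)⁻¹ * (algebraMap R K s')⁻¹, (a * s') • f + (a' * s) • f', ?_⟩
    change _ ⊗ₜ[R] _ + _ ⊗ₜ[R] _ = _ ⊗ₜ[R] (_ + _)
    rw [TensorProduct.tmul_add, ← TensorProduct.smul_tmul, ← TensorProduct.smul_tmul,
      Algebra.smul_def, Algebra.smul_def, map_mul, map_mul]
    congr 2 <;> field_simp

/-- A functor which becomes fully faithful when the scalars of `R` are inverted. -/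
structure IsAlmostFullyFaithful (R K : Type u) [CommRing R] [Field K] [Algebra R K]
    {C : Type v} [Category.{u} C] [Preadditive C] [Linear R C]
    {D : Type v} [Category.{u} D] [Preadditive D] [Linear K D] (G : C ⥤ D) : Prop where
  faithful : ∀ {X Y : C} (f : X ⟶ Y), G.map f = 0 → ∃ r : R, r ≠ 0 ∧ r • f = 0
  full : ∀ {X Y : C} (h : G.obj X ⟶ G.obj Y), ∃ r : R, r ≠ 0 ∧ ∃ f : X ⟶ Y,
    G.map f = algebraMap R K r • h

variable [IsLinearAlong R K G] {G}

theorem IsAlmostFullyFaithful.lift_faithful (hG : IsAlmostFullyFaithful R K G) :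
    (lift R K G).Faithful := by
  have key : ∀ {X Y : ScalarExt R K C} (g : X ⟶ Y), (lift R K G).map g = 0 → g = 0 := by
    intro X Y g hg
    obtain ⟨k, f, rfl⟩ := exists_eq_hom g
    rw [lift_map_hom] at hg
    by_cases hk : k = 0
    · rw [hk]; exact TensorProduct.zero_tmul _ _
    · obtain ⟨r, hr, h⟩ := hG.faithful f ((smul_eq_zero_iff_right hk).mp hg)
      have hr' : algebraMap R K r ≠ 0 := by
        rwa [Ne, FaithfulSMul.algebraMap_eq_zero_iff R K]
      have : k = r • (k / algebraMap R K r) := by rw [Algebra.smul_def]; field_simp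
      change k ⊗ₜ[R] f = 0
      rw [this, TensorProduct.smul_tmul, h, TensorProduct.tmul_zero]
  exact ⟨fun {X Y f g} h => sub_eq_zero.mp (key _ (by rw [Functor.map_sub, h, sub_self]))⟩

theorem IsAlmostFullyFaithful.lift_full (hG : IsAlmostFullyFaithful R K G) :
    (lift R K G).Full where
  map_surjective {X Y} h := by
    change G.obj X.as ⟶ G.obj Y.as at h
    obtain ⟨r, hr, f, hf⟩ := hG.full h
    have hr' : algebraMap R K r ≠ 0 := by
      rwa [Ne, FaithfulSMul.algebraMap_eq_zero_iff R K]
    refine ⟨hom (algebraMap R K r)⁻¹ f, (lift_map_hom G _ f).trans ?_⟩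
    rw [hf, inv_smul_smul₀ hr']

/-- Kernels do not change when a morphism is multiplied by a nonzero scalar. -/
theorem _root_.CategoryTheory.isLimit_kernelFork_of_smul {X Y Z : D} {h f : X ⟶ Y} {k : K}
    (hk : k ≠ 0) (hf : f = k • h) (i : Z ⟶ X) (w : i ≫ f = 0)
    (hi : Nonempty (IsLimit (KernelFork.ofι i w))) :
    ∃ w : i ≫ h = 0, Nonempty (IsLimit (KernelFork.ofι i w)) := by
  obtain ⟨hi⟩ := hi
  have hz : ∀ {W} (j : W ⟶ X), j ≫ h = 0 ↔ j ≫ f = 0 := fun j => by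
    rw [hf, Linear.comp_smul, smul_eq_zero_iff_right hk]
  have := Fork.IsLimit.mono hi
  have : Mono i := this
  exact ⟨(hz i).mpr w, ⟨KernelFork.IsLimit.ofι' i _ fun j hj =>
    ⟨hi.lift (KernelFork.ofι j ((hz j).mp hj)), Fork.IsLimit.lift_ι hi⟩⟩⟩

/-- Cokernels do not change when a morphism is multiplied by a nonzero scalar. -/
theorem _root_.CategoryTheory.isColimit_cokernelCofork_of_smul {X Y Z : D} {h f : X ⟶ Y} {k : K}
    (hk : k ≠ 0) (hf : f = k • h) (q : Y ⟶ Z) (w : f ≫ q = 0)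
    (hq : Nonempty (IsColimit (CokernelCofork.ofπ q w))) :
    ∃ w : h ≫ q = 0, Nonempty (IsColimit (CokernelCofork.ofπ q w)) := by
  obtain ⟨hq⟩ := hq
  have hz : ∀ {W} (j : Y ⟶ W), h ≫ j = 0 ↔ f ≫ j = 0 := fun j => by
    rw [hf, Linear.smul_comp, smul_eq_zero_iff_right hk]
  have := Cofork.IsColimit.epi hq
  have : Epi q := this
  exact ⟨(hz q).mpr w, ⟨CokernelCofork.IsColimit.ofπ' q _ fun j hj =>
    ⟨hq.desc (CokernelCofork.ofπ j ((hz j).mp hj)), Cofork.IsColimit.π_desc hq⟩⟩⟩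

/-- The closure conditions of `HasAbelianImage` for `C ⊗ K`, in terms of `C`. -/
theorem IsAlmostFullyFaithful.hasAbelianImage (hG : IsAlmostFullyFaithful R K G)
    (zero : ∃ X, IsZero (G.obj X))
    (prod : ∀ X Y, ∃ (Z : C) (p : G.obj Z ⟶ G.obj X) (q : G.obj Z ⟶ G.obj Y),
      Nonempty (IsLimit (BinaryFan.mk p q)))
    (ker : ∀ {X Y} (f : X ⟶ Y), ∃ (Z : C) (i : G.obj Z ⟶ G.obj X) (w : i ≫ G.map f = 0),
      Nonempty (IsLimit (KernelFork.ofι i w)))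
    (coker : ∀ {X Y} (f : X ⟶ Y), ∃ (Z : C) (q : G.obj Y ⟶ G.obj Z) (w : G.map f ≫ q = 0),
      Nonempty (IsColimit (CokernelCofork.ofπ q w))) : HasAbelianImage (lift R K G) where
  zero := zero.imp' of fun _ h => h
  prod X Y := (prod X.as Y.as).imp' of fun _ h => h
  ker {X Y} h := by
    obtain ⟨r, hr, f, hf⟩ := hG.full (X := X.as) (Y := Y.as) h
    have hr' : algebraMap R K r ≠ 0 := by
      rwa [Ne, FaithfulSMul.algebraMap_eq_zero_iff R K]
    obtain ⟨Z, i, w, hi⟩ := ker f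
    exact ⟨of Z, i, isLimit_kernelFork_of_smul hr' hf i w hi⟩
  coker {X Y} h := by
    obtain ⟨r, hr, f, hf⟩ := hG.full (X := X.as) (Y := Y.as) h
    have hr' : algebraMap R K r ≠ 0 := by
      rwa [Ne, FaithfulSMul.algebraMap_eq_zero_iff R K]
    obtain ⟨Z, i, w, hi⟩ := coker f
    exact ⟨of Z, i, isColimit_cokernelCofork_of_smul hr' hf i w hi⟩

end ScalarExt

/-! ### Full faithfulness of the generic fibre -/

namespace DiffRing
section GenericFibre
attribute [local instance] Algebra.TensorProduct.rightAlgebra genericModule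
variable {R K B : Type u} [CommRing R] [IsDomain R] [IsNoetherianRing R] [Field K] [Algebra R K]
  [IsFractionRing R K] [CommRing B] [Algebra R B]

/-- The generic fibre of a module is its localization at the nonzero elements of `R`. -/
instance isLocalizedModule_mk_one (M : Type u) [AddCommGroup M] [Module B M] :
    IsLocalizedModule (Algebra.algebraMapSubmonoid B (nonZeroDivisors R))
      (TensorProduct.mk B (K ⊗[R] B) M 1) :=
  (isLocalizedModule_iff_isBaseChange _ (K ⊗[R] B) _).mpr
    (TensorProduct.isBaseChange B M (K ⊗[R] B))

variable (R K) in
/-- The kernel of the map to the generic fibre is the `R`-torsion. -/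
theorem exists_smul_eq_zero_of_one_tmul_eq_zero {M : Type u} [AddCommGroup M] [Module B M] (m : M)
    (h : (1 : K ⊗[R] B) ⊗ₜ[B] m = 0) : ∃ r : R, r ≠ 0 ∧ algebraMap R B r • m = 0 := by
  obtain ⟨⟨_, r, hr, rfl⟩, hc⟩ := IsLocalizedModule.exists_of_eq
    (S := Algebra.algebraMapSubmonoid B (nonZeroDivisors R))
    (f := TensorProduct.mk B (K ⊗[R] B) M 1) (x₁ := m) (x₂ := 0)
    (h.trans (TensorProduct.tmul_zero _ _).symm)
  exact ⟨r, nonZeroDivisors.ne_zero hr, hc.trans (smul_zero _)⟩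

variable (R K) in
/-- The torsion of a noetherian module has bounded exponent. -/
theorem exists_forall_smul_eq_zero {M : Type u} [AddCommGroup M] [Module B M]
    [IsNoetherian B M] : ∃ r : R, r ≠ 0 ∧
      ∀ m : M, (1 : K ⊗[R] B) ⊗ₜ[B] m = 0 → algebraMap R B r • m = 0 := by
  classical
  let T : Submodule B M := LinearMap.ker (TensorProduct.mk B (K ⊗[R] B) M 1)
  obtain ⟨s, hs⟩ := IsNoetherian.noetherian T
  have hsT : ∀ m ∈ s, ∃ r : R, r ≠ 0 ∧ algebraMap R B r • m = 0 := fun m hm =>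
    exists_smul_eq_zero_of_one_tmul_eq_zero R K m
      (show m ∈ T by rw [← hs]; exact Submodule.subset_span hm)
  choose! c hc0 hc using hsT
  refine ⟨∏ m ∈ s, c m, Finset.prod_ne_zero_iff.mpr hc0, fun m hm => ?_⟩
  have hm' : m ∈ Submodule.span B (s : Set M) := by rw [hs]; exact hm
  induction hm' using Submodule.span_induction with
  | mem x hx =>
    obtain ⟨b, hb⟩ := Finset.dvd_prod_of_mem c hx
    rw [hb, mul_comm, map_mul, mul_smul, hc x hx, smul_zero]
  | zero => exact smul_zero _
  | add x y hx hy h h' =>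
    have ex : x ∈ T := by rw [← hs]; exact hx
    have ey : y ∈ T := by rw [← hs]; exact hy
    rw [smul_add, h ex, h' ey, add_zero]
  | smul b x hx h =>
    have ex : x ∈ T := by rw [← hs]; exact hx
    rw [smul_comm, h ex, smul_zero]

variable (K) in
/-- Linear maps out of a finitely presented module extend from the generic fibre, up to a
denominator. -/
theorem exists_linearMap_one_tmul {M N : Type u} [AddCommGroup M] [Module B M] [AddCommGroup N]
    [Module B N] [Module.FinitePresentation B M] (g : M →ₗ[B] (K ⊗[R] B) ⊗[B] N) :
    ∃ r : R, r ≠ 0 ∧ ∃ f : M →ₗ[B] N,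
      ∀ m, (1 : K ⊗[R] B) ⊗ₜ[B] f m = algebraMap R B r • g m := by
  obtain ⟨f, ⟨_, r, hr, rfl⟩, h⟩ := Module.FinitePresentation.exists_lift_of_isLocalizedModule
    (Algebra.algebraMapSubmonoid B (nonZeroDivisors R)) (TensorProduct.mk B (K ⊗[R] B) N 1) g
  exact ⟨r, nonZeroDivisors.ne_zero hr, f, LinearMap.congr_fun h⟩

variable (K) in
theorem exists_smul_eq_one_tmul {M : Type u} [AddCommGroup M] [Module B M]
    (z : (K ⊗[R] B) ⊗[B] M) :
    ∃ r : R, r ≠ 0 ∧ ∃ m : M, (1 : K ⊗[R] B) ⊗ₜ[B] m = algebraMap R B r • z := by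
  obtain ⟨⟨m, ⟨_, r, hr, rfl⟩⟩, h⟩ := IsLocalizedModule.surj
    (Algebra.algebraMapSubmonoid B (nonZeroDivisors R)) (TensorProduct.mk B (K ⊗[R] B) M 1) z
  exact ⟨r, nonZeroDivisors.ne_zero hr, m, h.symm⟩

theorem isUnit_algebraMap_generic {r : R} (hr : r ≠ 0) :
    IsUnit (algebraMap B (K ⊗[R] B) (algebraMap R B r)) := by
  rw [generic_compat R K B r]
  exact (IsUnit.mk0 _ (by rwa [Ne, FaithfulSMul.algebraMap_eq_zero_iff R K])).map _

theorem smul_left_injective_generic {r : R} (hr : r ≠ 0) {P : Type u} [AddCommGroup P] [Module B P]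
    [Module (K ⊗[R] B) P] [IsScalarTower B (K ⊗[R] B) P] {x y : P}
    (h : algebraMap R B r • x = algebraMap R B r • y) : x = y := by
  rw [← algebraMap_smul (K ⊗[R] B) (algebraMap R B r) x,
    ← algebraMap_smul (K ⊗[R] B) (algebraMap R B r) y] at h
  exact (isUnit_algebraMap_generic hr).smul_left_cancel.mp h

variable (R K B) in
/-- The base change functor of differential modules to the generic fibre. -/
abbrev genericFibre : (der R B).Diff ⥤ (derGeneric K R B).Diff := (genericTransport K R B).functor

instance : ScalarExt.IsLinearAlong R K (genericFibre R K B) :=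
  transport_isLinearAlong _ (generic_compat R K _)

theorem genericFibre_map_tmul {X Y : (der R B).Diff} (f : X ⟶ Y) (a : K ⊗[R] B) (m : X.module) :
    linMap ((genericFibre R K B).map f) (a ⊗ₜ[B] m) = a ⊗ₜ[B] linMap f m := rfl

theorem genericFibre_act (X : (der R B).Diff) (k : K) (x : Derivation R B B) (m : X.module) :
    (X.diffMod.generic K).act (k ⊗ₜ[R] x : K ⊗[R] Derivation R B B)
      ((1 : K ⊗[R] B) ⊗ₜ[B] m) = (k ⊗ₜ[R] (1 : B)) ⊗ₜ[B] X.diffMod.act x m := by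
  have h := genericAct_tmul_one K X.diffMod k x (1 : K) m
  rwa [mul_one] at h

/-- A linear map between generic fibres has a multiple which comes from a linear map `f` over `B`.
The map `f` is equivariant up to torsion, and the torsion of the target is killed by a single
scalar. -/
theorem isAlmostFullyFaithful_genericFibre [IsNoetherianRing B] :
    ScalarExt.IsAlmostFullyFaithful R K (genericFibre R K B) where
  faithful {X Y} f hf := by
    obtain ⟨r, hr, h⟩ := exists_forall_smul_eq_zero R K (B := B) (M := Y.module)
    refine ⟨r, hr, hom_ext fun m => h (linMap f m) ?_⟩
    rw [← genericFibre_map_tmul f, hf]; rfl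
  full {X Y} h := by
    let H : (K ⊗[R] B) ⊗[B] X.module →ₗ[K ⊗[R] B] (K ⊗[R] B) ⊗[B] Y.module := linMap h
    have hH : ∀ x z, H ((X.diffMod.generic K).act x z) = (Y.diffMod.generic K).act x (H z) :=
      linMap_act h
    obtain ⟨r, hr, f, hf⟩ := exists_linearMap_one_tmul K (R := R) (M := X.module) (N := Y.module)
      (H.restrictScalars B ∘ₗ TensorProduct.mk B (K ⊗[R] B) X.module 1)
    obtain ⟨r', hr', h'⟩ := exists_forall_smul_eq_zero R K (B := B) (M := Y.module)
    -- `f` is `r • h` in the generic fibre, so it is equivariant up to torsion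
    have hf' : ∀ m, (1 : K ⊗[R] B) ⊗ₜ[B] f m =
      algebraMap B (K ⊗[R] B) (algebraMap R B r) • H ((1 : K ⊗[R] B) ⊗ₜ[B] m) := fun m =>
        (hf m).trans (algebraMap_smul (K ⊗[R] B) (algebraMap R B r) _).symm
    have hact : ∀ x m,
        (1 : K ⊗[R] B) ⊗ₜ[B] (f (X.diffMod.act x m) - Y.diffMod.act x (f m)) = 0 := by
      intro x m
      rw [TensorProduct.tmul_sub, sub_eq_zero, hf']
      have h1 := genericFibre_act (K := K) X 1 x m
      have h2 := genericFibre_act (K := K) Y 1 x (f m)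
      rw [← Algebra.TensorProduct.one_def] at h1 h2
      rw [← h1, ← h2, hH, hf', DiffMod.leibniz, generic_compat R K B, Derivation.map_algebraMap,
        zero_smul, zero_add]
    refine ⟨r' * r, mul_ne_zero hr' hr, homMk (algebraMap R B r' • f) fun x m => ?_, ?_⟩
    · change algebraMap R B r' • f (X.diffMod.act x m) =
        Y.diffMod.act x (algebraMap R B r' • f m)
      rw [DiffMod.leibniz, LinearMap.id_apply, Derivation.map_algebraMap, zero_smul, zero_add,
        ← sub_eq_zero, ← smul_sub]
      exact h' _ (hact x m)
    · refine Subtype.ext (bc_hom_ext B fun m => ?_)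
      change (1 : K ⊗[R] B) ⊗ₜ[B] (algebraMap R B r' • f m) =
        algebraMap K (K ⊗[R] B) (algebraMap R K (r' * r)) • H ((1 : K ⊗[R] B) ⊗ₜ[B] m)
      rw [TensorProduct.tmul_smul, hf', ← generic_compat R K B, map_mul, map_mul, mul_smul,
        algebraMap_smul (K ⊗[R] B) (algebraMap R B r')]

end GenericFibre
end DiffRing

/-! ### Kernels, cokernels and duals over the generic fibre -/

namespace DiffRing
section GenericFibreImage
open Limits
attribute [local instance] Algebra.TensorProduct.rightAlgebra genericModule
variable {R K B : Type u} [CommRing R] [IsDomain R] [IsNoetherianRing R] [Field K] [Algebra R K]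
  [IsFractionRing R K] [CommRing B] [Algebra R B]

instance : (genericFibre R K B).Additive where
  map_add := ScalarExt.IsLinearAlong.map_add (R := R) (K := K) _ _

instance flat_generic : Module.Flat B (K ⊗[R] B) :=
  IsLocalization.flat _ (Algebra.algebraMapSubmonoid B (nonZeroDivisors R))

theorem genericFibre_isLimit {X Y Z : (der R B).Diff} (i : Z ⟶ X) (f : X ⟶ Y)
    (w : (genericFibre R K B).map i ≫ (genericFibre R K B).map f = 0)
    (hi : Function.Injective (linMap i)) (h : Function.Exact (linMap i) (linMap f)) :
    Nonempty (IsLimit (KernelFork.ofι ((genericFibre R K B).map i) w)) :=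
  isLimit_of_exact _ _ _ (Module.Flat.lTensor_preserves_injective_linearMap (M := K ⊗[R] B) _ hi)
    fun m hm => (Module.Flat.lTensor_exact (K ⊗[R] B) h m).mp hm

theorem genericFibre_isColimit {X Y Z : (der R B).Diff} (f : X ⟶ Y) (q : Y ⟶ Z)
    (w : (genericFibre R K B).map f ≫ (genericFibre R K B).map q = 0)
    (hq : Function.Surjective (linMap q)) (h : Function.Exact (linMap f) (linMap q)) :
    Nonempty (IsColimit (CokernelCofork.ofπ ((genericFibre R K B).map q) w)) :=
  isColimit_of_exact _ _ _ (LinearMap.lTensor_surjective (K ⊗[R] B) hq)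
    fun m hm => (lTensor_exact (K ⊗[R] B) h hq m).mp hm

variable (K) in
/-- The base change of the dual of a finitely presented module is the dual of its base change. -/
theorem generic_dual_bijective {M : Type u} [AddCommGroup M] [Module B M]
    [IsNoetherianRing B] [Module.FinitePresentation B M]
    (Ψ : (K ⊗[R] B) ⊗[B] (M →ₗ[B] B) →ₗ[K ⊗[R] B] (K ⊗[R] B) ⊗[B] M →ₗ[K ⊗[R] B] K ⊗[R] B)
    (hΨ : ∀ f m, Ψ ((1 : K ⊗[R] B) ⊗ₜ[B] f) ((1 : K ⊗[R] B) ⊗ₜ[B] m) =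
      algebraMap B (K ⊗[R] B) (f m)) : Function.Bijective Ψ := by
  have hext : ∀ φ ψ : (K ⊗[R] B) ⊗[B] M →ₗ[K ⊗[R] B] K ⊗[R] B,
      (∀ m, φ ((1 : K ⊗[R] B) ⊗ₜ[B] m) = ψ ((1 : K ⊗[R] B) ⊗ₜ[B] m)) → φ = ψ := fun φ ψ h =>
    TensorProduct.AlgebraTensorModule.ext fun a m => by
      have e : a ⊗ₜ[B] m = a • ((1 : K ⊗[R] B) ⊗ₜ[B] m) := by
        rw [TensorProduct.smul_tmul', smul_eq_mul, mul_one]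
      rw [e, map_smul, map_smul, h]
  refine ⟨(injective_iff_map_eq_zero Ψ).mpr fun z hz => ?_, fun φ => ?_⟩
  · obtain ⟨r, hr, f, hf⟩ := exists_smul_eq_one_tmul K (R := R) z
    obtain ⟨r', hr', h'⟩ := exists_forall_smul_eq_zero R K (B := B) (M := B)
    have h0 : ∀ m, algebraMap B (K ⊗[R] B) (f m) = 0 := fun m => by
      rw [← hΨ, hf, ← algebraMap_smul (K ⊗[R] B), map_smul, hz, smul_zero]; rfl
    have h1 : algebraMap R B r' • f = 0 := LinearMap.ext fun m => h' _ (by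
      rw [← mul_one (f m), ← smul_eq_mul, TensorProduct.tmul_smul, TensorProduct.smul_tmul',
        ← algebraMap_smul (K ⊗[R] B) (f m), h0, zero_smul, TensorProduct.zero_tmul])
    have h2 := congrArg (TensorProduct.mk B (K ⊗[R] B) (M →ₗ[B] B) 1) h1
    rw [map_smul, map_zero, TensorProduct.mk_apply, hf] at h2
    refine smul_left_injective_generic (K := K) (B := B) hr
      (smul_left_injective_generic (K := K) (B := B) hr' ?_)
    rw [h2, smul_zero, smul_zero]
  · obtain ⟨r, hr, f, hf⟩ := exists_linearMap_one_tmul K (R := R) (M := M) (N := B)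
      ((TensorProduct.rid B (K ⊗[R] B)).symm.toLinearMap ∘ₗ φ.restrictScalars B ∘ₗ
        TensorProduct.mk B (K ⊗[R] B) M 1)
    obtain ⟨u, hu⟩ := isUnit_algebraMap_generic (K := K) (B := B) hr
    refine ⟨(↑u⁻¹ : K ⊗[R] B) ⊗ₜ[B] f, hext _ _ fun m => ?_⟩
    have e : (↑u⁻¹ : K ⊗[R] B) ⊗ₜ[B] f = (↑u⁻¹ : K ⊗[R] B) • ((1 : K ⊗[R] B) ⊗ₜ[B] f) := by
      rw [TensorProduct.smul_tmul', smul_eq_mul, mul_one]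
    have hf' := congrArg (TensorProduct.rid B (K ⊗[R] B)) (hf m)
    rw [map_smul] at hf'
    change _ = algebraMap R B r • TensorProduct.rid B (K ⊗[R] B)
      ((TensorProduct.rid B (K ⊗[R] B)).symm (φ _)) at hf'
    rw [LinearEquiv.apply_symm_apply, TensorProduct.rid_tmul,
      ← algebraMap_smul (K ⊗[R] B), smul_eq_mul, mul_one,
      ← algebraMap_smul (K ⊗[R] B) (algebraMap R B r), ← hu] at hf'
    rw [e, map_smul, LinearMap.smul_apply, hΨ, hf', smul_smul, Units.inv_mul, one_smul]
    rfl

/-- Dual differential modules become dual objects over the generic fibre. -/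
theorem nonempty_exactPairing_genericFibre [IsNoetherianRing B]
    (hproj : ∀ X : (derGeneric K R B).Diff, Module.Projective (K ⊗[R] B) X.module)
    (X : (der R B).Diff) :
    Nonempty (ExactPairing ((genericFibre R K B).obj X)
      ((genericFibre R K B).obj (dualObj X))) := by
  have := hproj ((genericFibre R K B).obj X)
  let ev : (genericFibre R K B).obj (dualObj X) ⊗ (genericFibre R K B).obj X ⟶ 𝟙_ _ :=
    Functor.LaxMonoidal.μ (genericFibre R K B) (dualObj X) X ≫
      (genericFibre R K B).map (dualEval X) ≫ Functor.OplaxMonoidal.η (genericFibre R K B)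
  refine nonempty_exactPairing ev (generic_dual_bijective (R := R) K (M := X.module)
    (pairingMap ev) fun f m => ?_)
  have hμ : linMap (Functor.LaxMonoidal.μ (genericFibre R K B) (dualObj X) X)
      (((1 : K ⊗[R] B) ⊗ₜ[B] f) ⊗ₜ[K ⊗[R] B] ((1 : K ⊗[R] B) ⊗ₜ[B] m)) =
      (1 : K ⊗[R] B) ⊗ₜ[B] (f ⊗ₜ[B] m) := bc_μ_apply (M := (dualObj X).module) X.module f m
  have hε : ∀ a : K ⊗[R] B, linMap (Functor.LaxMonoidal.ε (genericFibre R K B)) a =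
    a ⊗ₜ[B] (1 : B) := bc_ε_apply
  have hη : linMap (Functor.OplaxMonoidal.η (genericFibre R K B)) ((1 : K ⊗[R] B) ⊗ₜ[B] f m) =
      algebraMap B (K ⊗[R] B) (f m) := by
    have e : (1 : K ⊗[R] B) ⊗ₜ[B] f m = linMap (Functor.LaxMonoidal.ε (genericFibre R K B))
        (algebraMap B (K ⊗[R] B) (f m)) := by
      rw [hε, Algebra.algebraMap_eq_smul_one, TensorProduct.smul_tmul, smul_eq_mul, mul_one]
    rw [e, ← linMap_comp, Functor.Monoidal.ε_η]; rfl
  change linMap ev _ = _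
  rw [linMap_comp, linMap_comp]
  erw [hμ, genericFibre_map_tmul]
  exact hη

variable {C : Type (u + 1)} [Category.{u} C] [Preadditive C] [Linear R C]

/-- A category of differential modules which is closed, up to multiplication of morphisms by
scalars of `R`, under the operations which make its generic fibre an abelian rigid category. -/
structure IsAlmostRigidAbelian [IsNoetherianRing B] (H : C ⥤ (der R B).Diff) : Prop where
  zero : H.essImage (zeroObj _)
  prod : ∀ X Y, H.essImage (prodObj (H.obj X) (H.obj Y))
  ker : ∀ {X Y} (f : X ⟶ Y), ∃ r : R, r ≠ 0 ∧ H.essImage (kerObj (r • H.map f))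
  coker : ∀ {X Y} (f : X ⟶ Y), H.essImage (cokerObj (H.map f))
  dual : ∀ X, H.essImage (dualObj (H.obj X))

variable [IsNoetherianRing B] {H : C ⥤ (der R B).Diff} [H.Full] [H.Faithful] [H.Additive]
  [H.Linear R]

theorem bijective_linMap_hom {A : Type u} [CommRing A] [Algebra B A]
    {𝒟 : DiffRing B A} {X Y : 𝒟.Diff} (e : X ≅ Y) : Function.Bijective (linMap e.hom) :=
  Function.bijective_iff_has_inverse.mpr ⟨linMap e.inv,
    fun m => by rw [← linMap_comp, e.hom_inv_id]; rfl,
    fun m => by rw [← linMap_comp, e.inv_hom_id]; rfl⟩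

variable (K H) in
/-- The generic fibre is fully faithful up to denominators on every full subcategory of differential
modules. -/
theorem isAlmostFullyFaithful_comp :
    ScalarExt.IsAlmostFullyFaithful R K (H ⋙ genericFibre R K B) where
  faithful {X Y} f hf := by
    obtain ⟨r, hr, h⟩ := (isAlmostFullyFaithful_genericFibre (K := K)).faithful (H.map f) hf
    exact ⟨r, hr, H.map_injective (by rw [H.map_smul, h, H.map_zero])⟩
  full {X Y} h := by
    obtain ⟨r, hr, f, hf⟩ := (isAlmostFullyFaithful_genericFibre (K := K)).full
      (X := H.obj X) (Y := H.obj Y) h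
    exact ⟨r, hr, H.preimage f, by rw [Functor.comp_map, H.map_preimage, hf]⟩

variable (K) in
/-- As the generic fibre is exact and turns nonzero scalars of `R` into isomorphisms, the closure
conditions up to scalars become closure conditions over `K`. -/
theorem IsAlmostRigidAbelian.hasAbelianImage (hH : IsAlmostRigidAbelian H) :
    HasAbelianImage (ScalarExt.lift R K (H ⋙ genericFibre R K B)) := by
  refine (isAlmostFullyFaithful_comp K H).hasAbelianImage ?_ (fun X Y => ?_)
    (fun {X Y} f => ?_) (fun {X Y} f => ?_)
  · obtain ⟨X, ⟨e⟩⟩ := hH.zero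
    refine ⟨X, (genericFibre R K B).map_isZero (IsZero.of_iso ?_ e)⟩
    exact ⟨fun Y => ⟨⟨⟨0⟩, fun f => hom_ext fun m => map_zero (linMap f)⟩⟩,
      fun Y => ⟨⟨⟨0⟩, fun f => hom_ext fun m => rfl⟩⟩⟩
  · obtain ⟨Z, ⟨e⟩⟩ := hH.prod X Y
    let b := prodBicone (H.obj X) (H.obj Y)
    have hb : b.fst ≫ b.inl + b.snd ≫ b.inr = 𝟙 _ := hom_ext fun m =>
      Prod.ext (add_zero m.1) (zero_add m.2)
    have hb' := isBinaryBilimitOfTotal ((genericFibre R K B).mapBinaryBicone b)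
      (Eq.trans (by
        rw [Functor.map_add, Functor.map_comp, Functor.map_comp]; rfl)
        ((congrArg (genericFibre R K B).map hb).trans ((genericFibre R K B).map_id _)))
    exact ⟨Z, (genericFibre R K B).map (e.hom ≫ b.fst), (genericFibre R K B).map (e.hom ≫ b.snd),
      ⟨hb'.isLimit.ofIsoLimit (BinaryFan.ext ((genericFibre R K B).mapIso e.symm)
        ((congrArg (genericFibre R K B).map (e.inv_hom_id_assoc b.fst)).symm.trans
          ((genericFibre R K B).map_comp _ _))
        ((congrArg (genericFibre R K B).map (e.inv_hom_id_assoc b.snd)).symm.trans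
          ((genericFibre R K B).map_comp _ _)))⟩⟩
  · obtain ⟨r, hr, Z, ⟨e⟩⟩ := hH.ker f
    let i : H.obj Z ⟶ H.obj X := e.hom ≫ kerι (r • H.map f)
    have hi : i ≫ (r • H.map f) = 0 := by rw [Category.assoc, kerι_comp, comp_zero]
    have he : Function.Bijective (linMap e.hom) := bijective_linMap_hom e
    have hr' : algebraMap R K r ≠ 0 := by
      rwa [Ne, FaithfulSMul.algebraMap_eq_zero_iff R K]
    refine ⟨Z, (genericFibre R K B).map i, CategoryTheory.isLimit_kernelFork_of_smul hr'
      (ScalarExt.IsLinearAlong.map_smul (K := K) r (H.map f)) _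
      (by rw [← Functor.map_comp, hi, Functor.map_zero])
      (genericFibre_isLimit i _ _ ((kerι_injective _).comp he.1) fun m => ⟨fun hm => ?_, ?_⟩)⟩
    · obtain ⟨z, rfl⟩ := exists_kerι _ hm
      obtain ⟨z, rfl⟩ := he.2 z
      exact ⟨z, rfl⟩
    · rintro ⟨z, rfl⟩
      rw [← linMap_comp, hi]; rfl
  · obtain ⟨Z, ⟨e⟩⟩ := hH.coker f
    let q : H.obj Y ⟶ H.obj Z := cokerπ (H.map f) ≫ e.inv
    have hq : H.map f ≫ q = 0 := by rw [← Category.assoc, comp_cokerπ, zero_comp]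
    have he : Function.Bijective (linMap e.inv) := bijective_linMap_hom e.symm
    refine ⟨Z, (genericFibre R K B).map q, _, genericFibre_isColimit (H.map f) q
      (by rw [← Functor.map_comp, hq, Functor.map_zero])
      (he.2.comp (cokerπ_surjective _)) fun m => ⟨fun hm => ?_, ?_⟩⟩
    · exact exists_of_cokerπ _ (he.1 (hm.trans (map_zero _).symm))
    · rintro ⟨z, rfl⟩
      rw [← linMap_comp, hq]; rfl

/-- Objects of `C` have duals in the essential image over `K`. -/
theorem IsAlmostRigidAbelian.exists_exactPairing (hH : IsAlmostRigidAbelian H)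
    (hproj : ∀ X : (derGeneric K R B).Diff, Module.Projective (K ⊗[R] B) X.module)
    (X : ScalarExt R K C) : ∃ Y, Nonempty (ExactPairing
      ((ScalarExt.lift R K (H ⋙ genericFibre R K B)).obj X)
      ((ScalarExt.lift R K (H ⋙ genericFibre R K B)).obj Y)) := by
  obtain ⟨Y, ⟨e⟩⟩ := hH.dual X.as
  obtain ⟨h⟩ := nonempty_exactPairing_genericFibre hproj (H.obj X.as)
  exact ⟨.of Y, ⟨@exactPairingCongrRight _ _ _ _ _ _ h ((genericFibre R K B).mapIso e)⟩⟩

end GenericFibreImage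
end DiffRing

/-! ### Integrable connections as differential modules -/

namespace Calculus
namespace Pairing
variable {B A : Type u} [CommRing B] [CommRing A] [Algebra B A] {𝒜 : Calculus B A}
  {𝒟 : DiffRing B A} (π : 𝒜.Pairing 𝒟)

/-- Dual families of vector fields and one-forms. -/
structure DualFamilies (n : ℕ) where
  x : Fin n → 𝒟.Δ
  ω : Fin n → 𝒜.Ω
  sum_ω : ∀ η, ∑ j, π.φ (x j) η • ω j = η
  sum_x : ∀ y, ∑ j, π.φ y (ω j) • x j = y

variable {π} {n : ℕ} (b : π.DualFamilies n) {M : Type u} [AddCommGroup M] [Module A M]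

namespace DualFamilies
include b

/-- An element of `M ⊗ Ω` is determined by its contractions with the dual family. -/
theorem sum_contract (z : M ⊗[A] 𝒜.Ω) : ∑ j, contract M (π.φ (b.x j)) z ⊗ₜ[A] b.ω j = z := by
  induction z using TensorProduct.induction_on with
  | zero => simp
  | add z z' h h' =>
    conv_rhs => rw [← h, ← h', ← Finset.sum_add_distrib]
    simp only [map_add, TensorProduct.add_tmul]
  | tmul m η =>
    conv_rhs => rw [← b.sum_ω η, TensorProduct.tmul_sum]
    exact Finset.sum_congr rfl fun j _ => by
      rw [contract_tmul, TensorProduct.smul_tmul]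

/-- A two-form is determined by its values on pairs of vector fields. -/
theorem sum_wedge (w : ⋀[A]^2 𝒜.Ω) :
    ∑ j, ∑ k with j < k, wedgeForm (π.φ (b.x j)) (π.φ (b.x k)) w • wedge A 𝒜.Ω (b.ω j) (b.ω k) =
      w := by
  let T : ⋀[A]^2 𝒜.Ω →ₗ[A] ⋀[A]^2 𝒜.Ω := ∑ j, ∑ k with j < k,
    (wedgeForm (π.φ (b.x j)) (π.φ (b.x k))).smulRight (wedge A 𝒜.Ω (b.ω j) (b.ω k))
  have hT : T = LinearMap.id := by
    refine exteriorPower.linearMap_ext (AlternatingMap.ext fun v => ?_)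
    obtain ⟨η, θ, rfl⟩ : ∃ η θ, v = ![η, θ] := ⟨v 0, v 1, by ext i; fin_cases i <;> rfl⟩
    change T (wedge A 𝒜.Ω η θ) = wedge A 𝒜.Ω η θ
    let a := fun j => π.φ (b.x j) η
    let c := fun j => π.φ (b.x j) θ
    let f : Fin n → Fin n → ⋀[A]^2 𝒜.Ω := fun j k => (a j * c k) • wedge A 𝒜.Ω (b.ω j) (b.ω k)
    have h1 : T (wedge A 𝒜.Ω η θ) = ∑ j, ∑ k with j < k, (f j k + f k j) := by
      simp only [T, LinearMap.sum_apply, LinearMap.smulRight_apply]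
      refine Finset.sum_congr rfl fun j _ => Finset.sum_congr rfl fun k _ => ?_
      rw [wedgeForm_wedge, sub_smul, sub_eq_add_neg, ← smul_neg, ← wedge_swap]
      simp only [f, a, c, mul_comm]
    have h2 : wedge A 𝒜.Ω η θ = ∑ j, ∑ k, f j k := by
      conv_lhs => rw [← b.sum_ω η, ← b.sum_ω θ]
      rw [map_sum (wedge A 𝒜.Ω), LinearMap.sum_apply]
      refine Finset.sum_congr rfl fun j _ => ?_
      rw [map_sum]
      refine Finset.sum_congr rfl fun k _ => ?_
      rw [map_smul, map_smul, LinearMap.smul_apply, smul_smul, mul_comm]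
    have h3 : ∀ j, f j j = 0 := fun j => by simp only [f, wedge_self, smul_zero]
    have h4 : ∀ j k, f j k = (if j < k then f j k else 0) + if k < j then f j k else 0 := by
      intro j k
      rcases lt_trichotomy j k with h | h | h
      · rw [if_pos h, if_neg h.not_gt, add_zero]
      · subst h; simp [h3]
      · rw [if_pos h, if_neg h.not_gt, zero_add]
    rw [h1, h2]
    have h5 : ∑ j, ∑ k, f j k = (∑ j, ∑ k, if j < k then f j k else 0) +
        ∑ j, ∑ k, if k < j then f j k else 0 := by
      rw [← Finset.sum_add_distrib]
      refine Finset.sum_congr rfl fun j _ => ?_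
      rw [← Finset.sum_add_distrib]
      exact Finset.sum_congr rfl fun k _ => h4 j k
    rw [h5, Finset.sum_comm (f := fun j k => if k < j then f j k else 0),
      ← Finset.sum_add_distrib]
    refine Finset.sum_congr rfl fun j _ => ?_
    rw [← Finset.sum_add_distrib, Finset.sum_filter]
    refine Finset.sum_congr rfl fun k _ => ?_
    split_ifs <;> simp
  have := LinearMap.congr_fun hT w
  simpa only [T, LinearMap.sum_apply, LinearMap.smulRight_apply, LinearMap.id_apply] using this

/-- Two-forms with values in a module vanish if all their values on pairs of vector fields do. -/
theorem eq_zero_of_contract (z : M ⊗[A] (⋀[A]^2 𝒜.Ω))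
    (h : ∀ x y, TensorProduct.rid A M ((wedgeForm (π.φ x) (π.φ y)).lTensor M z) = 0) : z = 0 := by
  have key : ∀ z : M ⊗[A] (⋀[A]^2 𝒜.Ω), ∑ j, ∑ k with j < k,
      TensorProduct.rid A M ((wedgeForm (π.φ (b.x j)) (π.φ (b.x k))).lTensor M z) ⊗ₜ[A]
        wedge A 𝒜.Ω (b.ω j) (b.ω k) = z := by
    intro z
    induction z using TensorProduct.induction_on with
    | zero => simp
    | add z z' h h' =>
      conv_rhs => rw [← h, ← h', ← Finset.sum_add_distrib]
      simp only [map_add, TensorProduct.add_tmul, Finset.sum_add_distrib]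
    | tmul m w =>
      conv_rhs => rw [← b.sum_wedge w]
      simp only [TensorProduct.tmul_sum]
      refine Finset.sum_congr rfl fun j _ => Finset.sum_congr rfl fun k _ => ?_
      rw [LinearMap.lTensor_tmul, TensorProduct.rid_tmul, TensorProduct.smul_tmul]
  rw [← key z]
  simp only [h, TensorProduct.zero_tmul, Finset.sum_const_zero]

/-- The connection attached to a differential module. -/
def preConn (s : 𝒟.DiffMod M) : 𝒜.PreConn M where
  nabla := AddMonoidHom.mk' (fun m => ∑ j, s.act (b.x j) m ⊗ₜ[A] b.ω j) fun m m' => by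
    simp only [map_add, TensorProduct.add_tmul, Finset.sum_add_distrib]
  leibniz a m := by
    simp only [AddMonoidHom.mk'_apply, s.leibniz, TensorProduct.add_tmul, Finset.sum_add_distrib,
      Finset.smul_sum, TensorProduct.smul_tmul']
    rw [add_comm]
    congr 1
    conv_rhs => rw [← b.sum_ω (𝒜.d a), TensorProduct.tmul_sum]
    exact Finset.sum_congr rfl fun j _ => by rw [π.φ_d, TensorProduct.smul_tmul]

theorem preConn_along (s : 𝒟.DiffMod M) (y : 𝒟.Δ) (m : M) :
    (b.preConn s).along (π.φ y) m = s.act y m := by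
  rw [PreConn.along_apply]
  change contract M (π.φ y) (∑ j, s.act (b.x j) m ⊗ₜ[A] b.ω j) = _
  conv_rhs => rw [← b.sum_x y]
  simp only [map_sum, contract_tmul, map_smul]
  rw [AddMonoidHom.finset_sum_apply]
  rfl

/-- By Cartan's formula the value of the curvature on `x` and `y` is the failure of `[x, y]` to act
as the commutator of `x` and `y`. -/
theorem preConn_integrable (s : 𝒟.DiffMod M) : (b.preConn s).Integrable := fun m => by
  refine b.eq_zero_of_contract _ fun x y => ?_
  rw [π.contract_nabla1, ← PreConn.along_apply, ← PreConn.along_apply, ← PreConn.along_apply,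
    b.preConn_along, b.preConn_along, b.preConn_along, b.preConn_along, b.preConn_along,
    s.act_lie, sub_self]

/-- The object with integrable connection attached to a differential module. -/
def toConn (X : 𝒟.Diff) : 𝒜.Conn :=
  ⟨X.module, ⟨b.preConn X.diffMod, inferInstance, b.preConn_integrable _⟩⟩

/-- The differential module attached to the connection of a differential module. -/
def toDiffToConn (X : 𝒟.Diff) : π.toDiff.obj (b.toConn X) ≅ X :=
  ModuleTheory.mkIso (Iso.refl X.module) fun x m => b.preConn_along X.diffMod x m

theorem horizontal_of_equivariant {N : Type u} [AddCommGroup N] [Module A N] {s : 𝒜.PreConn M}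
    {t : 𝒜.PreConn N} (f : M →ₗ[A] N)
    (h : ∀ y m, f (s.along (π.φ y) m) = t.along (π.φ y) (f m)) : s.Horizontal t f := fun m => by
  rw [← b.sum_contract (f.rTensor _ _), ← b.sum_contract (t.nabla _)]
  refine Finset.sum_congr rfl fun j _ => ?_
  rw [contract_rTensor]
  exact congrArg (· ⊗ₜ[A] b.ω j) (h (b.x j) m)

/-- If vector fields and one-forms are dual to each other then integrable connections are the same
as differential modules. -/
theorem isEquivalence_toDiff : π.toDiff.IsEquivalence where
  faithful := ⟨fun {X Y f g} h =>
    Subtype.ext (congrArg (fun q : π.toDiff.obj X ⟶ π.toDiff.obj Y => q.1) h)⟩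
  full := ⟨fun {X Y} f => ⟨⟨f.1, b.horizontal_of_equivariant (s := X.str.toPreConn)
    (t := Y.str.toPreConn) f.1.hom fun y m => f.2 y m⟩, rfl⟩⟩
  essSurj := ⟨fun X => ⟨b.toConn X, ⟨b.toDiffToConn X⟩⟩⟩

end DualFamilies
end Pairing
end Calculus

/-! ### Dual families of vector fields and one-forms -/

/-- The dual basis lemma for finite projective modules. -/
theorem Module.Projective.exists_sum_smul_eq (A M : Type*) [CommRing A] [AddCommGroup M]
    [Module A M] [Module.Finite A M] [Module.Projective A M] :
    ∃ (n : ℕ) (f : Fin n → M →ₗ[A] A) (e : Fin n → M), ∀ m, ∑ j, f j m • e j = m := by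
  obtain ⟨n, g, hg⟩ := Module.Finite.exists_fin' A M
  obtain ⟨s, hs⟩ := Module.projective_lifting_property g LinearMap.id hg
  refine ⟨n, fun j => LinearMap.proj j ∘ₗ s, fun j => g (Pi.single j 1), fun m => ?_⟩
  have h1 : ∀ v : Fin n → A, ∑ j, v j • g (Pi.single j 1) = g v := fun v => by
    conv_rhs => rw [pi_eq_sum_univ' v, map_sum]
    exact Finset.sum_congr rfl fun j _ => by rw [map_smul]
  exact (h1 (s m)).trans (LinearMap.congr_fun hs m)

namespace Calculus
section Derivations
variable {R B : Type u} [CommRing R] [CommRing B] [Algebra R B] {𝒜 : Calculus R B}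

/-- The derivation defined by a linear form on one-forms. -/
def derivationOfForm (f : 𝒜.Ω →ₗ[B] B) : Derivation R B B where
  toFun a := f (𝒜.d a)
  map_add' a b := by rw [map_add, map_add]
  map_smul' r b := by rw [𝒜.d_smul, map_smul, algebraMap_smul]; rfl
  map_one_eq_zero' := (congrArg f 𝒜.d_one).trans (map_zero f)
  leibniz' a b := by
    change f (𝒜.d (a * b)) = a • f (𝒜.d b) + b • f (𝒜.d a)
    rw [𝒜.d_mul, map_add, map_smul, map_smul]

theorem Pairing.φ_derivationOfForm (π : 𝒜.Pairing (DiffRing.der R B)) (f : 𝒜.Ω →ₗ[B] B) :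
    π.φ (derivationOfForm f) = f :=
  LinearMap.ext_on_range 𝒜.span_d fun a => (π.φ_d (derivationOfForm f) a)

/-- A dual basis of the projective module of one-forms gives dual families, as linear forms on
one-forms are derivations. -/
theorem exists_dualFamilies [Module.Finite B 𝒜.Ω] [Module.Projective B 𝒜.Ω]
    (π : 𝒜.Pairing (DiffRing.der R B)) : ∃ n, Nonempty (π.DualFamilies n) := by
  obtain ⟨n, f, e, h⟩ := Module.Projective.exists_sum_smul_eq B 𝒜.Ω
  refine ⟨n, ⟨⟨fun j => derivationOfForm (f j), e, fun η => ?_,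
    fun y => Derivation.ext fun a => ?_⟩⟩⟩
  · conv_rhs => rw [← h η]
    exact Finset.sum_congr rfl fun j _ => by rw [π.φ_derivationOfForm]
  · have h1 := π.φ_d y a
    conv_lhs at h1 => rw [← h (𝒜.d a), map_sum]
    refine Eq.trans ?_ h1
    rw [← Derivation.coeFnAddMonoidHom_apply, map_sum, Finset.sum_apply]
    refine Finset.sum_congr rfl fun j _ => ?_
    change π.φ y (e j) * f j (𝒜.d a) = _
    rw [map_smul, smul_eq_mul, mul_comm]

attribute [local instance] Algebra.TensorProduct.rightAlgebra DiffRing.genericModule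

/-- Base change of dual families to the generic fibre. -/
def Pairing.DualFamilies.generic (K : Type u) [CommRing K] [Algebra R K]
    {π : 𝒜.Pairing (DiffRing.der R B)} {n : ℕ} (b : π.DualFamilies n) :
    (π.generic K).DualFamilies n where
  x j := (1 : K) ⊗ₜ[R] b.x j
  ω j := (1 : K ⊗[R] B) ⊗ₜ[B] b.ω j
  sum_ω := by
    let g : Fin n → (K ⊗[R] B) ⊗[B] 𝒜.Ω →ₗ[K ⊗[R] B] K ⊗[R] B := fun j =>
      (π.generic K).φ ((1 : K) ⊗ₜ[R] b.x j)
    have hg : ∀ η, ∑ j, g j η • ((1 : K ⊗[R] B) ⊗ₜ[B] b.ω j) = η := fun η => by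
      induction η using TensorProduct.induction_on with
      | zero => simp
      | add η η' h h' =>
        conv_rhs => rw [← h, ← h', ← Finset.sum_add_distrib]
        exact Finset.sum_congr rfl fun j _ => by rw [map_add, add_smul]
      | tmul a η =>
        conv_rhs => rw [← b.sum_ω η, TensorProduct.tmul_sum]
        refine Finset.sum_congr rfl fun j _ => ?_
        change ((1 ⊗ₜ[R] 1) * (π.φ (b.x j) η • a)) • ((1 : K ⊗[R] B) ⊗ₜ[B] b.ω j) = _
        rw [← Algebra.TensorProduct.one_def, one_mul, TensorProduct.smul_tmul', smul_eq_mul,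
          mul_one, TensorProduct.smul_tmul]
    exact hg
  sum_x := by
    let g : Fin n → K ⊗[R] Derivation R B B →ₗ[K ⊗[R] B] K ⊗[R] B := fun j =>
      LinearMap.applyₗ ((1 : K ⊗[R] B) ⊗ₜ[B] b.ω j) ∘ₗ (π.generic K).φ
    have hg : ∀ y, ∑ j, g j y • ((1 : K) ⊗ₜ[R] b.x j) = y := fun y => by
      induction y using TensorProduct.induction_on with
      | zero => simp only [map_zero, zero_smul, Finset.sum_const_zero]
      | add y y' h h' =>
        conv_rhs => rw [← h, ← h', ← Finset.sum_add_distrib]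
        exact Finset.sum_congr rfl fun j _ => by rw [map_add, add_smul]
      | tmul k y =>
        conv_rhs => rw [← b.sum_x y, TensorProduct.tmul_sum]
        refine Finset.sum_congr rfl fun j _ => ?_
        change ((k ⊗ₜ[R] 1) * (π.φ y (b.ω j) • (1 : K ⊗[R] B))) • ((1 : K) ⊗ₜ[R] b.x j) = _
        rw [Algebra.TensorProduct.one_def, DiffRing.smul_tmul_one,
          Algebra.TensorProduct.tmul_mul_tmul, mul_one, one_mul, DiffRing.generic_smul_tmul,
          mul_one]
    exact hg

end Derivations
end Calculus

section
variable (p : ℕ) (R A : Type u) [CommRing R] [CommRing A] [Algebra R A] [IsNoetherianRing R]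
  [Algebra.Smooth R A]

theorem exists_dualFamilies_completedPairing :
    ∃ n, Nonempty ((completedPairing p R A).DualFamilies n) :=
  haveI : Module.Finite (PCompletion p A) (completedCalculus p R A).Ω := finite_ΩCompletion p R A
  haveI : Module.Projective (PCompletion p A) (completedCalculus p R A).Ω :=
    projective_ΩCompletion p R A
  Calculus.exists_dualFamilies _

instance : (completedPairing p R A).toDiff.IsEquivalence := by
  obtain ⟨n, ⟨b⟩⟩ := exists_dualFamilies_completedPairing p R A
  exact b.isEquivalence_toDiff

instance (K : Type u) [CommRing K] [Algebra R K] :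
    ((completedPairing p R A).generic K).toDiff.IsEquivalence := by
  obtain ⟨n, ⟨b⟩⟩ := exists_dualFamilies_completedPairing p R A
  exact (b.generic K).isEquivalence_toDiff
end

/-! ### Tensor functors and equivalences -/

section
open Limits ZeroObject

/-- The closure conditions are void for essentially surjective functors. -/
theorem HasAbelianImage.of_essSurj {C : Type v} [Category.{u} C] {D : Type v} [Category.{u} D]
    [Abelian D] (F : C ⥤ D) [F.EssSurj] : HasAbelianImage F where
  zero := ⟨F.objPreimage 0, (isZero_zero D).of_iso (F.objObjPreimageIso 0)⟩
  prod X Y := ⟨F.objPreimage (F.obj X ⨯ F.obj Y), (F.objObjPreimageIso _).hom ≫ prod.fst,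
    (F.objObjPreimageIso _).hom ≫ prod.snd, ⟨(prodIsProd _ _).ofIsoLimit
      (BinaryFan.ext (F.objObjPreimageIso _).symm (by simp) (by simp))⟩⟩
  ker f := ⟨F.objPreimage (kernel f), (F.objObjPreimageIso _).hom ≫ kernel.ι f, by simp,
    ⟨(kernelIsKernel f).ofIsoLimit (Fork.ext (F.objObjPreimageIso _).symm (by simp))⟩⟩
  coker f := ⟨F.objPreimage (cokernel f), cokernel.π f ≫ (F.objObjPreimageIso _).inv, by simp,
    ⟨(cokernelIsCokernel f).ofIsoColimit (Cofork.ext (F.objObjPreimageIso _).symm (by simp))⟩⟩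

/-- Full faithfulness and exactness of a tensor functor may be checked after composition with such
a functor. -/
theorem IsFullyFaithfulTensorExact.of_comp {K : Type u} [Field K]
    {C : Type v} [Category.{u} C] [Preadditive C] [Linear K C] [MonoidalCategory C]
    [SymmetricCategory C] {D : Type v} [Category.{u} D] [Preadditive D] [Linear K D]
    [MonoidalCategory D] [SymmetricCategory D] {E : Type v} [Category.{u} E] [Preadditive E]
    [Linear K E] [MonoidalCategory E] [SymmetricCategory E]
    {F : C ⥤ D} [F.Braided] [F.Additive] [F.Linear K] {Q : D ⥤ E} [Q.Full] [Q.Faithful]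
    [PreservesFiniteLimits Q] [PreservesFiniteColimits Q] {G : C ⥤ E} [G.Braided]
    (hG : IsFullyFaithfulTensorExact K G) (e : F ⋙ Q ≅ G) :
    IsFullyFaithfulTensorExact K F := by
  have := hG.full
  have := hG.faithful
  have := hG.preservesFiniteLimits
  have := hG.preservesFiniteColimits
  have : (F ⋙ Q).Full := Functor.Full.of_iso e.symm
  have : (F ⋙ Q).Faithful := Functor.Faithful.of_iso e.symm
  have : PreservesFiniteLimits (F ⋙ Q) := preservesFiniteLimits_of_natIso e.symm
  have : PreservesFiniteColimits (F ⋙ Q) := preservesFiniteColimits_of_natIso e.symm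
  have : ReflectsFiniteLimits Q := ⟨fun _ _ _ => inferInstance⟩
  have : ReflectsFiniteColimits Q := { }
  exact
    { full := Functor.Full.of_comp_faithful F Q
      faithful := Functor.Faithful.of_comp F Q
      additive := inferInstance
      linear := inferInstance
      preservesFiniteLimits := preservesFiniteLimits_of_reflects_of_preserves F Q
      preservesFiniteColimits := preservesFiniteColimits_of_reflects_of_preserves F Q }

theorem IsFullyFaithfulTensorExact.of_isEquivalence {K : Type u} [Field K]
    {C : Type v} [Category.{u} C] [Preadditive C] [Linear K C] [MonoidalCategory C]
    [SymmetricCategory C] {D : Type v} [Category.{u} D] [Preadditive D] [Linear K D]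
    [MonoidalCategory D] [SymmetricCategory D]
    (F : C ⥤ D) [F.Braided] [F.Additive] [F.Linear K] [F.IsEquivalence] :
    IsFullyFaithfulTensorExact K F :=
  ⟨inferInstance, inferInstance, inferInstance, inferInstance, inferInstance, inferInstance⟩

end

namespace ScalarExt
variable {R K : Type u} [CommRing R] [CommRing K] [Algebra R K]
variable {C : Type v} [Category.{u} C] [Preadditive C] [Linear R C]
variable {D : Type v} [Category.{u} D] [Preadditive D] [Linear R D]

/-- The functor induced on extensions of scalars is `F` on numerators. -/
theorem lift_ι_map_hom (F : C ⥤ D) [F.Additive] [F.Linear R] {X Y : ScalarExt R K C} (k : K)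
    (f : X.as ⟶ Y.as) :
    (lift R K (F ⋙ ι R K D)).map (hom k f : X ⟶ Y) = (hom k (F.map f) : of _ ⟶ of _) := by
  rw [lift_map_hom]
  exact (smul_hom (X := of _) (Y := of _) k 1 (F.map f)).trans (by rw [mul_one])

/-- Equivalences of `R`-linear categories induce equivalences of their extensions of scalars. -/
theorem isEquivalence_lift (F : C ⥤ D) [F.Additive] [F.Linear R] [F.IsEquivalence] :
    (lift R K (F ⋙ ι R K D)).IsEquivalence := by
  have key : ∀ X Y : ScalarExt R K C, Function.Bijective
      (fun f : X ⟶ Y => (lift R K (F ⋙ ι R K D)).map f) := by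
    intro X Y
    let e : (X.as ⟶ Y.as) ≃ₗ[R] (F.obj X.as ⟶ F.obj Y.as) :=
      LinearEquiv.ofBijective (F.mapLinearMap R)
        ((Functor.FullyFaithful.ofFullyFaithful F).map_bijective _ _)
    have he : ∀ f : X ⟶ Y, (lift R K (F ⋙ ι R K D)).map f = e.lTensor K f := fun f => by
      induction f using hom_induction with
      | zero => rw [Functor.map_zero]; exact (map_zero (e.lTensor K)).symm
      | add f g hf hg => rw [Functor.map_add, hf, hg]; exact (map_add (e.lTensor K) f g).symm
      | tmul k f => exact lift_ι_map_hom F k f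
    have : (fun f : X ⟶ Y => (lift R K (F ⋙ ι R K D)).map f) = e.lTensor K := funext he
    rw [this]
    exact (e.lTensor K).bijective
  exact
    { faithful := ⟨fun {X Y} => (key X Y).1⟩
      full := ⟨fun {X Y} => (key X Y).2⟩
      essSurj := ⟨fun Y => ⟨of (F.objPreimage Y.as),
        ⟨(ι R K D).mapIso (F.objObjPreimageIso Y.as)⟩⟩⟩ }

/-- Extension of scalars is compatible with composition. -/
def liftCompIso {E : Type v} [Category.{u} E] [Preadditive E] [Linear K E] (F : C ⥤ D) [F.Additive]
    [F.Linear R] (G : D ⥤ E) [IsLinearAlong R K G] :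
    lift R K (F ⋙ ι R K D) ⋙ lift R K G ≅ lift R K (F ⋙ G) :=
  NatIso.ofComponents (fun X => Iso.refl (G.obj (F.obj X.as))) fun {X Y} f => by
    refine (Category.comp_id _).trans (Eq.trans ?_ (Category.id_comp _).symm)
    induction f using hom_induction with
    | zero => rw [Functor.map_zero, Functor.map_zero]; rfl
    | add f g hf hg => rw [Functor.map_add, Functor.map_add, hf, hg]; rfl
    | tmul k f =>
      rw [Functor.comp_map, lift_ι_map_hom]; rfl

end ScalarExt

/-! ### Compatibility of base change with the passage to differential modules -/

section Square
open DiffRing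
attribute [local instance] Algebra.TensorProduct.rightAlgebra genericModule
variable {R B : Type u} [CommRing R] [CommRing B] [Algebra R B] {𝒜 : Calculus R B}
  (K : Type u) [CommRing K] [Algebra R K] (π : 𝒜.Pairing (der R B))

theorem Calculus.Pairing.generic_φ_tmul (k : K) (x : Derivation R B B) (a : K ⊗[R] B) (ω : 𝒜.Ω) :
    (π.generic K).φ (k ⊗ₜ[R] x : K ⊗[R] Derivation R B B) (a ⊗ₜ[B] ω) =
      (k ⊗ₜ[R] (1 : B)) * (π.φ x ω • a) := rfl

theorem Calculus.Pairing.contract_generic_ι {M : Type u} [AddCommGroup M] [Module B M] (k : K)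
    (x : Derivation R B B) (w : M ⊗[B] 𝒜.Ω) :
    Calculus.contract ((K ⊗[R] B) ⊗[B] M)
      ((π.generic K).φ (k ⊗ₜ[R] x : K ⊗[R] Derivation R B B)) ((𝒜.genericHom K).ι M w) =
      (k ⊗ₜ[R] (1 : B)) ⊗ₜ[B] Calculus.contract M (π.φ x) w := by
  induction w using TensorProduct.induction_on with
  | zero => simp
  | add w w' h h' => simp only [map_add, TensorProduct.tmul_add, h, h']
  | tmul m ω =>
    rw [Calculus.Hom.ι_tmul, Calculus.contract_tmul, Calculus.contract_tmul]
    refine (congrArg (· • ((1 : K ⊗[R] B) ⊗ₜ[B] m))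
      (π.generic_φ_tmul K k x (1 : K ⊗[R] B) ω)).trans ?_
    rw [TensorProduct.tmul_smul, TensorProduct.smul_tmul', TensorProduct.smul_tmul', mul_smul_comm,
      mul_one, smul_eq_mul, mul_one]

/-- The differential module of the base change of a connection is the base change of its
differential module. -/
theorem Calculus.Pairing.pullback_along_generic {M : Type u} [AddCommGroup M] [Module B M]
    (s : 𝒜.PreConn M) (hs : s.Integrable) (Y : K ⊗[R] Derivation R B B)
    (z : (K ⊗[R] B) ⊗[B] M) :
    ((𝒜.genericHom K).pullback s).along ((π.generic K).φ Y) z =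
      ((π.diffMod s hs).generic K).act Y z := by
  let T := (π.generic K).diffMod ((𝒜.genericHom K).pullback s)
    ((𝒜.genericHom K).pullback_integrable hs)
  change T.act Y z = ((π.diffMod s hs).generic K).act Y z
  induction Y using TensorProduct.induction_on with
  | zero =>
    exact (DFunLike.congr_fun (map_zero T.act) z).trans
      (DFunLike.congr_fun (map_zero ((π.diffMod s hs).generic K).act) z).symm
  | add Y Y' h h' =>
    exact (DFunLike.congr_fun (map_add T.act Y Y') z).trans ((congrArg₂ (· + ·) h h').trans
      (DFunLike.congr_fun (map_add ((π.diffMod s hs).generic K).act Y Y') z).symm)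
  | tmul k x =>
  induction z using generic_induction with
  | zero => rw [map_zero, map_zero]
  | add z z' h h' => rw [map_add, map_add, h, h']
  | tmul l m =>
    refine Eq.trans ?_ (DiffMod.generic_act K (π.diffMod s hs) k x l m).symm
    change Calculus.contract _ _ (((𝒜.genericHom K).pullback s).nabla _) = _
    have hd : (𝒜.generic K).d (l ⊗ₜ[R] (1 : B)) = 0 := by
      change 𝒜.genericD K _ = 0
      rw [𝒜.genericD_tmul K, 𝒜.d_one, TensorProduct.tmul_zero]
    rw [(𝒜.genericHom K).pullback_nabla s, hd, TensorProduct.tmul_zero, add_zero, map_smul,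
      π.contract_generic_ι K, TensorProduct.smul_tmul', smul_eq_mul,
      Algebra.TensorProduct.tmul_mul_tmul, mul_one, mul_comm l]
    rfl

end Square

section CompletedSquare
attribute [local instance] Algebra.TensorProduct.rightAlgebra DiffRing.genericModule
variable (p : ℕ) (R A : Type u) [CommRing R] [CommRing A] [Algebra R A] [IsNoetherianRing R]
  [Algebra.Smooth R A] (K : Type u) [CommRing K] [Algebra R K]

/-- The square of base change functors and passages to differential modules commutes. -/
def squareIso : connBaseChange p R A K ⋙ connToDiffK p R A K ≅
    connToDiff p R A K ⋙ diffBaseChange p R A K :=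
  NatIso.ofComponents
    (fun X => ModuleTheory.mkIso
      (X := (connBaseChange p R A K ⋙ connToDiffK p R A K).obj X)
      (Y := (connToDiff p R A K ⋙ diffBaseChange p R A K).obj X)
      (Iso.refl ((bcFunctor (PCompletion p A) (K ⊗[R] PCompletion p A)).obj X.as.module))
      fun Y z => (completedPairing p R A).pullback_along_generic K X.as.str.toPreConn
        X.as.str.integrable Y z)
    fun {X Y} f => by
      induction f using ScalarExt.hom_induction with
      | zero => rw [Functor.map_zero, Functor.map_zero, Limits.zero_comp, Limits.comp_zero]
      | add f g hf hg =>
        rw [Functor.map_add, Functor.map_add, Preadditive.add_comp, Preadditive.comp_add, hf, hg]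
      | tmul k f =>
        rw [Functor.comp_map, Functor.comp_map]
        refine Eq.trans ?_ (congrArg (_ ≫ ·) (congrArg (diffBaseChange p R A K).map
          (ScalarExt.lift_ι_map_hom (completedPairing p R A).toDiff k f))).symm
        rfl

theorem connToDiff_ε : Functor.LaxMonoidal.ε (connToDiff p R A K) =
    ScalarExt.hom 1 (Functor.LaxMonoidal.ε (completedPairing p R A).toDiff) :=
  (Functor.LaxMonoidal.comp_ε (completedPairing p R A).toDiff (ScalarExt.ι R K (DiffD p R A))).trans
    (Category.id_comp _)

theorem connToDiff_μ (X Y : ScalarExt R K (ConnD p R A)) :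
    Functor.LaxMonoidal.μ (connToDiff p R A K) X Y =
      ScalarExt.hom 1 (Functor.LaxMonoidal.μ (completedPairing p R A).toDiff X.as Y.as) :=
  (Functor.LaxMonoidal.comp_μ (completedPairing p R A).toDiff (ScalarExt.ι R K (DiffD p R A))
    X.as Y.as).trans (Category.id_comp _)

theorem squareIso_isMonoidal : NatTrans.IsMonoidal (squareIso p R A K).hom where
  unit := by
    rw [Functor.LaxMonoidal.comp_ε, Functor.LaxMonoidal.comp_ε, connToDiff_ε]
    refine Eq.trans ?_ (congrArg (_ ≫ ·) (ScalarExt.lift_map_one (K := K)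
      (DiffRing.genericTransport K R (PCompletion p A)).functor
      (Functor.LaxMonoidal.ε (completedPairing p R A).toDiff))).symm
    exact DiffRing.hom_ext fun m => rfl
  tensor X Y := by
    rw [Functor.LaxMonoidal.comp_μ, Functor.LaxMonoidal.comp_μ, connToDiff_μ]
    refine Eq.trans ?_ (congrArg (fun z => ((squareIso p R A K).hom.app X ⊗ₘ
      (squareIso p R A K).hom.app Y) ≫ Functor.LaxMonoidal.μ (diffBaseChange p R A K)
        ((connToDiff p R A K).obj X) ((connToDiff p R A K).obj Y) ≫ z)
      (ScalarExt.lift_map_one (K := K)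
        (DiffRing.genericTransport K R (PCompletion p A)).functor
        (Functor.LaxMonoidal.μ (completedPairing p R A).toDiff X.as Y.as))).symm
    exact Subtype.ext (bc_hom_ext₂ (PCompletion p A) (M := X.as.module) (N := Y.as.module)
      fun m n => rfl)

end CompletedSquare

/-! ### The square of categories -/

namespace DiffRing
section
attribute [local instance] Algebra.TensorProduct.rightAlgebra genericModule
variable {R K B : Type u} [CommRing R] [IsDomain R] [IsNoetherianRing R] [Field K] [CharZero K]
  [Algebra R K] [IsFractionRing R K] [CommRing B] [Algebra R B] [IsNoetherianRing B]

instance isNoetherianRing_generic : IsNoetherianRing (K ⊗[R] B) :=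
  IsLocalization.isNoetherianRing (Algebra.algebraMapSubmonoid B (nonZeroDivisors R)) _
    inferInstance

variable {C : Type (u + 1)} [Category.{u} C] [Preadditive C] [Linear R C] [MonoidalCategory C]
  [MonoidalPreadditive C] [MonoidalLinear R C] [SymmetricCategory C]
  {H : C ⥤ (der R B).Diff} [H.Full] [H.Faithful] [H.Additive] [H.Linear R] [H.Braided]

theorem IsAlmostRigidAbelian.isFullyFaithfulTensorExact (hH : IsAlmostRigidAbelian H) :
    IsFullyFaithfulTensorExact K (ScalarExt.lift R K (H ⋙ genericFibre R K B)) := by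
  have := (isAlmostFullyFaithful_comp K H).lift_full
  have := (isAlmostFullyFaithful_comp K H).lift_faithful
  exact (hH.hasAbelianImage K).isFullyFaithfulTensorExact _

theorem IsAlmostRigidAbelian.isTannakian (hH : IsAlmostRigidAbelian H)
    (h𝒟 : (derGeneric K R B).IsSimple) : IsTannakian K (ScalarExt R K C) := by
  have := (isAlmostFullyFaithful_comp K H).lift_full
  have := (isAlmostFullyFaithful_comp K H).lift_faithful
  refine h𝒟.isTannakian.of_fullyFaithful (ScalarExt.lift R K (H ⋙ genericFibre R K B))
    (hH.hasAbelianImage K) (hH.exists_exactPairing fun X => ?_)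
  exact h𝒟.projective (fun n hn => by
    have h := (isUnit_iff_ne_zero.mpr (Nat.cast_ne_zero.mpr hn : (n : K) ≠ 0)).map
      (algebraMap K (K ⊗[R] B))
    rwa [map_natCast] at h) X.diffMod

/-- For the category of all differential modules the closure conditions are void. -/
theorem isAlmostRigidAbelian_of_essSurj {C : Type (u + 1)} [Category.{u} C] [Preadditive C]
    [Linear R C] (H : C ⥤ (der R B).Diff) [H.EssSurj] : IsAlmostRigidAbelian H :=
  ⟨Functor.EssSurj.mem_essImage H _, fun _ _ => Functor.EssSurj.mem_essImage H _,
    fun _ => ⟨1, one_ne_zero, Functor.EssSurj.mem_essImage H _⟩,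
    fun _ => Functor.EssSurj.mem_essImage H _, fun _ => Functor.EssSurj.mem_essImage H _⟩

end
end DiffRing

section TannakianSquare
open DiffRing
attribute [local instance] Algebra.TensorProduct.rightAlgebra DiffRing.genericModule
variable {p : ℕ} [Fact p.Prime] {R A K : Type u} [CommRing R] [IsDomain R] [IsNoetherianRing R]
  [CommRing A] [Algebra R A] [Algebra.Smooth R A] [Field K] [CharZero K] [Algebra R K]
  [IsFractionRing R K] [IsNoetherianRing (PCompletion p A)]

instance connToDiff_isEquivalence : (connToDiff p R A K).IsEquivalence :=
  ScalarExt.isEquivalence_lift _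

theorem diffBaseChange_isFullyFaithfulTensorExact :
    IsFullyFaithfulTensorExact K (diffBaseChange p R A K) :=
  have h := (isAlmostRigidAbelian_of_essSurj (R := R)
    (𝟭 (DiffD p R A))).isFullyFaithfulTensorExact (K := K)
  ⟨h.full, h.faithful, h.additive, h.linear, h.preservesFiniteLimits, h.preservesFiniteColimits⟩

theorem isTannakian_connDK (h𝒟 : (derGeneric K R (PCompletion p A)).IsSimple) :
    IsTannakian K (ConnDK p R A K) := by
  refine h𝒟.isTannakian.of_fullyFaithful (connToDiffK p R A K) (.of_essSurj _) fun X => ?_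
  obtain ⟨h⟩ := h𝒟.isTannakian.rigid
  let Y := (connToDiffK p R A K).objPreimage ((connToDiffK p R A K).obj X)ᘁ
  exact ⟨Y, ⟨exactPairingCongrRight ((connToDiffK p R A K).objObjPreimageIso _)⟩⟩

/-- The assertions about the square, given that the generic fibre is simple and that the
quasi-nilpotent connections are closed under the operations of an abelian rigid category up to
scalars. The first two horizontal functors are compared with the base change of differential modules
to the generic fibre, which is fully faithful and exact. -/
theorem isTannakian_square (h𝒟 : (derGeneric K R (PCompletion p A)).IsSimple)
    (hQ : IsAlmostRigidAbelian ((topQuasiNilpotent p R A).ι ⋙ (completedPairing p R A).toDiff)) :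
    IsTannakian K (ScalarExt R K (QNC p R A)) ∧
    IsTannakian K (ScalarExt R K (ConnD p R A)) ∧
    IsTannakian K (ConnDK p R A K) ∧
    IsTannakian K (ScalarExt R K (DiffD p R A)) ∧
    IsTannakian K (DiffDK p R A K) ∧
    IsFullyFaithfulTensorExact K (inclusionFunctor p R A K) ∧
    IsFullyFaithfulTensorExact K (connBaseChange p R A K) ∧
    IsFullyFaithfulTensorExact K (diffBaseChange p R A K) ∧
    IsFullyFaithfulTensorExact K (connToDiff p R A K) ∧ (connToDiff p R A K).IsEquivalence ∧
    IsFullyFaithfulTensorExact K (connToDiffK p R A K) ∧ (connToDiffK p R A K).IsEquivalence ∧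
    ∃ e : connBaseChange p R A K ⋙ connToDiffK p R A K ≅
        connToDiff p R A K ⋙ diffBaseChange p R A K,
      NatTrans.IsMonoidal e.hom := by
  have hC : IsAlmostRigidAbelian (completedPairing p R A).toDiff :=
    isAlmostRigidAbelian_of_essSurj (R := R) _
  have hCK := hC.isFullyFaithfulTensorExact (K := K)
  refine ⟨hQ.isTannakian h𝒟, hC.isTannakian h𝒟, isTannakian_connDK h𝒟,
    (isAlmostRigidAbelian_of_essSurj (R := R) (𝟭 (DiffD p R A))).isTannakian h𝒟, h𝒟.isTannakian,
    ?_, ?_, diffBaseChange_isFullyFaithfulTensorExact, .of_isEquivalence _, inferInstance,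
    .of_isEquivalence _, inferInstance, squareIso p R A K, squareIso_isMonoidal p R A K⟩
  · have := hCK.full
    have := hCK.faithful
    have := hCK.preservesFiniteLimits
    have := hCK.preservesFiniteColimits
    exact .of_comp (Q := ScalarExt.lift R K
      ((completedPairing p R A).toDiff ⋙ genericFibre R K (PCompletion p A)))
      hQ.isFullyFaithfulTensorExact (ScalarExt.liftCompIso _ _)
  · exact .of_comp hCK (squareIso p R A K ≪≫ ScalarExt.liftCompIso _ _)

end TannakianSquare

/-! ### Permanence of topological quasi-nilpotence -/

section Saturated

/-- The map `f` is injective, with a cokernel without `p`-torsion. -/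
def IsSaturatedAt {B M N : Type u} [CommRing B] [AddCommGroup M] [Module B M]
    [AddCommGroup N] [Module B N] (p : ℕ) (f : M →ₗ[B] N) : Prop :=
  Function.Injective f ∧ ∀ (n : ℕ) (m : M) (v : N), (p : B) ^ n • v = f m → ∃ m', f m' = v

variable {B : Type u} [CommRing B] {p : ℕ} {M N : Type u} [AddCommGroup M] [Module B M]
  [AddCommGroup N] [Module B N] {f : M →ₗ[B] N}

/-- If `f m` is divisible by `pⁿ` then it is `pⁿ f y` for some `y`, so `m = pⁿ y`. -/
theorem IsSaturatedAt.injective_baseChange_quotient (hf : IsSaturatedAt p f) (n : ℕ) :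
    Function.Injective (f.baseChange (B ⧸ Ideal.span {(p : B) ^ n})) := by
  let I := Ideal.span {(p : B) ^ n}
  have key : ∀ {L : Type u} [AddCommGroup L] [Module B L] (l : L),
      (1 : B ⧸ I) ⊗ₜ[B] l = 0 ↔ ∃ l' : L, (p : B) ^ n • l' = l := by
    intro L _ _ l
    rw [← (TensorProduct.quotTensorEquivQuotSMul L I).map_eq_zero_iff]
    change TensorProduct.quotTensorEquivQuotSMul L I (Ideal.Quotient.mk I 1 ⊗ₜ[B] l) = 0 ↔ _
    rw [TensorProduct.quotTensorEquivQuotSMul_mk_tmul, one_smul, Submodule.Quotient.mk_eq_zero,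
      Submodule.ideal_span_singleton_smul, Submodule.mem_smul_pointwise_iff_exists]
    simp
  rw [injective_iff_map_eq_zero]
  intro z hz
  obtain ⟨m, rfl⟩ : ∃ m : M, (1 : B ⧸ I) ⊗ₜ[B] m = z := by
    clear hz
    induction z using TensorProduct.induction_on with
    | zero => exact ⟨0, TensorProduct.tmul_zero _ _⟩
    | tmul a m =>
      obtain ⟨b, rfl⟩ := Ideal.Quotient.mk_surjective a
      refine ⟨b • m, ?_⟩
      rw [← TensorProduct.smul_tmul, Algebra.smul_def, mul_one]; rfl
    | add z z' h h' =>
      obtain ⟨m, rfl⟩ := h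
      obtain ⟨m', rfl⟩ := h'
      exact ⟨m + m', TensorProduct.tmul_add _ _ _⟩
  rw [LinearMap.baseChange_tmul, key] at hz
  obtain ⟨v, hv⟩ := hz
  obtain ⟨m', rfl⟩ := hf.2 n m v hv
  exact (key m).mpr ⟨m', hf.1 (by rw [map_smul, hv])⟩

/-- Saturated maps remain injective over algebras which are flat modulo a power of `p`. -/
theorem IsSaturatedAt.injective_baseChange (hf : IsSaturatedAt p f) (n : ℕ) (C : Type u)
    [CommRing C] [Algebra B C] [Algebra (B ⧸ Ideal.span {(p : B) ^ n}) C]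
    [IsScalarTower B (B ⧸ Ideal.span {(p : B) ^ n}) C]
    [Module.Flat (B ⧸ Ideal.span {(p : B) ^ n}) C] :
    Function.Injective (f.baseChange C) := by
  let B' := B ⧸ Ideal.span {(p : B) ^ n}
  let eM := AlgebraTensorModule.cancelBaseChange B B' C C M
  let eN := AlgebraTensorModule.cancelBaseChange B B' C C N
  have h : f.baseChange C = eN.toLinearMap ∘ₗ (f.baseChange B').baseChange C ∘ₗ
      eM.symm.toLinearMap := by
    refine TensorProduct.AlgebraTensorModule.ext fun c m => ?_
    simp [eM, eN]
  rw [h]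
  exact eN.injective.comp ((Module.Flat.lTensor_preserves_injective_linearMap (M := C) _
    (hf.injective_baseChange_quotient n)).comp eM.symm.injective)

end Saturated

/-- The base change of a horizontal pairing satisfies the Leibniz rule. -/
theorem Calculus.Hom.exists_pairing {B A B' A' : Type u} [CommRing B] [CommRing A] [Algebra B A]
    [CommRing B'] [CommRing A'] [Algebra B' A'] [Algebra A A'] {𝒜 : Calculus B A}
    {𝒜' : Calculus B' A'} (φ : 𝒜.Hom 𝒜') {M N : Type u} [AddCommGroup M] [Module A M]
    [AddCommGroup N] [Module A N] {s : 𝒜.PreConn M} {t : 𝒜.PreConn N} (e : M ⊗[A] N →ₗ[A] A)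
    (he : (s.tensor t).Horizontal (PreConn.unit 𝒜) e) :
    ∃ q : A' ⊗[A] M →ₗ[A'] A' ⊗[A] N →ₗ[A'] A',
      (∀ m n, q ((1 : A') ⊗ₜ[A] m) ((1 : A') ⊗ₜ[A] n) = algebraMap A A' (e (m ⊗ₜ[A] n))) ∧
      ∀ (x : 𝒜'.Ω →ₗ[A'] A') z w, (PreConn.unit 𝒜').along x (q z w) =
        q ((φ.pullback s).along x z) w + q z ((φ.pullback t).along x w) := by
  let μ := (AlgebraTensorModule.distribBaseChange A A' M N).symm.toLinearMap
  have hμ : ∀ m n, μ (((1 : A') ⊗ₜ[A] m) ⊗ₜ[A'] ((1 : A') ⊗ₜ[A] n)) =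
      (1 : A') ⊗ₜ[A] (m ⊗ₜ[A] n) := fun m n =>
    (AlgebraTensorModule.distribBaseChange A A' M N).symm_apply_eq.mpr rfl
  let ρ := (AlgebraTensorModule.rid A A' A').toLinearMap
  have hμ' : ((φ.pullback s).tensor (φ.pullback t)).Horizontal (φ.pullback (s.tensor t)) μ := by
    refine PreConn.horizontal_of_span _ _ span_one_tmul_one ?_
    rintro _ ⟨⟨m, n⟩, rfl⟩
    exact φ.μ_horizontal_aux μ hμ m n
  have hρ : (φ.pullback (PreConn.unit 𝒜)).Horizontal (PreConn.unit 𝒜') ρ := by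
    refine PreConn.horizontal_of_span _ _ span_one_tmul ?_
    rintro _ ⟨a, rfl⟩
    have h : ρ ((1 : A') ⊗ₜ[A] a) = algebraMap A A' a :=
      (Algebra.algebraMap_eq_smul_one a).symm
    have h1 : ρ ((1 : A') ⊗ₜ[A] (1 : A)) = 1 := one_smul A (1 : A')
    rw [pullback_nabla_one, PreConn.unit_nabla, h, PreConn.unit_nabla, ι_tmul,
      LinearMap.rTensor_tmul, h1, φ.f_d]
  refine ⟨TensorProduct.curry (ρ ∘ₗ e.baseChange A' ∘ₗ μ), fun m n => ?_, fun x z w => ?_⟩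
  · change ρ (e.baseChange A' (μ (((1 : A') ⊗ₜ[A] m) ⊗ₜ[A'] ((1 : A') ⊗ₜ[A] n)))) = _
    rw [hμ]
    exact (Algebra.algebraMap_eq_smul_one _).symm
  · change (PreConn.unit 𝒜').along x (ρ (e.baseChange A' (μ (z ⊗ₜ[A'] w)))) = _
    rw [PreConn.along_horizontal hρ, PreConn.along_horizontal (φ.horizontal_baseChange he),
      PreConn.along_horizontal hμ', PreConn.along_tensor, map_add, map_add, map_add]
    rfl

section QuasiNilpotentClosure
open DiffRing
variable {p : ℕ} {R A : Type u} [CommRing R] [CommRing A] [Algebra R A] [IsNoetherianRing R]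
  [Algebra.Smooth R A] {X Y Z : ConnD p R A}

/-- The linear map underlying a morphism of connections. -/
abbrev connMap (f : X ⟶ Y) : X.module →ₗ[PCompletion p A] Y.module := f.1.hom

theorem horizontal_openReduction (f : X ⟶ Y) (n : ℕ)
    (g : PCompletion p A ⧸ Ideal.span {(p : PCompletion p A) ^ n}) :
    ((openReduction p R A n g).pullback X.str.toPreConn).Horizontal
      ((openReduction p R A n g).pullback Y.str.toPreConn)
      ((connMap f).baseChange (Localization.Away g)) :=
  (openReduction p R A n g).horizontal_baseChange f.2

/-- Quotients of topologically quasi-nilpotent connections are topologically quasi-nilpotent. -/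
theorem topQuasiNilpotent_of_surjective (f : X ⟶ Y) (hf : Function.Surjective (connMap f))
    (hX : topQuasiNilpotent p R A X) : topQuasiNilpotent p R A Y := fun n g d x b hb i y => by
  obtain ⟨z, rfl⟩ := LinearMap.lTensor_surjective (Localization.Away g) hf y
  exact Calculus.PreConn.NilAt.map (horizontal_openReduction f n g) (hX n g d x b hb i z)

/-- Saturated subobjects of topologically quasi-nilpotent connections are topologically
quasi-nilpotent, since they are subobjects of the reductions modulo `pⁿ`. -/
theorem topQuasiNilpotent_of_isSaturatedAt (f : X ⟶ Y) (hf : IsSaturatedAt p (connMap f))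
    (hY : topQuasiNilpotent p R A Y) : topQuasiNilpotent p R A X := fun n g d x b hb i z => by
  obtain ⟨k, hk⟩ := hY n g d x b hb i ((connMap f).baseChange _ z)
  refine ⟨k, hf.injective_baseChange n (Localization.Away g) ?_⟩
  rw [map_zero, ← hk]
  exact ((Function.Semiconj.iterate_right (f := (connMap f).baseChange (Localization.Away g))
    (ga := ((openReduction p R A n g).pullback X.str.toPreConn).along (b.coord i))
    (gb := ((openReduction p R A n g).pullback Y.str.toPreConn).along (b.coord i))
    (fun m => (Calculus.PreConn.along_horizontal
      (horizontal_openReduction f n g) _ m).symm) k) z)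

/-- Sums of topologically quasi-nilpotent connections are topologically quasi-nilpotent. -/
theorem topQuasiNilpotent_of_sum (f : X ⟶ Z) (g : Y ⟶ Z)
    (h : ∀ z, ∃ x y, z = connMap f x + connMap g y) (hX : topQuasiNilpotent p R A X)
    (hY : topQuasiNilpotent p R A Y) : topQuasiNilpotent p R A Z := fun n l d x b hb i z => by
  have : ∃ x y,
      z = (connMap f).baseChange (Localization.Away l) x + (connMap g).baseChange _ y := by
    induction z using TensorProduct.induction_on with
    | zero => exact ⟨0, 0, by rw [map_zero, map_zero, add_zero]⟩
    | add z z' h h' =>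
      obtain ⟨x, y, rfl⟩ := h
      obtain ⟨x', y', rfl⟩ := h'
      exact ⟨x + x', y + y', by rw [map_add, map_add]; abel⟩
    | tmul c m =>
      obtain ⟨x, y, rfl⟩ := h m
      exact ⟨c ⊗ₜ x, c ⊗ₜ y, TensorProduct.tmul_add _ _ _⟩
  obtain ⟨v, w, rfl⟩ := this
  exact .add (.map (horizontal_openReduction f n l) (hX n l d x b hb i v))
    (.map (horizontal_openReduction g n l) (hY n l d x b hb i w))

theorem topQuasiNilpotent_of_subsingleton (h : ∀ x : X.module, x = 0) :
    topQuasiNilpotent p R A X := fun n l d x b hb i z => ⟨0, by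
  change z = 0
  induction z using TensorProduct.induction_on with
  | zero => rfl
  | add z z' h h' => rw [h, h', add_zero]
  | tmul c m => rw [h m, TensorProduct.tmul_zero]⟩

/-- If the values of a horizontal pairing are nilpotent and `m` is killed by a power of the
covariant derivative, so is the pairing of all high derivatives of `z` with `m`. -/
theorem exists_forall_pairing_iterate_eq_zero {M N P : Type*} [AddCommGroup M] [AddCommGroup N]
    [AddCommGroup P] (δ : M → M) (ε : N → N) (θ : P →+ P) (q : M → N →+ P)
    (hq : ∀ z m, θ (q z m) = q (δ z) m + q z (ε m)) (hθ : ∀ c, ∃ k, θ^[k] c = 0)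
    (a : ℕ) (z : M) (m : N) (hm : ε^[a] m = 0) : ∃ K, ∀ k ≥ K, q (δ^[k] z) m = 0 := by
  induction a generalizing m with
  | zero => exact ⟨0, fun k _ => by rw [show m = 0 from hm, map_zero]⟩
  | succ a ih =>
    obtain ⟨K, hK⟩ := ih (ε m) hm
    obtain ⟨l, hl⟩ := hθ (q (δ^[K] z) m)
    have key : ∀ j, q (δ^[K + j] z) m = θ^[j] (q (δ^[K] z) m) := fun j => by
      induction j with
      | zero => rfl
      | succ j ih =>
        rw [Function.iterate_succ_apply' θ, ← ih, hq, hK _ (Nat.le_add_right _ _), add_zero,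
          ← Function.iterate_succ_apply' δ]
        rfl
    -- beyond `K` the derivatives of the pairing are the pairings of the derivatives of `z`
    refine ⟨K + l, fun k hk => ?_⟩
    obtain ⟨j, rfl⟩ := Nat.exists_eq_add_of_le hk
    rw [add_assoc, key, add_comm l j, Function.iterate_add_apply, hl, iterate_map_zero]

/-- Evaluation at generators embeds the dual of a finite module as a saturated submodule of a
free module. -/
theorem isSaturatedAt_pi {B : Type u} [CommRing B] (hp : ∀ b : B, (p : B) * b = 0 → b = 0)
    {M W ι : Type u} [AddCommGroup M] [Module B M] [AddCommGroup W] [Module B W]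
    (e : W →ₗ[B] M →ₗ[B] B) (he : Function.Bijective e) (m : ι → M)
    (hm : Submodule.span B (Set.range m) = ⊤) :
    IsSaturatedAt p (LinearMap.pi fun i => (LinearMap.applyₗ (m i)) ∘ₗ e) := by
  have hp' : ∀ (n : ℕ) (b : B), (p : B) ^ n * b = 0 → b = 0 := fun n => by
    induction n with
    | zero => exact fun b hb => by rwa [pow_zero, one_mul] at hb
    | succ n ih => exact fun b hb => ih b (hp _ (by rwa [← mul_assoc, ← pow_succ']))
  refine ⟨(injective_iff_map_eq_zero _).mpr fun w hw => ?_, fun n w v hv => ?_⟩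
  · refine (map_eq_zero_iff e he.1).mp (LinearMap.ext_on_range hm fun i => ?_)
    exact congrFun hw i
  · have h1 : ∀ x : M, ∃ b : B, (p : B) ^ n * b = e w x := fun x => by
      have hx : x ∈ Submodule.span B (Set.range m) := hm ▸ trivial
      induction hx using Submodule.span_induction with
      | mem x hx =>
        obtain ⟨i, rfl⟩ := hx
        exact ⟨v i, congrFun hv i⟩
      | zero => exact ⟨0, by rw [mul_zero, map_zero]⟩
      | add x y _ _ hx hy =>
        obtain ⟨b, hb⟩ := hx
        obtain ⟨c, hc⟩ := hy
        exact ⟨b + c, by rw [mul_add, hb, hc, map_add]⟩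
      | smul r x _ hx =>
        obtain ⟨b, hb⟩ := hx
        exact ⟨r * b, by rw [mul_left_comm, hb, map_smul, smul_eq_mul]⟩
    choose g hg using h1
    have hinj : ∀ {b c : B}, (p : B) ^ n * b = (p : B) ^ n * c → b = c := fun {b c} h =>
      sub_eq_zero.mp (hp' n _ (by rw [mul_sub, h, sub_self]))
    obtain ⟨w', hw'⟩ := he.2
      { toFun := g
        map_add' := fun x y => hinj (by rw [hg, mul_add, hg, hg, map_add])
        map_smul' := fun r x => hinj (by
          rw [hg, map_smul, smul_eq_mul, RingHom.id_apply, smul_eq_mul, mul_left_comm, hg]) }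
    refine ⟨w', funext fun i => ?_⟩
    change e w' (m i) = v i
    rw [hw']
    exact hinj ((hg _).trans (congrFun hv i).symm)

/-- The base change of a perfect pairing to an algebra which is flat modulo a power of `p` is
nondegenerate. -/
theorem exists_forall_eq_zero_of_pairing {B : Type u} [CommRing B]
    (hp : ∀ b : B, (p : B) * b = 0 → b = 0)
    {M W : Type u} [AddCommGroup M] [Module B M] [Module.Finite B M] [AddCommGroup W] [Module B W]
    (e : W →ₗ[B] M →ₗ[B] B) (he : Function.Bijective e) (n : ℕ) (C : Type u) [CommRing C]
    [Algebra B C] [Algebra (B ⧸ Ideal.span {(p : B) ^ n}) C]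
    [IsScalarTower B (B ⧸ Ideal.span {(p : B) ^ n}) C]
    [Module.Flat (B ⧸ Ideal.span {(p : B) ^ n}) C]
    (q : C ⊗[B] W →ₗ[C] C ⊗[B] M →ₗ[C] C)
    (hq : ∀ y x, q ((1 : C) ⊗ₜ[B] y) ((1 : C) ⊗ₜ[B] x) = algebraMap B C (e y x)) :
    ∃ (r : ℕ) (m : Fin r → M), ∀ w, (∀ j, q w ((1 : C) ⊗ₜ[B] m j) = 0) → w = 0 := by
  obtain ⟨r, m, hm⟩ := Module.Finite.exists_fin (R := B) (M := M)
  refine ⟨r, m, fun w hw => ?_⟩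
  have hsat := isSaturatedAt_pi hp e he (fun j : ULift.{u} (Fin r) => m j.down) (by
    rw [← hm]; congr 1; ext; simp)
  refine hsat.injective_baseChange n C ?_
  rw [map_zero]
  apply (TensorProduct.piScalarRight B C C (ULift.{u} (Fin r))).injective
  rw [map_zero]
  funext j
  rw [Pi.zero_apply, ← hw j.down]
  clear hw
  induction w using TensorProduct.induction_on with
  | zero => simp
  | add v v' h h' => simp only [map_add, Pi.add_apply, LinearMap.add_apply, h, h']
  | tmul c y =>
    have e1 : c ⊗ₜ[B] y = c • ((1 : C) ⊗ₜ[B] y) := by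
      rw [TensorProduct.smul_tmul', smul_eq_mul, mul_one]
    rw [e1, map_smul, map_smul, map_smul, LinearMap.smul_apply, hq, LinearMap.baseChange_tmul]
    simp [Algebra.algebraMap_eq_smul_one]

/-- Duals of topologically quasi-nilpotent connections are topologically quasi-nilpotent: a section
of the dual modulo `pⁿ` is zero if its pairing with finitely many generators is, and by the Leibniz
rule high derivatives pair to zero with each of these. -/
theorem topQuasiNilpotent_of_dual [Fact p.Prime]
    (hp : ∀ b : PCompletion p A, (p : PCompletion p A) * b = 0 → b = 0)
    (ev : Y ⊗ X ⟶ 𝟙_ (ConnD p R A))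
    (e : Y.module →ₗ[PCompletion p A] X.module →ₗ[PCompletion p A] PCompletion p A)
    (he : Function.Bijective e)
    (hev : ∀ (y : Y.module) (x : X.module), connMap ev (y ⊗ₜ[PCompletion p A] x) = e y x)
    (hX : topQuasiNilpotent p R A X) : topQuasiNilpotent p R A Y := fun n l d x b hb i z => by
  let B := PCompletion p A
  let C := Localization.Away l
  have hfin : Module.Finite B X.module := by
    have := X.str.finitePresentation
    infer_instance
  let sY := (openReduction p R A n l).pullback Y.str.toPreConn
  let sX := (openReduction p R A n l).pullback X.str.toPreConn
  obtain ⟨q, hq1, hq2⟩ := (openReduction p R A n l).exists_pairing (s := Y.str.toPreConn)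
    (t := X.str.toPreConn) (connMap ev) ev.2
  obtain ⟨r, m, hm⟩ := exists_forall_eq_zero_of_pairing hp e he n C q
    fun y x => (hq1 y x).trans (congrArg _ (hev y x))
  have hθ := Calculus.nilpotentInCoordinates_unit (R := R) (Fact.out : p.Prime)
    (isNilpotent_localization p l) d x b hb i
  have h3 : ∀ j, ∃ K, ∀ k ≥ K, q ((sY.along (b.coord i))^[k] z) ((1 : C) ⊗ₜ[B] m j) = 0 := by
    intro j
    obtain ⟨a, ha⟩ := hX n l d x b hb i ((1 : C) ⊗ₜ[B] m j)
    exact exists_forall_pairing_iterate_eq_zero _ _ _ (fun z => (q z).toAddMonoidHom) (hq2 _) hθ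
      a z _ ha
  choose K hK using h3
  refine ⟨Finset.univ.sup K, ?_⟩
  exact hm _ fun j => hK j _ (Finset.le_sup (Finset.mem_univ j))

end QuasiNilpotentClosure

/-! ### The category of topologically quasi-nilpotent connections -/

section QuasiNilpotentImage
open DiffRing
variable {p : ℕ} {R A : Type u} [CommRing R] [CommRing A] [Algebra R A] [IsNoetherianRing R]
  [Algebra.Smooth R A]

theorem connMap_preimage {X Y : ConnD p R A} (g : (completedPairing p R A).toDiff.obj X ⟶
    (completedPairing p R A).toDiff.obj Y) :
    connMap ((completedPairing p R A).toDiff.preimage g) = linMap g :=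
  congrArg linMap ((completedPairing p R A).toDiff.map_preimage g)

/-- A differential module is in the image of the topologically quasi-nilpotent connections if every
connection defining it is topologically quasi-nilpotent. -/
theorem topQuasiNilpotent_essImage [Fact p.Prime] {W : DiffD p R A}
    (h : ∀ (X : ConnD p R A) (_ : (completedPairing p R A).toDiff.obj X ≅ W),
      topQuasiNilpotent p R A X) :
    ((topQuasiNilpotent p R A).ι ⋙ (completedPairing p R A).toDiff).essImage W :=
  ⟨⟨_, h _ ((completedPairing p R A).toDiff.objObjPreimageIso W)⟩,
    ⟨(completedPairing p R A).toDiff.objObjPreimageIso W⟩⟩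

theorem linMap_hom_linMap_comp_inv {B S : Type u} [CommRing B] [CommRing S] [Algebra B S]
    {𝒟 : DiffRing B S} {X Y Z : 𝒟.Diff} (e : Y ≅ Z) (g : X ⟶ Z) (x : X.module) :
    linMap e.hom (linMap (g ≫ e.inv) x) = linMap g x := by
  rw [← linMap_comp, Category.assoc, e.inv_hom_id, Category.comp_id]

attribute [local instance] Algebra.TensorProduct.rightAlgebra genericModule

/-- Topologically quasi-nilpotent connections are stable under the operations on connections, except
that only the kernels of suitable multiples of morphisms have a cokernel without `p`-torsion. -/
theorem isAlmostRigidAbelian_topQuasiNilpotent [IsDomain R] [CharZero R] [Fact p.Prime]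
    [IsNoetherianRing (PCompletion p A)]
    (hp : ∀ b : PCompletion p A, (p : PCompletion p A) * b = 0 → b = 0) :
    IsAlmostRigidAbelian ((topQuasiNilpotent p R A).ι ⋙ (completedPairing p R A).toDiff) where
  zero := topQuasiNilpotent_essImage fun X e => topQuasiNilpotent_of_subsingleton fun x =>
    (bijective_linMap_hom e).1 rfl
  prod X Y := topQuasiNilpotent_essImage fun Z e => by
    let T := (completedPairing p R A).toDiff
    let b := prodBicone (T.obj X.obj) (T.obj Y.obj)
    refine topQuasiNilpotent_of_sum (T.preimage (b.inl ≫ e.inv)) (T.preimage (b.inr ≫ e.inv))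
      (fun z => ⟨(linMap e.hom z).1, (linMap e.hom z).2, ?_⟩) X.property Y.property
    rw [connMap_preimage, connMap_preimage]
    apply (bijective_linMap_hom e).1
    refine Eq.trans ?_ (map_add (linMap e.hom) _ _).symm
    refine Eq.trans ?_ (congrArg₂ (· + ·) (linMap_hom_linMap_comp_inv e b.inl _)
      (linMap_hom_linMap_comp_inv e b.inr _)).symm
    exact Prod.ext (add_zero _).symm (zero_add _).symm
  ker {X Y} f := by
    let T := (completedPairing p R A).toDiff
    let K := FractionRing R
    have : Module.Finite (PCompletion p A) Y.obj.module := by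
      have := Y.obj.str.finitePresentation
      infer_instance
    have := isNoetherian_of_isNoetherianRing_of_finite (PCompletion p A) Y.obj.module
    -- `r` kills the torsion of the target, so that the kernel of `r • f` is saturated
    obtain ⟨r, hr, h⟩ := exists_forall_smul_eq_zero R K (B := PCompletion p A) (M := Y.obj.module)
    refine ⟨r, hr, topQuasiNilpotent_essImage fun Z e => ?_⟩
    let f' : T.obj X.obj ⟶ T.obj Y.obj := ((topQuasiNilpotent p R A).ι ⋙ T).map f
    refine topQuasiNilpotent_of_isSaturatedAt (T.preimage (e.hom ≫ kerι (r • f'))) ?_ X.property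
    rw [connMap_preimage]
    refine ⟨(kerι_injective _).comp (bijective_linMap_hom e).1, fun n m v hv => ?_⟩
    suffices hv' : linMap (r • f') v = 0 by
      obtain ⟨z, hz⟩ := exists_kerι _ hv'
      obtain ⟨z, rfl⟩ := (bijective_linMap_hom e).2 z
      exact ⟨z, hz⟩
    refine h (linMap f' v) ?_
    have h1 : linMap (r • f') ((p : PCompletion p A) ^ n • v) = 0 := by
      refine (congrArg (linMap (r • f')) hv).trans ?_
      exact DFunLike.congr_fun (congrArg linMap (show (e.hom ≫ kerι (r • f')) ≫ (r • f') = 0 by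
        rw [Category.assoc, kerι_comp, Limits.comp_zero])) m
    have h2 : algebraMap R (PCompletion p A) (r * p ^ n) • linMap f' v = 0 := by
      rw [map_mul, map_pow, map_natCast, mul_smul]
      exact (congrArg _ (map_smul (linMap f') _ v).symm).trans h1
    have h3 := congrArg (TensorProduct.mk (PCompletion p A) (K ⊗[R] PCompletion p A) _ 1) h2
    rw [map_smul, map_zero] at h3
    refine smul_left_injective_generic (K := K) (B := PCompletion p A) (mul_ne_zero hr
      (pow_ne_zero n (Nat.cast_ne_zero.mpr (Fact.out : p.Prime).ne_zero))) ?_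
    exact h3.trans (smul_zero _).symm
  coker {X Y} f := topQuasiNilpotent_essImage fun Z e => by
    let T := (completedPairing p R A).toDiff
    let f' : T.obj X.obj ⟶ T.obj Y.obj := ((topQuasiNilpotent p R A).ι ⋙ T).map f
    refine topQuasiNilpotent_of_surjective (T.preimage (cokerπ f' ≫ e.inv)) ?_ Y.property
    rw [connMap_preimage]
    exact (bijective_linMap_hom e.symm).2.comp (cokerπ_surjective f')
  dual X := topQuasiNilpotent_essImage fun Z e => by
    let T := (completedPairing p R A).toDiff
    refine topQuasiNilpotent_of_dual hp (T.preimage (X := Z ⊗ X.obj) (Y := 𝟙_ _)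
      (Functor.OplaxMonoidal.δ T Z X.obj ≫ e.hom ▷ T.obj X.obj ≫ dualEval (T.obj X.obj) ≫
        Functor.LaxMonoidal.ε T))
      (linMap e.hom) (bijective_linMap_hom e) (fun y x => ?_) X.property
    rw [connMap_preimage]
    rfl

end QuasiNilpotentImage

/-! ### Complete noetherian rings -/

section CompleteNakayama
open Submodule
variable {A : Type*} [CommRing A] {x : A} {M : Type*} [AddCommGroup M] [Module A M]

theorem mem_span_singleton_pow_smul_top {n : ℕ} {y : M} :
    y ∈ (Ideal.span {x} ^ n • ⊤ : Submodule A M) ↔ ∃ z, x ^ n • z = y := by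
  rw [Ideal.span_singleton_pow, ideal_span_singleton_smul, mem_smul_pointwise_iff_exists]
  simp

/-- Finite free modules over complete rings are complete; a coordinatewise limit suffices since the
ideal is principal. -/
theorem isPrecomplete_pi (ι : Type*) [IsPrecomplete (Ideal.span {x}) A] :
    IsPrecomplete (Ideal.span {x}) (ι → A) where
  prec' f hf := by
    have h : ∀ i, ∃ L : A, ∀ n, f n i ≡ L [SMOD (Ideal.span {x} ^ n • ⊤ : Submodule A A)] :=
      fun i => IsPrecomplete.prec (I := Ideal.span {x}) inferInstance fun {m n} hmn => by
        obtain ⟨z, hz⟩ := mem_span_singleton_pow_smul_top.mp (SModEq.sub_mem.mp (hf hmn))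
        exact SModEq.sub_mem.mpr (mem_span_singleton_pow_smul_top.mpr ⟨z i, congrFun hz i⟩)
    choose L hL using h
    refine ⟨L, fun n => SModEq.sub_mem.mpr (mem_span_singleton_pow_smul_top.mpr ?_)⟩
    choose z hz using fun i => mem_span_singleton_pow_smul_top.mp (SModEq.sub_mem.mp (hL i n))
    exact ⟨z, funext hz⟩

/-- Nakayama's lemma over complete rings. -/
theorem Module.Finite.of_isPrecomplete [IsPrecomplete (Ideal.span {x}) A]
    [IsHausdorff (Ideal.span {x}) M]
    [h : Module.Finite A (M ⧸ (Ideal.span {x} • ⊤ : Submodule A M))] : Module.Finite A M := by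
  obtain ⟨n, m, hm⟩ := Module.Finite.exists_fin (R := A)
    (M := M ⧸ (Ideal.span {x} • ⊤ : Submodule A M))
  choose m' hm' using fun i => Submodule.Quotient.mk_surjective _ (m i)
  have := isPrecomplete_pi (A := A) (x := x) (Fin n)
  refine .of_surjective (Fintype.linearCombination A m') (surjective_of_mkQ_comp_surjective
    (I := Ideal.span {x}) (LinearMap.range_eq_top.mp (top_le_iff.mp ?_)))
  rw [← hm, span_le]
  rintro _ ⟨i, rfl⟩
  exact ⟨Pi.single i 1, by simp [hm']⟩

/-- A ring which is complete with respect to a principal ideal is noetherian if its quotient by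
that ideal is. -/
theorem isNoetherianRing_of_isAdicComplete [IsAdicComplete (Ideal.span {x}) A]
    [IsNoetherianRing (A ⧸ Ideal.span {x})] : IsNoetherianRing A := by
  have hA : IsNoetherian A (A ⧸ Ideal.span {x}) :=
    ⟨fun N => by
      let N' : Submodule (A ⧸ Ideal.span {x}) (A ⧸ Ideal.span {x}) :=
        { N.toAddSubmonoid with
          smul_mem' := fun c m hm => by
            obtain ⟨a, rfl⟩ := Ideal.Quotient.mk_surjective c
            exact N.smul_mem a hm }
      exact (IsNoetherian.noetherian N').restrictScalars_of_surjective
        Ideal.Quotient.mk_surjective⟩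
  -- A prime `Q` not containing `x` satisfies `Q ∩ (x) = x Q`, so `Q / x Q` embeds into `A / (x)`.
  refine .of_prime fun Q hQ => ?_
  by_cases hx : x ∈ Q
  · refine fg_of_fg_map_of_fg_inf_ker (Ideal.span {x}).mkQ (IsNoetherian.noetherian _) ?_
    rw [ker_mkQ, inf_eq_right.mpr ((Ideal.span_singleton_le_iff_mem _).mpr hx)]
    exact fg_span_singleton _
  · have hker : ∀ q : Q, (Ideal.span {x}).mkQ q.1 = 0 →
        q ∈ (Ideal.span {x} • ⊤ : Submodule A Q) := by
      intro q hq
      obtain ⟨a, ha⟩ := Ideal.mem_span_singleton'.mp ((Submodule.Quotient.mk_eq_zero _).mp hq)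
      have haQ : a ∈ Q := (hQ.mem_or_mem (ha ▸ q.2 : a * x ∈ Q)).resolve_right hx
      rw [show q = x • (⟨a, haQ⟩ : Q) from Subtype.ext (ha.symm.trans (mul_comm _ _))]
      exact smul_mem_smul (Ideal.mem_span_singleton_self x) trivial
    have : IsHausdorff (Ideal.span {x}) Q := ⟨fun q hq => Subtype.ext
      (IsHausdorff.haus (I := Ideal.span {x}) (M := A) inferInstance q.1 fun n => by
        obtain ⟨z, hz⟩ := mem_span_singleton_pow_smul_top.mp (SModEq.zero.mp (hq n))
        exact SModEq.zero.mpr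
          (mem_span_singleton_pow_smul_top.mpr ⟨z.1, congrArg Subtype.val hz⟩))⟩
    let f : (Q ⧸ (Ideal.span {x} • ⊤ : Submodule A Q)) →ₗ[A] A ⧸ Ideal.span {x} :=
      liftQ _ ((Ideal.span {x}).mkQ ∘ₗ Q.subtype) (by
        rw [smul_le]
        rintro r hr q -
        exact (Submodule.Quotient.mk_eq_zero _).mpr (Ideal.mul_mem_right _ _ hr))
    have hf : Function.Injective f := LinearMap.ker_eq_bot.mp (ker_liftQ_eq_bot _ _ _ hker)
    have := Module.Finite.of_injective f hf
    exact (Submodule.fg_top Q).mp (Module.Finite.of_isPrecomplete (x := x) (M := Q)).fg_top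

end CompleteNakayama

section Completion
variable (p : ℕ) (A : Type u) [CommRing A]

theorem pCompletion_isAdicComplete :
    IsAdicComplete (Ideal.span {(p : PCompletion p A)}) (PCompletion p A) := by
  have h := AdicCompletion.isAdicComplete_self (Ideal.span {(p : A)})
    (Submodule.fg_span_singleton _)
  rwa [Ideal.map_span, Set.image_singleton, map_natCast] at h

/-- `A` is dense in its completion. -/
theorem algebraMap_pCompletion_surjective_mod (b : PCompletion p A) (n : ℕ) :
    ∃ a c, b = algebraMap A (PCompletion p A) a + p ^ n * c := by
  obtain ⟨a, c, h⟩ := exists_eq_of_add p A n b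
  exact ⟨a, c, h.trans (by rw [nsmul_eq_mul, Nat.cast_pow]; rfl)⟩

/-- The completion is noetherian, as it has the same quotient modulo `p` as `A`. -/
instance isNoetherianRing_pCompletion [IsNoetherianRing A] :
    IsNoetherianRing (PCompletion p A) := by
  have := pCompletion_isAdicComplete p A
  have : IsNoetherianRing (PCompletion p A ⧸ Ideal.span {(p : PCompletion p A)}) := by
    refine isNoetherianRing_of_surjective A _
      ((Ideal.Quotient.mk (Ideal.span {(p : PCompletion p A)})).comp (algebraMap A _)) fun b => ?_
    obtain ⟨b, rfl⟩ := Ideal.Quotient.mk_surjective b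
    obtain ⟨a, c, rfl⟩ := algebraMap_pCompletion_surjective_mod p A b 1
    refine ⟨a, (Ideal.Quotient.eq.mpr ?_)⟩
    rw [sub_add_cancel_left, pow_one, neg_mem_iff]
    exact Ideal.mul_mem_right _ _ (Ideal.mem_span_singleton_self _)
  exact isNoetherianRing_of_isAdicComplete (x := (p : PCompletion p A))

end Completion

/-! ### Idempotents of the generic fibre -/

/-- Elements of the generic fibre have a denominator. -/
theorem exists_one_tmul_eq_smul {R K B : Type u} [CommRing R] [IsDomain R] [Field K] [Algebra R K]
    [IsFractionRing R K] [AddCommGroup B] [Module R B] (z : K ⊗[R] B) :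
    ∃ r : R, r ≠ 0 ∧ ∃ b : B, (1 : K) ⊗ₜ[R] b = r • z := by
  have := (isLocalizedModule_iff_isBaseChange (nonZeroDivisors R) K _).mpr
    (TensorProduct.isBaseChange R B K)
  obtain ⟨⟨b, r⟩, h⟩ := IsLocalizedModule.surj (nonZeroDivisors R) (TensorProduct.mk R K B 1) z
  exact ⟨r, nonZeroDivisors.ne_zero r.2, b, h.symm⟩

section Flatness
variable (p : ℕ) (R A : Type u) [CommRing R] [CommRing A] [Algebra R A] [Algebra.Smooth R A]
  [IsNoetherianRing A]

theorem flat_pCompletion : Module.Flat R (PCompletion p A) := by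
  have := Algebra.Smooth.flat R A
  have := AdicCompletion.flat_of_isNoetherian (Ideal.span {(p : A)})
  exact .trans R A (PCompletion p A)

variable {R}

/-- The completion of a smooth algebra has no torsion, as it is flat. -/
theorem smul_pCompletion_injective [IsDomain R] {r : R} (hr : r ≠ 0) {b b' : PCompletion p A}
    (h : r • b = r • b') : b = b' := by
  have := flat_pCompletion p R A
  exact Module.Flat.isSMulRegular_of_nonZeroDivisors (mem_nonZeroDivisors_of_ne_zero hr) h

theorem includeRight_pCompletion_injective (K : Type u) [Field K] [Algebra R K] [FaithfulSMul R K] :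
    Function.Injective
      (Algebra.TensorProduct.includeRight : PCompletion p A →ₐ[R] K ⊗[R] PCompletion p A) := by
  have := flat_pCompletion p R A
  exact Algebra.TensorProduct.includeRight_injective (FaithfulSMul.algebraMap_injective R K)

end Flatness

section
variable (p : ℕ) {A : Type u} [CommRing A]

/-- `A / pⁿ = Â / pⁿ`, on the level of elements divisible by `pⁿ`. -/
theorem exists_eq_pow_mul_of_algebraMap_pCompletion {n : ℕ} {a : A} {c : PCompletion p A}
    (h : algebraMap A (PCompletion p A) a = p ^ n * c) : ∃ a', a = p ^ n * a' := by
  have h' := congrArg (AdicCompletion.evalₐ (Ideal.span {(p : A)}) n) h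
  rw [AlgHom.commutes, map_mul, map_pow, map_natCast] at h'
  have h0 : ((p : A ⧸ Ideal.span {(p : A)} ^ n)) ^ n = 0 := by
    rw [← map_natCast (Ideal.Quotient.mk (Ideal.span {(p : A)} ^ n)), ← map_pow]
    exact Ideal.Quotient.eq_zero_iff_mem.mpr
      (Ideal.pow_mem_pow (Ideal.mem_span_singleton_self _) n)
  rw [h0, zero_mul, Ideal.Quotient.algebraMap_eq, Ideal.Quotient.eq_zero_iff_mem,
    Ideal.span_singleton_pow, Ideal.mem_span_singleton] at h'
  exact h'

theorem eq_zero_of_forall_pow_dvd {b : PCompletion p A} (h : ∀ n, (p : PCompletion p A) ^ n ∣ b) :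
    b = 0 := by
  have := pCompletion_isAdicComplete p A
  refine IsHausdorff.haus (I := Ideal.span {(p : PCompletion p A)}) inferInstance b fun n => ?_
  obtain ⟨c, rfl⟩ := h n
  exact SModEq.zero.mpr (mem_span_singleton_pow_smul_top.mpr ⟨c, rfl⟩)

end

section DVR
variable {R : Type u} [CommRing R] [IsDomain R] [IsDiscreteValuationRing R]

theorem IsDiscreteValuationRing.exists_dvd_pow {r s : R} (hr : r ≠ 0)
    (hs : s ∈ IsLocalRing.maximalIdeal R) : ∃ n, r ∣ s ^ n := by
  obtain ⟨ϖ, hϖ⟩ := IsDiscreteValuationRing.exists_irreducible R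
  obtain ⟨n, hn⟩ := IsDiscreteValuationRing.associated_pow_irreducible hr hϖ
  rw [hϖ.maximalIdeal_eq, Ideal.mem_span_singleton] at hs
  exact ⟨n, hn.dvd.trans (pow_dvd_pow_of_dvd hs n)⟩

theorem IsDiscreteValuationRing.exists_pow_le_span {I : Ideal R} (hI : I ≠ ⊤) {s : R} (hs : s ≠ 0) :
    ∃ n, I ^ n ≤ Ideal.span {s} := by
  obtain ⟨ϖ, hϖ⟩ := IsDiscreteValuationRing.exists_irreducible R
  obtain ⟨n, hn⟩ := IsDiscreteValuationRing.associated_pow_irreducible hs hϖ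
  refine ⟨n, (Ideal.pow_right_mono (IsLocalRing.le_maximalIdeal hI) n).trans ?_⟩
  rw [hϖ.maximalIdeal_eq, Ideal.span_singleton_pow, Ideal.span_singleton_le_span_singleton]
  exact hn.dvd

end DVR

/-- A ring with connected spectrum has only the trivial idempotents. -/
theorem eq_zero_or_one_of_isIdempotentElem {A : Type u} [CommRing A]
    [ConnectedSpace (PrimeSpectrum A)] {e : A} (he : IsIdempotentElem e) : e = 0 ∨ e = 1 := by
  let E := PrimeSpectrum.isIdempotentElemEquivClopens (R := A)
  have key : ∀ f (hf : IsIdempotentElem f),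
      (E ⟨e, he⟩ : Set (PrimeSpectrum A)) = E ⟨f, hf⟩ → e = f := fun f hf h =>
    congrArg Subtype.val (E.injective (TopologicalSpace.Clopens.ext h))
  refine (isClopen_iff.mp (E ⟨e, he⟩).isClopen).imp (fun h => ?_) fun h => ?_
  · refine key 0 .zero (h.trans ?_)
    simp [E, PrimeSpectrum.coe_isIdempotentElemEquivClopens_apply]
  · refine key 1 .one (h.trans ?_)
    simp [E, PrimeSpectrum.coe_isIdempotentElemEquivClopens_apply]

section Idempotents
variable {R A : Type u} [CommRing R] [IsDomain R] [IsDiscreteValuationRing R]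
  [CommRing A] [Algebra R A] [Algebra.Smooth R A]

/-- A smooth algebra over a discrete valuation ring is integrally closed in its generic fibre;
this is the case of the quadratic equation `x² = x + c` of `x = a / r`. -/
theorem exists_eq_mul_of_sq_eq {r : R} (hr : r ≠ 0) {a c : A}
    (h : a * a = algebraMap R A r * a + algebraMap R A r ^ 2 * c) :
    ∃ a', a = algebraMap R A r * a' := by
  cases subsingleton_or_nontrivial A
  · exact ⟨0, Subsingleton.elim _ _⟩
  let K := FractionRing R
  let q : K := (algebraMap R K r)⁻¹
  have hq : r • q = 1 := by
    rw [Algebra.smul_def, mul_inv_cancel₀]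
    rwa [Ne, FaithfulSMul.algebraMap_eq_zero_iff R K]
  let x : A ⊗[R] K := a ⊗ₜ q
  have hr' : ∀ (y : A) (k : K), (algebraMap R A r * y) ⊗ₜ[R] k = y ⊗ₜ[R] (r • k) := fun y k => by
    rw [← Algebra.smul_def, TensorProduct.smul_tmul]
  have hx : x * x = x + algebraMap A (A ⊗[R] K) c := by
    rw [Algebra.TensorProduct.tmul_mul_tmul, h, TensorProduct.add_tmul, hr', pow_two, mul_assoc,
      hr', hr', ← smul_mul_assoc, hq, one_mul, hq]
    rfl
  have hint : IsIntegral A x := by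
    refine ⟨Polynomial.X ^ 2 - (Polynomial.X + Polynomial.C c), ?_, ?_⟩
    · exact Polynomial.monic_X_pow_sub (n := 2)
        ((Polynomial.degree_X_add_C c).trans_lt (by norm_num))
    · simp [pow_two, hx]
  obtain ⟨y, hy⟩ :=
    (TensorProduct.toIntegralClosure_bijective_of_smooth (R := R) (S := A) (B := K)).2 ⟨x, hint⟩
  have hy' : ∀ y : A ⊗[R] integralClosure R K, ∃ a' : A,
      (TensorProduct.toIntegralClosure R A K y : A ⊗[R] K) = a' ⊗ₜ 1 := fun y => by
    induction y with
    | zero => exact ⟨0, by simp⟩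
    | add y z hy hz =>
      obtain ⟨⟨a₁, h₁⟩, a₂, h₂⟩ := hy, hz
      exact ⟨a₁ + a₂, by rw [map_add, AddMemClass.coe_add, h₁, h₂, TensorProduct.add_tmul]⟩
    | tmul b k =>
      obtain ⟨s, hs⟩ := IsIntegrallyClosed.isIntegral_iff.mp k.2
      refine ⟨s • b, ?_⟩
      rw [TensorProduct.smul_tmul, Algebra.smul_def, mul_one, hs]
      rfl
  obtain ⟨a', ha'⟩ := hy' y
  rw [hy] at ha'
  have := Algebra.Smooth.flat R A
  refine ⟨a', Algebra.TensorProduct.includeLeft_injective (R := R) (S := A) (A := A) (B := K)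
    (FaithfulSMul.algebraMap_injective R K) ?_⟩
  change a ⊗ₜ[R] (1 : K) = _ ⊗ₜ[R] (1 : K)
  rw [← Algebra.smul_def, ← TensorProduct.smul_tmul', ← ha', ← hq, TensorProduct.tmul_smul]

variable (p : ℕ)

/-- Idempotents of the generic fibre of the completion are integral. They are of the form `b / pⁿ`;
approximating `b` by an element of `A` reduces this to the smooth algebra `A`. -/
theorem exists_isIdempotentElem_includeRight [CharZero R] [Fact p.Prime]
    [CharP (IsLocalRing.ResidueField R) p]
    {K : Type u} [Field K] [Algebra R K] [IsFractionRing R K]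
    {e : K ⊗[R] PCompletion p A} (he : IsIdempotentElem e) :
    ∃ b : PCompletion p A, IsIdempotentElem b ∧ e = 1 ⊗ₜ b := by
  have : IsNoetherianRing A := Algebra.FiniteType.isNoetherianRing R A
  let ι : PCompletion p A →ₐ[R] K ⊗[R] PCompletion p A := Algebra.TensorProduct.includeRight
  have hι : Function.Injective ι := includeRight_pCompletion_injective p A K
  have hp0 : (p : R) ≠ 0 := Nat.cast_ne_zero.mpr (Fact.out : p.Prime).ne_zero
  have hpm : (p : R) ∈ IsLocalRing.maximalIdeal R := by
    rw [← IsLocalRing.residue_eq_zero_iff, map_natCast, CharP.cast_eq_zero]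
  -- `e = b / pⁿ`, as every nonzero element of `R` divides a power of `p`
  obtain ⟨n, b, hb⟩ : ∃ (n : ℕ) (b : PCompletion p A), ι b = ((p : R) ^ n) • e := by
    obtain ⟨r, hr, b, hb⟩ := exists_one_tmul_eq_smul e
    obtain ⟨n, s, hs⟩ := IsDiscreteValuationRing.exists_dvd_pow hr hpm
    refine ⟨n, s • b, ?_⟩
    rw [map_smul, hs, mul_comm, mul_smul, ← hb]
    rfl
  have hb2 : b * b = p ^ n * b := hι (by
    rw [map_mul, hb, smul_mul_smul_comm, he.eq, map_mul, hb, mul_smul, map_pow, map_natCast]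
    refine (Algebra.smul_def (A := K ⊗[R] PCompletion p A) ((p : R) ^ n) _).trans ?_
    rw [map_pow, map_natCast])
  -- if `a` approximates `b` modulo `p²ⁿ` then `b² = pⁿ b` becomes a quadratic equation for `a / pⁿ`
  obtain ⟨a, d, rfl⟩ := algebraMap_pCompletion_surjective_mod p A b (2 * n)
  obtain ⟨c, hc⟩ : ∃ c, a * a - p ^ n * a = p ^ (2 * n) * c := by
    refine exists_eq_pow_mul_of_algebraMap_pCompletion p
      (c := p ^ n * d - 2 * algebraMap A _ a * d - p ^ (2 * n) * d * d) ?_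
    rw [map_sub, map_mul, map_mul, map_pow, map_natCast]
    linear_combination hb2
  obtain ⟨a', rfl⟩ := exists_eq_mul_of_sq_eq (pow_ne_zero n hp0) (a := a) (c := c) (by
    rw [map_pow, map_natCast]
    linear_combination hc)
  set b' := algebraMap A (PCompletion p A) a' + p ^ n * d with hb'
  have hbb' : algebraMap A (PCompletion p A) (algebraMap R A (p ^ n) * a') + p ^ (2 * n) * d =
      ((p : R) ^ n) • b' := by
    rw [Algebra.smul_def, map_pow, map_natCast, map_pow, map_natCast, map_mul, map_pow, map_natCast]
    ring
  rw [hbb'] at hb hb2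
  have hb'' : e = ι b' := by
    rw [map_smul] at hb
    have hu : IsUnit (algebraMap R K (p ^ n)) := by
      rw [isUnit_iff_ne_zero, Ne, FaithfulSMul.algebraMap_eq_zero_iff R K]
      exact pow_ne_zero n hp0
    rw [← algebraMap_smul K, ← algebraMap_smul K (_ ^ _) e] at hb
    exact (hu.smul_left_cancel.mp hb).symm
  exact ⟨b', hι (by rw [map_mul, ← hb'', he.eq]), hb''⟩

variable [CharZero R] [Fact p.Prime]

/-- An idempotent of `Â` which vanishes modulo `I` is zero. As a power of `I` is contained in `(p)`,
a power of `b` is divisible by `p`; but `b` is equal to all its powers, so it is divisible by all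
powers of `p`. -/
theorem eq_zero_of_isIdempotentElem_pCompletion {I : Ideal R} (hI : I ≠ ⊤)
    {b : PCompletion p A} (hb : IsIdempotentElem b) {a : A} (ha : a ∈ I.map (algebraMap R A))
    {c : PCompletion p A} (h : b = algebraMap A _ a + p * c) : b = 0 := by
  have hp0 : (p : R) ≠ 0 := Nat.cast_ne_zero.mpr (Fact.out : p.Prime).ne_zero
  obtain ⟨m, hm⟩ := IsDiscreteValuationRing.exists_pow_le_span hI hp0
  have hpb : (p : PCompletion p A) ∣ b := by
    have ham : (p : A) ∣ a ^ m := by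
      have := Ideal.map_mono (f := algebraMap R A) hm
      rw [Ideal.map_pow, Ideal.map_span, Set.image_singleton, map_natCast] at this
      exact Ideal.mem_span_singleton.mp (this (Ideal.pow_mem_pow ha m))
    have h1 : (p : PCompletion p A) ∣ algebraMap A _ a ^ (m + 1) := by
      rw [pow_succ, ← map_pow]
      exact ((map_natCast (algebraMap A (PCompletion p A)) p ▸ map_dvd _ ham :)).mul_right _
    rw [← hb.pow_succ_eq m, h]
    have h2 := sub_dvd_pow_sub_pow (algebraMap A (PCompletion p A) a + p * c) (algebraMap A _ a)
      (m + 1)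
    rw [add_sub_cancel_left] at h2
    exact (dvd_sub_left h1).mp ((dvd_mul_right _ _).trans h2)
  refine eq_zero_of_forall_pow_dvd p fun n => (pow_dvd_pow_of_dvd hpb n).trans ?_
  cases n with
  | zero => exact (pow_zero b).dvd.trans (one_dvd _)
  | succ n => rw [hb.pow_succ_eq]

variable [CharP (IsLocalRing.ResidueField R) p]
  {K : Type u} [Field K] [Algebra R K] [IsFractionRing R K]
  {I : Ideal R} (hpI : (p : R) ∈ I) [ConnectedSpace (PrimeSpectrum (A ⧸ I.map (algebraMap R A)))]
include hpI

/-- An idempotent of the generic fibre is integral and reduces to an idempotent of the connected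
ring `A / I A`, that is to `0` or to `1`; idempotents of `Â` are determined by this reduction. -/
theorem eq_zero_or_one_of_isIdempotentElem_generic {e : K ⊗[R] PCompletion p A}
    (he : IsIdempotentElem e) : e = 0 ∨ e = 1 := by
  have hI : I ≠ ⊤ := by
    rintro rfl
    rw [Ideal.map_top] at *
    obtain ⟨x⟩ := (inferInstance : Nonempty (PrimeSpectrum (A ⧸ (⊤ : Ideal A))))
    exact x.2.ne_top (Subsingleton.elim _ _)
  obtain ⟨b, hb, rfl⟩ := exists_isIdempotentElem_includeRight p he
  obtain ⟨a, c, h⟩ := algebraMap_pCompletion_surjective_mod p A b 1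
  rw [pow_one] at h
  have hpA : (p : A) ∈ I.map (algebraMap R A) := map_natCast (algebraMap R A) p ▸
    Ideal.mem_map_of_mem _ hpI
  have ha : IsIdempotentElem (Ideal.Quotient.mk (I.map (algebraMap R A)) a) := by
    obtain ⟨a', ha'⟩ : ∃ a', a * a - a = p ^ 1 * a' := by
      refine exists_eq_pow_mul_of_algebraMap_pCompletion p
        (c := c - 2 * algebraMap A _ a * c - p * c * c) ?_
      rw [map_sub, map_mul]
      have := hb.eq
      rw [h] at this
      linear_combination this
    refine Ideal.Quotient.eq.mpr ?_
    rw [ha', pow_one]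
    exact Ideal.mul_mem_right _ _ hpA
  refine (eq_zero_or_one_of_isIdempotentElem ha).imp (fun h0 => ?_) fun h1 => ?_
  · rw [eq_zero_of_isIdempotentElem_pCompletion p hI hb (Ideal.Quotient.eq_zero_iff_mem.mp h0) h,
      TensorProduct.tmul_zero]
  · rw [← map_one (Ideal.Quotient.mk _), Ideal.Quotient.eq, ← neg_mem_iff, neg_sub] at h1
    have := eq_zero_of_isIdempotentElem_pCompletion p hI hb.one_sub h1 (c := -c) (by
      rw [h, map_sub, map_one]; ring)
    rw [← sub_eq_zero.mp this]
    rfl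

/-- If the generic fibre were zero then so would be the torsion-free ring `Â`, and `A / p A` with
it. -/
theorem nontrivial_generic_pCompletion : Nontrivial (K ⊗[R] PCompletion p A) := by
  have : IsNoetherianRing A := Algebra.FiniteType.isNoetherianRing R A
  refine ⟨⟨0, 1, fun h01 => ?_⟩⟩
  have h := includeRight_pCompletion_injective (R := R) p A K
    ((map_zero _).trans (h01.trans (map_one _).symm))
  have h0 := exists_eq_pow_mul_of_algebraMap_pCompletion p (n := 1) (a := (1 : A)) (c := 0) (by
    rw [map_one, ← h, mul_zero])
  obtain ⟨a, ha⟩ := h0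
  obtain ⟨x⟩ := (inferInstance : Nonempty (PrimeSpectrum (A ⧸ I.map (algebraMap R A))))
  refine x.2.ne_top ((Ideal.eq_top_iff_one _).mpr ?_)
  have : Ideal.Quotient.mk (I.map (algebraMap R A)) 1 = 0 := by
    rw [Ideal.Quotient.eq_zero_iff_mem, ha, pow_one]
    exact Ideal.mul_mem_right _ _ (map_natCast (algebraMap R A) p ▸ Ideal.mem_map_of_mem _ hpI)
  rw [← map_one (Ideal.Quotient.mk _), this]
  exact zero_mem _

end Idempotents

/-! ### Finiteness over a complete discrete valuation ring -/

section Krull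
variable {C : Type*} [CommRing C] [IsDomain C] [IsNoetherianRing C] {t : C}

/-- By prime avoidance and Krull's principal ideal theorem, a prime ideal strictly containing a
minimal prime of `(t)` would contain a nonzero prime ideal without `t`. -/
theorem Ideal.mem_minimalPrimes_span_singleton (ht : t ≠ 0)
    (h : ∀ Q : Ideal C, Q.IsPrime → Q ≠ ⊥ → t ∈ Q) {Q : Ideal C} (hQ : Q.IsPrime) (htQ : t ∈ Q) :
    Q ∈ (span {t}).minimalPrimes := by
  have hle : span {t} ≤ Q := (span_singleton_le_iff_mem _).mpr htQ
  have hfin := finite_minimalPrimes_of_isNoetherianRing C (span {t})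
  -- prime avoidance: otherwise `Q` contains some `y` outside all minimal primes of `(t)`
  have hsub : (Q : Set C) ⊆ ⋃ q ∈ (hfin.toFinset : Set (Ideal C)), (id q : Ideal C) := by
    by_contra hcon
    obtain ⟨y, hyQ, hy⟩ := Set.not_subset.mp hcon
    have hy' : ∀ q ∈ (span {t}).minimalPrimes, y ∉ q := fun q hq hyq =>
      hy (Set.mem_biUnion (by rwa [Set.Finite.coe_toFinset]) hyq)
    obtain ⟨q₀, hq₀, -⟩ := exists_minimalPrimes_le hle
    have hy0 : y ≠ 0 := fun h0 => hy' q₀ hq₀ (h0 ▸ q₀.zero_mem)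
    obtain ⟨r, hr, -⟩ := exists_minimalPrimes_le ((span_singleton_le_iff_mem _).mpr hyQ)
    have := hr.isPrime
    have hyr : y ∈ r := hr.le (mem_span_singleton_self y)
    have htr : t ∈ r := h r hr.isPrime fun h0 => hy0 (by rwa [h0, mem_bot] at hyr)
    obtain ⟨q, hq, hqr⟩ := exists_minimalPrimes_le ((span_singleton_le_iff_mem _).mpr htr)
    have := hq.isPrime
    rcases hqr.lt_or_eq with hlt | rfl
    · have hh := height_le_one_of_isPrincipal_of_mem_minimalPrimes _ r hr
      have h0 := (height_le_iff (n := 1)).mp (by simpa using hh) q hq.isPrime hlt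
      rw [Nat.cast_one, ENat.lt_one_iff_eq_zero, height_eq_zero_iff,
        IsDomain.minimalPrimes_eq_singleton_bot, Set.mem_singleton_iff] at h0
      exact ht (by simpa [h0] using hq.le (mem_span_singleton_self t))
    · exact hy' _ hq hyr
  obtain ⟨q, hq, hQq⟩ := (subset_union_prime ⊥ ⊥ fun q hq _ _ =>
    (hfin.mem_toFinset.mp hq).isPrime).mp hsub
  have hq' := hfin.mem_toFinset.mp hq
  rwa [hQq.antisymm (hq'.2 ⟨hQ, hle⟩ hQq)]

/-- A noetherian domain all of whose nonzero primes contain `t` has dimension at most one. -/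
theorem Ring.krullDimLE_zero_quotient_span_singleton (ht : t ≠ 0)
    (h : ∀ Q : Ideal C, Q.IsPrime → Q ≠ ⊥ → t ∈ Q) : Ring.KrullDimLE 0 (C ⧸ Ideal.span {t}) := by
  refine Ring.krullDimLE_zero_iff.mpr fun Q hQ => ?_
  obtain ⟨N, hN, hQN⟩ := Q.exists_le_maximal hQ.ne_top
  have hmem : ∀ N : Ideal (C ⧸ Ideal.span {t}), t ∈ N.comap (Ideal.Quotient.mk _) := fun N => by
    rw [Ideal.mem_comap, Ideal.Quotient.eq_zero_iff_mem.mpr (Ideal.mem_span_singleton_self t)]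
    exact N.zero_mem
  have h1 := Ideal.mem_minimalPrimes_span_singleton ht h (hN.isPrime.comap (Ideal.Quotient.mk _))
    (hmem N)
  have h2 := h1.2 ⟨hQ.comap _, (Ideal.span_singleton_le_iff_mem _).mpr (hmem Q)⟩
    (Ideal.comap_mono hQN)
  rwa [hQN.antisymm
    ((Ideal.comap_le_comap_iff_of_surjective _ Ideal.Quotient.mk_surjective _ _).mp h2)]

end Krull

section Finiteness
variable {R A B : Type u} [CommRing R] [IsDomain R] [IsDiscreteValuationRing R]
  [IsAdicComplete (IsLocalRing.maximalIdeal R) R] [CommRing A] [Algebra R A]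
  [Algebra.FiniteType R A] [CommRing B] [Algebra R B] [Algebra A B] [IsScalarTower R A B]
  [IsNoetherianRing B]
  {ϖ : R}

/-- A finitely generated `B`-module is finite over the complete ring `R` if it is so
modulo `ϖ`. -/
theorem Module.Finite.of_quotient_of_mem_jacobson (hϖ : Irreducible ϖ)
    (hJ : algebraMap R B ϖ ∈ Ideal.jacobson (⊥ : Ideal B))
    (M : Type*) [AddCommGroup M] [Module B M] [Module R M] [IsScalarTower R B M] [Module.Finite B M]
    [Module.Finite R (M ⧸ (Ideal.span {algebraMap R B ϖ} • ⊤ : Submodule B M))] :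
    Module.Finite R M := by
  have hmem : ∀ (n : ℕ) (x : M), x ∈ (Ideal.span {ϖ} ^ n • ⊤ : Submodule R M) ↔
      x ∈ (Ideal.span {algebraMap R B ϖ} ^ n • ⊤ : Submodule B M) := fun n x => by
    rw [mem_span_singleton_pow_smul_top, mem_span_singleton_pow_smul_top]
    simp only [← map_pow, algebraMap_smul]
  have : IsPrecomplete (Ideal.span {ϖ}) R := by
    rw [← hϖ.maximalIdeal_eq]; infer_instance
  have := IsHausdorff.of_le_jacobson _ M ((Ideal.span_singleton_le_iff_mem _).mpr hJ)
  have : IsHausdorff (Ideal.span {ϖ}) M := ⟨fun x hx =>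
    IsHausdorff.haus (I := Ideal.span {algebraMap R B ϖ}) inferInstance x fun n =>
      SModEq.zero.mpr ((hmem n x).mp (SModEq.zero.mp (hx n)))⟩
  have e : (Ideal.span {ϖ} • ⊤ : Submodule R M) =
      (Ideal.span {algebraMap R B ϖ} • ⊤ : Submodule B M).restrictScalars R := by
    ext x
    simpa using hmem 1 x
  have : Module.Finite R (M ⧸ (Ideal.span {ϖ} • ⊤ : Submodule R M)) :=
    .equiv ((Submodule.quotEquivOfEq _ _ e).trans
      (Submodule.Quotient.restrictScalarsEquiv R _)).symm
  exact .of_isPrecomplete (x := ϖ)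

variable (A) in
/-- Closed points of the generic fibre have residue fields finite over `K`; integral version. -/
theorem Module.Finite.quotient_of_forall_prime (hϖ : Irreducible ϖ)
    (hJ : algebraMap R B ϖ ∈ Ideal.jacobson (⊥ : Ideal B))
    (hAB : ∀ b : B, ∃ (a : A) (c : B), b = algebraMap A B a + algebraMap R B ϖ * c)
    {P : Ideal B} [P.IsPrime] (hP : algebraMap R B ϖ ∉ P)
    (h : ∀ Q : Ideal B, Q.IsPrime → P < Q → algebraMap R B ϖ ∈ Q) :
    Module.Finite R (B ⧸ P) := by
  let t : B ⧸ P := Ideal.Quotient.mk P (algebraMap R B ϖ)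
  let D := (B ⧸ P) ⧸ Ideal.span {t}
  have hdim : Ring.KrullDimLE 0 D := Ring.krullDimLE_zero_quotient_span_singleton
    (fun h0 => hP (Ideal.Quotient.eq_zero_iff_mem.mp h0)) fun Q hQ hQ0 => by
      refine h _ (hQ.comap (Ideal.Quotient.mk P)) (lt_of_le_of_ne ?_ fun h0 => hQ0 ?_)
      · exact Ideal.mk_ker.symm.trans_le (Ideal.ker_le_comap _)
      · rw [← Ideal.map_comap_of_surjective _ Ideal.Quotient.mk_surjective Q, ← h0,
          Ideal.map_quotient_self]
  -- `D` is artinian and of finite type over the field `R / ϖ`, hence finite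
  have hart : IsArtinianRing D := isArtinianRing_iff_krullDimLE_zero.mpr hdim
  have ht0 : algebraMap R D ϖ = 0 :=
    Ideal.Quotient.eq_zero_iff_mem.mpr (Ideal.mem_span_singleton_self t)
  have hsurj : Function.Surjective (IsScalarTower.toAlgHom R A D) := fun d => by
    obtain ⟨c, rfl⟩ := Ideal.Quotient.mk_surjective d
    obtain ⟨b, rfl⟩ := Ideal.Quotient.mk_surjective c
    obtain ⟨a, c, rfl⟩ := hAB b
    refine ⟨a, ?_⟩
    have : Ideal.Quotient.mk (Ideal.span {t}) (Ideal.Quotient.mk P (algebraMap R B ϖ)) = 0 := ht0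
    rw [map_add, map_mul, map_add, map_mul, this, zero_mul, add_zero]
    rfl
  have hft : Algebra.FiniteType R D := .of_surjective _ hsurj
  let k := R ⧸ Ideal.span {ϖ}
  letI : Field k := @Ideal.Quotient.field _ _ _ (hϖ.maximalIdeal_eq ▸ inferInstance)
  letI : Algebra k D := (Ideal.Quotient.lift _ (algebraMap R D) fun r hr => by
    obtain ⟨s, rfl⟩ := Ideal.mem_span_singleton'.mp hr
    rw [map_mul, ht0, mul_zero]).toAlgebra
  have : IsScalarTower R k D := .of_algebraMap_eq fun _ => rfl
  have : Algebra.FiniteType k D := .of_restrictScalars_finiteType R k D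
  have : Module.Finite k D := (Module.finite_iff_isArtinianRing k D).mpr hart
  have : Module.Finite R D := .trans k D
  have e : (Ideal.span {algebraMap R B ϖ} • ⊤ : Submodule B (B ⧸ P)) =
      (Ideal.span {t}).restrictScalars B := by
    ext x
    have := mem_span_singleton_pow_smul_top (A := B) (M := B ⧸ P) (x := algebraMap R B ϖ) (n := 1)
      (y := x)
    rw [pow_one, pow_one] at this
    rw [this, Submodule.restrictScalars_mem, Ideal.mem_span_singleton']
    exact exists_congr fun z => by rw [mul_comm]; rfl
  have : Module.Finite R ((B ⧸ P) ⧸ (Ideal.span {algebraMap R B ϖ} • ⊤ : Submodule B (B ⧸ P))) :=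
    .equiv (((Submodule.quotEquivOfEq _ _ e).trans
      (Submodule.Quotient.restrictScalarsEquiv B _)).symm.restrictScalars R : D ≃ₗ[R] _)
  exact .of_quotient_of_mem_jacobson hϖ hJ _

omit [IsDomain R] [IsDiscreteValuationRing R] [IsAdicComplete (IsLocalRing.maximalIdeal R) R] in
/-- Finiteness passes from a quotient by `P` to infinitesimal neighbourhoods. -/
theorem Module.Finite.quotient_of_mul_le {P Q : Ideal B} (hQ : P * P ≤ Q)
    [h : Module.Finite R (B ⧸ P)] : Module.Finite R (B ⧸ Q) := by
  classical
  obtain ⟨s, hs⟩ := h.fg_top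
  obtain ⟨s, rfl⟩ : ∃ s' : Finset B, s = s'.image (Ideal.Quotient.mk P) :=
    ⟨s.image (Function.surjInv Ideal.Quotient.mk_surjective), by
      rw [Finset.image_image]
      simp [Function.comp_def, Function.surjInv_eq]⟩
  -- If `F` spans `B` modulo `P` over `R`, and `y` generates the ideal `P`, then `F + F y` spans `B`
  -- modulo `P²`.
  let F : Submodule R B := Submodule.span R s
  have hF : ∀ b : B, ∃ f ∈ F, b - f ∈ P := fun b => by
    have hb : Ideal.Quotient.mk P b ∈ F.map (Ideal.Quotient.mkₐ R P).toLinearMap := by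
      rw [Submodule.map_span]
      have : Ideal.Quotient.mk P b ∈ (⊤ : Submodule R (B ⧸ P)) := trivial
      rwa [← hs, Finset.coe_image] at this
    obtain ⟨f, hf, hfb⟩ := hb
    exact ⟨f, hf, Ideal.Quotient.eq.mp hfb.symm⟩
  obtain ⟨y, hy⟩ := IsNoetherian.noetherian P
  let Y : Submodule R B := Submodule.span R y
  have hPY : ∀ x ∈ P, ∀ b : B, ∃ z ∈ F * Y, b * x - z ∈ Q := fun x hx => by
    rw [← hy] at hx
    induction hx using Submodule.span_induction with
    | mem x hx =>
      intro b
      obtain ⟨f, hf, hfb⟩ := hF b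
      refine ⟨f * x, Submodule.mul_mem_mul hf (Submodule.subset_span hx), hQ ?_⟩
      rw [← sub_mul]
      exact Ideal.mul_mem_mul hfb (hy ▸ Submodule.subset_span hx)
    | zero => exact fun b => ⟨0, zero_mem _, by simp⟩
    | add x x' _ _ h h' =>
      intro b
      obtain ⟨⟨z, hz, hzQ⟩, z', hz', hzQ'⟩ := h b, h' b
      refine ⟨z + z', add_mem hz hz', ?_⟩
      rw [mul_add, add_sub_add_comm]
      exact add_mem hzQ hzQ'
    | smul c x _ h =>
      intro b
      obtain ⟨z, hz, hzQ⟩ := h (b * c)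
      exact ⟨z, hz, by rwa [smul_eq_mul, ← mul_assoc]⟩
  have hG : (F ⊔ F * Y).FG := (Submodule.fg_span s.finite_toSet).sup
    ((Submodule.fg_span s.finite_toSet).mul (Submodule.fg_span y.finite_toSet))
  have := Module.Finite.iff_fg.mpr hG
  refine .of_surjective ((Ideal.Quotient.mkₐ R Q).toLinearMap ∘ₗ (F ⊔ F * Y).subtype) fun b => ?_
  obtain ⟨b, rfl⟩ := Ideal.Quotient.mk_surjective b
  obtain ⟨f, hf, hfb⟩ := hF b
  obtain ⟨z, hz, hzQ⟩ := hPY _ hfb 1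
  refine ⟨⟨f + z, add_mem (Submodule.mem_sup_left hf) (Submodule.mem_sup_right hz)⟩,
    Ideal.Quotient.eq.mpr ?_⟩
  change f + z - b ∈ Q
  rw [← neg_mem_iff]
  convert hzQ using 1
  ring

variable (A) in
omit [IsAdicComplete (IsLocalRing.maximalIdeal R) R] [Algebra.FiniteType R A]
  [IsNoetherianRing B] in
/-- By Nakayama's lemma over `R`, the algebra `A` surjects onto finite quotients of `B` as it does
so modulo `ϖ`. -/
theorem exists_algebraMap_sub_mem (hϖ : Irreducible ϖ)
    (hAB : ∀ b : B, ∃ (a : A) (c : B), b = algebraMap A B a + algebraMap R B ϖ * c)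
    (Q : Ideal B) [h : Module.Finite R (B ⧸ Q)] (b : B) : ∃ a : A, b - algebraMap A B a ∈ Q := by
  have hle : (⊤ : Submodule R (B ⧸ Q)) ≤
      LinearMap.range (IsScalarTower.toAlgHom R A (B ⧸ Q)).toLinearMap := by
    refine Submodule.le_of_le_smul_of_le_jacobson_bot (I := IsLocalRing.maximalIdeal R) h.fg_top
      (IsLocalRing.maximalIdeal_le_jacobson _) fun x _ => ?_
    obtain ⟨b, rfl⟩ := Ideal.Quotient.mk_surjective x
    obtain ⟨a, c, rfl⟩ := hAB b
    rw [map_add]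
    refine Submodule.add_mem_sup ⟨a, rfl⟩ ?_
    rw [← Algebra.smul_def]
    exact Submodule.smul_mem_smul (N := ⊤) (n := Ideal.Quotient.mk Q c)
      ((IsLocalRing.mem_maximalIdeal _).mpr hϖ.not_isUnit) trivial
  obtain ⟨a, ha⟩ := hle (show Ideal.Quotient.mk Q b ∈ ⊤ from trivial)
  exact ⟨a, Ideal.Quotient.eq.mp ha.symm⟩

end Finiteness

/-! ### Closed points and Euler vector fields -/

section ClosedPoints
variable {R K A B : Type u} [CommRing R] [IsDomain R] [IsDiscreteValuationRing R]
  [IsAdicComplete (IsLocalRing.maximalIdeal R) R] [Field K] [Algebra R K] [IsFractionRing R K]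
  [CommRing A] [Algebra R A] [Algebra.FiniteType R A]
  [CommRing B] [Algebra R B] [Algebra A B] [IsScalarTower R A B] [IsNoetherianRing B]
  {ϖ : R}

variable (A) in
/-- The closure of a closed point of the generic fibre is finite over `R`. -/
theorem Module.Finite.quotient_comap_includeRight (hϖ : Irreducible ϖ)
    (hJ : algebraMap R B ϖ ∈ Ideal.jacobson (⊥ : Ideal B))
    (hAB : ∀ b : B, ∃ (a : A) (c : B), b = algebraMap A B a + algebraMap R B ϖ * c)
    (hB : Function.Injective (Algebra.TensorProduct.includeRight : B →ₐ[R] K ⊗[R] B))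
    (m : Ideal (K ⊗[R] B)) [hm : m.IsMaximal] :
    Module.Finite R (B ⧸ m.comap (Algebra.TensorProduct.includeRight : B →ₐ[R] K ⊗[R] B)) := by
  let ι : B →ₐ[R] K ⊗[R] B := Algebra.TensorProduct.includeRight
  have hunit : ∀ r : R, r ≠ 0 → algebraMap R B r ∉ m.comap ι := fun r hr h => by
    refine hm.ne_top (Ideal.eq_top_of_isUnit_mem _ (Ideal.mem_comap.mp h) ?_)
    rw [AlgHom.commutes, IsScalarTower.algebraMap_apply R K]
    exact (IsUnit.mk0 _ (by rwa [Ne, FaithfulSMul.algebraMap_eq_zero_iff R K])).map _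
  have := hm.isPrime.comap ι
  refine .quotient_of_forall_prime A hϖ hJ hAB (hunit ϖ hϖ.ne_zero) fun Q hQ hPQ => ?_
  -- A prime strictly above `m ∩ B` contains an element which is invertible modulo `m`; clearing
  -- denominators it contains a nonzero element of `R`, hence `ϖ`.
  obtain ⟨y, hyQ, hy⟩ := Set.exists_of_ssubset hPQ
  obtain ⟨z, i, hi, hz⟩ := hm.exists_inv (x := ι y) hy
  obtain ⟨r, hr, b, hb⟩ := exists_one_tmul_eq_smul z
  obtain ⟨s, hs, c, hc⟩ := exists_one_tmul_eq_smul i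
  have hcQ : c ∈ Q := hPQ.le (show ι c ∈ m by
    rw [show ι c = s • i from hc, Algebra.smul_def]
    exact m.mul_mem_left _ hi)
  have hrs : algebraMap R B (r * s) = s • (b * y) + r • c := hB (by
    change ι _ = ι _
    rw [map_add, map_smul, map_smul, map_mul ι b y, show ι b = r • z from hb,
      show ι c = s • i from hc, smul_mul_assoc, smul_comm s r, ← smul_add, ← smul_add, hz,
      AlgHom.commutes, smul_smul, Algebra.algebraMap_eq_smul_one])
  have hmem : algebraMap R B (r * s) ∈ Q := by
    rw [hrs, Algebra.smul_def, Algebra.smul_def]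
    exact add_mem (Q.mul_mem_left _ (Q.mul_mem_left _ hyQ)) (Q.mul_mem_left _ hcQ)
  obtain ⟨n, hn⟩ := IsDiscreteValuationRing.exists_dvd_pow (mul_ne_zero hr hs)
    ((IsLocalRing.mem_maximalIdeal _).mpr hϖ.not_isUnit)
  refine hQ.mem_of_pow_mem n ?_
  rw [← map_pow]
  exact Ideal.mem_of_dvd Q (map_dvd _ hn) hmem

omit [IsDiscreteValuationRing R] [IsAdicComplete (IsLocalRing.maximalIdeal R) R] [IsDomain R]
  [IsNoetherianRing B] [IsFractionRing R K] in
/-- `K ⊗ B / (m ∩ B)` surjects onto `(K ⊗ B) / m`. -/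
theorem Module.Finite.quotient_generic (m : Ideal (K ⊗[R] B))
    [Module.Finite R (B ⧸ m.comap (Algebra.TensorProduct.includeRight : B →ₐ[R] K ⊗[R] B))] :
    Module.Finite K ((K ⊗[R] B) ⧸ m) := by
  let f : (B ⧸ m.comap (Algebra.TensorProduct.includeRight : B →ₐ[R] K ⊗[R] B)) →ₐ[R]
    (K ⊗[R] B) ⧸ m := Ideal.quotientMapₐ m Algebra.TensorProduct.includeRight le_rfl
  refine .of_surjective (f.toLinearMap.liftBaseChange K) fun z => ?_
  obtain ⟨z, rfl⟩ := Ideal.Quotient.mk_surjective z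
  induction z with
  | zero => exact ⟨0, by simp⟩
  | add y z hy hz =>
    obtain ⟨⟨y', hy⟩, z', hz⟩ := hy, hz
    exact ⟨y' + z', by rw [map_add, map_add, hy, hz]⟩
  | tmul k b =>
    refine ⟨k ⊗ₜ Ideal.Quotient.mk _ b, ?_⟩
    rw [LinearMap.liftBaseChange_tmul]
    change k • Ideal.Quotient.mk m (1 ⊗ₜ b) = _
    rw [← Ideal.Quotient.mkₐ_eq_mk K, ← map_smul, TensorProduct.smul_tmul', smul_eq_mul, mul_one]

variable (A) in
/-- Infinitesimal neighbourhoods of closed points of the generic fibre of the completion of `A`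
are generated by functions from `A`. -/
theorem exists_one_tmul_sub_mem_sq (hϖ : Irreducible ϖ)
    (hAB : ∀ b : B, ∃ (a : A) (c : B), b = algebraMap A B a + algebraMap R B ϖ * c)
    (m : Ideal (K ⊗[R] B))
    [Module.Finite R (B ⧸ m.comap (Algebra.TensorProduct.includeRight : B →ₐ[R] K ⊗[R] B))]
    (b : B) : ∃ a : A, (1 : K) ⊗ₜ[R] (b - algebraMap A B a) ∈ m ^ 2 := by
  have : Module.Finite R (B ⧸ (m ^ 2).comap
      (Algebra.TensorProduct.includeRight : B →ₐ[R] K ⊗[R] B)) :=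
    .quotient_of_mul_le (P := m.comap (Algebra.TensorProduct.includeRight : B →ₐ[R] K ⊗[R] B))
      ((Ideal.le_comap_mul _).trans_eq (by rw [pow_two]))
  exact exists_algebraMap_sub_mem A hϖ hAB ((m ^ 2).comap
    (Algebra.TensorProduct.includeRight : B →ₐ[R] K ⊗[R] B)) b

end ClosedPoints

section Euler
variable (K : Type*) {S : Type*} [Field K] [CharZero K] [CommRing S] [Algebra K S]
  (m : Ideal S) [hm : m.IsMaximal] [Module.Finite K (S ⧸ m)]

/-- Since the residue field `S / m` is separable over `K`, it lifts to a subfield of `S / m²`; the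
derivation is the projection along this subfield. -/
theorem exists_derivation_cotangentIdeal :
    ∃ δ : Derivation K S m.cotangentIdeal,
      ∀ f ∈ m, (δ f : S ⧸ m ^ 2) = Ideal.Quotient.mk (m ^ 2) f := by
  letI : Field (S ⧸ m) := Ideal.Quotient.field m
  have : Algebra.IsSeparable K (S ⧸ m) := inferInstance
  have : Algebra.FormallyEtale K (S ⧸ m) := .of_isSeparable K (S ⧸ m)
  let g : (S ⧸ m) →ₐ[K] (S ⧸ m ^ 2) ⧸ m.cotangentIdeal :=
    Ideal.Quotient.liftₐ m (IsScalarTower.toAlgHom K S _) fun f hf =>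
      Ideal.Quotient.eq_zero_iff_mem.mpr (Ideal.mk_mem_cotangentIdeal.mpr hf)
  obtain ⟨σ, hσ⟩ := Algebra.FormallySmooth.exists_lift m.cotangentIdeal
    ⟨2, m.cotangentIdeal_square⟩ g
  let δ := derivationToSquareZeroOfLift m.cotangentIdeal m.cotangentIdeal_square
    (σ.comp (Ideal.Quotient.mkₐ K m)) (by
      rw [← AlgHom.comp_assoc, hσ]
      rfl)
  refine ⟨-δ, fun f hf => ?_⟩
  have h := derivationToSquareZeroOfLift_apply m.cotangentIdeal m.cotangentIdeal_square
    (σ.comp (Ideal.Quotient.mkₐ K m)) (by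
      rw [← AlgHom.comp_assoc, hσ]
      rfl) f
  rw [AlgHom.comp_apply, Ideal.Quotient.mkₐ_eq_mk, Ideal.Quotient.eq_zero_iff_mem.mpr hf, map_zero,
    zero_sub] at h
  change -(δ f : S ⧸ m ^ 2) = _
  rw [h, neg_neg]
  rfl

end Euler

namespace DiffRing
section Simple
variable {K S : Type u} [CommRing K] [CommRing S] [Algebra K S] {𝒟 : DiffRing K S}

/-- Vector fields vanishing at `m` map stable ideals `J` to `m J`. -/
theorem ι_mem_mul {m J : Ideal S} (hJ : 𝒟.IsStable J) {X : 𝒟.Δ}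
    (hX : X ∈ (m • ⊤ : Submodule S 𝒟.Δ)) {f : S} (hf : f ∈ J) : 𝒟.ι X f ∈ m * J := by
  refine Submodule.smul_induction_on hX (fun s hs x _ => ?_) fun x y hx hy => ?_
  · rw [map_smul]
    exact Ideal.mul_mem_mul hs (hJ x f hf)
  · rw [map_add]
    exact add_mem hx hy

/-- An Euler vector field acts on `mⁿ⁺¹ / mⁿ⁺²` as multiplication by `n + 1`. -/
theorem ι_sub_mem_pow {m : Ideal S} {X : 𝒟.Δ} (hX : ∀ f ∈ m, 𝒟.ι X f - f ∈ m ^ 2) (n : ℕ) :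
    ∀ f ∈ m ^ (n + 1), 𝒟.ι X f - (n + 1 : ℕ) * f ∈ m ^ (n + 2) := by
  induction n with
  | zero => simpa using hX
  | succ n ih =>
    intro f hf
    rw [pow_succ] at hf
    refine Submodule.mul_induction_on hf (fun g hg h hh => ?_) fun x y hx hy => ?_
    · have h1 : g * (𝒟.ι X h - h) ∈ m ^ (n + 1 + 2) := by
        rw [pow_add _ (n + 1)]
        exact Ideal.mul_mem_mul hg (hX h hh)
      have h2 : (𝒟.ι X g - (n + 1 : ℕ) * g) * h ∈ m ^ (n + 1 + 2) := by
        rw [show n + 1 + 2 = n + 2 + 1 by ring, pow_succ]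
        exact Ideal.mul_mem_mul (ih g hg) hh
      convert add_mem h1 h2 using 1
      rw [Derivation.leibniz, smul_eq_mul, smul_eq_mul]
      push_cast
      ring
    · convert add_mem hx hy using 1
      rw [map_add]
      ring

/-- A connected noetherian ring is simple if at each closed point there is an Euler vector field,
that is, one which vanishes there and acts as the identity on the cotangent space. It acts as
multiplication by `n` on `mⁿ / mⁿ⁺¹`, so a stable ideal vanishing at the point vanishes to infinite
order there. -/
theorem isSimple_of_forall_isMaximal [Nontrivial S] [IsNoetherianRing S]
    (hS : ∀ n : ℕ, n ≠ 0 → IsUnit (n : S))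
    (hidem : ∀ e : S, IsIdempotentElem e → e = 0 ∨ e = 1)
    (h : ∀ m : Ideal S, m.IsMaximal → ∃ X ∈ (m • ⊤ : Submodule S 𝒟.Δ),
      ∀ f ∈ m, 𝒟.ι X f - f ∈ m ^ 2) : 𝒟.IsSimple := by
  refine ⟨inferInstance, fun J hJ => ?_⟩
  have hpow : ∀ m : Ideal S, m.IsMaximal → J ≤ m → ∀ n, J ≤ m ^ (n + 1) := fun m hm hJm n => by
    obtain ⟨X, hX, hXm⟩ := h m hm
    induction n with
    | zero => rwa [zero_add, pow_one]
    | succ n ih =>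
      intro f hf
      have h1 := ι_sub_mem_pow hXm n f (ih hf)
      have h2 : 𝒟.ι X f ∈ m ^ (n + 1 + 1) := by
        rw [pow_succ' m (n + 1)]
        exact Ideal.mul_mono_right ih (ι_mem_mul hJ hX hf)
      have h3 := sub_mem h2 h1
      rw [sub_sub_cancel] at h3
      exact (Ideal.unit_mul_mem_iff_mem _ (hS (n + 1) n.succ_ne_zero)).mp h3
  -- If the ideal of all `s` with `s x ∈ J²` were contained in some `m`, then `J ≤ m`, hence `x` is
  -- in all powers of `m`, and Krull's theorem gives `r ∈ m` with `(1 - r) x = 0`, so `1 - r ∈ m`.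
  have hidemJ : IsIdempotentElem J := by
    refine le_antisymm Ideal.mul_le_right fun x hx => ?_
    by_contra hxJ
    have hne : (J * J).colon {x} ≠ ⊤ := fun h1 => hxJ (by
      have := Submodule.mem_colon_singleton.mp (h1 ▸ trivial : (1 : S) ∈ (J * J).colon {x})
      rwa [one_smul] at this)
    obtain ⟨m, hm, hle⟩ := Ideal.exists_le_maximal _ hne
    have hJm : J ≤ m := fun y hy => hle
      (Submodule.mem_colon_singleton.mpr (Ideal.mul_mem_mul hy hx))
    have hxm : x ∈ (⨅ i : ℕ, m ^ i • ⊤ : Submodule S S) := by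
      rw [Submodule.mem_iInf]
      intro i
      rw [smul_eq_mul, Ideal.mul_top]
      exact Ideal.pow_le_pow_right (Nat.le_succ i) (hpow m hm hJm i hx)
    obtain ⟨r, hr⟩ := (Ideal.mem_iInf_smul_pow_eq_bot_iff m x).mp hxm
    refine hm.ne_top ((Ideal.eq_top_iff_one _).mpr ?_)
    have h1 : (1 - r : S) ∈ m := hle (Submodule.mem_colon_singleton.mpr (by
      rw [sub_smul, one_smul, hr, sub_self]
      exact zero_mem _))
    simpa using add_mem h1 r.2
  obtain ⟨e, he, rfl⟩ := (Ideal.isIdempotentElem_iff_of_fg J (IsNoetherian.noetherian J)).mp hidemJ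
  rcases hidem e he with rfl | rfl
  · exact .inl (Submodule.span_zero_singleton S)
  · exact .inr Ideal.span_singleton_one

end Simple
end DiffRing

/-! ### Simplicity of the generic fibre -/

section VectorFields
variable {K S : Type u} [CommRing K] [CommRing S] [Algebra K S] {𝒜 : Calculus K S}
  {𝒟 : DiffRing K S} {π : 𝒜.Pairing 𝒟} {n : ℕ}

/-- A linear form on one-forms with values in `m / m²` is represented modulo `m²` by a vector field
which vanishes at `m`. -/
theorem Calculus.Pairing.DualFamilies.exists_mk_ι_eq (b : π.DualFamilies n) {m : Ideal S}
    (φ : 𝒜.Ω →ₗ[S] m.cotangentIdeal) :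
    ∃ X ∈ (m • ⊤ : Submodule S 𝒟.Δ), ∀ f, Ideal.Quotient.mk (m ^ 2) (𝒟.ι X f) = φ (𝒜.d f) := by
  have hlift : ∀ j, ∃ s ∈ m, Ideal.Quotient.mk (m ^ 2) s = φ (b.ω j) := fun j => by
    obtain ⟨s, hs⟩ := Ideal.Quotient.mk_surjective (φ (b.ω j) : S ⧸ m ^ 2)
    exact ⟨s, Ideal.mk_mem_cotangentIdeal.mp (hs ▸ (φ (b.ω j)).2), hs⟩
  choose s hs hsφ using hlift
  refine ⟨∑ j, s j • b.x j, sum_mem fun j _ => Submodule.smul_mem_smul (hs j) trivial, fun f => ?_⟩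
  have h1 : 𝒟.ι (∑ j, s j • b.x j) f = ∑ j, s j * 𝒟.ι (b.x j) f := by
    rw [map_sum, ← Derivation.coeFnAddMonoidHom_apply, map_sum, Finset.sum_apply]
    refine Finset.sum_congr rfl fun j _ => ?_
    rw [map_smul]
    rfl
  rw [h1, ← b.sum_ω (𝒜.d f), map_sum, map_sum, AddSubmonoidClass.coe_finsetSum]
  refine Finset.sum_congr rfl fun j _ => ?_
  rw [π.φ_d, map_smul, map_mul, hsφ, mul_comm]
  rfl

end VectorFields

section EulerField
attribute [local instance] Algebra.TensorProduct.rightAlgebra DiffRing.genericModule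
variable (p : ℕ) {R A K : Type u} [CommRing R] [CommRing A] [Algebra R A] [IsNoetherianRing R]
  [Algebra.Smooth R A] [Field K] [Algebra R K]

/-- A derivation of `K ⊗ Â` coincides on `A` with a linear form on one-forms. -/
theorem exists_linearMap_d_algebraMap {E : Type u} [AddCommGroup E]
    [Module K E] [Module (K ⊗[R] PCompletion p A) E] [IsScalarTower K (K ⊗[R] PCompletion p A) E]
    (δ : Derivation K (K ⊗[R] PCompletion p A) E) :
    ∃ φ : ((completedCalculus p R A).generic K).Ω →ₗ[K ⊗[R] PCompletion p A] E, ∀ a : A,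
      φ (((completedCalculus p R A).generic K).d (1 ⊗ₜ algebraMap A (PCompletion p A) a)) =
        δ (1 ⊗ₜ algebraMap A (PCompletion p A) a) := by
  letI : Module (PCompletion p A) E :=
    Module.compHom E (algebraMap (PCompletion p A) (K ⊗[R] PCompletion p A))
  letI : Module A E := Module.compHom E (algebraMap A (PCompletion p A))
  letI : Module R E := Module.compHom E (algebraMap R K)
  haveI : IsScalarTower (PCompletion p A) (K ⊗[R] PCompletion p A) E :=
    .of_algebraMap_smul fun _ _ => rfl
  haveI : IsScalarTower A (PCompletion p A) E := .of_algebraMap_smul fun _ _ => rfl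
  haveI : IsScalarTower R A E := .of_algebraMap_smul fun r e => by
    change algebraMap (PCompletion p A) (K ⊗[R] PCompletion p A)
      (algebraMap A (PCompletion p A) (algebraMap R A r)) • e = algebraMap R K r • e
    rw [← IsScalarTower.algebraMap_apply R A (PCompletion p A), generic_compat R K,
      algebraMap_smul (K ⊗[R] PCompletion p A)]
  let δA : Derivation R A E :=
    .mk' { toFun := fun a => δ (1 ⊗ₜ algebraMap A (PCompletion p A) a)
           map_add' := fun a b => by rw [map_add, TensorProduct.tmul_add, map_add]
           map_smul' := fun r a => by
            rw [Algebra.smul_def, map_mul, ← IsScalarTower.algebraMap_apply, ← Algebra.smul_def,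
              TensorProduct.tmul_smul]
            exact (congrArg δ (algebraMap_smul K r _).symm).trans (δ.map_smul _ _) }
      fun a b => by
        change δ (1 ⊗ₜ algebraMap A (PCompletion p A) (a * b)) = _
        rw [map_mul, ← one_mul (1 : K), ← Algebra.TensorProduct.tmul_mul_tmul, δ.leibniz, one_mul]
        rfl
  refine ⟨((isBaseChange_ΩCompletion p R A).lift δA.liftKaehlerDifferential).liftBaseChange
    (K ⊗[R] PCompletion p A), fun a => ?_⟩
  have h1 : ((completedCalculus p R A).generic K).d (1 ⊗ₜ algebraMap A (PCompletion p A) a) =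
      (1 : K ⊗[R] PCompletion p A) ⊗ₜ[PCompletion p A] AdicCompletion.of (Ideal.span {(p : A)}) _
        (KaehlerDifferential.D R A a) := rfl
  rw [h1]
  refine (LinearMap.liftBaseChange_one_tmul _ _ _).trans ?_
  rw [IsBaseChange.lift_eq]
  exact δA.liftKaehlerDifferential_comp_D a

/-- A derivation into a module killed by `m` is a linear form on one-forms, if the functions from
`A` generate the first infinitesimal neighbourhood of `m`. -/
theorem exists_linearMap_d {m : Ideal (K ⊗[R] PCompletion p A)}
    (hm : ∀ b : PCompletion p A, ∃ a : A, (1 : K) ⊗ₜ[R] (b - algebraMap A _ a) ∈ m ^ 2)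
    {E : Type u} [AddCommGroup E]
    [Module K E] [Module (K ⊗[R] PCompletion p A) E] [IsScalarTower K (K ⊗[R] PCompletion p A) E]
    (hE : ∀ x ∈ m, ∀ e : E, x • e = 0)
    (δ : Derivation K (K ⊗[R] PCompletion p A) E) :
    ∃ φ : ((completedCalculus p R A).generic K).Ω →ₗ[K ⊗[R] PCompletion p A] E, ∀ s,
      φ (((completedCalculus p R A).generic K).d s) = δ s := by
  obtain ⟨φ, hφ⟩ := exists_linearMap_d_algebraMap p δ
  refine ⟨φ, fun s => ?_⟩
  -- both sides vanish on `m²`, since the module is killed by `m`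
  have hsq : ∀ s ∈ m ^ 2, φ (((completedCalculus p R A).generic K).d s) = δ s := fun s hs => by
    rw [pow_two] at hs
    refine Submodule.mul_induction_on hs (fun x hx y hy => ?_) fun x y hx hy => ?_
    · rw [Calculus.d_mul, map_add, map_smul, map_smul, δ.leibniz]
      simp only [hE x hx, hE y hy]
    · rw [map_add, map_add, map_add, hx, hy]
  induction s with
  | zero => rw [map_zero, map_zero, map_zero]
  | add x y hx hy => rw [map_add, map_add, map_add, hx, hy]
  | tmul k b =>
    obtain ⟨a, ha⟩ := hm b
    have h1 : k ⊗ₜ[R] b = algebraMap K (K ⊗[R] PCompletion p A) k *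
        (1 ⊗ₜ algebraMap A _ a + 1 ⊗ₜ (b - algebraMap A _ a)) := by
      rw [← TensorProduct.tmul_add, add_sub_cancel, Algebra.TensorProduct.algebraMap_apply,
        Algebra.TensorProduct.tmul_mul_tmul, one_mul, mul_one]
      rfl
    rw [h1, Calculus.d_mul, Calculus.d_algebraMap, smul_zero, add_zero, map_smul, map_add, map_add,
      hφ, hsq _ ha, ← map_add, Derivation.leibniz, Derivation.map_algebraMap, smul_zero, add_zero]

variable [CharZero K]

/-- The derivation `exists_derivation_cotangentIdeal` comes from a vector field. -/
theorem exists_euler {m : Ideal (K ⊗[R] PCompletion p A)} [m.IsMaximal]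
    [Module.Finite K ((K ⊗[R] PCompletion p A) ⧸ m)]
    (hm : ∀ b : PCompletion p A, ∃ a : A, (1 : K) ⊗ₜ[R] (b - algebraMap A _ a) ∈ m ^ 2) :
    ∃ X ∈ (m • ⊤ : Submodule (K ⊗[R] PCompletion p A)
        (DiffRing.derGeneric K R (PCompletion p A)).Δ),
      ∀ f ∈ m, (DiffRing.derGeneric K R (PCompletion p A)).ι X f - f ∈ m ^ 2 := by
  obtain ⟨δ, hδ⟩ := exists_derivation_cotangentIdeal K m
  obtain ⟨φ, hφ⟩ := exists_linearMap_d p hm (E := m.cotangentIdeal) (fun x hx e => by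
    have h1 := Ideal.mul_mem_mul (Ideal.mk_mem_cotangentIdeal.mpr hx) e.2
    rw [← pow_two, m.cotangentIdeal_square] at h1
    exact Subtype.ext h1) δ
  obtain ⟨n, ⟨b⟩⟩ := exists_dualFamilies_completedPairing p R A
  obtain ⟨X, hX, h⟩ := (b.generic K).exists_mk_ι_eq φ
  exact ⟨X, hX, fun f hf => Ideal.Quotient.eq.mp (by rw [h, hφ, hδ f hf])⟩

end EulerField

section Simplicity
attribute [local instance] Algebra.TensorProduct.rightAlgebra DiffRing.genericModule
variable {R : Type u} [CommRing R] [IsDomain R] [IsDiscreteValuationRing R]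
    [IsAdicComplete (IsLocalRing.maximalIdeal R) R] [CharZero R] (p : ℕ) [Fact p.Prime]
    [CharP (IsLocalRing.ResidueField R) p]
    (K : Type u) [Field K] [Algebra R K] [IsFractionRing R K]
    {A : Type u} [CommRing A] [Algebra R A] [Algebra.Smooth R A]
    {I : Ideal R} (hpI : (p : R) ∈ I)
    [ConnectedSpace (PrimeSpectrum (A ⧸ I.map (algebraMap R A)))]
include hpI

/-- The generic fibre of the completion of `A` has Euler vector fields at its closed points and only
trivial idempotents, so it is simple. -/
theorem isSimple_derGeneric_pCompletion :
    (DiffRing.derGeneric K R (PCompletion p A)).IsSimple := by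
  have : CharZero K := charZero_of_injective_algebraMap (IsFractionRing.injective R K)
  have : IsNoetherianRing A := Algebra.FiniteType.isNoetherianRing R A
  have : Nontrivial (K ⊗[R] PCompletion p A) := nontrivial_generic_pCompletion p hpI
  obtain ⟨ϖ, hϖ⟩ := IsDiscreteValuationRing.exists_irreducible R
  have hϖp : ϖ ∣ (p : R) := by
    rw [← Ideal.mem_span_singleton, ← hϖ.maximalIdeal_eq, ← IsLocalRing.residue_eq_zero_iff,
      map_natCast, CharP.cast_eq_zero]
  have hJ : algebraMap R (PCompletion p A) ϖ ∈ Ideal.jacobson (⊥ : Ideal (PCompletion p A)) := by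
    obtain ⟨n, hn⟩ := IsDiscreteValuationRing.exists_dvd_pow (s := ϖ)
      (Nat.cast_ne_zero.mpr (Fact.out : p.Prime).ne_zero : (p : R) ≠ 0)
      ((IsLocalRing.mem_maximalIdeal _).mpr hϖ.not_isUnit)
    have := pCompletion_isAdicComplete p A
    have h1 := IsAdicComplete.le_jacobson_bot (Ideal.span {(p : PCompletion p A)})
      (Ideal.mem_span_singleton_self _)
    refine Submodule.mem_sInf.mpr fun N hN => hN.2.isPrime.mem_of_pow_mem n ?_
    have h2 := Submodule.mem_sInf.mp h1 N hN
    rw [← map_natCast (algebraMap R (PCompletion p A))] at h2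
    rw [← map_pow]
    exact Ideal.mem_of_dvd N (map_dvd _ hn) h2
  have hAB : ∀ b : PCompletion p A, ∃ (a : A) (c : PCompletion p A),
      b = algebraMap A _ a + algebraMap R _ ϖ * c := fun b => by
    obtain ⟨a, c, h⟩ := algebraMap_pCompletion_surjective_mod p A b 1
    obtain ⟨s, hs⟩ := hϖp
    refine ⟨a, algebraMap R _ s * c, ?_⟩
    rw [h, pow_one, ← mul_assoc, ← map_mul, ← hs, map_natCast]
  refine DiffRing.isSimple_of_forall_isMaximal (fun n hn => ?_)
    (fun e he => eq_zero_or_one_of_isIdempotentElem_generic p hpI he) fun m hm => ?_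
  · have h := (isUnit_iff_ne_zero.mpr (Nat.cast_ne_zero.mpr hn : (n : K) ≠ 0)).map
      (algebraMap K (K ⊗[R] PCompletion p A))
    rwa [map_natCast] at h
  · have := Module.Finite.quotient_comap_includeRight A hϖ hJ hAB
      (includeRight_pCompletion_injective p A K) m
    have := Module.Finite.quotient_generic m
    exact exists_euler p (exists_one_tmul_sub_mem_sq A hϖ hAB m)

end Simplicity

end

theorem mainTheorem10 {R : Type u} [CommRing R] [IsDomain R] [IsDiscreteValuationRing R]
    [IsAdicComplete (IsLocalRing.maximalIdeal R) R] [CharZero R] (p : ℕ) [Fact p.Prime]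
    [CharP (IsLocalRing.ResidueField R) p] [PerfectField (IsLocalRing.ResidueField R)]
    (K : Type u) [Field K] [Algebra R K] [IsFractionRing R K]
    (A : Type u) [CommRing A] [Algebra R A] [Algebra.Smooth R A]
    (I : Ideal R) (γ : DividedPowers I) (hpI : (p : R) ∈ I)
    [ConnectedSpace (PrimeSpectrum (A ⧸ I.map (algebraMap R A)))] :
    IsTannakian K (ScalarExt R K (QNC p R A)) ∧
    IsTannakian K (ScalarExt R K (ConnD p R A)) ∧
    IsTannakian K (ConnDK p R A K) ∧
    IsTannakian K (ScalarExt R K (DiffD p R A)) ∧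
    IsTannakian K (DiffDK p R A K) ∧
    IsFullyFaithfulTensorExact K (inclusionFunctor p R A K) ∧
    IsFullyFaithfulTensorExact K (connBaseChange p R A K) ∧
    IsFullyFaithfulTensorExact K (diffBaseChange p R A K) ∧
    IsFullyFaithfulTensorExact K (connToDiff p R A K) ∧ (connToDiff p R A K).IsEquivalence ∧
    IsFullyFaithfulTensorExact K (connToDiffK p R A K) ∧ (connToDiffK p R A K).IsEquivalence ∧
    ∃ e : connBaseChange p R A K ⋙ connToDiffK p R A K ≅
        connToDiff p R A K ⋙ diffBaseChange p R A K,
      NatTrans.IsMonoidal e.hom := by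
  have : CharZero K := charZero_of_injective_algebraMap (IsFractionRing.injective R K)
  have : IsNoetherianRing A := Algebra.FiniteType.isNoetherianRing R A
  exact isTannakian_square (isSimple_derGeneric_pCompletion p K hpI)
    (isAlmostRigidAbelian_topQuasiNilpotent fun b hb =>
      smul_pCompletion_injective (R := R) p A (r := p)
        (Nat.cast_ne_zero.mpr (Fact.out : p.Prime).ne_zero) (by
          rw [Algebra.smul_def, map_natCast, hb, smul_zero]))
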